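/- Let $M$ be a closed connected complex manifold of complex dimension $n\ge 2$, and let $\omega$ be a symplectic form on $M$ that tames the complex structure of $M$ (for instance, a Kähler form). Let $x_1,\dots,x_k\in M$ be distinct points, and for each $i$ let $\mathbf a_i=(a_{i,1},\dots,a_{i,n})$ be a tuple of pairwise coprime positive integers; put $\langle\mathbf a_i\rangle=a_{i,1}\cdots a_{i,n}$. Let $\Pi:\tilde M\to M$ be a weighted blow-up of $M$ at $x_1,\dots,x_k$ with weights $\mathbf a_1,\dots,\mathbf a_k$. That is, $\tilde M$ is a compact complex orbifold and $\Pi$ is a holomorphic map which is biholomorphic over $M\setminus\{x_1,\dots,x_k\}$ and which, in suitable holomorphic coordinates centered at $x_i$, is the map $[t,z]\mapsto (t^{a_{i,1}}z_1,\dots,t^{a_{i,n}}z_n)$ on the quotient of an open subset of $\mathbb C\times(\mathbb C^n\setminus 0)$ by the action $s\cdot(t,z)=(s^{-1}t,s^{a_{i,1}}z_1,\dots,s^{a_{i,n}}z_n)$ of $\mathbb C^*$. Let $E_i=\Pi^{-1}(x_i)$ be the exceptional divisors, regarded as complex suborbifolds, let $\varepsilon_i\in H^2(\tilde M;\mathbb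 R)$ be the class with $\langle\varepsilon_i\cup\beta,[\tilde M]\rangle=\int_{E_i}\beta$ for all $\beta\in H^{2n-2}(\tilde M;\mathbb R)$, and let $e_i=\langle\mathbf a_i\rangle\,\varepsilon_i$ (the smallest positive multiple of the rational Poincaré dual $\varepsilon_i$ that is an integral class). Here cohomology is de Rham cohomology of orbifold forms, and the integral of a form supported in a chart $\tilde U/\Gamma$ is $|\Gamma|^{-1}$ times its integral over $\tilde U$. For $r>0$ let $$\mathcal E_{\mathbf a}(r)=\Big\{z\in\mathbb C^n:\ \pi\sum_{j=1}^n a_j|z_j|^2\le r\Big\},$$ and let $\mathrm{Vol}$ denote the symplectic volume, that is, the integral of $\big(\sum_j dx_j\wedge dy_j\big)^n$. Then for all $r_1,\dots,r_k>0$ $$\Big\langle\Big(\Pi^*[\omega]-\sum_{i=1}^k\frac{r_i}{\langle\mathbf a_i\rangle}e_i\Big)^n,[\tilde M]\Big\rangle=\int_M\omega^n-\sum_{i=1}^k\mathrm{Vol}\big(\mathcal E_{\mathbf a_i}(r_i)\big)=\int_M\omega^n-\sum_{i=1}^k\frac{r_i^n}{\langle\mathbf a_i\rangle}.$$ -/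

import Mathlib

open Set MeasureTheory
open scoped ContDiff Manifold Topology

noncomputable section

namespace WeightedBlowup

/-! ### Alternating forms on complex coordinate space -/

/-- The complex coordinate space of dimension `n`. -/
abbrev Cn (n : ℕ) : Type := Fin n → ℂ

/-- Real-valued real-alternating forms of degree `k` on the complex coordinate space. -/
abbrev Alt (n k : ℕ) : Type := Cn n [⋀^Fin k]→L[ℝ] ℝ

/-- The multilinear map sending `(v₁, …, v_{p+q})` to `α (v₁, …, v_p) * β (v_{p+1}, …, v_{p+q})`. -/
def tensorForm {n p q : ℕ} (α : Alt n p) (β : Alt n q) :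
    ContinuousMultilinearMap ℝ (fun _ : Fin (p + q) => Cn n) ℝ where
  toMultilinearMap :=
    ((LinearMap.mul' ℝ ℝ).compMultilinearMap
      (MultilinearMap.domCoprod α.toMultilinearMap β.toMultilinearMap)).domDomCongr finSumFinEquiv
  cont := by
    change Continuous fun v : Fin (p + q) → Cn n =>
      α (fun i => v (Fin.castAdd q i)) * β (fun i => v (Fin.natAdd p i))
    fun_prop

theorem tensorForm_apply {n p q : ℕ} (α : Alt n p) (β : Alt n q) (v : Fin (p + q) → Cn n) :
    tensorForm α β v = α (fun i => v (Fin.castAdd q i)) * β (fun i => v (Fin.natAdd p i)) :=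
  rfl

/-- The wedge product, with the normalization
`(α ∧ β) (v₁, …, v_{p+q}) = 1 / (p! q!) ∑_σ sign σ α (v_{σ 1}, …) β (…, v_{σ (p + q)})`,
so that `dx ∧ dy` takes the value `1` on the standard frame. -/
def wedge {n p q : ℕ} (α : Alt n p) (β : Alt n q) : Alt n (p + q) :=
  (((p.factorial * q.factorial : ℕ) : ℝ)⁻¹) • ContinuousMultilinearMap.alternatization (tensorForm α β)

/-- The wedge power `α ∧ ⋯ ∧ α` (`m` factors) of a two-form. -/
def wedgePow {n : ℕ} (α : Alt n 2) : (m : ℕ) → Alt n (2 * m)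
  | 0 => ContinuousAlternatingMap.constOfIsEmpty ℝ (Cn n) (Fin 0) (1 : ℝ)
  | m + 1 => wedge (wedgePow α m) α

/-- The positively oriented real frame `(e₁, i e₁, e₂, i e₂, …)` of complex coordinate space. -/
def frame (n : ℕ) : Fin (2 * n) → Cn n := fun m =>
  Pi.single (⟨m / 2, by omega⟩ : Fin n) (if (m : ℕ) % 2 = 0 then 1 else Complex.I)

/-! ### Complex orbifolds -/

/-- A complex orbifold chart: an open set `dom` of complex coordinate space, a finite group of
linear automorphisms preserving it, and a continuous open map `proj` to `X` which identifies
the quotient of `dom` by the group with an open subset of `X`.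
(Only the values of `proj` on `dom` matter.) -/
structure OrbifoldChart (n : ℕ) (X : Type*) [TopologicalSpace X] where
  dom : Set (Cn n)
  isOpen_dom : IsOpen dom
  group : Subgroup (Cn n ≃ₗ[ℂ] Cn n)
  finite_group : Finite group
  map_dom : ∀ γ ∈ group, ∀ u ∈ dom, γ u ∈ dom
  proj : Cn n → X
  continuousOn_proj : ContinuousOn proj dom
  isOpen_image : ∀ W ⊆ dom, IsOpen W → IsOpen (proj '' W)
  proj_eq_iff : ∀ u ∈ dom, ∀ v ∈ dom, proj u = proj v ↔ ∃ γ ∈ group, γ u = v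

/-- The open subset of `X` uniformized by the chart. -/
def OrbifoldChart.image {n : ℕ} {X : Type*} [TopologicalSpace X] (c : OrbifoldChart n X) : Set X :=
  c.proj '' c.dom

/-- `h` is a biholomorphism from an open subset of `s` onto an open subset of `t` which
intertwines the parametrizations `p` (defined on `s`) and `q` (defined on `t`). -/
structure IsTransition {n : ℕ} {X : Type*} (s : Set (Cn n)) (p : Cn n → X) (t : Set (Cn n))
    (q : Cn n → X) (h : OpenPartialHomeomorph (Cn n) (Cn n)) : Prop where
  source_subset : h.source ⊆ s
  target_subset : h.target ⊆ t
  holomorphic : ContDiffOn ℂ ω h h.source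
  holomorphic_symm : ContDiffOn ℂ ω h.symm h.target
  comm : ∀ w ∈ h.source, q (h w) = p w

/-- Near `u` and `v`, the parametrizations `p` on `s` and `q` on `t` differ by
a local biholomorphism mapping `u` to `v`. -/
def LocallyEquivalent {n : ℕ} {X : Type*} (s : Set (Cn n)) (p : Cn n → X) (t : Set (Cn n))
    (q : Cn n → X) (u v : Cn n) : Prop :=
  ∃ h, IsTransition s p t q h ∧ u ∈ h.source ∧ h u = v

/-- An atlas of complex orbifold charts of dimension `n` on `X`: the charts cover `X`, and any two
of them are related by a local biholomorphism near any two points with the same image. -/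
structure ComplexOrbifold (n : ℕ) (X : Type*) [TopologicalSpace X] where
  charts : Set (OrbifoldChart n X)
  cover : ∀ x, ∃ c ∈ charts, x ∈ c.image
  compatible : ∀ c ∈ charts, ∀ d ∈ charts, ∀ u ∈ c.dom, ∀ v ∈ d.dom, c.proj u = d.proj v →
    LocallyEquivalent c.dom c.proj d.dom d.proj u v

/-- A chart of a complex manifold, as an orbifold chart with trivial group. -/
def OrbifoldChart.ofChart {n : ℕ} {M : Type*} [TopologicalSpace M]
    (e : OpenPartialHomeomorph M (Cn n)) : OrbifoldChart n M where
  dom := e.target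
  isOpen_dom := e.open_target
  group := ⊥
  finite_group := inferInstance
  map_dom := by
    intro γ hγ u hu
    rw [Subgroup.mem_bot] at hγ
    simpa [hγ] using hu
  proj := e.symm
  continuousOn_proj := e.continuousOn_symm
  isOpen_image := fun W hW hWo => e.symm.isOpen_image_of_subset_source hWo hW
  proj_eq_iff := by
    intro u hu v hv
    constructor
    · intro h
      exact ⟨1, Subgroup.one_mem _, by simpa using e.symm.injOn hu hv h⟩
    · rintro ⟨γ, hγ, rfl⟩
      rw [Subgroup.mem_bot] at hγ
      simp [hγ]

theorem isTransition_ofChart {n : ℕ} {M : Type*} [TopologicalSpace M] [ChartedSpace (Cn n) M]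
    [IsManifold 𝓘(ℂ, Cn n) ω M] {e e' : OpenPartialHomeomorph M (Cn n)}
    (he : e ∈ atlas (Cn n) M) (he' : e' ∈ atlas (Cn n) M) :
    IsTransition e.target e.symm e'.target e'.symm (e.symm.trans e') where
  source_subset := by intro w hw; simp at hw; exact hw.1
  target_subset := by intro w hw; simp at hw; exact hw.1
  holomorphic := by
    have := (contDiffGroupoid ω 𝓘(ℂ, Cn n)).compatible he he'
    rw [contDiffGroupoid, mem_groupoid_of_pregroupoid] at this
    simpa [contDiffPregroupoid] using this.1
  holomorphic_symm := by
    have := (contDiffGroupoid ω 𝓘(ℂ, Cn n)).compatible he he'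
    rw [contDiffGroupoid, mem_groupoid_of_pregroupoid] at this
    simpa [contDiffPregroupoid] using this.2
  comm := by
    intro w hw
    simp at hw
    simp [hw.2]

/-- A complex manifold, as a complex orbifold with trivial groups. -/
def ComplexOrbifold.ofManifold (n : ℕ) (M : Type*) [TopologicalSpace M] [ChartedSpace (Cn n) M]
    [IsManifold 𝓘(ℂ, Cn n) ω M] : ComplexOrbifold n M where
  charts := OrbifoldChart.ofChart '' atlas (Cn n) M
  cover := fun x => ⟨_, ⟨_, chart_mem_atlas (Cn n) x, rfl⟩, chartAt (Cn n) x x,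
    mem_chart_target _ x, (chartAt (Cn n) x).left_inv (mem_chart_source _ x)⟩
  compatible := by
    rintro _ ⟨e, he, rfl⟩ _ ⟨e', he', rfl⟩ u hu v hv huv
    change u ∈ e.target at hu
    change v ∈ e'.target at hv
    change e.symm u = e'.symm v at huv
    refine ⟨e.symm.trans e', isTransition_ofChart he he', ?_, ?_⟩
    · simp only [OpenPartialHomeomorph.trans_source, OpenPartialHomeomorph.symm_source, mem_inter_iff,
        mem_preimage]
      exact ⟨hu, by rw [huv]; exact e'.map_target hv⟩
    · simp [huv, e'.right_inv hv]

/-! ### Differential forms and de Rham cohomology -/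

section Forms

variable {n : ℕ} {X : Type*} [TopologicalSpace X]

/-- A family of alternating forms of degree `k` on the domains of all charts, with no condition. -/
def ComplexOrbifold.Family (𝓧 : ComplexOrbifold n X) (k : ℕ) : Type _ :=
  𝓧.charts → Cn n → Alt n k

instance (𝓧 : ComplexOrbifold n X) (k : ℕ) : AddCommGroup (𝓧.Family k) :=
  inferInstanceAs (AddCommGroup (𝓧.charts → Cn n → Alt n k))

instance (𝓧 : ComplexOrbifold n X) (k : ℕ) : Module ℝ (𝓧.Family k) :=
  inferInstanceAs (Module ℝ (𝓧.charts → Cn n → Alt n k))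

theorem ComplexOrbifold.Family.zero_apply {𝓧 : ComplexOrbifold n X} {k : ℕ}
    (c : 𝓧.charts) : (0 : 𝓧.Family k) c = 0 := rfl

theorem ComplexOrbifold.Family.add_apply {𝓧 : ComplexOrbifold n X} {k : ℕ} (α β : 𝓧.Family k)
    (c : 𝓧.charts) : (α + β) c = α c + β c := rfl

theorem ComplexOrbifold.Family.smul_apply {𝓧 : ComplexOrbifold n X} {k : ℕ} (r : ℝ)
    (α : 𝓧.Family k) (c : 𝓧.charts) : (r • α) c = r • α c := rfl

/-- The orbifold differential forms of degree `k`: families of smooth forms on the domains of the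
charts which are compatible with all transitions (hence in particular invariant). -/
def ComplexOrbifold.forms (𝓧 : ComplexOrbifold n X) (k : ℕ) : Submodule ℝ (𝓧.Family k) where
  carrier := {α | (∀ c, ContDiffOn ℝ ∞ (α c) c.1.dom) ∧
    ∀ (c d : 𝓧.charts) (h : OpenPartialHomeomorph (Cn n) (Cn n)),
      IsTransition c.1.dom c.1.proj d.1.dom d.1.proj h → ∀ w ∈ h.source,
        α c w = (α d (h w)).compContinuousLinearMap (fderiv ℝ h w)}
  add_mem' := by
    rintro α β ⟨hα, hα'⟩ ⟨hβ, hβ'⟩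
    refine ⟨fun c => (hα c).add (hβ c), fun c d h hh w hw => ?_⟩
    simp only [Family.add_apply, Pi.add_apply, hα' c d h hh w hw, hβ' c d h hh w hw]
    rfl
  zero_mem' := ⟨fun c => contDiffOn_const, fun c d h hh w hw => rfl⟩
  smul_mem' := by
    rintro r α ⟨hα, hα'⟩
    refine ⟨fun c => (hα c).const_smul r, fun c d h hh w hw => ?_⟩
    simp only [Family.smul_apply, Pi.smul_apply, hα' c d h hh w hw]
    rfl

theorem ComplexOrbifold.forms_differentiableAt {𝓧 : ComplexOrbifold n X} {k : ℕ}
    {α : 𝓧.Family k} (hα : α ∈ 𝓧.forms k) (c : 𝓧.charts) {u : Cn n} (hu : u ∈ c.1.dom) :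
    DifferentiableAt ℝ (α c) u :=
  ((hα.1 c).contDiffAt (c.1.isOpen_dom.mem_nhds hu)).differentiableAt (by simp)

/-- The closed orbifold forms. -/
def ComplexOrbifold.closedForms (𝓧 : ComplexOrbifold n X) (k : ℕ) :
    Submodule ℝ (𝓧.Family k) where
  carrier := {α | α ∈ 𝓧.forms k ∧ ∀ c, ∀ u ∈ c.1.dom, extDeriv (α c) u = 0}
  add_mem' := by
    rintro α β ⟨hα, hα'⟩ ⟨hβ, hβ'⟩
    refine ⟨add_mem hα hβ, fun c u hu => ?_⟩
    have := extDeriv_add (forms_differentiableAt hα c hu) (forms_differentiableAt hβ c hu)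
    rw [Family.add_apply, this, hα' c u hu, hβ' c u hu, add_zero]
  zero_mem' := by
    refine ⟨zero_mem _, fun c u hu => ?_⟩
    simpa [Family.zero_apply] using extDeriv_smul (0 : ℝ) (0 : Cn n → Alt n k) (x := u)
  smul_mem' := by
    rintro r α ⟨hα, hα'⟩
    refine ⟨Submodule.smul_mem _ r hα, fun c u hu => ?_⟩
    have := extDeriv_smul r (α c) (x := u)
    rw [Family.smul_apply, this, hα' c u hu, smul_zero]

/-- The exact orbifold forms of positive degree, that is, differentials of orbifold forms. -/
def ComplexOrbifold.exactForms (𝓧 : ComplexOrbifold n X) (k : ℕ) :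
    Submodule ℝ (𝓧.Family (k + 1)) where
  carrier := {α | ∃ β ∈ 𝓧.forms k, ∀ c, ∀ u ∈ c.1.dom, α c u = extDeriv (β c) u}
  add_mem' := by
    rintro α α' ⟨β, hβ, h⟩ ⟨β', hβ', h'⟩
    refine ⟨β + β', add_mem hβ hβ', fun c u hu => ?_⟩
    have := extDeriv_add (forms_differentiableAt hβ c hu) (forms_differentiableAt hβ' c hu)
    rw [Family.add_apply, Family.add_apply, Pi.add_apply, this, h c u hu, h' c u hu]
  zero_mem' := by
    refine ⟨0, zero_mem _, fun c u hu => ?_⟩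
    simpa [Family.zero_apply] using (extDeriv_smul (0 : ℝ) (0 : Cn n → Alt n k) (x := u)).symm
  smul_mem' := by
    rintro r α ⟨β, hβ, h⟩
    refine ⟨r • β, Submodule.smul_mem _ r hβ, fun c u hu => ?_⟩
    have := extDeriv_smul r (β c) (x := u)
    rw [Family.smul_apply, Family.smul_apply, Pi.smul_apply, this, h c u hu]

/-- The second de Rham cohomology: closed two-forms modulo exact two-forms. -/
abbrev ComplexOrbifold.H2 (𝓧 : ComplexOrbifold n X) : Type _ :=
  𝓧.closedForms 2 ⧸ (𝓧.exactForms 1).submoduleOf (𝓧.closedForms 2)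

/-- The cohomology class of a closed two-form. -/
abbrev ComplexOrbifold.cls (𝓧 : ComplexOrbifold n X) : 𝓧.closedForms 2 →ₗ[ℝ] 𝓧.H2 :=
  ((𝓧.exactForms 1).submoduleOf (𝓧.closedForms 2)).mkQ

open scoped Classical in
/-- The integral of a form of top degree over a compact complex orbifold, with its complex
orientation. For a continuous partition of unity `ρ` subordinate to finitely many charts `c j`, it
is the sum over `j` of `1 / |Γ_j|` times the integral of `ρ_j α` over the domain of `c j`. The
result does not depend on the choice of the charts and of the partition of unity. -/
def ComplexOrbifold.integral (𝓧 : ComplexOrbifold n X) (α : 𝓧.Family (2 * n)) : ℝ :=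
  if h : ∃ P : Σ N : ℕ, (Fin N → 𝓧.charts) × PartitionOfUnity (Fin N) X,
      P.2.2.IsSubordinate fun j => (P.2.1 j).1.image then
    ∑ j, (Nat.card (h.choose.2.1 j).1.group : ℝ)⁻¹ *
      ∫ u in (h.choose.2.1 j).1.dom,
        h.choose.2.2 j ((h.choose.2.1 j).1.proj u) * α (h.choose.2.1 j) u (frame n)
  else 0

end Forms

/-! ### Holomorphic maps from orbifolds to manifolds and pullback -/

section Pullback

/-- Antisymmetrization of multilinear forms, as a continuous linear map. -/
def alternatizationL (F : Type*) [NormedAddCommGroup F] [NormedSpace ℝ F] (k : ℕ) :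
    ContinuousMultilinearMap ℝ (fun _ : Fin k => F) ℝ →L[ℝ] F [⋀^Fin k]→L[ℝ] ℝ :=
  AddMonoidHom.toRealLinearMap ContinuousMultilinearMap.alternatization <| by
    refine AddMonoidHomClass.continuous_of_bound _ (Fintype.card (Equiv.Perm (Fin k)) : ℝ)
      fun f => ContinuousAlternatingMap.opNorm_le_bound _ (by positivity) fun v => ?_
    rw [ContinuousMultilinearMap.alternatization_apply_apply]
    refine (norm_sum_le _ _).trans ?_
    rw [mul_assoc, ← nsmul_eq_mul, ← Finset.card_univ, ← Finset.sum_const]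
    refine Finset.sum_le_sum fun σ _ => ?_
    have h1 : ‖Equiv.Perm.sign σ • f (v ∘ σ)‖ = ‖f (v ∘ σ)‖ := by
      rcases Int.units_eq_one_or (Equiv.Perm.sign σ) with h | h <;> simp [h]
    rw [h1, ← Equiv.prod_comp σ fun i => ‖v i‖]
    exact f.le_opNorm _

/-- Precomposition with a smooth family of linear maps is smooth. -/
theorem contDiffAt_comp {E F G : Type*} [NormedAddCommGroup E] [NormedSpace ℝ E]
    [NormedAddCommGroup F] [NormedSpace ℝ F] [NormedAddCommGroup G] [NormedSpace ℝ G] {k : ℕ}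
    {α : E → G [⋀^Fin k]→L[ℝ] ℝ} {g : E → F →L[ℝ] G} {x : E}
    (hα : ContDiffAt ℝ ∞ α x) (hg : ContDiffAt ℝ ∞ g x) :
    ContDiffAt ℝ ∞ (fun y => (α y).compContinuousLinearMap (g y)) x := by
  have h1 : ContDiffAt ℝ ∞
      (fun y => ((α y).toContinuousMultilinearMap).compContinuousLinearMap fun _ => g y) x := by
    have hm := ContinuousMultilinearMap.contDiff (𝕜 := ℝ) (E := fun _ : Fin k => F →L[ℝ] G)
      (F := (ContinuousMultilinearMap ℝ (fun _ : Fin k => G) ℝ) →L[ℝ]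
        (ContinuousMultilinearMap ℝ (fun _ : Fin k => F) ℝ)) (n := ∞)
      (ContinuousMultilinearMap.compContinuousLinearMapContinuousMultilinear ℝ
        (fun _ : Fin k => F) (fun _ : Fin k => G) ℝ)
    have h2 : ContDiffAt ℝ ∞ (fun y => ContinuousMultilinearMap.compContinuousLinearMapContinuousMultilinear
      ℝ (fun _ : Fin k => F) (fun _ : Fin k => G) ℝ (fun _ => g y)) x :=
      hm.contDiffAt.comp x (contDiffAt_pi.2 fun _ => hg)
    have h3 : ContDiffAt ℝ ∞ (fun y => ContinuousAlternatingMap.toContinuousMultilinearMapCLM ℝ (α y)) x :=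
      (ContinuousAlternatingMap.toContinuousMultilinearMapCLM (𝕜 := ℝ) (E := G) (F := ℝ)
        (ι := Fin k) ℝ).contDiff.contDiffAt.comp x hα
    exact h2.clm_apply h3
  have h4 := ((alternatizationL F k).contDiff.contDiffAt.comp x h1).const_smul ((k.factorial : ℝ)⁻¹)
  refine h4.congr_of_eventuallyEq (Filter.Eventually.of_forall fun y => ?_)
  ext v
  change _ = (k.factorial : ℝ)⁻¹ • (ContinuousMultilinearMap.alternatization
    (((α y).toContinuousMultilinearMap).compContinuousLinearMap fun _ => g y)) v
  rw [ContinuousMultilinearMap.alternatization_apply_apply]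
  have h5 : ∀ σ : Equiv.Perm (Fin k), Equiv.Perm.sign σ •
      (((α y).toContinuousMultilinearMap).compContinuousLinearMap fun _ => g y) (v ∘ σ) =
      ((α y).compContinuousLinearMap (g y)) v := by
    intro σ
    change Equiv.Perm.sign σ • ((α y).compContinuousLinearMap (g y)) (v ∘ σ) = _
    have := ((α y).compContinuousLinearMap (g y)).toAlternatingMap.map_perm v σ
    have h6 : ((α y).compContinuousLinearMap (g y)) (v ∘ σ) =
      Equiv.Perm.sign σ • ((α y).compContinuousLinearMap (g y)) v := this
    rw [h6, smul_smul, Int.units_mul_self, one_smul]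
  rw [Finset.sum_congr rfl fun σ _ => h5 σ, Finset.sum_const, Finset.card_univ, Fintype.card_perm,
    Fintype.card_fin, nsmul_eq_mul, smul_eq_mul, ← mul_assoc, inv_mul_cancel₀ (by positivity),
    one_mul]

variable {n m : ℕ} {X : Type*} [TopologicalSpace X] {M : Type*} [TopologicalSpace M]
  [ChartedSpace (Cn m) M]

/-- A holomorphic map from a complex orbifold to a complex manifold. -/
structure HolomorphicMap (𝓧 : ComplexOrbifold n X) (m : ℕ) (M : Type*) [TopologicalSpace M]
    [ChartedSpace (Cn m) M] where
  toFun : X → M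
  holomorphic : ∀ c ∈ 𝓧.charts,
    ContMDiffOn 𝓘(ℂ, Cn n) 𝓘(ℂ, Cn m) ω (fun u => toFun (c.proj u)) c.dom

/-- The expression of a holomorphic map in an orbifold chart of the source and in the preferred
chart at `p` of the target. -/
def HolomorphicMap.lift {𝓧 : ComplexOrbifold n X} (f : HolomorphicMap 𝓧 m M)
    (c : OrbifoldChart n X) (p : M) (u : Cn n) : Cn m :=
  chartAt (Cn m) p (f.toFun (c.proj u))

/-- The preferred chart at a point of a complex manifold, as an orbifold chart. -/
def ComplexOrbifold.prefChart [IsManifold 𝓘(ℂ, Cn m) ω M] (p : M) :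
    (ComplexOrbifold.ofManifold m M).charts :=
  ⟨OrbifoldChart.ofChart (chartAt (Cn m) p), _, chart_mem_atlas (Cn m) p, rfl⟩

variable {𝓧 : ComplexOrbifold n X}

theorem HolomorphicMap.eventually_mem (f : HolomorphicMap 𝓧 m M) {c : OrbifoldChart n X}
    (hc : c ∈ 𝓧.charts) {p : M} {u : Cn n} (hu : u ∈ c.dom)
    (hp : f.toFun (c.proj u) ∈ (chartAt (Cn m) p).source) :
    ∀ᶠ w in 𝓝 u, w ∈ c.dom ∧ f.toFun (c.proj w) ∈ (chartAt (Cn m) p).source := by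
  have h1 := ((f.holomorphic c hc).contMDiffAt (c.isOpen_dom.mem_nhds hu)).continuousAt
  exact (c.isOpen_dom.eventually_mem hu).and (h1.eventually ((chartAt (Cn m) p).open_source.mem_nhds hp))

variable [IsManifold 𝓘(ℂ, Cn m) ω M]

/-- The pullback of a form along a holomorphic map, computed in charts. -/
def HolomorphicMap.pullback (f : HolomorphicMap 𝓧 m M) (k : ℕ) :
    (ComplexOrbifold.ofManifold m M).Family k →ₗ[ℝ] 𝓧.Family k where
  toFun α := fun c u =>
    (α (ComplexOrbifold.prefChart (f.toFun (c.1.proj u)))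
      (f.lift c.1 (f.toFun (c.1.proj u)) u)).compContinuousLinearMap
        (fderiv ℝ (f.lift c.1 (f.toFun (c.1.proj u))) u)
  map_add' _ _ := rfl
  map_smul' _ _ := rfl

theorem HolomorphicMap.lift_contDiffAt (f : HolomorphicMap 𝓧 m M) {c : OrbifoldChart n X}
    (hc : c ∈ 𝓧.charts) {p : M} {u : Cn n} (hu : u ∈ c.dom)
    (hp : f.toFun (c.proj u) ∈ (chartAt (Cn m) p).source) :
    ContDiffAt ℝ ∞ (f.lift c p) u := by
  have h1 := (f.holomorphic c hc).contMDiffAt (c.isOpen_dom.mem_nhds hu)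
  have h2 : ContMDiffAt 𝓘(ℂ, Cn m) 𝓘(ℂ, Cn m) ω (chartAt (Cn m) p) (f.toFun (c.proj u)) :=
    contMDiffAt_of_mem_maximalAtlas (IsManifold.chart_mem_maximalAtlas p) hp
  have h3 := ContMDiffAt.comp u h2 h1
  have h4 := (contMDiffAt_iff_contDiffAt.1 h3).restrict_scalars ℝ
  exact h4.of_le le_top

/-- The pullback of a form may be computed in any preferred chart of the target. -/
theorem HolomorphicMap.pullback_eq (f : HolomorphicMap 𝓧 m M) {k : ℕ}
    {α : (ComplexOrbifold.ofManifold m M).Family k}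
    (hα : α ∈ (ComplexOrbifold.ofManifold m M).forms k) (c : 𝓧.charts) {p : M} {u : Cn n}
    (hu : u ∈ c.1.dom) (hp : f.toFun (c.1.proj u) ∈ (chartAt (Cn m) p).source) :
    f.pullback k α c u =
      (α (ComplexOrbifold.prefChart p) (f.lift c.1 p u)).compContinuousLinearMap
        (fderiv ℝ (f.lift c.1 p) u) := by
  set q := f.toFun (c.1.proj u) with hq
  set e' := chartAt (Cn m) q with he'
  set e := chartAt (Cn m) p with he
  have hqs : q ∈ e'.source := mem_chart_source _ q
  have htr := isTransition_ofChart (chart_mem_atlas (Cn m) q) (chart_mem_atlas (Cn m) p)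
  have hsrc : f.lift c.1 q u ∈ (e'.symm.trans e).source := by
    simp only [OpenPartialHomeomorph.trans_source, OpenPartialHomeomorph.symm_source, mem_inter_iff,
      mem_preimage, lift]
    exact ⟨e'.map_source hqs, by rw [← he', ← hq, e'.left_inv hqs]; exact hp⟩
  have hev : (fun w => (e'.symm.trans e) (f.lift c.1 q w)) =ᶠ[𝓝 u] f.lift c.1 p := by
    filter_upwards [f.eventually_mem c.2 hu hqs] with w hw
    simp only [OpenPartialHomeomorph.coe_trans, Function.comp_apply, lift]
    rw [← he', e'.left_inv hw.2]
  have hcd : DifferentiableAt ℝ (e'.symm.trans e) (f.lift c.1 q u) := by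
    have := (htr.holomorphic.contDiffAt
      ((e'.symm.trans e).open_source.mem_nhds hsrc)).restrict_scalars ℝ
    exact this.differentiableAt (by simp)
  have hfd : fderiv ℝ (f.lift c.1 p) u =
      (fderiv ℝ (e'.symm.trans e) (f.lift c.1 q u)).comp (fderiv ℝ (f.lift c.1 q) u) := by
    rw [← hev.fderiv_eq]
    exact fderiv_comp u hcd ((f.lift_contDiffAt c.2 hu hqs).differentiableAt (by simp))
  have key := hα.2 (ComplexOrbifold.prefChart q) (ComplexOrbifold.prefChart p) _ htr _ hsrc
  change (α (ComplexOrbifold.prefChart q) (f.lift c.1 q u)).compContinuousLinearMap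
    (fderiv ℝ (f.lift c.1 q) u) = _
  rw [key, hfd, ← hev.eq_of_nhds]
  rfl

theorem HolomorphicMap.pullback_eventuallyEq (f : HolomorphicMap 𝓧 m M) {k : ℕ}
    {α : (ComplexOrbifold.ofManifold m M).Family k}
    (hα : α ∈ (ComplexOrbifold.ofManifold m M).forms k) (c : 𝓧.charts) {u : Cn n}
    (hu : u ∈ c.1.dom) :
    f.pullback k α c =ᶠ[𝓝 u] fun w =>
      (α (ComplexOrbifold.prefChart (f.toFun (c.1.proj u)))
        (f.lift c.1 (f.toFun (c.1.proj u)) w)).compContinuousLinearMap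
          (fderiv ℝ (f.lift c.1 (f.toFun (c.1.proj u))) w) := by
  filter_upwards [f.eventually_mem c.2 hu (mem_chart_source _ _)] with w hw
  exact f.pullback_eq hα c hw.1 hw.2

theorem HolomorphicMap.lift_mem (f : HolomorphicMap 𝓧 m M) (c : OrbifoldChart n X) (u : Cn n) :
    f.lift c (f.toFun (c.proj u)) u ∈
      (ComplexOrbifold.prefChart (m := m) (f.toFun (c.proj u))).1.dom :=
  (chartAt (Cn m) _).map_source (mem_chart_source _ _)

theorem HolomorphicMap.pullback_mem_forms (f : HolomorphicMap 𝓧 m M) {k : ℕ}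
    {α : (ComplexOrbifold.ofManifold m M).Family k}
    (hα : α ∈ (ComplexOrbifold.ofManifold m M).forms k) : f.pullback k α ∈ 𝓧.forms k := by
  constructor
  · intro c u hu
    refine ContDiffAt.contDiffWithinAt ?_
    refine ContDiffAt.congr_of_eventuallyEq ?_ (f.pullback_eventuallyEq hα c hu)
    have hl := f.lift_contDiffAt c.2 hu (mem_chart_source (Cn m) _)
    refine contDiffAt_comp ?_ (hl.fderiv_right (m := ∞) (by simp))
    exact ContDiffAt.comp u ((hα.1 _).contDiffAt ((OrbifoldChart.isOpen_dom _).mem_nhds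
      (f.lift_mem c.1 u))) hl
  · intro c d h hh w hw
    have hwc := hh.source_subset hw
    have hwd := hh.target_subset (h.map_source hw)
    have hp : f.toFun (d.1.proj (h w)) = f.toFun (c.1.proj w) := by rw [hh.comm w hw]
    have hs : f.toFun (d.1.proj (h w)) ∈ (chartAt (Cn m) (f.toFun (c.1.proj w))).source := by
      rw [hp]; exact mem_chart_source _ _
    rw [f.pullback_eq hα c hwc (mem_chart_source (Cn m) (f.toFun (c.1.proj w))),
      f.pullback_eq hα d hwd hs]
    have hev : (fun v => f.lift d.1 (f.toFun (c.1.proj w)) (h v)) =ᶠ[𝓝 w]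
        f.lift c.1 (f.toFun (c.1.proj w)) := by
      filter_upwards [h.open_source.mem_nhds hw] with v hv
      simp only [lift, hh.comm v hv]
    have hcd : DifferentiableAt ℝ h w :=
      ((hh.holomorphic.contDiffAt (h.open_source.mem_nhds hw)).restrict_scalars ℝ).differentiableAt
        (by simp)
    have hfd : fderiv ℝ (f.lift c.1 (f.toFun (c.1.proj w))) w =
        (fderiv ℝ (f.lift d.1 (f.toFun (c.1.proj w))) (h w)).comp (fderiv ℝ h w) := by
      rw [← hev.fderiv_eq]
      exact fderiv_comp w ((f.lift_contDiffAt d.2 hwd hs).differentiableAt (by simp)) hcd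
    rw [hfd, ← hev.eq_of_nhds]
    rfl

theorem HolomorphicMap.extDeriv_pullback (f : HolomorphicMap 𝓧 m M) {k : ℕ}
    {α : (ComplexOrbifold.ofManifold m M).Family k}
    (hα : α ∈ (ComplexOrbifold.ofManifold m M).forms k) (c : 𝓧.charts) {u : Cn n}
    (hu : u ∈ c.1.dom) :
    extDeriv (f.pullback k α c) u =
      (extDeriv (α (ComplexOrbifold.prefChart (f.toFun (c.1.proj u))))
        (f.lift c.1 (f.toFun (c.1.proj u)) u)).compContinuousLinearMap
          (fderiv ℝ (f.lift c.1 (f.toFun (c.1.proj u))) u) := by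
  rw [(f.pullback_eventuallyEq hα c hu).extDeriv_eq]
  refine _root_.extDeriv_pullback (r := ∞)
    (ComplexOrbifold.forms_differentiableAt hα _ (f.lift_mem c.1 u))
    (f.lift_contDiffAt c.2 hu (mem_chart_source (Cn m) _)) ?_
  simp only [minSmoothness_of_isRCLikeNormedField]
  exact ENat.LEInfty.out

theorem HolomorphicMap.pullback_mem_closedForms (f : HolomorphicMap 𝓧 m M) {k : ℕ}
    {α : (ComplexOrbifold.ofManifold m M).Family k}
    (hα : α ∈ (ComplexOrbifold.ofManifold m M).closedForms k) :
    f.pullback k α ∈ 𝓧.closedForms k := by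
  refine ⟨f.pullback_mem_forms hα.1, fun c u hu => ?_⟩
  rw [f.extDeriv_pullback hα.1 c hu, hα.2 _ _ (f.lift_mem c.1 u)]
  rfl

theorem HolomorphicMap.pullback_mem_exactForms (f : HolomorphicMap 𝓧 m M) {k : ℕ}
    {α : (ComplexOrbifold.ofManifold m M).Family (k + 1)}
    (hα : α ∈ (ComplexOrbifold.ofManifold m M).exactForms k) :
    f.pullback (k + 1) α ∈ 𝓧.exactForms k := by
  obtain ⟨β, hβ, h⟩ := hα
  refine ⟨f.pullback k β, f.pullback_mem_forms hβ, fun c u hu => ?_⟩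
  rw [f.extDeriv_pullback hβ c hu, ← h _ _ (f.lift_mem c.1 u)]
  rfl

/-- The map induced on second cohomology by a holomorphic map. -/
def HolomorphicMap.pullbackH2 (f : HolomorphicMap 𝓧 m M) :
    (ComplexOrbifold.ofManifold m M).H2 →ₗ[ℝ] 𝓧.H2 :=
  Submodule.mapQ _ _
    ((f.pullback 2).restrict (p := (ComplexOrbifold.ofManifold m M).closedForms 2)
      (q := 𝓧.closedForms 2) fun _ hα => f.pullback_mem_closedForms hα)
    fun _ hα => f.pullback_mem_exactForms hα

end Pullback

/-! ### Suborbifolds and Poincaré duals -/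

section Dual

variable {n m : ℕ} {X : Type*} [TopologicalSpace X]

/-- A complex suborbifold structure on a subset `E` of a complex orbifold: a complex orbifold
structure on `E` for which the inclusion lifts locally to holomorphic immersions between charts. -/
structure Suborbifold (𝓧 : ComplexOrbifold n X) (E : Set X) (m : ℕ) where
  orb : ComplexOrbifold m E
  immersion : ∀ (c : orb.charts) (u : Cn m), u ∈ c.1.dom →
    ∃ L : 𝓧.charts × (Cn m → Cn n), AnalyticAt ℂ L.2 u ∧ Function.Injective (fderiv ℂ L.2 u) ∧
      L.2 u ∈ L.1.1.dom ∧ ∀ᶠ w in 𝓝 u, L.1.1.proj (L.2 w) = c.1.proj w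

open scoped Classical in
/-- The restriction of an orbifold form to a suborbifold, that is, its pullback along local lifts of
the inclusion. (As the form is invariant, the choice of the lifts is irrelevant.) -/
def Suborbifold.restrict {𝓧 : ComplexOrbifold n X} {E : Set X} (S : Suborbifold 𝓧 E m) {k : ℕ}
    (β : 𝓧.Family k) : S.orb.Family k := fun c u =>
  if hu : u ∈ c.1.dom then
    (β (S.immersion c u hu).choose.1 ((S.immersion c u hu).choose.2 u)).compContinuousLinearMap
      (fderiv ℝ (S.immersion c u hu).choose.2 u)
  else 0

/-- The second cohomology class `v` is Poincaré dual to the fundamental class of the complex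
suborbifold `E` of codimension one: `⟨v ∪ b, [X]⟩ = ∫_E b` for all classes `b` of complementary
degree. -/
def IsPoincareDual (𝓧 : ComplexOrbifold (m + 1) X) {E : Set X} (S : Suborbifold 𝓧 E m)
    (v : 𝓧.H2) : Prop :=
  ∀ η : 𝓧.closedForms 2, 𝓧.cls η = v → ∀ β ∈ 𝓧.closedForms (2 * m),
    𝓧.integral (fun c u => wedge (β c u) (η.1 c u)) = S.orb.integral (S.restrict β)

/-- The top power of a closed two-form, evaluated on the fundamental class. By Stokes' theorem it
depends only on the cohomology class of the form. -/
def ComplexOrbifold.topPower (𝓧 : ComplexOrbifold n X) (θ : 𝓧.closedForms 2) : ℝ :=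
  𝓧.integral fun c u => wedgePow (θ.1 c u) n

/-- The two-form `θ` tames the complex structure: `θ (v, i v) > 0` for all nonzero `v`. -/
def ComplexOrbifold.Tames (𝓧 : ComplexOrbifold n X) (θ : 𝓧.closedForms 2) : Prop :=
  ∀ c : 𝓧.charts, ∀ u ∈ c.1.dom, ∀ v : Cn n, v ≠ 0 → 0 < θ.1 c u ![v, Complex.I • v]

end Dual

/-! ### Weighted blow-ups -/

section Blowup

variable {n : ℕ}

/-- The map `(t, z) ↦ (t ^ a₁ z₁, …, t ^ aₙ zₙ)`. -/
def blowdown (a : Fin n → ℕ) (p : ℂ × Cn n) : Cn n := fun l => p.1 ^ a l * p.2 l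

/-- The points `(t, z)`, `z ≠ 0`, lying over the open set `W`. The quotient of this set by the
action `(t, z) ↦ (s⁻¹ t, s ^ a₁ z₁, …, s ^ aₙ zₙ)` of the nonzero complex numbers, together with the
map induced by `blowdown a`, is the weighted blow-up of `W` at the origin. -/
def blowupDomain (a : Fin n → ℕ) (W : Set (Cn n)) : Set (ℂ × Cn n) :=
  {p | p.2 ≠ 0 ∧ blowdown a p ∈ W}

/-- The parametrization of the slice `z_j = 1`: the coordinate `u_j` is used as `t`. -/
def slice (j : Fin n) (u : Cn n) : ℂ × Cn n := (u j, Function.update u j 1)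

/-- The holomorphic map `f` from the complex orbifold `𝓧` to the complex manifold `M` is a weighted
blow-up of `M` at the points `x i` with weights `a i` (in some holomorphic coordinates centered
at `x i`): it is a biholomorphism over the complement of the points, and near `x i` it is the
weighted blow-up of the origin, where the slices `z_j = 1` serve as orbifold charts. -/
structure IsWeightedBlowup {X : Type*} [TopologicalSpace X] {M : Type*} [TopologicalSpace M]
    [ChartedSpace (Cn n) M] (𝓧 : ComplexOrbifold n X) (f : HolomorphicMap 𝓧 n M) {k : ℕ}
    (x : Fin k → M) (a : Fin k → Fin n → ℕ) : Prop where
  bijOn : BijOn f.toFun (f.toFun ⁻¹' (range x)ᶜ) (range x)ᶜ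
  biholomorphic : ∀ c ∈ 𝓧.charts, ∀ e ∈ atlas (Cn n) M, ∀ u ∈ c.dom, ∀ v ∈ e.target,
    f.toFun (c.proj u) = e.symm v → f.toFun (c.proj u) ∉ range x →
      LocallyEquivalent c.dom (fun w => f.toFun (c.proj w)) e.target e.symm u v
  model : ∀ i, ∃ φ ∈ IsManifold.maximalAtlas 𝓘(ℂ, Cn n) ω M,
    x i ∈ φ.source ∧ φ (x i) = 0 ∧ (∀ j ≠ i, x j ∉ φ.source) ∧
    ∃ Ψ : ℂ × Cn n → X,
      Ψ '' blowupDomain (a i) φ.target = f.toFun ⁻¹' φ.source ∧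
      (∀ p ∈ blowupDomain (a i) φ.target, f.toFun (Ψ p) = φ.symm (blowdown (a i) p)) ∧
      (∀ p ∈ blowupDomain (a i) φ.target, ∀ q ∈ blowupDomain (a i) φ.target,
        Ψ p = Ψ q ↔ ∃ s : ℂ, s ≠ 0 ∧ q.1 = s⁻¹ * p.1 ∧ ∀ l, q.2 l = s ^ a i l * p.2 l) ∧
      ∀ j, ∀ c ∈ 𝓧.charts, ∀ u, slice j u ∈ blowupDomain (a i) φ.target → ∀ v ∈ c.dom,
        Ψ (slice j u) = c.proj v →
          LocallyEquivalent {w | slice j w ∈ blowupDomain (a i) φ.target}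
            (fun w => Ψ (slice j w)) c.dom c.proj u v

end Blowup

/-! ### Ellipsoids -/

section Ellipsoid

variable {n : ℕ}

/-- The coordinate one-form `dx_j`. -/
def dx (j : Fin n) : Alt n 1 :=
  ContinuousAlternatingMap.ofSubsingleton ℝ (Cn n) ℝ (0 : Fin 1)
    (Complex.reCLM.comp (ContinuousLinearMap.proj (R := ℝ) (φ := fun _ : Fin n => ℂ) j))

/-- The coordinate one-form `dy_j`. -/
def dy (j : Fin n) : Alt n 1 :=
  ContinuousAlternatingMap.ofSubsingleton ℝ (Cn n) ℝ (0 : Fin 1)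
    (Complex.imCLM.comp (ContinuousLinearMap.proj (R := ℝ) (φ := fun _ : Fin n => ℂ) j))

/-- The standard symplectic form `∑ dx_j ∧ dy_j`. -/
def stdForm (n : ℕ) : Alt n 2 := ∑ j : Fin n, wedge (dx j) (dy j)

/-- The symplectic volume of a subset of complex coordinate space: the integral of the top power of
the standard symplectic form. -/
def symplecticVolume (S : Set (Cn n)) : ℝ := ∫ _ in S, wedgePow (stdForm n) n (frame n)

/-- The closed ellipsoid `π ∑ a_j |z_j|² ≤ r`. -/
def ellipsoid (a : Fin n → ℕ) (r : ℝ) : Set (Cn n) :=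
  {z | Real.pi * ∑ j, (a j : ℝ) * ‖z j‖ ^ 2 ≤ r}

end Ellipsoid

end WeightedBlowup

end

open WeightedBlowup

/-!
The number to be computed is a top intersection number. It depends only on the cohomology class,
because of Stokes' theorem and the telescoping identity
`α ^ (n + 1) - β ^ (n + 1) = (∑ α ^ i ∧ β ^ (n - i)) ∧ (α - β)` (`topPower_sub_topPower`,
`pairing_eq_zero`). Poincaré duality is not needed: in the telescoping identity the duals `ε i` enter
only through their pairings with closed forms, which are integrals over the exceptional divisors, so
they may be replaced by any closed forms with the same pairings.

Such forms `τ i` are constructed explicitly. On `ℂⁿ⁺¹` without the origin there is a connection form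
`weightForm` for the weighted action: with `A` the product of the weights, the map
`w ↦ (w_l ^ (A / a_l))` turns the weighted action into the standard one, whose connection form is
`Im ⟨w, dw⟩ / |w|²` up to a factor. In a chart of the blow-up, with `t` the coordinate normal to the
exceptional divisor, it becomes `dθ / 2π`, with `θ` the argument of `t`, plus a smooth form pulled
back from the divisor (`weightForm_slice`). The differential of a cut-off of minus the connection
form therefore extends smoothly over the divisor and vanishes outside a neighborhood of it. By
Stokes' theorem and the residue formula for `dθ / 2π` (`integral_extDeriv_wedge_angForm`), its
pairing with a closed form is the integral over the divisor (`Suborbifold.integral_wedge_eq`,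
`LocalModel.exists_thomForm`).

Applying the telescoping identity to `f^* Ω - ∑ r_i τ_i` and `f^* Ω` leaves integrals over the
exceptional divisors. On the divisor of `x_i` the form `f^* Ω` vanishes, since the divisor is mapped
to a point, and so do the `τ_j` with `j ≠ i`. What remains is a multiple of the integral of
`(-τ_i) ^ n`, a power of the curvature. It is computed on a single slice `z_j = 1`, which covers the
divisor up to a null set: there the curvature is the pullback of a multiple of the standard
symplectic form of the unit ball under a branched covering of known degree
(`integral_wedgePow_extDeriv_sliceForm`), and the result is `1 / (a_{i,1} ⋯ a_{i,n+1})`. Finally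
`f^* Ω` and `Ω` have the same top power since `f` is biholomorphic off a thin set
(`HolomorphicMap.integral_pullback`), and the volume of an ellipsoid follows from that of a ball by
scaling (`symplecticVolume_ellipsoid`).

The integral over an orbifold is defined by choices of charts and of a partition of unity. Its
independence of these choices rests on counting preimages of points under two charts
(`lintegral_fiber_count`, `integral_eq_sum`); this also allows for charts added to the atlas, such as
the slices of the blow-up, and for neglecting thin sets.
-/

noncomputable section

namespace WeightedBlowup

/-! ### Alternating sums and the wedge product -/

/-- The alternating sum of a function of `m` vectors over all permutations of its arguments. -/
def altSum {m : ℕ} {V : Type*} (T : (Fin m → V) → ℝ) (v : Fin m → V) : ℝ :=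
  ∑ σ : Equiv.Perm (Fin m), ((Equiv.Perm.sign σ : ℤ) : ℝ) * T (v ∘ σ)

/-- The tensor product of a function of `p` vectors and a function of `q` vectors. -/
def tens {p q : ℕ} {V : Type*} (S : (Fin p → V) → ℝ) (T : (Fin q → V) → ℝ) (v : Fin (p + q) → V) :
    ℝ :=
  S (fun i => v (Fin.castAdd q i)) * T (fun i => v (Fin.natAdd p i))

theorem altSum_perm {m : ℕ} {V : Type*} (T : (Fin m → V) → ℝ) (τ : Equiv.Perm (Fin m))
    (v : Fin m → V) :
    altSum (fun w => T (w ∘ τ)) v = ((Equiv.Perm.sign τ : ℤ) : ℝ) * altSum T v := by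
  unfold altSum
  rw [Finset.mul_sum]
  refine Fintype.sum_equiv (Equiv.mulRight τ) _ _ fun σ => ?_
  have h : ((Equiv.Perm.sign τ : ℤ) : ℝ) * ((Equiv.Perm.sign τ : ℤ) : ℝ) = 1 := by
    exact_mod_cast Int.isUnit_mul_self (Units.isUnit _)
  simp only [Equiv.coe_mulRight, Equiv.Perm.sign_mul, Units.val_mul, Int.cast_mul,
    Equiv.Perm.coe_mul, Function.comp_assoc]
  linear_combination -((Equiv.Perm.sign σ : ℤ) : ℝ) * T (v ∘ ⇑σ ∘ ⇑τ) * h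

/-- Antisymmetrizing first over a family of permutations of a block of `p` arguments multiplies the
alternating sum by `p!`. -/
theorem altSum_block {p m : ℕ} {V : Type*} (S : (Fin m → V) → ℝ)
    (ι : Equiv.Perm (Fin p) → Equiv.Perm (Fin m))
    (hι : ∀ π, Equiv.Perm.sign (ι π) = Equiv.Perm.sign π) (v : Fin m → V) :
    altSum (fun w => ∑ π : Equiv.Perm (Fin p), ((Equiv.Perm.sign π : ℤ) : ℝ) * S (w ∘ ι π)) v =
      (p.factorial : ℝ) * altSum S v := by
  have h1 : altSum (fun w => ∑ π : Equiv.Perm (Fin p),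
      ((Equiv.Perm.sign π : ℤ) : ℝ) * S (w ∘ ι π)) v =
      ∑ π : Equiv.Perm (Fin p), ((Equiv.Perm.sign π : ℤ) : ℝ) * altSum (fun w => S (w ∘ ι π)) v := by
    unfold altSum
    simp only [Finset.mul_sum]
    rw [Finset.sum_comm]
    refine Finset.sum_congr rfl fun π _ => Finset.sum_congr rfl fun σ _ => by ring
  rw [h1]
  have h2 : ∀ π : Equiv.Perm (Fin p),
      ((Equiv.Perm.sign π : ℤ) : ℝ) * altSum (fun w => S (w ∘ ι π)) v = altSum S v := fun π => by
    have h : ((Equiv.Perm.sign π : ℤ) : ℝ) * ((Equiv.Perm.sign π : ℤ) : ℝ) = 1 := by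
      exact_mod_cast Int.isUnit_mul_self (Units.isUnit _)
    rw [altSum_perm, hι, ← mul_assoc, h, one_mul]
  simp [h2, Fintype.card_perm]

theorem altSum_smul {m : ℕ} {V : Type*} (r : ℝ) (T : (Fin m → V) → ℝ) (v : Fin m → V) :
    altSum (fun w => r * T w) v = r * altSum T v := by
  unfold altSum
  rw [Finset.mul_sum]
  exact Finset.sum_congr rfl fun σ _ => by ring

theorem altSum_sum {m : ℕ} {V ι : Type*} (s : Finset ι) (T : ι → (Fin m → V) → ℝ) (v : Fin m → V) :
    altSum (fun w => ∑ i ∈ s, T i w) v = ∑ i ∈ s, altSum (T i) v := by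
  unfold altSum
  rw [Finset.sum_comm]
  exact Finset.sum_congr rfl fun σ _ => by rw [Finset.mul_sum]

theorem altSum_cast {m m' : ℕ} {V : Type*} (e : Fin m' ≃ Fin m) (T : (Fin m' → V) → ℝ)
    (v : Fin m → V) : altSum (fun w => T (w ∘ e)) v = altSum T (v ∘ e) := by
  unfold altSum
  refine Fintype.sum_equiv e.symm.permCongr _ _ fun σ => ?_
  rw [Equiv.Perm.sign_permCongr]
  refine congrArg (fun x => _ * T x) ?_
  ext i : 1
  simp [Equiv.permCongr_apply]

theorem altSum_alternating {n m : ℕ} (α : Alt n m) (v : Fin m → Cn n) :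
    altSum α v = (m.factorial : ℝ) * α v := by
  unfold altSum
  have : ∀ σ : Equiv.Perm (Fin m), ((Equiv.Perm.sign σ : ℤ) : ℝ) * α (v ∘ σ) = α v := fun σ => by
    have h : α (v ∘ σ) = Equiv.Perm.sign σ • α v := α.toAlternatingMap.map_perm v σ
    have h' : ((Equiv.Perm.sign σ : ℤ) : ℝ) * ((Equiv.Perm.sign σ : ℤ) : ℝ) = 1 := by
      exact_mod_cast Int.isUnit_mul_self (Units.isUnit _)
    rw [h, Units.smul_def, zsmul_eq_mul, ← mul_assoc, h', one_mul]
  simp [this, Fintype.card_perm]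

/-- Antisymmetrizing the first block of arguments beforehand only contributes the factor `p!`. -/
theorem altSum_tens_left {p q : ℕ} {V : Type*} (S : (Fin p → V) → ℝ) (T : (Fin q → V) → ℝ)
    (v : Fin (p + q) → V) :
    altSum (tens (altSum S) T) v = (p.factorial : ℝ) * altSum (tens S T) v := by
  rw [← altSum_block (tens S T)
    (fun π => finSumFinEquiv.permCongr (Equiv.Perm.sumCongr π (1 : Equiv.Perm (Fin q))))
    (fun π => by simp)]
  congr 1
  ext w
  simp only [tens, altSum, Finset.sum_mul]
  refine Finset.sum_congr rfl fun π _ => ?_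
  rw [mul_assoc]
  congr 3
  · ext i; simp [Equiv.permCongr_apply]
  · ext i; simp [Equiv.permCongr_apply]

theorem altSum_tens_right {p q : ℕ} {V : Type*} (S : (Fin p → V) → ℝ) (T : (Fin q → V) → ℝ)
    (v : Fin (p + q) → V) :
    altSum (tens S (altSum T)) v = (q.factorial : ℝ) * altSum (tens S T) v := by
  rw [← altSum_block (tens S T)
    (fun π => finSumFinEquiv.permCongr (Equiv.Perm.sumCongr (1 : Equiv.Perm (Fin p)) π))
    (fun π => by simp)]
  congr 1
  ext w
  simp only [tens, altSum, Finset.mul_sum]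
  refine Finset.sum_congr rfl fun π _ => ?_
  rw [mul_left_comm]
  congr 3
  · ext i; simp [Equiv.permCongr_apply]
  · ext i; simp [Equiv.permCongr_apply]

theorem wedge_apply {n p q : ℕ} (α : Alt n p) (β : Alt n q) (v : Fin (p + q) → Cn n) :
    wedge α β v = ((p.factorial : ℝ) * q.factorial)⁻¹ * altSum (tens α β) v := by
  unfold wedge altSum
  rw [ContinuousAlternatingMap.smul_apply, ContinuousMultilinearMap.alternatization_apply_apply,
    smul_eq_mul, Nat.cast_mul]
  congr 1
  refine Finset.sum_congr rfl fun σ _ => ?_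
  rw [Units.smul_def, zsmul_eq_mul, tensorForm_apply]
  rfl

theorem wedge_add_left {n p q : ℕ} (α α' : Alt n p) (β : Alt n q) :
    wedge (α + α') β = wedge α β + wedge α' β := by
  ext v
  simp only [wedge_apply, ContinuousAlternatingMap.add_apply, altSum, tens, ← mul_add,
    ← Finset.sum_add_distrib, add_mul]

theorem wedge_add_right {n p q : ℕ} (α : Alt n p) (β β' : Alt n q) :
    wedge α (β + β') = wedge α β + wedge α β' := by
  ext v
  simp only [wedge_apply, ContinuousAlternatingMap.add_apply, altSum, tens, ← mul_add,
    ← Finset.sum_add_distrib]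

theorem wedge_smul_left {n p q : ℕ} (r : ℝ) (α : Alt n p) (β : Alt n q) :
    wedge (r • α) β = r • wedge α β := by
  ext v
  have h : tens ⇑(r • α) ⇑β = fun w => r * tens α β w := by
    ext w
    simp [tens, mul_assoc]
  rw [ContinuousAlternatingMap.smul_apply, wedge_apply, wedge_apply, h, altSum_smul, smul_eq_mul,
    mul_left_comm]

theorem wedge_smul_right {n p q : ℕ} (r : ℝ) (α : Alt n p) (β : Alt n q) :
    wedge α (r • β) = r • wedge α β := by
  ext v
  have h : tens ⇑α ⇑(r • β) = fun w => r * tens α β w := by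
    ext w
    simp [tens, mul_left_comm]
  rw [ContinuousAlternatingMap.smul_apply, wedge_apply, wedge_apply, h, altSum_smul, smul_eq_mul,
    mul_left_comm]

theorem wedge_comp {n m p q : ℕ} (α : Alt n p) (β : Alt n q) (g : Cn m →L[ℝ] Cn n) :
    (wedge α β).compContinuousLinearMap g =
      wedge (α.compContinuousLinearMap g) (β.compContinuousLinearMap g) := by
  ext v
  simp only [ContinuousAlternatingMap.compContinuousLinearMap_apply, wedge_apply]
  rfl

theorem norm_wedge_le {n p q : ℕ} (α : Alt n p) (β : Alt n q) :
    ‖wedge α β‖ ≤ ((p + q).factorial : ℝ) * ‖α‖ * ‖β‖ := by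
  refine ContinuousAlternatingMap.opNorm_le_bound _ (by positivity) fun v => ?_
  rw [wedge_apply, norm_mul]
  have h1 : ‖((p.factorial : ℝ) * q.factorial)⁻¹‖ ≤ 1 := by
    rw [norm_inv, norm_mul, Real.norm_natCast, Real.norm_natCast]
    refine inv_le_one_of_one_le₀ ?_
    exact_mod_cast Nat.one_le_iff_ne_zero.2 (by positivity)
  have h2 : ‖altSum (tens α β) v‖ ≤ ((p + q).factorial : ℝ) * ‖α‖ * ‖β‖ * ∏ i, ‖v i‖ := by
    unfold altSum
    refine (norm_sum_le _ _).trans ?_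
    have hb : ∀ σ ∈ (Finset.univ : Finset (Equiv.Perm (Fin (p + q)))),
        ‖((Equiv.Perm.sign σ : ℤ) : ℝ) * tens α β (v ∘ σ)‖ ≤ ‖α‖ * ‖β‖ * ∏ i, ‖v i‖ := by
      intro σ _
      have hs : ‖((Equiv.Perm.sign σ : ℤ) : ℝ)‖ = 1 := by
        rcases Int.units_eq_one_or (Equiv.Perm.sign σ) with h | h <;> simp [h]
      rw [norm_mul, hs, one_mul, ← Equiv.prod_comp σ fun i => ‖v i‖, Fin.prod_univ_add]
      unfold tens
      rw [norm_mul]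
      refine (mul_le_mul (α.le_opNorm _) (β.le_opNorm _) (norm_nonneg _) (by positivity)).trans ?_
      apply le_of_eq
      simp only [Function.comp_apply]
      ring
    refine (Finset.sum_le_sum hb).trans (le_of_eq ?_)
    rw [Finset.sum_const, Finset.card_univ, Fintype.card_perm, Fintype.card_fin, nsmul_eq_mul]
    ring
  calc _ ≤ 1 * _ := mul_le_mul h1 h2 (norm_nonneg _) zero_le_one
    _ = _ := one_mul _

/-- The wedge product as a continuous bilinear map. -/
def wedgeL (n p q : ℕ) : Alt n p →L[ℝ] Alt n q →L[ℝ] Alt n (p + q) :=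
  LinearMap.mkContinuous₂
    (LinearMap.mk₂ ℝ wedge wedge_add_left wedge_smul_left wedge_add_right wedge_smul_right)
    ((p + q).factorial : ℝ) norm_wedge_le

theorem wedgeL_apply {n p q : ℕ} (α : Alt n p) (β : Alt n q) : wedgeL n p q α β = wedge α β := rfl

theorem wedge_sub_left {n p q : ℕ} (α α' : Alt n p) (β : Alt n q) :
    wedge (α - α') β = wedge α β - wedge α' β := by
  simp only [← wedgeL_apply, map_sub, sub_apply]

theorem wedge_sub_right {n p q : ℕ} (α : Alt n p) (β β' : Alt n q) :
    wedge α (β - β') = wedge α β - wedge α β' := by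
  simp only [← wedgeL_apply, map_sub]

theorem wedge_zero_right {n p q : ℕ} (α : Alt n p) : wedge α (0 : Alt n q) = 0 := by
  rw [← wedgeL_apply, map_zero]

theorem wedge_zero_left {n p q : ℕ} (β : Alt n q) : wedge (0 : Alt n p) β = 0 := by
  rw [← wedgeL_apply, map_zero, zero_apply]

theorem wedge_sum_right {n p q : ℕ} {ι : Type*} (s : Finset ι) (α : Alt n p) (β : ι → Alt n q) :
    wedge α (∑ i ∈ s, β i) = ∑ i ∈ s, wedge α (β i) := by
  simp only [← wedgeL_apply, map_sum]

theorem tens_wedge_left {n p q r : ℕ} (α : Alt n p) (β : Alt n q) (γ : Alt n r)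
    (v : Fin (p + q + r) → Cn n) :
    altSum (tens (wedge α β) γ) v =
      ((p.factorial : ℝ) * q.factorial)⁻¹ * ((p + q).factorial * altSum (tens (tens α β) γ) v) := by
  rw [← altSum_tens_left, ← altSum_smul]
  congr 1
  ext w
  simp only [tens, wedge_apply]
  ring

theorem tens_wedge_right {n p q r : ℕ} (α : Alt n p) (β : Alt n q) (γ : Alt n r)
    (v : Fin (p + (q + r)) → Cn n) :
    altSum (tens α (wedge β γ)) v =
      ((q.factorial : ℝ) * r.factorial)⁻¹ * ((q + r).factorial * altSum (tens α (tens β γ)) v) := by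
  rw [← altSum_tens_right, ← altSum_smul]
  congr 1
  ext w
  simp only [tens, wedge_apply]
  ring

/-- Two-forms commute in a wedge product. -/
theorem wedge_right_comm {n p : ℕ} (γ : Alt n p) (δ θ : Alt n 2) :
    wedge (wedge γ δ) θ = wedge (wedge γ θ) δ := by
  ext v
  rw [wedge_apply, wedge_apply, tens_wedge_left, tens_wedge_left]
  -- The even permutation which exchanges the arguments of `δ` with those of `θ`.
  let τ : Equiv.Perm (Fin (p + 2 + 2)) :=
    Equiv.swap (Fin.castAdd 2 (Fin.natAdd p 0)) (Fin.natAdd (p + 2) 0) *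
      Equiv.swap (Fin.castAdd 2 (Fin.natAdd p 1)) (Fin.natAdd (p + 2) 1)
  have hne : ∀ i j : Fin 2, (Fin.castAdd 2 (Fin.natAdd p i) : Fin (p + 2 + 2)) ≠
      Fin.natAdd (p + 2) j := fun i j h => by
    have := congrArg Fin.val h
    simp at this
    omega
  have hτ : Equiv.Perm.sign τ = 1 := by
    simp only [τ, Equiv.Perm.sign_mul, Equiv.Perm.sign_swap (hne _ _)]
    rfl
  have h1 : altSum (tens (tens γ δ) θ) v = altSum (tens (tens γ θ) δ) v := by
    have := altSum_perm (tens (tens γ δ) θ) τ v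
    rw [hτ] at this
    simp only [Units.val_one, Int.cast_one, one_mul] at this
    rw [← this]
    congr 1
    ext w
    have e1 : ∀ i : Fin p, τ (Fin.castAdd 2 (Fin.castAdd 2 i)) = Fin.castAdd 2 (Fin.castAdd 2 i) := by
      intro i
      simp only [τ, Equiv.Perm.mul_apply]
      rw [Equiv.swap_apply_of_ne_of_ne (a := Fin.castAdd 2 (Fin.natAdd p 1)),
        Equiv.swap_apply_of_ne_of_ne] <;>
        (intro h; have := congrArg Fin.val h; simp at this; try omega)
    have e2 : ∀ i : Fin 2, τ (Fin.castAdd 2 (Fin.natAdd p i)) = Fin.natAdd (p + 2) i := by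
      intro i
      simp only [τ, Equiv.Perm.mul_apply]
      fin_cases i
      · rw [Equiv.swap_apply_of_ne_of_ne (a := Fin.castAdd 2 (Fin.natAdd p 1))]
        · exact Equiv.swap_apply_left _ _
        · intro h; have := congrArg Fin.val h; simp at this
        · exact hne _ _
      · have : (Equiv.swap (Fin.castAdd 2 (Fin.natAdd p 1)) (Fin.natAdd (p + 2) (1 : Fin 2)))
            (Fin.castAdd 2 (Fin.natAdd p 1)) = Fin.natAdd (p + 2) 1 := Equiv.swap_apply_left _ _
        simp only [Fin.mk_one, this]
        rw [Equiv.swap_apply_of_ne_of_ne]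
        · exact (hne _ _).symm
        · intro h; have := congrArg Fin.val h; simp at this
    have e3 : ∀ i : Fin 2, τ (Fin.natAdd (p + 2) i) = Fin.castAdd 2 (Fin.natAdd p i) := by
      intro i
      simp only [τ, Equiv.Perm.mul_apply]
      fin_cases i
      · rw [Equiv.swap_apply_of_ne_of_ne (a := Fin.castAdd 2 (Fin.natAdd p 1))]
        · exact Equiv.swap_apply_right _ _
        · exact (hne _ _).symm
        · intro h; have := congrArg Fin.val h; simp at this
      · have : (Equiv.swap (Fin.castAdd 2 (Fin.natAdd p 1)) (Fin.natAdd (p + 2) (1 : Fin 2)))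
            (Fin.natAdd (p + 2) 1) = Fin.castAdd 2 (Fin.natAdd p 1) := Equiv.swap_apply_right _ _
        simp only [Fin.mk_one, this]
        rw [Equiv.swap_apply_of_ne_of_ne]
        · intro h; have := congrArg Fin.val h; simp at this
        · exact hne _ _
    simp only [tens, Function.comp_apply, e1, e2, e3]
    ring
  rw [h1]

/-- Associativity for two one-forms on the right, the only case needed to expand powers of `∑ dx_j ∧
dy_j`. -/
theorem wedge_assoc_one_one {n p : ℕ} (γ : Alt n p) (α β : Alt n 1) :
    wedge γ (wedge α β) = wedge (wedge γ α) β := by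
  ext v
  have h1 := wedge_apply γ (wedge α β) v
  have h2 := wedge_apply (wedge γ α) β v
  rw [tens_wedge_left] at h2
  rw [tens_wedge_right] at h1
  have h3 : altSum (tens (tens γ α) β) v = altSum (tens γ (tens α β)) v := by
    congr 1
    ext w
    simp only [tens, mul_assoc]
    refine congrArg₂ _ rfl (congrArg₂ _ rfl (congrArg β ?_))
    ext i : 1
    exact congrArg w (Fin.ext (by simp))
  refine h1.trans (Eq.trans ?_ h2.symm)
  rw [h3]
  have hp : (p.factorial : ℝ) ≠ 0 := by positivity
  have hq : ((p + 1).factorial : ℝ) ≠ 0 := by positivity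
  simp
  field_simp

/-! ### The wedge product and the exterior derivative -/

/-- The function of `k + 1` vectors underlying a linear family of alternating forms. -/
def uncurryFun {n k : ℕ} (B : Cn n →L[ℝ] Alt n k) (v : Fin (k + 1) → Cn n) : ℝ :=
  B (v 0) (fun i => v i.succ)

/-- Mathlib defines the exterior derivative as the signed sum `alternatizeUncurryFin` over the
argument that is fed to the derivative; it is a multiple of the full alternating sum. -/
theorem altSum_uncurryFun {n k : ℕ} (B : Cn n →L[ℝ] Alt n k) (v : Fin (k + 1) → Cn n) :
    altSum (uncurryFun B) v =
      (k.factorial : ℝ) * ContinuousAlternatingMap.alternatizeUncurryFin B v := by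
  have h1 := altSum_alternating (ContinuousAlternatingMap.alternatizeUncurryFin B) v
  have h2 : altSum (ContinuousAlternatingMap.alternatizeUncurryFin B) v =
      ((k + 1 : ℕ) : ℝ) * altSum (uncurryFun B) v := by
    -- The summand with index `i` is obtained by moving the argument `i` to the front, by a cycle of
    -- sign `(-1) ^ i`.
    have : (ContinuousAlternatingMap.alternatizeUncurryFin B : (Fin (k + 1) → Cn n) → ℝ) =
        fun w => ∑ i : Fin (k + 1), (-1) ^ (i : ℕ) * uncurryFun B (w ∘ (Fin.cycleRange i).symm) := by
      ext w
      rw [ContinuousAlternatingMap.alternatizeUncurryFin_apply]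
      refine Finset.sum_congr rfl fun i _ => ?_
      simp only [uncurryFun, Function.comp_apply, Fin.cycleRange_symm_zero,
        Fin.cycleRange_symm_succ, zsmul_eq_mul, Int.cast_pow, Int.cast_neg, Int.cast_one]
      rfl
    rw [this, altSum_sum]
    have : ∀ i : Fin (k + 1), altSum (fun w => (-1) ^ (i : ℕ) *
        uncurryFun B (w ∘ (Fin.cycleRange i).symm)) v = altSum (uncurryFun B) v := by
      intro i
      rw [altSum_smul, altSum_perm, ← mul_assoc]
      rw [Equiv.Perm.sign_symm, Fin.sign_cycleRange]
      simp [← mul_pow]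
    simp [this]
  rw [h2, Nat.factorial_succ, Nat.cast_mul, mul_assoc] at h1
  exact mul_left_cancel₀ (by positivity) h1

theorem altSum_tail {m : ℕ} {V : Type*} (S : V → (Fin m → V) → ℝ) (v : Fin (m + 1) → V) :
    altSum (fun w : Fin (m + 1) → V => altSum (S (w 0)) (fun i => w i.succ)) v =
      (m.factorial : ℝ) * altSum (fun w : Fin (m + 1) → V => S (w 0) (fun i => w i.succ)) v := by
  rw [← altSum_block _ (fun π => Equiv.Perm.decomposeFin.symm (0, π)) (fun π => by simp)]
  congr 1

/-- The part of the Leibniz rule in which the right factor is differentiated; `F` is the linear map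
`v ↦ γ ∧ B v`. -/
theorem altUncurry_wedge_right {n p q : ℕ} (γ : Alt n p) (B : Cn n →L[ℝ] Alt n q)
    (F : Cn n →L[ℝ] Alt n (p + q)) (hF : ∀ v, F v = wedge γ (B v)) :
    ContinuousAlternatingMap.alternatizeUncurryFin F =
      (-1 : ℝ) ^ p • wedge γ (ContinuousAlternatingMap.alternatizeUncurryFin B) := by
  have hp : (p.factorial : ℝ) ≠ 0 := by positivity
  have hq : (q.factorial : ℝ) ≠ 0 := by positivity
  have hpq : ((p + q).factorial : ℝ) ≠ 0 := by positivity
  have hq1 : ((q + 1).factorial : ℝ) ≠ 0 := by positivity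
  ext v
  have h1 := altSum_uncurryFun F v
  have h2 : altSum (uncurryFun F) v = ((p.factorial : ℝ) * q.factorial)⁻¹ * ((p + q).factorial *
      altSum (fun w : Fin (p + q + 1) → Cn n => tens γ (B (w 0)) (fun i => w i.succ)) v) := by
    have := altSum_tail (fun x : Cn n => tens γ (B x)) v
    rw [← this, ← altSum_smul]
    congr 1
    ext w
    simp only [uncurryFun, hF, wedge_apply]
  have h3 : ContinuousAlternatingMap.alternatizeUncurryFin F v =
      ((p.factorial : ℝ) * q.factorial)⁻¹ *
      altSum (fun w : Fin (p + q + 1) → Cn n => tens γ (B (w 0)) (fun i => w i.succ)) v := by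
    rw [h2] at h1
    apply mul_left_cancel₀ hpq
    rw [← h1]
    ring
  have h4 : altSum (tens γ (ContinuousAlternatingMap.alternatizeUncurryFin B)) v =
      ((q + 1).factorial : ℝ) * (q.factorial : ℝ)⁻¹ * altSum (tens γ (uncurryFun B)) v := by
    rw [mul_comm ((q + 1).factorial : ℝ), mul_assoc, ← altSum_tens_right, ← altSum_smul]
    congr 1
    ext w
    simp only [tens, altSum_uncurryFun]
    field_simp
  -- Moving the differentiated argument past the `p` arguments of `γ` is a cycle of sign `(-1) ^ p`.
  have h5 := altSum_perm (tens γ (uncurryFun B))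
    (Fin.cycleRange (⟨p, by omega⟩ : Fin (p + q + 1))) v
  have h6 : (fun w : Fin (p + q + 1) → Cn n => tens γ (uncurryFun B)
      (w ∘ (Fin.cycleRange (⟨p, by omega⟩ : Fin (p + q + 1))))) =
      fun w : Fin (p + q + 1) → Cn n => tens γ (B (w 0)) (fun i => w i.succ) := by
    ext w
    have e1 : ∀ i : Fin p, Fin.cycleRange (⟨p, by omega⟩ : Fin (p + q + 1)) (Fin.castAdd (q + 1) i) =
        (Fin.castAdd q i).succ := by
      intro i
      rw [Fin.cycleRange_of_lt (by rw [Fin.lt_def]; simp)]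
      refine Fin.ext ?_
      have h := Fin.val_add_one_of_lt (n := p + q) (i := Fin.castAdd (q + 1) i)
        (by rw [Fin.lt_def]; simp; omega)
      exact h
    have e2 : Fin.cycleRange (⟨p, by omega⟩ : Fin (p + q + 1)) (Fin.natAdd p (0 : Fin (q + 1))) =
        0 := by
      rw [Fin.cycleRange_of_eq]
      ext; simp
    have e3 : ∀ i : Fin q, Fin.cycleRange (⟨p, by omega⟩ : Fin (p + q + 1))
        (Fin.natAdd p i.succ) = (Fin.natAdd p i).succ := by
      intro i
      rw [Fin.cycleRange_of_gt]
      · ext; simp; omega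
      · rw [Fin.lt_def]; simp
    simp only [tens, uncurryFun, Function.comp_apply]
    erw [e2]
    congr 3
    · ext i : 1
      exact congrArg w (e1 i)
    · ext i : 1
      exact congrArg w (e3 i)
  replace h5 := (congrArg (fun T => altSum T v) h6).symm.trans h5
  rw [Fin.sign_cycleRange] at h5
  rw [h3, h5, ContinuousAlternatingMap.smul_apply]
  have h7 := wedge_apply γ (ContinuousAlternatingMap.alternatizeUncurryFin B) v
  rw [h4] at h7
  refine Eq.trans ?_ (congrArg (fun x => (-1 : ℝ) ^ p • x) h7.symm)
  simp only [smul_eq_mul, Units.val_pow_eq_pow_val, Units.val_neg, Units.val_one, Int.cast_pow,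
    Int.cast_neg, Int.cast_one]
  field_simp

/-- The part of the Leibniz rule in which the left factor is differentiated vanishes if the left
factor is closed. -/
theorem altUncurry_wedge_left {n p q : ℕ} (B : Cn n →L[ℝ] Alt n p) (δ : Alt n q)
    (hB : ContinuousAlternatingMap.alternatizeUncurryFin B = 0)
    (F : Cn n →L[ℝ] Alt n (p + q)) (hF : ∀ v, F v = wedge (B v) δ) :
    ContinuousAlternatingMap.alternatizeUncurryFin F = 0 := by
  have hpq : ((p + q).factorial : ℝ) ≠ 0 := by positivity
  ext v
  have h1 := altSum_uncurryFun F v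
  have h2 : altSum (uncurryFun F) v = ((p.factorial : ℝ) * q.factorial)⁻¹ * ((p + q).factorial *
      altSum (fun w : Fin (p + q + 1) → Cn n => tens (B (w 0)) δ (fun i => w i.succ)) v) := by
    have := altSum_tail (fun x : Cn n => tens (B x) δ) v
    rw [← this, ← altSum_smul]
    congr 1
    ext w
    simp only [uncurryFun, hF, wedge_apply]
  have h3 : altSum (fun w : Fin (p + q + 1) → Cn n => tens (B (w 0)) δ (fun i => w i.succ)) v =
      altSum (tens (uncurryFun B) δ) (v ∘ finCongr (by omega : p + 1 + q = p + q + 1)) := by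
    rw [← altSum_cast]
    congr 1
    ext w
    simp only [tens, uncurryFun, Function.comp_apply]
    congr 3
    · ext i : 1
      congr 1
      ext
      simp
      omega
  have h4 : altSum (tens (uncurryFun B) δ) (v ∘ finCongr (by omega : p + 1 + q = p + q + 1)) = 0 := by
    have h5 := altSum_tens_left (uncurryFun B) δ (v ∘ finCongr (by omega : p + 1 + q = p + q + 1))
    have h6 : tens (altSum (uncurryFun B)) δ = fun _ => 0 := by
      ext w
      simp only [tens, altSum_uncurryFun, hB]
      simp
    rw [h6] at h5
    have h7 : ((p + 1).factorial : ℝ) ≠ 0 := by positivity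
    have h8 : altSum (fun _ : Fin (p + 1 + q) → Cn n => (0 : ℝ))
        (v ∘ finCongr (by omega : p + 1 + q = p + q + 1)) = 0 := by simp [altSum]
    rw [h8] at h5
    exact (mul_eq_zero.1 h5.symm).resolve_left h7
  rw [h2, h3, h4, mul_zero, mul_zero] at h1
  simpa using (mul_eq_zero.1 h1.symm).resolve_left hpq

/-- The wedge product with a one-form, expanded over the argument that is fed to the one-form. -/
theorem wedge_one_apply {n p : ℕ} (γ : Alt n p) (α : Alt n 1) (v : Fin (p + 1) → Cn n) :
    wedge γ α v = (-1 : ℝ) ^ p *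
      ∑ i : Fin (p + 1), (-1 : ℝ) ^ (i : ℕ) * (α (fun _ => v i) * γ (i.removeNth v)) := by
  let a : Cn n →L[ℝ] ℝ := (ContinuousAlternatingMap.ofSubsingleton ℝ (Cn n) ℝ (0 : Fin 1)).symm α
  have ha : ∀ x, a x = α (fun _ => x) := fun x => rfl
  -- Up to a rotation of the arguments `γ ∧ α` is the alternation of the linear family `x ↦ α x •
  -- γ`.
  let B : Cn n →L[ℝ] Alt n p := a.smulRight γ
  have hB : ∀ x w, B x w = α (fun _ => x) * γ w := fun x w => by
    simp [B, ha]
  have h1 := altSum_uncurryFun B v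
  rw [ContinuousAlternatingMap.alternatizeUncurryFin_apply] at h1
  have h2 := altSum_perm (tens γ α) (finRotate (p + 1)) v
  have h3 : (fun w : Fin (p + 1) → Cn n => tens γ α (w ∘ finRotate (p + 1))) = uncurryFun B := by
    ext w
    simp only [tens, uncurryFun, hB, Function.comp_apply]
    rw [mul_comm]
    congr 2
    · ext i : 1
      congr 1
      rw [Fin.fin_one_eq_zero i]
      have : Fin.natAdd p (0 : Fin 1) = Fin.last p := by ext; simp
      rw [this, finRotate_last]
    · ext i : 1
      congr 1
      have : Fin.castAdd 1 i = i.castSucc := rfl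
      rw [this, finRotate_apply]
      simp
  rw [h3, h1, sign_finRotate] at h2
  have hs : ((((-1 : ℤˣ) ^ p : ℤˣ) : ℤ) : ℝ) = (-1 : ℝ) ^ p := by push_cast; rfl
  rw [Nat.add_sub_cancel, hs] at h2
  have h4 : altSum (tens γ α) v = (-1 : ℝ) ^ p * ((p.factorial : ℝ) *
      ∑ i : Fin (p + 1), (-1 : ℤ) ^ (i : ℕ) • (B (v i)) (i.removeNth v)) := by
    rw [h2, ← mul_assoc, ← mul_pow]
    simp
  rw [wedge_apply, h4]
  have hp : (p.factorial : ℝ) ≠ 0 := by positivity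
  simp only [hB, zsmul_eq_mul, Int.cast_pow, Int.cast_neg, Int.cast_one, Nat.factorial_one,
    Nat.cast_one, mul_one]
  field_simp

theorem fderiv_wedge {n p q : ℕ} {α : Cn n → Alt n p} {β : Cn n → Alt n q} {u : Cn n}
    (hα : DifferentiableAt ℝ α u) (hβ : DifferentiableAt ℝ β u) :
    fderiv ℝ (fun w => wedge (α w) (β w)) u =
      (wedgeL n p q (α u)).comp (fderiv ℝ β u) + ((wedgeL n p q).flip (β u)).comp (fderiv ℝ α u) := by
  have := (wedgeL n p q).hasFDerivAt_of_bilinear hα.hasFDerivAt hβ.hasFDerivAt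
  have h := this.fderiv
  simp only [wedgeL_apply] at h
  rw [h]
  ext v w
  simp [ContinuousLinearMap.precompR, ContinuousLinearMap.precompL]

/-- The Leibniz rule when the left factor is closed. -/
theorem extDeriv_wedge_of_closed {n p q : ℕ} {α : Cn n → Alt n p} {β : Cn n → Alt n q} {u : Cn n}
    (hα : DifferentiableAt ℝ α u) (hβ : DifferentiableAt ℝ β u) (h : extDeriv α u = 0) :
    extDeriv (fun w => wedge (α w) (β w)) u = (-1 : ℝ) ^ p • wedge (α u) (extDeriv β u) := by
  unfold extDeriv at h ⊢
  rw [fderiv_wedge hα hβ, ContinuousAlternatingMap.alternatizeUncurryFin_add,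
    altUncurry_wedge_right (α u) (fderiv ℝ β u) _ (fun v => rfl),
    altUncurry_wedge_left (fderiv ℝ α u) (β u) h _ (fun v => rfl), add_zero]

theorem isBoundedBilinearMap_wedge (n p q : ℕ) :
    IsBoundedBilinearMap ℝ (fun x : Alt n p × Alt n q => wedge x.1 x.2) where
  add_left := wedge_add_left
  smul_left := wedge_smul_left
  add_right := wedge_add_right
  smul_right := wedge_smul_right
  bound := ⟨((p + q).factorial : ℝ), by positivity, norm_wedge_le⟩

theorem contDiffAt_bilin {E F G H : Type*} [NormedAddCommGroup E] [NormedSpace ℝ E] [NormedAddCommGroup F] [NormedSpace ℝ F] [NormedAddCommGroup G] [NormedSpace ℝ G] [NormedAddCommGroup H] [NormedSpace ℝ H]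
  {b : F × G → H} {α : E → F} {β : E → G}  {u : E} {k : WithTop ℕ∞} (hb : IsBoundedBilinearMap ℝ b)
    (hα : ContDiffAt ℝ k α u) (hβ : ContDiffAt ℝ k β u) :
    ContDiffAt ℝ k (fun w => b (α w, β w)) u :=  hb.contDiff.contDiffAt.comp u (hα.prodMk hβ)

theorem contDiffAt_wedge {E : Type*} [NormedAddCommGroup E] [NormedSpace ℝ E] {n p q : ℕ}
    {α : E → Alt n p} {β : E → Alt n q} {u : E} {k : WithTop ℕ∞}
    (hα : ContDiffAt ℝ k α u) (hβ : ContDiffAt ℝ k β u) :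
    ContDiffAt ℝ k (fun w => wedge (α w) (β w)) u := 
  contDiffAt_bilin (isBoundedBilinearMap_wedge n p q) hα hβ

/-! ### Top-degree forms and Jacobians -/

/-- The standard frame as a real basis of complex coordinate space. -/
def frameBasis (n : ℕ) : Module.Basis (Fin (2 * n)) ℝ (Cn n) :=
  (Pi.basis fun _ : Fin n => Complex.basisOneI).reindex
    ((Equiv.sigmaEquivProd (Fin n) (Fin 2)).trans
      (finProdFinEquiv.trans (finCongr (Nat.mul_comm n 2))))

theorem coe_frameBasis (n : ℕ) : ⇑(frameBasis n) = frame n := by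
  ext m : 1
  obtain ⟨⟨i, j⟩, rfl⟩ := (finProdFinEquiv.trans (finCongr (Nat.mul_comm n 2))).surjective m
  rw [frameBasis, Module.Basis.reindex_apply]
  have h1 : ((Equiv.sigmaEquivProd (Fin n) (Fin 2)).trans
      (finProdFinEquiv.trans (finCongr (Nat.mul_comm n 2)))).symm
      ((finProdFinEquiv.trans (finCongr (Nat.mul_comm n 2))) (i, j)) = ⟨i, j⟩ := by
    rw [Equiv.symm_apply_eq]
    rfl
  rw [h1, Pi.basis_apply]
  have h2 : (((finProdFinEquiv.trans (finCongr (Nat.mul_comm n 2))) (i, j) : Fin (2 * n)) : ℕ) =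
      j + 2 * i := rfl
  unfold frame
  have h3 : (⟨(((finProdFinEquiv.trans (finCongr (Nat.mul_comm n 2))) (i, j) : Fin (2 * n)) : ℕ) / 2,
      by omega⟩ : Fin n) = i := Fin.ext (by simp only [h2]; omega)
  rw [h3, h2]
  congr 1
  fin_cases j <;> simp [Nat.add_mod]

theorem alt_comp_frame {n : ℕ} (α : Alt n (2 * n)) (g : Cn n →L[ℝ] Cn n) :
    α.compContinuousLinearMap g (frame n) = g.det * α (frame n) := by
  have h := AlternatingMap.eq_smul_basis_det (frameBasis n) α.toAlternatingMap
  have h1 : ∀ v, α v = α (frame n) * (frameBasis n).det v := fun v => by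
    have := congrArg (fun f => f v) h
    simp only [AlternatingMap.smul_apply, smul_eq_mul, coe_frameBasis] at this
    exact this
  rw [ContinuousAlternatingMap.compContinuousLinearMap_apply, h1]
  have h2 : (frameBasis n).det (⇑g ∘ frame n) = g.det := by
    rw [← coe_frameBasis, ← ContinuousLinearMap.coe_coe, Module.Basis.det_comp,
      Module.Basis.det_self, mul_one]
  rw [h2, mul_comm]

/-- The real determinant of a complex linear map is nonnegative. -/
theorem det_restrictScalars_eq {n : ℕ} (g : Cn n →L[ℂ] Cn n) :
    (g.restrictScalars ℝ).det = Complex.normSq g.det := by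
  have := LinearMap.det_restrictScalars (R := ℝ) (S := ℂ) (f := (g : Cn n →ₗ[ℂ] Cn n))
  rw [Algebra.norm_complex_eq] at this
  exact this

/-! ### Transitions -/

section Transition

variable {n : ℕ} {X : Type*} {s t r : Set (Cn n)} {p q o : Cn n → X}
  {h h' : OpenPartialHomeomorph (Cn n) (Cn n)}

theorem IsTransition.differentiableAt (hh : IsTransition s p t q h) {w : Cn n} (hw : w ∈ h.source) :
    DifferentiableAt ℂ h w :=
  (hh.holomorphic.contDiffAt (h.open_source.mem_nhds hw)).differentiableAt (by simp)

theorem IsTransition.contDiffAt (hh : IsTransition s p t q h) {w : Cn n} (hw : w ∈ h.source) :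
    ContDiffAt ℝ ∞ h w :=
  ((hh.holomorphic.contDiffAt (h.open_source.mem_nhds hw)).restrict_scalars ℝ).of_le le_top

theorem IsTransition.fderiv_eq (hh : IsTransition s p t q h) {w : Cn n} (hw : w ∈ h.source) :
    fderiv ℝ h w = (fderiv ℂ h w).restrictScalars ℝ :=
  ((hh.differentiableAt hw).hasFDerivAt.restrictScalars ℝ).fderiv

theorem IsTransition.abs_det (hh : IsTransition s p t q h) {w : Cn n} (hw : w ∈ h.source) :
    |(fderiv ℝ h w).det| = (fderiv ℝ h w).det := by
  rw [hh.fderiv_eq hw, det_restrictScalars_eq]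
  exact abs_of_nonneg (Complex.normSq_nonneg _)

theorem IsTransition.refl (hs : IsOpen s) :
    IsTransition s p s p (OpenPartialHomeomorph.ofSet s hs) where
  source_subset := subset_rfl
  target_subset := subset_rfl
  holomorphic := contDiff_id.contDiffOn
  holomorphic_symm := contDiff_id.contDiffOn
  comm _ _ := rfl

theorem IsTransition.symm (hh : IsTransition s p t q h) : IsTransition t q s p h.symm where
  source_subset := hh.target_subset
  target_subset := hh.source_subset
  holomorphic := hh.holomorphic_symm
  holomorphic_symm := by simpa using hh.holomorphic
  comm w hw := by
    have := hh.comm (h.symm w) (h.map_target hw)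
    rw [h.right_inv hw] at this
    exact this.symm

theorem IsTransition.trans (hh : IsTransition s p t q h) (hh' : IsTransition t q r o h') :
    IsTransition s p r o (h.trans h') where
  source_subset w hw := by
    simp only [OpenPartialHomeomorph.trans_source, mem_inter_iff] at hw
    exact hh.source_subset hw.1
  target_subset w hw := by
    simp only [OpenPartialHomeomorph.trans_target, mem_inter_iff] at hw
    exact hh'.target_subset hw.1
  holomorphic := by
    refine hh'.holomorphic.comp (hh.holomorphic.mono ?_) ?_
    · intro w hw
      simp only [OpenPartialHomeomorph.trans_source, mem_inter_iff] at hw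
      exact hw.1
    · intro w hw
      simp only [OpenPartialHomeomorph.trans_source, mem_inter_iff] at hw
      exact hw.2
  holomorphic_symm := by
    refine hh.holomorphic_symm.comp (hh'.holomorphic_symm.mono ?_) ?_
    · intro w hw
      simp only [OpenPartialHomeomorph.trans_target, mem_inter_iff] at hw
      exact hw.1
    · intro w hw
      simp only [OpenPartialHomeomorph.trans_target, mem_inter_iff] at hw
      exact hw.2
  comm w hw := by
    simp only [OpenPartialHomeomorph.trans_source, mem_inter_iff] at hw
    exact (hh'.comm _ hw.2).trans (hh.comm _ hw.1)

/-- The restriction of a transition to smaller open domains. -/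
theorem IsTransition.restr (hh : IsTransition s p t q h) {s' t' : Set (Cn n)} (hs' : IsOpen s')
    (ht' : IsOpen t') {u : Cn n} (hu : u ∈ h.source) (hus : u ∈ s') (hut : h u ∈ t') :
    ∃ k : OpenPartialHomeomorph (Cn n) (Cn n), IsTransition s' p t' q k ∧ u ∈ k.source ∧
      k.source ⊆ h.source ∧ ⇑k = ⇑h := by
  have hopen : IsOpen (h.source ∩ h ⁻¹' t') := h.isOpen_inter_preimage ht'
  refine ⟨h.restrOpen (s' ∩ (h.source ∩ h ⁻¹' t')) (hs'.inter hopen), ⟨?_, ?_, ?_, ?_, ?_⟩,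
    ?_, ?_, rfl⟩
  · intro w hw
    rw [OpenPartialHomeomorph.restrOpen_source] at hw
    exact hw.2.1
  · intro w hw
    have h1 := (h.restrOpen (s' ∩ (h.source ∩ h ⁻¹' t')) (hs'.inter hopen)).map_target hw
    rw [OpenPartialHomeomorph.restrOpen_source] at h1
    have h2 := (h.restrOpen (s' ∩ (h.source ∩ h ⁻¹' t')) (hs'.inter hopen)).right_inv hw
    rw [← h2]
    exact h1.2.2.2
  · refine hh.holomorphic.mono fun w hw => ?_
    rw [OpenPartialHomeomorph.restrOpen_source] at hw
    exact hw.1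
  · refine hh.holomorphic_symm.mono fun w hw => hw.1
  · intro w hw
    rw [OpenPartialHomeomorph.restrOpen_source] at hw
    exact hh.comm w hw.1
  · rw [OpenPartialHomeomorph.restrOpen_source]
    exact ⟨hu, hus, hu, hut⟩
  · intro w hw
    rw [OpenPartialHomeomorph.restrOpen_source] at hw
    exact hw.1

theorem IsTransition.mono (hh : IsTransition s p t q h) {s' t' : Set (Cn n)} (hs' : s ⊆ s')
    (ht' : t ⊆ t') : IsTransition s' p t' q h :=
  { hh with
    source_subset := hh.source_subset.trans hs'
    target_subset := hh.target_subset.trans ht' }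

theorem LocallyEquivalent.symm {u v : Cn n} (hh : LocallyEquivalent s p t q u v) :
    LocallyEquivalent t q s p v u := by
  obtain ⟨h, h1, h2, rfl⟩ := hh
  exact ⟨h.symm, h1.symm, h.map_source h2, h.left_inv h2⟩

theorem LocallyEquivalent.trans {u v w : Cn n} (hh : LocallyEquivalent s p t q u v)
    (hh' : LocallyEquivalent t q r o v w) : LocallyEquivalent s p r o u w := by
  obtain ⟨h, h1, h2, rfl⟩ := hh
  obtain ⟨h', h1', h2', rfl⟩ := hh'
  refine ⟨h.trans h', h1.trans h1', ?_, rfl⟩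
  rw [OpenPartialHomeomorph.trans_source]
  exact ⟨h2, h2'⟩

theorem LocallyEquivalent.restr {u v : Cn n} (hh : LocallyEquivalent s p t q u v)
    {s' t' : Set (Cn n)} (hs' : IsOpen s') (ht' : IsOpen t') (hu : u ∈ s') (hv : v ∈ t') :
    LocallyEquivalent s' p t' q u v := by
  obtain ⟨h, h1, h2, rfl⟩ := hh
  obtain ⟨k, hk, hk1, hk2, hk3⟩ := h1.restr hs' ht' h2 hu hv
  exact ⟨k, hk, hk1, by rw [hk3]⟩

end Transition

/-! ### Counting preimages -/

open scoped ENNReal in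
/-- Counting with multiplicity, as a sum of indicator functions. -/
theorem mul_encard_eq_tsum {ι : Type*} (x : ℝ≥0∞) (I : Set ι) :
    x * ((I.encard : ℕ∞) : ℝ≥0∞) = ∑' i, I.indicator (fun _ => x) i := by
  rw [← ENNReal.tsum_set_one, ← ENNReal.tsum_mul_left, ← tsum_subtype]
  simp

open scoped ENNReal in
/-- Two parametrizations `p` and `q` which are locally related by biholomorphisms, and two densities
`F` and `G` which correspond to each other under these: the integrals of the densities agree once
each point is counted with the number of its partners. The pairs `(u, v)` with `p u = q v` form a
separable space, which is covered by the graphs of countably many transitions; summing the change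
of variables formula over disjoint measurable pieces of these graphs gives the claim. -/
theorem lintegral_fiber_count {n : ℕ} {Y : Type*} {s t : Set (Cn n)} {p q : Cn n → Y}
    (hs : IsOpen s) (ht : IsOpen t)
    (hLE : ∀ u ∈ s, ∀ v ∈ t, p u = q v → LocallyEquivalent s p t q u v)
    (hinj : ∀ v ∈ t, ∃ V ∈ 𝓝 v, InjOn q (V ∩ t)) {F G : Cn n → ℝ≥0∞}
    (hF : AEMeasurable F (volume.restrict s)) (hG : AEMeasurable G (volume.restrict t))
    (hFG : ∀ h, IsTransition s p t q h → ∀ w ∈ h.source,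
      F w = ENNReal.ofReal |(fderiv ℝ h w).det| * G (h w)) :
    ∫⁻ u in s, F u * (({v | v ∈ t ∧ q v = p u}.encard : ℕ∞) : ℝ≥0∞) =
      ∫⁻ v in t, G v * (({u | u ∈ s ∧ p u = q v}.encard : ℕ∞) : ℝ≥0∞) := by
  set Z : Set (Cn n × Cn n) := {z | z.1 ∈ s ∧ z.2 ∈ t ∧ p z.1 = q z.2} with hZ
  -- Near each of its points the set of pairs lies on the graph of a single transition, since `q` is
  -- locally injective.
  have hloc : ∀ z : Cn n × Cn n, ∃ h : OpenPartialHomeomorph (Cn n) (Cn n), z ∈ Z →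
      IsTransition s p t q h ∧ {z' : Cn n × Cn n | z'.1 ∈ h.source ∧ h z'.1 = z'.2} ∈ 𝓝[Z] z := by
    rintro ⟨u, v⟩
    by_cases hz : (u, v) ∈ Z
    swap
    · exact ⟨OpenPartialHomeomorph.refl _, fun h => absurd h hz⟩
    obtain ⟨h, hh, hu, hv⟩ := hLE u hz.1 v hz.2.1 hz.2.2
    refine ⟨h, fun _ => ⟨hh, ?_⟩⟩
    obtain ⟨V, hV, hVi⟩ := hinj v hz.2.1
    have c1 : ∀ᶠ z' : Cn n × Cn n in 𝓝 (u, v), z'.1 ∈ h.source :=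
      continuousAt_fst.eventually (h.open_source.mem_nhds hu)
    have c2 : ∀ᶠ z' : Cn n × Cn n in 𝓝 (u, v), z'.2 ∈ V := continuousAt_snd.eventually hV
    have c3 : ∀ᶠ z' : Cn n × Cn n in 𝓝 (u, v), h z'.1 ∈ V := by
      have h1 : ContinuousAt (fun z' : Cn n × Cn n => h z'.1) (u, v) :=
        ContinuousAt.comp (f := Prod.fst) (x := (u, v)) (h.continuousAt hu) continuousAt_fst
      refine h1.eventually ?_
      simp only [hv]
      exact hV
    filter_upwards [mem_nhdsWithin_of_mem_nhds c1, mem_nhdsWithin_of_mem_nhds c2,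
      mem_nhdsWithin_of_mem_nhds c3, self_mem_nhdsWithin] with z' h1 h2 h3 h4
    refine ⟨h1, hVi ⟨h3, hh.target_subset (h.map_source h1)⟩ ⟨h2, h4.2.1⟩ ?_⟩
    rw [hh.comm _ h1]
    exact h4.2.2
  choose h hh using hloc
  obtain ⟨T, hTZ, hTc, hTcov⟩ := TopologicalSpace.countable_cover_nhdsWithin
    (f := fun z => {z' : Cn n × Cn n | z'.1 ∈ (h z).source ∧ h z z'.1 = z'.2})
    (fun z hz => (hh z hz).2)
  have : Countable T := hTc
  obtain ⟨e, he⟩ := exists_injective_nat T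
  have htr : ∀ i : T, IsTransition s p t q (h i) := fun i => (hh i (hTZ i.2)).1
  -- Points over which the graph of `h i` does not meet a graph with a smaller number: the
  -- corresponding pieces of the graphs are disjoint.
  set S : T → Set (Cn n) := fun i => {u | u ∈ (h i).source ∧
    ∀ k : T, e k < e i → ¬(u ∈ (h k).source ∧ h k u = h i u)} with hS
  have hSsub : ∀ i, S i ⊆ (h i).source := fun i u hu => hu.1
  have hSs : ∀ i, S i ⊆ s := fun i => (hSsub i).trans (htr i).source_subset
  have hSm : ∀ i, MeasurableSet (S i) := by
    intro i
    have : S i = (h i).source ∩ ⋂ k : T, ⋂ _ : e k < e i,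
        (((h i).source ∩ (h k).source) \
          (((h i).source ∩ (h k).source) ∩ (fun u => h k u - h i u) ⁻¹' {0}ᶜ))ᶜ := by
      ext u
      simp only [hS, mem_ofPred_eq, mem_inter_iff, mem_iInter, mem_compl_iff, mem_sdiff, mem_preimage,
        mem_singleton_iff, sub_eq_zero]
      refine and_congr_right fun hu => forall₂_congr fun k _ => ?_
      tauto
    rw [this]
    refine (h i).open_source.measurableSet.inter (MeasurableSet.iInter fun k =>
      MeasurableSet.iInter fun _ => MeasurableSet.compl (MeasurableSet.diff ?_ ?_))
    · exact ((h i).open_source.inter (h k).open_source).measurableSet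
    · refine (ContinuousOn.isOpen_inter_preimage ?_ ((h i).open_source.inter (h k).open_source)
        isOpen_compl_singleton).measurableSet
      exact ((h k).continuousOn.mono inter_subset_right).sub
        ((h i).continuousOn.mono inter_subset_left)
  have hTm : ∀ i : T, MeasurableSet (h i '' S i) := fun i =>
    (hSm i).image_of_continuousOn_injOn ((h i).continuousOn.mono (hSsub i))
      ((h i).injOn.mono (hSsub i))
  have hTt : ∀ i : T, h i '' S i ⊆ t := by
    rintro i _ ⟨u, hu, rfl⟩
    exact (htr i).target_subset ((h i).map_source (hSsub i hu))
  have huniq : ∀ (i k : T) (u : Cn n), u ∈ S i → u ∈ S k → h i u = h k u → i = k := by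
    intro i k u hi hk hik
    rcases lt_trichotomy (e i) (e k) with hlt | heq | hlt
    · exact absurd ⟨hi.1, hik⟩ (hk.2 i hlt)
    · exact he heq
    · exact absurd ⟨hk.1, hik.symm⟩ (hi.2 k hlt)
  have hex : ∀ u v, (u, v) ∈ Z → ∃ i : T, u ∈ S i ∧ h i u = v := by
    intro u v huv
    have hne : ∃ m : ℕ, ∃ i : T, e i = m ∧ u ∈ (h i).source ∧ h i u = v := by
      obtain ⟨z, hz, hz'⟩ := mem_iUnion₂.1 (hTcov huv)
      exact ⟨_, ⟨z, hz⟩, rfl, hz'.1, hz'.2⟩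
    classical
    obtain ⟨i, hi, hi1, hi2⟩ := Nat.find_spec hne
    refine ⟨i, ⟨hi1, fun k hk hk' => ?_⟩, hi2⟩
    rw [hi] at hk
    exact Nat.find_min hne hk ⟨k, rfl, hk'.1, hk'.2.trans hi2⟩
  -- Hence the partners of `u` correspond to the indices `i` with `u ∈ S i`, and those of `v` to the
  -- indices `i` with `v ∈ h i (S i)`.
  have hcs : ∀ u ∈ s, {v | v ∈ t ∧ q v = p u}.encard = {i : T | u ∈ S i}.encard := by
    intro u hu
    have : {v | v ∈ t ∧ q v = p u} = (fun i : T => h i u) '' {i : T | u ∈ S i} := by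
      ext v
      constructor
      · rintro ⟨hv, hv'⟩
        obtain ⟨i, hi, hi'⟩ := hex u v ⟨hu, hv, hv'.symm⟩
        exact ⟨i, hi, hi'⟩
      · rintro ⟨i, hi, rfl⟩
        exact ⟨hTt i ⟨u, hi, rfl⟩, (htr i).comm u hi.1⟩
    rw [this, InjOn.encard_image]
    exact fun i hi k hk hik => huniq i k u hi hk hik
  have hct : ∀ v ∈ t, {u | u ∈ s ∧ p u = q v}.encard = {i : T | v ∈ h i '' S i}.encard := by
    intro v hv
    have hl : ∀ i : T, ∀ u ∈ S i, (h i).symm (h i u) = u := fun i u hu =>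
      (h i).left_inv (hSsub i hu)
    have : {u | u ∈ s ∧ p u = q v} = (fun i : T => (h i).symm v) '' {i : T | v ∈ h i '' S i} := by
      ext u
      constructor
      · rintro ⟨hu, hu'⟩
        obtain ⟨i, hi, rfl⟩ := hex u v ⟨hu, hv, hu'⟩
        exact ⟨i, ⟨u, hi, rfl⟩, hl i u hi⟩
      · rintro ⟨i, ⟨u', hi, rfl⟩, rfl⟩
        simp only [hl i u' hi]
        exact ⟨hSs i hi, ((htr i).comm u' hi.1).symm⟩
    rw [this, InjOn.encard_image]
    rintro i ⟨u, hu, hu'⟩ k ⟨w, hw, hw'⟩ hik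
    have e1 : (h i).symm v = u := by rw [← hu', hl i u hu]
    have e2 : (h k).symm v = w := by rw [← hw', hl k w hw]
    simp only [e1, e2] at hik
    subst hik
    exact huniq i k u hu hw (hu'.trans hw'.symm)
  have L : ∫⁻ u in s, F u * (({v | v ∈ t ∧ q v = p u}.encard : ℕ∞) : ℝ≥0∞) =
      ∑' i : T, ∫⁻ u in S i, F u := by
    rw [setLIntegral_congr_fun (g := fun u => ∑' i : T, (S i).indicator F u) hs.measurableSet]
    · rw [lintegral_tsum fun i => hF.indicator (hSm i)]
      refine tsum_congr fun i => ?_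
      rw [lintegral_indicator (hSm i), Measure.restrict_restrict (hSm i),
        inter_eq_left.2 (hSs i)]
    · intro u hu
      simp only [hcs u hu, mul_encard_eq_tsum]
      rfl
  have R : ∫⁻ v in t, G v * (({u | u ∈ s ∧ p u = q v}.encard : ℕ∞) : ℝ≥0∞) =
      ∑' i : T, ∫⁻ v in h i '' S i, G v := by
    rw [setLIntegral_congr_fun (g := fun v => ∑' i : T, (h i '' S i).indicator G v)
      ht.measurableSet]
    · rw [lintegral_tsum fun i => hG.indicator (hTm i)]
      refine tsum_congr fun i => ?_
      rw [lintegral_indicator (hTm i), Measure.restrict_restrict (hTm i),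
        inter_eq_left.2 (hTt i)]
    · intro v hv
      simp only [hct v hv, mul_encard_eq_tsum]
      rfl
  rw [L, R]
  refine tsum_congr fun i => ?_
  rw [lintegral_image_eq_lintegral_abs_det_fderiv_mul volume (hSm i)
    (fun u hu => (((htr i).contDiffAt (hSsub i hu)).differentiableAt
      (by simp)).hasFDerivAt.hasFDerivWithinAt) ((h i).injOn.mono (hSsub i))]
  exact setLIntegral_congr_fun (hSm i) fun u hu => hFG _ (htr i) u (hSsub i hu)

/-! ### The free part of an orbifold chart -/

section Free

variable {n : ℕ} {X : Type*} [TopologicalSpace X]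

/-- The points of the domain of an orbifold chart with trivial stabilizer. -/
def OrbifoldChart.free (c : OrbifoldChart n X) : Set (Cn n) :=
  {u | u ∈ c.dom ∧ ∀ γ ∈ c.group, γ u = u → γ = 1}

theorem OrbifoldChart.free_subset (c : OrbifoldChart n X) : c.free ⊆ c.dom := fun _ hu => hu.1

instance (c : OrbifoldChart n X) : Finite c.group := c.finite_group

theorem OrbifoldChart.continuous_act (γ : Cn n ≃ₗ[ℂ] Cn n) : Continuous γ :=
  LinearMap.continuous_of_finiteDimensional (γ : Cn n →ₗ[ℂ] Cn n)

theorem OrbifoldChart.proj_act (c : OrbifoldChart n X) {γ : Cn n ≃ₗ[ℂ] Cn n} (hγ : γ ∈ c.group)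
    {u : Cn n} (hu : u ∈ c.dom) : c.proj (γ u) = c.proj u :=
  ((c.proj_eq_iff u hu _ (c.map_dom γ hγ u hu)).2 ⟨γ, hγ, rfl⟩).symm

theorem OrbifoldChart.isOpen_free (c : OrbifoldChart n X) : IsOpen c.free := by
  have : c.free = c.dom ∩ ⋂ γ : c.group, {u | γ.1 u = u → γ.1 = 1} := by
    ext u
    simp [free]
  rw [this]
  refine c.isOpen_dom.inter (isOpen_iInter_of_finite fun γ => ?_)
  by_cases hγ : γ.1 = 1
  · simp [hγ]
  · simp only [hγ, imp_false]
    exact isOpen_ne_fun (continuous_act γ.1) continuous_id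

/-- Only fixed points of nontrivial linear maps are removed, and these form proper subspaces. -/
theorem OrbifoldChart.volume_dom_diff_free (c : OrbifoldChart n X) :
    volume (c.dom \ c.free) = 0 := by
  have hsub : c.dom \ c.free ⊆ ⋃ γ : c.group, {u | γ.1 ≠ 1 ∧ γ.1 u = u} := by
    rintro u ⟨hu, hu'⟩
    simp only [free, mem_ofPred_eq, not_and, not_forall] at hu'
    obtain ⟨γ, hγ, hγu, hγ1⟩ := hu' hu
    exact mem_iUnion.2 ⟨⟨γ, hγ⟩, hγ1, hγu⟩
  refine measure_mono_null hsub (measure_iUnion_null fun γ => ?_)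
  by_cases hγ : γ.1 = 1
  · simp [hγ]
  · let V : Submodule ℝ (Cn n) :=
      (LinearMap.ker ((γ.1 : Cn n →ₗ[ℂ] Cn n) - LinearMap.id)).restrictScalars ℝ
    have hV : V ≠ ⊤ := by
      intro h
      apply hγ
      ext u : 1
      have : u ∈ V := h ▸ Submodule.mem_top
      simpa [V, sub_eq_zero] using this
    refine measure_mono_null (fun u hu => ?_) (Measure.addHaar_submodule volume V hV)
    have : γ.1 u = u := hu.2
    simp [V, this]

theorem OrbifoldChart.free_ae_eq (c : OrbifoldChart n X) : c.free =ᵐ[volume] c.dom :=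
  (LE.le.eventuallyLE c.free_subset).antisymm
    (ae_le_set.2 c.volume_dom_diff_free)

/-- The projection is injective near a point with trivial stabilizer. -/
theorem OrbifoldChart.exists_injOn (c : OrbifoldChart n X) {v : Cn n} (hv : v ∈ c.free) :
    ∃ V ∈ 𝓝 v, InjOn c.proj (V ∩ c.dom) := by
  have h1 : ∀ᶠ z : Cn n × Cn n in 𝓝 (v, v), ∀ γ : c.group, γ.1 z.1 = z.2 → γ.1 = 1 := by
    rw [Filter.eventually_all]
    intro γ
    by_cases hγ : γ.1 = 1
    · simp [hγ]
    · simp only [hγ, imp_false]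
      have : Continuous fun z : Cn n × Cn n => γ.1 z.1 := (continuous_act γ.1).comp continuous_fst
      exact (isOpen_ne_fun this continuous_snd).mem_nhds fun h => hγ (hv.2 γ.1 γ.2 h)
  rw [nhds_prod_eq] at h1
  obtain ⟨V, hV, hV'⟩ := Filter.mem_prod_same_iff.1 h1
  refine ⟨V, hV, fun u hu w hw huw => ?_⟩
  obtain ⟨γ, hγ, hγu⟩ := (c.proj_eq_iff u hu.2 w hw.2).1 huw
  have := hV' (mk_mem_prod hu.1 hw.1) ⟨γ, hγ⟩ hγu
  simp only at this
  rw [← hγu, this]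
  rfl

/-- A local equivalence preserves triviality of the stabilizer: near `u` the projection is
injective, so a stabilizing linear map is the identity near `v`, hence everywhere. -/
theorem OrbifoldChart.mem_free_of_locallyEquivalent (c d : OrbifoldChart n X) {u v : Cn n}
    (hu : u ∈ c.free) (hv : v ∈ d.dom) (h : LocallyEquivalent d.dom d.proj c.dom c.proj v u) :
    v ∈ d.free := by
  refine ⟨hv, fun γ hγ hγv => ?_⟩
  obtain ⟨h, hh, hvs, rfl⟩ := h
  obtain ⟨V, hV, hinj⟩ := c.exists_injOn hu
  have e1 : ∀ᶠ w in 𝓝 v, w ∈ h.source ∧ h w ∈ V :=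
    (h.open_source.eventually_mem hvs).and ((h.continuousAt hvs).eventually hV)
  have e2 : ∀ᶠ w in 𝓝 v, γ w ∈ h.source ∧ h (γ w) ∈ V := by
    have : Filter.Tendsto γ (𝓝 v) (𝓝 v) := by
      have := (continuous_act γ).continuousAt (x := v)
      rwa [ContinuousAt, hγv] at this
    exact this.eventually e1
  have e3 : ∀ᶠ w in 𝓝 v, γ w = w := by
    filter_upwards [e1, e2] with w h1 h2
    have hw := hh.source_subset h1.1
    refine h.injOn h2.1 h1.1 (hinj ⟨h2.2, hh.target_subset (h.map_source h2.1)⟩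
      ⟨h1.2, hh.target_subset (h.map_source h1.1)⟩ ?_)
    rw [hh.comm _ h1.1, hh.comm _ h2.1, d.proj_act hγ hw]
  ext x : 1
  have e4 : Filter.Tendsto (fun t : ℂ => v + t • x) (𝓝 0) (𝓝 v) := by
    have : Continuous fun t : ℂ => v + t • x := by fun_prop
    simpa using this.tendsto 0
  have e5 : ∀ᶠ t in 𝓝[≠] (0 : ℂ), γ (v + t • x) = v + t • x :=
    (e4.eventually e3).filter_mono nhdsWithin_le_nhds
  obtain ⟨t, ht, ht'⟩ := (e5.and self_mem_nhdsWithin).exists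
  rw [map_add, map_smul, hγv] at ht
  exact smul_right_injective _ ht' (add_left_cancel ht)

theorem OrbifoldChart.encard_fiber (c : OrbifoldChart n X) {v : Cn n} (hv : v ∈ c.free) :
    {w | w ∈ c.dom ∧ c.proj w = c.proj v}.encard = Nat.card c.group := by
  have : {w | w ∈ c.dom ∧ c.proj w = c.proj v} = range fun γ : c.group => γ.1 v := by
    ext w
    constructor
    · rintro ⟨hw, hw'⟩
      obtain ⟨γ, hγ, rfl⟩ := (c.proj_eq_iff v hv.1 w hw).1 hw'.symm
      exact ⟨⟨γ, hγ⟩, rfl⟩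
    · rintro ⟨γ, rfl⟩
      exact ⟨c.map_dom _ γ.2 _ hv.1, c.proj_act γ.2 hv.1⟩
  rw [this, ← image_univ, InjOn.encard_image, encard_univ, ENat.card_eq_coe_natCard]
  rintro ⟨γ, hγ⟩ - ⟨δ, hδ⟩ - hγδ
  have h1 : γ v = δ v := hγδ
  have h2 : δ⁻¹ * γ = 1 := by
    refine hv.2 _ (mul_mem (inv_mem hδ) hγ) ?_
    rw [LinearEquiv.mul_apply, h1]
    exact δ.symm_apply_apply v
  exact Subtype.ext (by simpa [inv_mul_eq_one] using (inv_mul_eq_one.1 h2).symm)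

theorem OrbifoldChart.isOpen_imageSet (c : OrbifoldChart n X) : IsOpen c.image :=
  c.isOpen_image _ subset_rfl c.isOpen_dom

open scoped ENNReal in
/-- Densities on two orbifold charts which correspond to each other under transitions and are
concentrated on the overlap have the same integral, up to the orders of the groups. On the free
parts, which have full measure, a point of the overlap has as many partners in the other chart as
the group of that chart has elements. -/
theorem OrbifoldChart.lintegral_transfer (c d : OrbifoldChart n X)
    (hcd : ∀ u ∈ c.dom, ∀ v ∈ d.dom, c.proj u = d.proj v →
      LocallyEquivalent c.dom c.proj d.dom d.proj u v) {F G : Cn n → ℝ≥0∞}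
    (hF : AEMeasurable F (volume.restrict c.dom)) (hG : AEMeasurable G (volume.restrict d.dom))
    (hFG : ∀ h, IsTransition c.dom c.proj d.dom d.proj h → ∀ w ∈ h.source,
      F w = ENNReal.ofReal |(fderiv ℝ h w).det| * G (h w))
    (hF0 : ∀ᵐ u ∂volume.restrict c.dom, F u ≠ 0 → c.proj u ∈ d.image)
    (hG0 : ∀ᵐ v ∂volume.restrict d.dom, G v ≠ 0 → d.proj v ∈ c.image) :
    (Nat.card d.group : ℝ≥0∞) * ∫⁻ u in c.dom, F u =
      (Nat.card c.group : ℝ≥0∞) * ∫⁻ v in d.dom, G v := by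
  have hcr : volume.restrict c.dom = volume.restrict c.free :=
    Measure.restrict_congr_set c.free_ae_eq.symm
  have hdr : volume.restrict d.dom = volume.restrict d.free :=
    Measure.restrict_congr_set d.free_ae_eq.symm
  have key := lintegral_fiber_count (s := c.free) (t := d.free) (p := c.proj) (q := d.proj)
    (F := F) (G := G) c.isOpen_free d.isOpen_free
    (fun u hu v hv huv => (hcd u hu.1 v hv.1 huv).restr c.isOpen_free d.isOpen_free hu hv)
    (fun v hv => by
      obtain ⟨V, hV, hV'⟩ := d.exists_injOn hv
      exact ⟨V, hV, hV'.mono (inter_subset_inter_right _ d.free_subset)⟩)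
    (hcr ▸ hF) (hdr ▸ hG) (fun h hh => hFG h (hh.mono c.free_subset d.free_subset))
  have L : ∫⁻ u in c.free, F u * (({v | v ∈ d.free ∧ d.proj v = c.proj u}.encard : ℕ∞) : ℝ≥0∞) =
      (Nat.card d.group : ℝ≥0∞) * ∫⁻ u in c.dom, F u := by
    rw [hcr] at hF0
    rw [hcr, ← lintegral_const_mul' _ _ (ENNReal.natCast_ne_top _)]
    refine lintegral_congr_ae ?_
    filter_upwards [hF0, ae_restrict_mem c.isOpen_free.measurableSet] with u h0 hu
    by_cases hz : F u = 0
    · simp [hz]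
    · obtain ⟨v, hv, hvu⟩ := h0 hz
      have hvf : v ∈ d.free :=
        c.mem_free_of_locallyEquivalent d hu hv (hcd u hu.1 v hv hvu.symm).symm
      have : {w | w ∈ d.free ∧ d.proj w = c.proj u} = {w | w ∈ d.dom ∧ d.proj w = d.proj v} := by
        ext w
        simp only [mem_ofPred_eq, hvu]
        refine ⟨fun h => ⟨h.1.1, h.2⟩, fun h => ⟨?_, h.2⟩⟩
        exact c.mem_free_of_locallyEquivalent d hu h.1 (hcd u hu.1 w h.1 h.2.symm).symm
      rw [this, d.encard_fiber hvf, mul_comm]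
      rfl
  have R : ∫⁻ v in d.free, G v * (({u | u ∈ c.free ∧ c.proj u = d.proj v}.encard : ℕ∞) : ℝ≥0∞) =
      (Nat.card c.group : ℝ≥0∞) * ∫⁻ v in d.dom, G v := by
    rw [hdr] at hG0
    rw [hdr, ← lintegral_const_mul' _ _ (ENNReal.natCast_ne_top _)]
    refine lintegral_congr_ae ?_
    filter_upwards [hG0, ae_restrict_mem d.isOpen_free.measurableSet] with v h0 hv
    by_cases hz : G v = 0
    · simp [hz]
    · obtain ⟨u, hu, huv⟩ := h0 hz
      have huf : u ∈ c.free := d.mem_free_of_locallyEquivalent c hv hu (hcd u hu v hv.1 huv)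
      have : {w | w ∈ c.free ∧ c.proj w = d.proj v} = {w | w ∈ c.dom ∧ c.proj w = c.proj u} := by
        ext w
        simp only [mem_ofPred_eq, huv]
        refine ⟨fun h => ⟨h.1.1, h.2⟩, fun h => ⟨?_, h.2⟩⟩
        exact d.mem_free_of_locallyEquivalent c hv h.1 (hcd w h.1 v hv.1 h.2)
      rw [this, c.encard_fiber huf, mul_comm]
      rfl
  rw [← L, ← R, key]

theorem OrbifoldChart.card_ne_zero (c : OrbifoldChart n X) : Nat.card c.group ≠ 0 :=
  Nat.card_pos.ne'

/-- The signed version of `OrbifoldChart.lintegral_transfer`. -/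
theorem OrbifoldChart.integral_transfer (c d : OrbifoldChart n X)
    (hcd : ∀ u ∈ c.dom, ∀ v ∈ d.dom, c.proj u = d.proj v →
      LocallyEquivalent c.dom c.proj d.dom d.proj u v) {F G : Cn n → ℝ}
    (hF : AEStronglyMeasurable F (volume.restrict c.dom)) (hG : IntegrableOn G d.dom)
    (hFG : ∀ h, IsTransition c.dom c.proj d.dom d.proj h → ∀ w ∈ h.source,
      F w = (fderiv ℝ h w).det * G (h w))
    (hF0 : ∀ᵐ u ∂volume.restrict c.dom, F u ≠ 0 → c.proj u ∈ d.image)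
    (hG0 : ∀ᵐ v ∂volume.restrict d.dom, G v ≠ 0 → d.proj v ∈ c.image) :
    IntegrableOn F c.dom ∧ (Nat.card c.group : ℝ)⁻¹ * ∫ u in c.dom, F u =
      (Nat.card d.group : ℝ)⁻¹ * ∫ v in d.dom, G v := by
  have hG' := hG.aestronglyMeasurable
  have hcc : (Nat.card c.group : ℝ) ≠ 0 := by exact_mod_cast c.card_ne_zero
  have hdd : (Nat.card d.group : ℝ) ≠ 0 := by exact_mod_cast d.card_ne_zero
  -- Transitions are holomorphic, so their Jacobian determinants are nonnegative; this allows to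
  -- treat absolute value, positive part and negative part alike.
  have key : ∀ φ : ℝ → ENNReal, Measurable φ → φ 0 = 0 →
      (∀ a b : ℝ, 0 ≤ a → φ (a * b) = ENNReal.ofReal a * φ b) →
      (Nat.card d.group : ENNReal) * ∫⁻ u in c.dom, φ (F u) =
        (Nat.card c.group : ENNReal) * ∫⁻ v in d.dom, φ (G v) := by
    intro φ hφ hφ0 hφm
    refine c.lintegral_transfer d hcd (hφ.comp_aemeasurable hF.aemeasurable)
      (hφ.comp_aemeasurable hG'.aemeasurable) ?_ ?_ ?_
    · intro h hh w hw
      have h0 : 0 ≤ (fderiv ℝ h w).det := by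
        rw [← hh.abs_det hw]; exact abs_nonneg _
      rw [hFG h hh w hw, hφm _ _ h0, abs_of_nonneg h0]
    · filter_upwards [hF0] with u hu hne
      exact hu fun h => hne (by rw [h, hφ0])
    · filter_upwards [hG0] with u hu hne
      exact hu fun h => hne (by rw [h, hφ0])
  have k1 := key (fun x => ‖x‖ₑ) measurable_enorm (by simp) (fun a b ha => by
    rw [enorm_mul, Real.enorm_of_nonneg ha])
  have k2 := key ENNReal.ofReal ENNReal.measurable_ofReal (by simp)
    (fun a b ha => ENNReal.ofReal_mul ha)
  have k3 := key (fun x => ENNReal.ofReal (-x)) (ENNReal.measurable_ofReal.comp measurable_neg)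
    (by simp) (fun a b ha => by rw [← ENNReal.ofReal_mul ha, mul_neg])
  have hFi : IntegrableOn F c.dom := by
    refine ⟨hF, ?_⟩
    have h1 : (Nat.card c.group : ENNReal) * ∫⁻ v in d.dom, ‖G v‖ₑ < ⊤ :=
      ENNReal.mul_lt_top (ENNReal.natCast_lt_top _) hG.2
    rw [← k1] at h1
    have := ENNReal.lt_top_of_mul_ne_top_right h1.ne (by exact_mod_cast d.card_ne_zero)
    exact this
  refine ⟨hFi, ?_⟩
  rw [integral_eq_lintegral_pos_part_sub_lintegral_neg_part hFi,
    integral_eq_lintegral_pos_part_sub_lintegral_neg_part hG]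
  have k2' := congrArg ENNReal.toReal k2
  have k3' := congrArg ENNReal.toReal k3
  simp only [ENNReal.toReal_mul, ENNReal.toReal_natCast] at k2' k3'
  field_simp
  linear_combination k2' - k3'

end Free

/-! ### Integration over compact orbifolds -/

section Integral

variable {n : ℕ} {X : Type*} [TopologicalSpace X]

/-- A family of forms on the charts is natural if it is compatible with all transitions; unlike
for an orbifold form, no smoothness is required. -/
def ComplexOrbifold.Natural (𝓧 : ComplexOrbifold n X) {k : ℕ} (α : 𝓧.Family k) : Prop :=
  ∀ (c d : 𝓧.charts) (h : OpenPartialHomeomorph (Cn n) (Cn n)),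
    IsTransition c.1.dom c.1.proj d.1.dom d.1.proj h → ∀ w ∈ h.source,
      α c w = (α d (h w)).compContinuousLinearMap (fderiv ℝ h w)

/-- A subset of an orbifold is thin if it has measure zero in every chart. -/
def ComplexOrbifold.Thin (𝓧 : ComplexOrbifold n X) (B : Set X) : Prop :=
  ∀ c : 𝓧.charts, volume {u | u ∈ c.1.dom ∧ c.1.proj u ∈ B} = 0

theorem ComplexOrbifold.thin_empty (𝓧 : ComplexOrbifold n X) : 𝓧.Thin ∅ := fun c => by simp

theorem ComplexOrbifold.Thin.ae {𝓧 : ComplexOrbifold n X} {B : Set X} (hB : 𝓧.Thin B)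
    (c : 𝓧.charts) : ∀ᵐ u ∂volume.restrict c.1.dom, c.1.proj u ∉ B := by
  rw [ae_restrict_iff' c.1.isOpen_dom.measurableSet, ae_iff]
  convert hB c using 2
  ext u
  simp

theorem OrbifoldChart.isOpen_diff (c : OrbifoldChart n X) {B : Set X} (hB : IsClosed B) :
    IsOpen (c.dom \ c.proj ⁻¹' B) := by
  have := c.continuousOn_proj.isOpen_inter_preimage c.isOpen_dom hB.isOpen_compl
  exact this

theorem ComplexOrbifold.Thin.aestronglyMeasurable {𝓧 : ComplexOrbifold n X} {B : Set X}
    (hB : 𝓧.Thin B) (hBc : IsClosed B) (c : 𝓧.charts) {F : Cn n → ℝ}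
    (hF : ContinuousOn F (c.1.dom \ c.1.proj ⁻¹' B)) :
    AEStronglyMeasurable F (volume.restrict c.1.dom) := by
  have h1 : c.1.dom \ c.1.proj ⁻¹' B =ᵐ[volume] c.1.dom := by
    refine (LE.le.eventuallyLE sdiff_subset).antisymm (ae_le_set.2 ?_)
    refine measure_mono_null ?_ (hB c)
    rintro u ⟨hu, hu'⟩
    refine ⟨hu, ?_⟩
    by_contra h
    exact hu' ⟨hu, h⟩
  rw [Measure.restrict_congr_set h1.symm]
  exact hF.aestronglyMeasurable (c.1.isOpen_diff hBc).measurableSet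

/-- The definition of the integral, with the partition of unity it is computed with: the junk value
does not occur on a compact Hausdorff orbifold. -/
theorem ComplexOrbifold.exists_partition [T2Space X] [CompactSpace X] (𝓧 : ComplexOrbifold n X) :
    ∃ (N : ℕ) (c : Fin N → 𝓧.charts) (ρ : PartitionOfUnity (Fin N) X),
      (ρ.IsSubordinate fun j => (c j).1.image) ∧
      ∀ α : 𝓧.Family (2 * n), 𝓧.integral α = ∑ j, (Nat.card (c j).1.group : ℝ)⁻¹ *
        ∫ u in (c j).1.dom, ρ j ((c j).1.proj u) * α (c j) u (frame n) := by
  have hex : ∃ P : Σ N : ℕ, (Fin N → 𝓧.charts) × PartitionOfUnity (Fin N) X,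
      P.2.2.IsSubordinate fun j => (P.2.1 j).1.image := by
    obtain ⟨t, ht⟩ := isCompact_univ.elim_finite_subcover (fun c : 𝓧.charts => c.1.image)
      (fun c => c.1.isOpen_imageSet) (fun x _ => by
        obtain ⟨c, hc, hx⟩ := 𝓧.cover x
        exact mem_iUnion.2 ⟨⟨c, hc⟩, hx⟩)
    let c : Fin t.card → 𝓧.charts := fun j => (t.equivFin.symm j).1
    obtain ⟨ρ, hρ⟩ := PartitionOfUnity.exists_isSubordinate_of_locallyFinite (s := (univ : Set X))
      isClosed_univ (fun j => (c j).1.image) (fun j => (c j).1.isOpen_imageSet)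
      (locallyFinite_of_finite _) (fun x hx => by
        obtain ⟨d, hd, hxd⟩ := mem_iUnion₂.1 (ht hx)
        refine mem_iUnion.2 ⟨t.equivFin ⟨d, hd⟩, ?_⟩
        simpa [c] using hxd)
    exact ⟨⟨t.card, c, ρ⟩, hρ⟩
  refine ⟨hex.choose.1, hex.choose.2.1, hex.choose.2.2, hex.choose_spec, fun α => ?_⟩
  unfold ComplexOrbifold.integral
  rw [dif_pos hex]

/-- If a top-degree family is a sum of integrable natural families `ψ k`, each concentrated on the
image of a single chart `p k`, its integral is the sum of the integrals of the `ψ k` in these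
charts. Singularities along a thin closed set `B` are allowed. Taking for `ψ k` the products with a
partition of unity gives independence of all choices. -/
theorem ComplexOrbifold.integral_eq_sum [T2Space X] [CompactSpace X] (𝓧 : ComplexOrbifold n X)
    {B : Set X} (hBc : IsClosed B) (hB : 𝓧.Thin B) {ι : Type*} [Fintype ι] (p : ι → 𝓧.charts)
    (α : 𝓧.Family (2 * n)) (ψ : ι → 𝓧.Family (2 * n)) (hψ : ∀ k, 𝓧.Natural (ψ k))
    (hcont : ∀ k c, ContinuousOn (ψ k c) (c.1.dom \ c.1.proj ⁻¹' B))
    (hsupp : ∀ k c, ∀ u ∈ c.1.dom, c.1.proj u ∉ B → ψ k c u ≠ 0 → c.1.proj u ∈ (p k).1.image)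
    (hint : ∀ k, IntegrableOn (fun u => ψ k (p k) u (frame n)) (p k).1.dom)
    (hsum : ∀ c, ∀ u ∈ c.1.dom, c.1.proj u ∉ B → α c u = ∑ k, ψ k c u) :
    𝓧.integral α = ∑ k, (Nat.card (p k).1.group : ℝ)⁻¹ *
      ∫ u in (p k).1.dom, ψ k (p k) u (frame n) := by
  obtain ⟨N, c, ρ, hρ, hint'⟩ := 𝓧.exists_partition
  rw [hint']
  have hρc : ∀ l (d : 𝓧.charts), ContinuousOn (fun u => ρ l (d.1.proj u)) d.1.dom := fun l d =>
    (ρ l).continuous.comp_continuousOn d.1.continuousOn_proj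
  have hψc : ∀ k (d : 𝓧.charts), ContinuousOn (fun u => ψ k d u (frame n))
      (d.1.dom \ d.1.proj ⁻¹' B) := fun k d => by
    have h1 : Continuous fun a : Alt n (2 * n) => a (frame n) :=
      (ContinuousAlternatingMap.apply ℝ (Cn n) ℝ (frame n)).continuous
    exact h1.comp_continuousOn (hcont k d)
  have hint2 : ∀ l k, IntegrableOn (fun u => ρ l ((p k).1.proj u) * ψ k (p k) u (frame n))
      (p k).1.dom := by
    intro l k
    refine Integrable.bdd_mul (c := 1) (hint k) ((hρc l (p k)).aestronglyMeasurable
      (p k).1.isOpen_dom.measurableSet) ?_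
    refine Filter.Eventually.of_forall fun u => ?_
    rw [Real.norm_of_nonneg (ρ.nonneg _ _)]
    exact ρ.le_one _ _
  -- The product `ρ l * ψ k` lives on the overlap of `c l` and `p k`, and may be integrated in
  -- either chart.
  have htrans : ∀ l k,
      IntegrableOn (fun u => ρ l ((c l).1.proj u) * ψ k (c l) u (frame n)) (c l).1.dom ∧
      (Nat.card (c l).1.group : ℝ)⁻¹ *
        ∫ u in (c l).1.dom, ρ l ((c l).1.proj u) * ψ k (c l) u (frame n) =
      (Nat.card (p k).1.group : ℝ)⁻¹ *
        ∫ u in (p k).1.dom, ρ l ((p k).1.proj u) * ψ k (p k) u (frame n) := by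
    intro l k
    refine OrbifoldChart.integral_transfer (c l).1 (p k).1 (𝓧.compatible _ (c l).2 _ (p k).2)
      ?_ (hint2 l k) ?_ ?_ ?_
    · exact hB.aestronglyMeasurable hBc (c l)
        (((hρc l (c l)).mono sdiff_subset).mul (hψc k (c l)))
    · intro h hh w hw
      rw [hψ k (c l) (p k) h hh w hw, alt_comp_frame, hh.comm w hw]
      ring
    · filter_upwards [hB.ae (c l), ae_restrict_mem (c l).1.isOpen_dom.measurableSet] with u h1 h2 h3
      refine hsupp k _ u h2 h1 fun h => h3 ?_
      simp [h]
    · filter_upwards with u h3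
      refine hρ l (subset_tsupport _ ?_)
      exact left_ne_zero_of_mul h3
  have h1 : ∀ l, ∫ u in (c l).1.dom, ρ l ((c l).1.proj u) * α (c l) u (frame n) =
      ∑ k, ∫ u in (c l).1.dom, ρ l ((c l).1.proj u) * ψ k (c l) u (frame n) := by
    intro l
    rw [← integral_finsetSum _ fun k _ => (htrans l k).1]
    refine integral_congr_ae ?_
    filter_upwards [hB.ae (c l), ae_restrict_mem (c l).1.isOpen_dom.measurableSet] with u hu1 hu2
    rw [hsum _ u hu2 hu1, ContinuousAlternatingMap.sum_apply, Finset.mul_sum]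
  have h2 : ∀ k, ∫ u in (p k).1.dom, ψ k (p k) u (frame n) =
      ∑ l, ∫ u in (p k).1.dom, ρ l ((p k).1.proj u) * ψ k (p k) u (frame n) := by
    intro k
    rw [← integral_finsetSum _ fun l _ => hint2 l k]
    refine integral_congr_ae (Filter.Eventually.of_forall fun u => ?_)
    have := ρ.sum_eq_one (mem_univ ((p k).1.proj u))
    rw [finsum_eq_sum_of_fintype] at this
    simp only [← Finset.sum_mul, this, one_mul]
  simp only [h1, h2, Finset.mul_sum]
  rw [Finset.sum_comm]
  exact Finset.sum_congr rfl fun k _ => Finset.sum_congr rfl fun l _ => (htrans l k).2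

end Integral

/-! ### Smooth partitions of unity -/

section Smooth

variable {n : ℕ} {X : Type*} [TopologicalSpace X]

/-- The part of the domain of a chart over a compact subset of its image is compact: the projection
of a chart is the quotient map by a finite group, hence proper. -/
theorem OrbifoldChart.isCompact_preimage [T2Space X] (c : OrbifoldChart n X) {K : Set X}
    (hK : IsCompact K) (hKc : K ⊆ c.image) : IsCompact {u | u ∈ c.dom ∧ c.proj u ∈ K} := by
  have h1 : ∀ x ∈ K, ∃ L : Set (Cn n), IsCompact L ∧ L ⊆ c.dom ∧ c.proj '' L ∈ 𝓝 x := by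
    intro x hx
    obtain ⟨u, hu, rfl⟩ := hKc hx
    obtain ⟨L, hL, hLd, hLc⟩ :=
      (LocallyCompactSpace.local_compact_nhds u c.dom (c.isOpen_dom.mem_nhds hu))
    refine ⟨L, hLc, hLd, ?_⟩
    have h2 : IsOpen (c.proj '' interior L) :=
      c.isOpen_image _ (interior_subset.trans hLd) isOpen_interior
    exact Filter.mem_of_superset (h2.mem_nhds ⟨u, mem_interior_iff_mem_nhds.2 hL, rfl⟩)
      (image_mono interior_subset)
  choose! L hL1 hL2 hL3 using h1
  obtain ⟨t, ht, htK⟩ := hK.elim_nhds_subcover (fun x => c.proj '' L x) hL3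
  -- Finitely many compact sets `L x` project onto neighborhoods covering `K`; their translates
  -- under the group contain the whole preimage.
  let C : Set (Cn n) := ⋃ x ∈ t, ⋃ γ : c.group, γ.1 '' L x
  have hC : IsCompact C := t.isCompact_biUnion fun x hx =>
    isCompact_iUnion fun γ => (hL1 x (ht x hx)).image (continuous_act γ.1)
  have hCd : C ⊆ c.dom := by
    intro u hu
    obtain ⟨x, hx, hu⟩ := mem_iUnion₂.1 hu
    obtain ⟨γ, v, hv, rfl⟩ := mem_iUnion.1 hu
    exact c.map_dom _ γ.2 _ (hL2 x (ht x hx) hv)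
  have h3 : {u | u ∈ c.dom ∧ c.proj u ∈ K} = C ∩ c.proj ⁻¹' K := by
    ext u
    constructor
    · rintro ⟨hu, huK⟩
      obtain ⟨x, hx, v, hv, hvu⟩ := mem_iUnion₂.1 (htK huK)
      obtain ⟨γ, hγ, rfl⟩ := (c.proj_eq_iff v (hL2 x (ht x hx) hv) u hu).1 hvu
      exact ⟨mem_iUnion₂.2 ⟨x, hx, mem_iUnion.2 ⟨⟨γ, hγ⟩, v, hv, rfl⟩⟩, huK⟩
    · rintro ⟨hu, huK⟩
      exact ⟨hCd hu, huK⟩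
  rw [h3]
  have h4 : IsClosed (C ∩ c.proj ⁻¹' K) :=
    (c.continuousOn_proj.mono hCd).preimage_isClosed_of_isClosed hC.isClosed hK.isClosed
  exact hC.of_isClosed_subset h4 inter_subset_left

/-- A function on an orbifold is smooth if it is smooth in all charts. -/
def ComplexOrbifold.SmoothFun (𝓧 : ComplexOrbifold n X) (g : X → ℝ) : Prop :=
  ∀ c : 𝓧.charts, ContDiffOn ℝ ∞ (fun u => g (c.1.proj u)) c.1.dom

/-- Continuity may be tested in charts, since their projections are open. -/
theorem ComplexOrbifold.continuous_of_charts {Y : Type*} [TopologicalSpace Y]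
    (𝓧 : ComplexOrbifold n X) {g : X → Y}
    (hg : ∀ c : 𝓧.charts, ContinuousOn (fun u => g (c.1.proj u)) c.1.dom) : Continuous g := by
  rw [continuous_def]
  intro V hV
  rw [isOpen_iff_mem_nhds]
  intro x hx
  obtain ⟨c, hc, u, hu, rfl⟩ := 𝓧.cover x
  have h1 : IsOpen (c.dom ∩ (fun u => g (c.proj u)) ⁻¹' V) :=
    (hg ⟨c, hc⟩).isOpen_inter_preimage c.isOpen_dom hV
  have h2 := c.isOpen_image _ inter_subset_left h1
  refine Filter.mem_of_superset (h2.mem_nhds ⟨u, ⟨hu, hx⟩, rfl⟩) ?_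
  rintro _ ⟨w, ⟨_, hw⟩, rfl⟩
  exact hw

theorem ComplexOrbifold.SmoothFun.continuous {𝓧 : ComplexOrbifold n X} {g : X → ℝ}
    (hg : 𝓧.SmoothFun g) : Continuous g :=
  𝓧.continuous_of_charts fun c => (hg c).continuousOn

/-- A bump function on an orbifold, obtained by averaging a bump function in a chart over the
group. -/
theorem ComplexOrbifold.exists_bump [T2Space X] (𝓧 : ComplexOrbifold n X) (c : 𝓧.charts)
    {x : X} (hx : x ∈ c.1.image) : ∃ g : X → ℝ, 𝓧.SmoothFun g ∧ (∀ y, 0 ≤ g y) ∧ 0 < g x ∧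
      tsupport g ⊆ c.1.image := by
  obtain ⟨u, hu, rfl⟩ := hx
  obtain ⟨φ, hφs, hφc, hφd, hφr, hφu⟩ :=
    exists_contDiff_tsupport_subset (n := (⊤ : ℕ∞)) (c.1.isOpen_dom.mem_nhds hu)
  have hφ0 : ∀ v, 0 ≤ φ v := fun v => (hφr ⟨v, rfl⟩).1
  have := Fintype.ofFinite c.1.group
  let Φ : Cn n → ℝ := fun v => ∑ γ : c.1.group, φ (γ.1 v)
  have hΦ : ContDiff ℝ ∞ Φ := by
    refine ContDiff.sum fun γ _ => hφd.comp ?_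
    exact ((LinearMap.toContinuousLinearMap (γ.1 : Cn n →ₗ[ℂ] Cn n)).restrictScalars ℝ).contDiff
  have hΦi : ∀ γ ∈ c.1.group, ∀ v, Φ (γ v) = Φ v := by
    intro γ hγ v
    refine Fintype.sum_equiv (Equiv.mulRight (⟨γ, hγ⟩ : c.1.group)) _ _ fun δ => ?_
    rfl
  classical
  let g : X → ℝ := fun y => if h : ∃ v ∈ c.1.dom, c.1.proj v = y then Φ h.choose else 0
  have hg : ∀ v ∈ c.1.dom, g (c.1.proj v) = Φ v := by
    intro v hv
    have h : ∃ w ∈ c.1.dom, c.1.proj w = c.1.proj v := ⟨v, hv, rfl⟩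
    obtain ⟨γ, hγ, hγv⟩ := (c.1.proj_eq_iff _ h.choose_spec.1 v hv).1 h.choose_spec.2
    simp only [g, dif_pos h]
    exact (hΦi γ hγ _).symm.trans (congrArg Φ hγv)
  let K : Set (Cn n) := ⋃ γ : c.1.group, γ.1 '' tsupport φ
  have hK : IsCompact K := isCompact_iUnion fun γ =>
    IsCompact.image hφc (OrbifoldChart.continuous_act γ.1)
  have hKd : K ⊆ c.1.dom := by
    intro v hv
    obtain ⟨γ, w, hw, rfl⟩ := mem_iUnion.1 hv
    exact c.1.map_dom _ γ.2 _ (hφs hw)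
  -- The function descends to the image of the chart, and extends by zero because its support there
  -- is compact, hence closed in `X`.
  have hPK : IsClosed (c.1.proj '' K) :=
    (hK.image_of_continuousOn (c.1.continuousOn_proj.mono hKd)).isClosed
  have hg0 : ∀ y, y ∉ c.1.proj '' K → g y = 0 := by
    intro y hy
    by_cases h : ∃ v ∈ c.1.dom, c.1.proj v = y
    · obtain ⟨v, hv, rfl⟩ := h
      rw [hg v hv]
      refine Finset.sum_eq_zero fun γ _ => ?_
      by_contra hne
      refine hy ⟨v, mem_iUnion.2 ⟨γ⁻¹, γ.1 v, subset_tsupport _ hne, ?_⟩, rfl⟩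
      exact γ.1.symm_apply_apply v
    · simp only [g, dif_neg h]
  refine ⟨g, ?_, ?_, ?_, ?_⟩
  · intro d w hw
    refine ContDiffAt.contDiffWithinAt ?_
    by_cases h : d.1.proj w ∈ c.1.image
    · obtain ⟨v, hv, hvw⟩ := h
      obtain ⟨h, hh, hws, -⟩ := 𝓧.compatible _ d.2 _ c.2 w hw v hv hvw.symm
      have h1 : (fun u => g (d.1.proj u)) =ᶠ[𝓝 w] fun u => Φ (h u) := by
        filter_upwards [h.open_source.mem_nhds hws] with u hu
        rw [← hh.comm u hu, hg _ (hh.target_subset (h.map_source hu))]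
      exact (hΦ.contDiffAt.comp w (hh.contDiffAt hws)).congr_of_eventuallyEq h1
    · have h1 : (fun u => g (d.1.proj u)) =ᶠ[𝓝 w] fun _ => 0 := by
        have h2 := d.1.continuousOn_proj.continuousAt (d.1.isOpen_dom.mem_nhds hw)
        have h3 : d.1.proj w ∈ (c.1.proj '' K)ᶜ := fun ⟨v, hv, hv'⟩ => h ⟨v, hKd hv, hv'⟩
        filter_upwards [h2.eventually (hPK.isOpen_compl.mem_nhds h3)] with u hu
        exact hg0 _ hu
      exact contDiffAt_const.congr_of_eventuallyEq h1
  · intro y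
    by_cases h : ∃ v ∈ c.1.dom, c.1.proj v = y
    · obtain ⟨v, hv, rfl⟩ := h
      rw [hg v hv]
      exact Finset.sum_nonneg fun γ _ => hφ0 _
    · simp only [g, dif_neg h, le_refl]
  · rw [hg u hu]
    refine Finset.sum_pos' (fun γ _ => hφ0 _) ⟨1, Finset.mem_univ _, ?_⟩
    have : φ ((1 : c.1.group).1 u) = 1 := hφu
    rw [this]
    exact one_pos
  · refine (closure_minimal (fun y hy => ?_) hPK).trans (image_mono hKd)
    by_contra h
    exact hy (hg0 y h)

/-- A smooth partition of unity subordinate to charts taken from a given covering family. -/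
theorem ComplexOrbifold.exists_smooth_partition [T2Space X] [CompactSpace X]
    (𝓧 : ComplexOrbifold n X) (S : Set 𝓧.charts) (hS : ∀ x, ∃ c ∈ S, x ∈ c.1.image) :
    ∃ (t : Finset X) (p : t → 𝓧.charts) (ρ : t → X → ℝ), (∀ k, p k ∈ S) ∧
      (∀ k, 𝓧.SmoothFun (ρ k)) ∧ (∀ x, ∑ k, ρ k x = 1) ∧
      ∀ k, tsupport (ρ k) ⊆ (p k).1.image := by
  choose c hcS hcx using hS
  choose g hg hg0 hgx hgs using fun x => 𝓧.exists_bump (c x) (hcx x)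
  obtain ⟨t, ht⟩ := isCompact_univ.elim_finite_subcover (fun x => {y | 0 < g x y})
    (fun x => isOpen_lt continuous_const (hg x).continuous)
    (fun x _ => mem_iUnion.2 ⟨x, hgx x⟩)
  -- Normalizing by the sum of finitely many bump functions.
  let G : X → ℝ := fun y => ∑ k : t, g k y
  have hG : ∀ y, 0 < G y := by
    intro y
    obtain ⟨x, hx, hy⟩ := mem_iUnion₂.1 (ht (mem_univ y))
    exact Finset.sum_pos' (fun k _ => hg0 k y) ⟨⟨x, hx⟩, Finset.mem_univ _, hy⟩
  have hGs : 𝓧.SmoothFun G := fun d => ContDiffOn.sum fun k _ => hg k d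
  refine ⟨t, fun k => c k, fun k y => g k y / G y, fun k => hcS k, fun k d => ?_, fun x => ?_,
    fun k => ?_⟩
  · exact (hg k d).div (hGs d) fun u _ => (hG _).ne'
  · rw [← Finset.sum_div]
    exact div_self (hG x).ne'
  · refine (closure_mono ?_).trans (hgs k)
    intro y hy h
    exact hy (by simp [h])

/-- The product of a function and a family of forms. -/
def ComplexOrbifold.fmul {𝓧 : ComplexOrbifold n X} {k : ℕ} (g : X → ℝ) (α : 𝓧.Family k) :
    𝓧.Family k := fun c u => g (c.1.proj u) • α c u

theorem ComplexOrbifold.Natural.fmul {𝓧 : ComplexOrbifold n X} {k : ℕ} {α : 𝓧.Family k}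
    (hα : 𝓧.Natural α) (g : X → ℝ) : 𝓧.Natural (fmul g α) := by
  intro c d h hh w hw
  simp only [ComplexOrbifold.fmul, hα c d h hh w hw, hh.comm w hw]
  rfl

theorem ComplexOrbifold.Natural.wedge {𝓧 : ComplexOrbifold n X} {k l : ℕ} {α : 𝓧.Family k}
    {β : 𝓧.Family l} (hα : 𝓧.Natural α) (hβ : 𝓧.Natural β) :
    𝓧.Natural (k := k + l) (fun c u => WeightedBlowup.wedge (α c u) (β c u)) := by
  intro c d h hh w hw
  simp only [hα c d h hh w hw, hβ c d h hh w hw, wedge_comp]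

/-- The exterior derivative of a natural family which is differentiable at the point in question is
natural there. -/
theorem ComplexOrbifold.Natural.extDeriv_eq {𝓧 : ComplexOrbifold n X} {k : ℕ} {α : 𝓧.Family k}
    (hα : 𝓧.Natural α) {c d : 𝓧.charts} {h : OpenPartialHomeomorph (Cn n) (Cn n)}
    (hh : IsTransition c.1.dom c.1.proj d.1.dom d.1.proj h) {w : Cn n} (hw : w ∈ h.source)
    (hd : DifferentiableAt ℝ (α d) (h w)) :
    extDeriv (α c) w = (extDeriv (α d) (h w)).compContinuousLinearMap (fderiv ℝ h w) := by
  have h1 : α c =ᶠ[𝓝 w] fun v => (α d (h v)).compContinuousLinearMap (fderiv ℝ h v) := by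
    filter_upwards [h.open_source.mem_nhds hw] with v hv
    exact hα c d h hh v hv
  rw [h1.extDeriv_eq]
  refine extDeriv_pullback (r := ∞) hd (hh.contDiffAt hw) ?_
  simp only [minSmoothness_of_isRCLikeNormedField]
  exact ENat.LEInfty.out

theorem contDiffAt_extDeriv {k : ℕ} {α : Cn n → Alt n k} {u : Cn n} (hα : ContDiffAt ℝ ∞ α u) :
    ContDiffAt ℝ ∞ (extDeriv α) u := by
  have h1 : ContDiffAt ℝ ∞ (fderiv ℝ α) u := hα.fderiv_right (m := ∞) (by simp)
  exact (ContinuousAlternatingMap.alternatizeUncurryFinCLM ℝ (Cn n) ℝ).contDiff.contDiffAt.comp u h1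

theorem ComplexOrbifold.forms.natural {𝓧 : ComplexOrbifold n X} {k : ℕ} {α : 𝓧.Family k}
    (hα : α ∈ 𝓧.forms k) : 𝓧.Natural α := hα.2

theorem ComplexOrbifold.forms.contDiffAt {𝓧 : ComplexOrbifold n X} {k : ℕ} {α : 𝓧.Family k}
    (hα : α ∈ 𝓧.forms k) (c : 𝓧.charts) {u : Cn n} (hu : u ∈ c.1.dom) :
    ContDiffAt ℝ ∞ (α c) u :=
  (hα.1 c).contDiffAt (c.1.isOpen_dom.mem_nhds hu)

theorem ComplexOrbifold.extDeriv_mem_forms {𝓧 : ComplexOrbifold n X} {k : ℕ} {α : 𝓧.Family k}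
    (hα : α ∈ 𝓧.forms k) : (fun c u => extDeriv (α c) u : 𝓧.Family (k + 1)) ∈ 𝓧.forms (k + 1) := by
  refine ⟨fun c u hu => (contDiffAt_extDeriv (forms.contDiffAt hα c hu)).contDiffWithinAt,
    fun c d h hh w hw => ?_⟩
  exact (forms.natural hα).extDeriv_eq hh hw
    (forms_differentiableAt hα d (hh.target_subset (h.map_source hw)))

theorem ComplexOrbifold.fmul_mem_forms {𝓧 : ComplexOrbifold n X} {k : ℕ} {g : X → ℝ}
    {α : 𝓧.Family k} (hg : 𝓧.SmoothFun g) (hα : α ∈ 𝓧.forms k) : fmul g α ∈ 𝓧.forms k :=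
  ⟨fun c => (hg c).smul (hα.1 c), (forms.natural hα).fmul g⟩

theorem ComplexOrbifold.wedge_mem_forms {𝓧 : ComplexOrbifold n X} {k l : ℕ} {α : 𝓧.Family k}
    {β : 𝓧.Family l} (hα : α ∈ 𝓧.forms k) (hβ : β ∈ 𝓧.forms l) :
    (fun c u => wedge (α c u) (β c u) : 𝓧.Family (k + l)) ∈ 𝓧.forms (k + l) :=
  ⟨fun c _ hu => (contDiffAt_wedge (forms.contDiffAt hα c hu)
    (forms.contDiffAt hβ c hu)).contDiffWithinAt, (forms.natural hα).wedge (forms.natural hβ)⟩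

theorem ComplexOrbifold.wedge_mem_closedForms {𝓧 : ComplexOrbifold n X} {k l : ℕ}
    {α : 𝓧.Family k} {β : 𝓧.Family l} (hα : α ∈ 𝓧.closedForms k) (hβ : β ∈ 𝓧.closedForms l) :
    (fun c u => wedge (α c u) (β c u) : 𝓧.Family (k + l)) ∈ 𝓧.closedForms (k + l) := by
  refine ⟨wedge_mem_forms hα.1 hβ.1, fun c u hu => ?_⟩
  rw [extDeriv_wedge_of_closed (forms_differentiableAt hα.1 c hu)
    (forms_differentiableAt hβ.1 c hu) (hα.2 c u hu), hβ.2 c u hu, wedge_zero_right, smul_zero]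

end Smooth

/-! ### Integration with a partition of unity -/

section PartitionIntegral

variable {n : ℕ} {X : Type*} [TopologicalSpace X]

theorem continuous_apply_frame {n : ℕ} {k : ℕ} (v : Fin k → Cn n) :
    Continuous fun a : Alt n k => a v :=
  (ContinuousAlternatingMap.apply ℝ (Cn n) ℝ v).continuous

/-- A continuous function on the domain of a chart which vanishes outside the preimage of a compact
subset of the image is integrable. -/
theorem OrbifoldChart.integrableOn_of_support [T2Space X] (c : OrbifoldChart n X) {K : Set X}
    (hK : IsCompact K) (hKc : K ⊆ c.image) {F : Cn n → ℝ} (hF : ContinuousOn F c.dom)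
    (hF0 : ∀ u ∈ c.dom, c.proj u ∉ K → F u = 0) : IntegrableOn F c.dom := by
  have hC := c.isCompact_preimage hK hKc
  have h1 : IntegrableOn F {u | u ∈ c.dom ∧ c.proj u ∈ K} :=
    (hF.mono fun u hu => hu.1).integrableOn_compact hC
  refine h1.of_forall_sdiff_eq_zero c.isOpen_dom.measurableSet fun u hu => ?_
  exact hF0 u hu.1 fun h => hu.2 ⟨hu.1, h⟩

/-- The integral of a continuous natural family, computed with any continuous partition of unity
subordinate to charts. -/
theorem ComplexOrbifold.integral_eq_partition [T2Space X] [CompactSpace X]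
    (𝓧 : ComplexOrbifold n X) {ι : Type*} [Fintype ι] (p : ι → 𝓧.charts) (ρ : ι → X → ℝ)
    (hρ : ∀ k, Continuous (ρ k)) (hρ1 : ∀ x, ∑ k, ρ k x = 1)
    (hρs : ∀ k, tsupport (ρ k) ⊆ (p k).1.image) {α : 𝓧.Family (2 * n)} (hα : 𝓧.Natural α)
    (hαc : ∀ c, ContinuousOn (α c) c.1.dom) :
    𝓧.integral α = ∑ k, (Nat.card (p k).1.group : ℝ)⁻¹ *
      ∫ u in (p k).1.dom, ρ k ((p k).1.proj u) * α (p k) u (frame n) := by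
  have hρc : ∀ k (d : 𝓧.charts), ContinuousOn (fun u => ρ k (d.1.proj u)) d.1.dom := fun k d =>
    (hρ k).comp_continuousOn d.1.continuousOn_proj
  refine 𝓧.integral_eq_sum isClosed_empty 𝓧.thin_empty p α (fun k => fmul (ρ k) α)
    (fun k => hα.fmul _) (fun k c => ?_) (fun k c u hu _ hne => ?_) (fun k => ?_)
    (fun c u _ _ => ?_)
  · exact (((hρc k c).smul (hαc c))).mono sdiff_subset
  · refine hρs k (subset_tsupport _ fun h => hne ?_)
    simp [fmul, h]
  · refine (p k).1.integrableOn_of_support (isClosed_tsupport (ρ k)).isCompact (hρs k) ?_ ?_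
    · exact (continuous_apply_frame (frame n)).comp_continuousOn ((hρc k _).smul (hαc _))
    · intro u _ hu
      simp [fmul, image_eq_zero_of_notMem_tsupport hu]
  · simp only [fmul, ← Finset.sum_smul, hρ1, one_smul]

theorem ComplexOrbifold.integral_add [T2Space X] [CompactSpace X] (𝓧 : ComplexOrbifold n X)
    {α β : 𝓧.Family (2 * n)} (hα : 𝓧.Natural α) (hαc : ∀ c, ContinuousOn (α c) c.1.dom)
    (hβ : 𝓧.Natural β) (hβc : ∀ c, ContinuousOn (β c) c.1.dom) :
    𝓧.integral (α + β) = 𝓧.integral α + 𝓧.integral β := by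
  obtain ⟨t, p, ρ, -, hρ, hρ1, hρs⟩ := 𝓧.exists_smooth_partition univ fun x => by
    obtain ⟨c, hc, hx⟩ := 𝓧.cover x
    exact ⟨⟨c, hc⟩, mem_univ _, hx⟩
  have hi : ∀ {γ : 𝓧.Family (2 * n)}, (∀ c, ContinuousOn (γ c) c.1.dom) → ∀ k,
      IntegrableOn (fun u => ρ k ((p k).1.proj u) * γ (p k) u (frame n)) (p k).1.dom := by
    intro γ hγ k
    refine (p k).1.integrableOn_of_support (isClosed_tsupport (ρ k)).isCompact (hρs k) ?_ ?_
    · exact (hρ k (p k)).continuousOn.mul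
        ((continuous_apply_frame (frame n)).comp_continuousOn (hγ _))
    · intro u _ hu
      simp [image_eq_zero_of_notMem_tsupport hu]
  rw [𝓧.integral_eq_partition p ρ (fun k => (hρ k).continuous) hρ1 hρs hα hαc,
    𝓧.integral_eq_partition p ρ (fun k => (hρ k).continuous) hρ1 hρs hβ hβc,
    𝓧.integral_eq_partition p ρ (fun k => (hρ k).continuous) hρ1 hρs (α := α + β)
      (fun c d h hh w hw => by
        simp only [Family.add_apply, Pi.add_apply, hα c d h hh w hw, hβ c d h hh w hw]
        rfl)
      (fun c => (hαc c).add (hβc c)), ← Finset.sum_add_distrib]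
  refine Finset.sum_congr rfl fun k _ => ?_
  rw [← mul_add, ← MeasureTheory.integral_add (hi hαc k) (hi hβc k)]
  refine congrArg (_ * ·) (integral_congr_ae (Filter.Eventually.of_forall fun u => ?_))
  simp only [Family.add_apply, Pi.add_apply, ContinuousAlternatingMap.add_apply, mul_add]

theorem ComplexOrbifold.integral_smul [T2Space X] [CompactSpace X] (𝓧 : ComplexOrbifold n X)
    (r : ℝ) (α : 𝓧.Family (2 * n)) : 𝓧.integral (r • α) = r * 𝓧.integral α := by
  obtain ⟨N, c, ρ, -, h⟩ := 𝓧.exists_partition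
  rw [h, h, Finset.mul_sum]
  refine Finset.sum_congr rfl fun k _ => ?_
  have h1 : ∫ u in (c k).1.dom, ρ k ((c k).1.proj u) * (r • α) (c k) u (frame n) =
      r * ∫ u in (c k).1.dom, ρ k ((c k).1.proj u) * α (c k) u (frame n) := by
    rw [← integral_const_mul]
    refine integral_congr_ae (Filter.Eventually.of_forall fun u => ?_)
    simp only [Family.smul_apply, Pi.smul_apply, ContinuousAlternatingMap.smul_apply, smul_eq_mul]
    ring
  rw [h1]
  ring

/-- The integral only depends on the values of a family on the domains of the charts. -/
theorem ComplexOrbifold.integral_congr [T2Space X] [CompactSpace X] (𝓧 : ComplexOrbifold n X)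
    {α β : 𝓧.Family (2 * n)} (h : ∀ c, ∀ u ∈ c.1.dom, α c u = β c u) :
    𝓧.integral α = 𝓧.integral β := by
  obtain ⟨N, c, ρ, -, h'⟩ := 𝓧.exists_partition
  rw [h', h']
  refine Finset.sum_congr rfl fun k _ => ?_
  congr 1
  exact setIntegral_congr_fun (c k).1.isOpen_dom.measurableSet fun u hu => by
    simp only [h _ u hu]

end PartitionIntegral

/-! ### Stokes' theorem and the residue formula on coordinate space -/

section LocalStokes

variable {E F : Type*} [NormedAddCommGroup E] [NormedSpace ℝ E] [NormedAddCommGroup F]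
  [NormedSpace ℝ F]

/-- Extension by zero of a smooth function on an open set which vanishes off a closed subset. -/
theorem contDiff_indicator {f : E → F} {s K : Set E} (hs : IsOpen s) (hK : IsClosed K)
    (hKs : K ⊆ s) (hf : ContDiffOn ℝ ∞ f s) (hf0 : ∀ u ∈ s, u ∉ K → f u = 0) :
    ContDiff ℝ ∞ (s.indicator f) := by
  rw [contDiff_iff_contDiffAt]
  intro u
  by_cases hu : u ∈ s
  · refine (hf.contDiffAt (hs.mem_nhds hu)).congr_of_eventuallyEq ?_
    filter_upwards [hs.mem_nhds hu] with v hv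
    exact indicator_of_mem hv f
  · refine (contDiffAt_const (c := (0 : F))).congr_of_eventuallyEq ?_
    filter_upwards [hK.isOpen_compl.mem_nhds fun h => hu (hKs h)] with v hv
    by_cases hvs : v ∈ s
    · rw [indicator_of_mem hvs, hf0 v hvs hv]
    · exact indicator_of_notMem hvs f

theorem hasCompactSupport_indicator {E F : Type*} [TopologicalSpace E] [R1Space E] [Zero F]
    {f : E → F} {s K : Set E} (hK : IsCompact K)
    (hf0 : ∀ u ∈ s, u ∉ K → f u = 0) : HasCompactSupport (s.indicator f) := by
  refine HasCompactSupport.intro hK fun u hu => ?_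
  by_cases hus : u ∈ s
  · rw [indicator_of_mem hus, hf0 u hus hu]
  · exact indicator_of_notMem hus f

theorem integrable_fderiv_apply [MeasurableSpace E] [BorelSpace E] {μ : Measure E}
    [IsFiniteMeasureOnCompacts μ] {g : E → F} (hg : ContDiff ℝ 1 g)
    (hgc : HasCompactSupport g) (v : E) : Integrable (fun u => fderiv ℝ g u v) μ := by
  have h1 : Continuous fun u => fderiv ℝ g u v :=
    (hg.continuous_fderiv one_ne_zero).clm_apply continuous_const
  exact h1.integrable_of_hasCompactSupport (hgc.fderiv_apply ℝ v)

theorem integral_fderiv_apply_eq_zero [FiniteDimensional ℝ E] [MeasurableSpace E] [BorelSpace E]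
    {μ : Measure E} [μ.IsAddHaarMeasure] {𝕜 : Type*} [RCLike 𝕜] {g : E → 𝕜}
    (hg : ContDiff ℝ 1 g) (hgc : HasCompactSupport g) (v : E) :
    ∫ u, fderiv ℝ g u v ∂μ = 0 := by
  have h := integral_mul_fderiv_eq_neg_fderiv_mul_of_integrable (𝕜 := 𝕜) (μ := μ)
    (f := fun _ : E => (1 : 𝕜)) (g := g) (v := v) (by simp)
    (by simpa using integrable_fderiv_apply hg hgc v)
    (by simpa using hg.continuous.integrable_of_hasCompactSupport hgc)
    (fun _ _ => differentiableAt_const _) (fun _ _ => (hg.differentiable one_ne_zero) _)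
  simpa using h

/-- Stokes' theorem for a compactly supported form of degree one less than the real dimension. -/
theorem integral_extDeriv_eq_zero {n : ℕ} {β : Cn (n + 1) → Alt (n + 1) (2 * n + 1)}
    (hβ : ContDiff ℝ 1 β) (hβc : HasCompactSupport β) :
    Integrable (fun u => extDeriv β u (frame (n + 1))) ∧
      ∫ u, extDeriv β u (frame (n + 1)) = 0 := by
  let g : Fin (2 * n + 1 + 1) → Cn (n + 1) → ℝ := fun i u =>
    β u (i.removeNth (frame (n + 1) : Fin (2 * n + 1 + 1) → Cn (n + 1)))
  have hg : ∀ i, ContDiff ℝ 1 (g i) := fun i =>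
    (ContinuousAlternatingMap.apply ℝ (Cn (n + 1)) ℝ
      (i.removeNth (frame (n + 1) : Fin (2 * n + 1 + 1) → Cn (n + 1)))).contDiff.comp hβ
  have hgc : ∀ i, HasCompactSupport (g i) := fun i =>
    hβc.comp_left (g := fun a : Alt (n + 1) (2 * n + 1) => a _) rfl
  have h1 : ∀ u, extDeriv β u (frame (n + 1)) = ∑ i : Fin (2 * n + 1 + 1),
      (-1 : ℝ) ^ (i : ℕ) * fderiv ℝ (g i) u (frame (n + 1) i) := fun u => by
    rw [extDeriv_apply (hβ.differentiable one_ne_zero u)]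
    exact Finset.sum_congr rfl fun i _ => by simp [g]
  have hi : ∀ i : Fin (2 * n + 1 + 1), Integrable fun u =>
      (-1 : ℝ) ^ (i : ℕ) * fderiv ℝ (g i) u (frame (n + 1) i) := fun i =>
    (integrable_fderiv_apply (hg i) (hgc i) _).const_mul _
  simp only [h1]
  refine ⟨integrable_finsetSum _ fun i _ => hi i, ?_⟩
  rw [integral_finsetSum _ fun i _ => hi i]
  refine Finset.sum_eq_zero fun i _ => ?_
  rw [integral_const_mul, integral_fderiv_apply_eq_zero (hg i) (hgc i), mul_zero]

end LocalStokes

section Residue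

theorem measurePreserving_cons (n : ℕ) : MeasurePreserving
    (fun p : ℂ × Cn n => (Fin.cons p.1 p.2 : Cn (n + 1))) := by
  have := (volume_preserving_piFinSuccAbove (fun _ : Fin (n + 1) => ℂ) 0).symm
  convert this using 1
  ext p : 1
  exact (Fin.insertNth_zero' p.1 p.2).symm

theorem measurableEmbedding_cons (n : ℕ) : MeasurableEmbedding
    (fun p : ℂ × Cn n => (Fin.cons p.1 p.2 : Cn (n + 1))) := by
  have := (MeasurableEquiv.piFinSuccAbove (fun _ : Fin (n + 1) => ℂ) 0).symm.measurableEmbedding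
  convert this using 1
  ext p : 1
  exact (Fin.insertNth_zero' p.1 p.2).symm

/-- Differentiation of a function along the radius turns the density `1 / r` of polar coordinates
into the value at the origin. -/
theorem integral_fderiv_self_div_norm_sq {g : ℂ → ℝ} (hg : ContDiff ℝ 1 g)
    (hgc : HasCompactSupport g) : ∫ t, fderiv ℝ g t t / ‖t‖ ^ 2 = -(2 * Real.pi) * g 0 := by
  let e : ℝ → ℂ := fun θ => Real.cos θ + Real.sin θ * Complex.I
  have he : Continuous e := by fun_prop
  have hen : ∀ θ, ‖e θ‖ = 1 := fun θ => by
    have : e θ = Complex.exp (θ * Complex.I) := by simp [e, Complex.exp_mul_I]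
    rw [this, Complex.norm_exp_ofReal_mul_I]
  let G : ℝ × ℝ → ℝ := fun p => fderiv ℝ g (p.1 * e p.2) (e p.2)
  have hG : Continuous G := by
    have h1 : Continuous fun p : ℝ × ℝ => fderiv ℝ g (p.1 * e p.2) :=
      (hg.continuous_fderiv one_ne_zero).comp
        ((Complex.continuous_ofReal.comp continuous_fst).mul (he.comp continuous_snd))
    exact h1.clm_apply (he.comp continuous_snd)
  obtain ⟨R, hR⟩ : ∃ R : ℝ, ∀ z : ℂ, R < ‖z‖ → fderiv ℝ g z = 0 := by
    obtain ⟨R, hR⟩ := (hgc.fderiv ℝ).isCompact.isBounded.subset_closedBall 0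
    refine ⟨R, fun z hz => image_eq_zero_of_notMem_tsupport fun h => ?_⟩
    have := hR h
    simp only [Metric.mem_closedBall, dist_zero_right] at this
    exact absurd this (not_le.2 hz)
  have hGi : IntegrableOn G (Ioi 0 ×ˢ Ioo (-Real.pi) Real.pi) := by
    have h1 : IntegrableOn G (Icc 0 R ×ˢ Icc (-Real.pi) Real.pi) :=
      hG.continuousOn.integrableOn_compact (isCompact_Icc.prod isCompact_Icc)
    refine h1.of_forall_sdiff_eq_zero (measurableSet_Ioi.prod measurableSet_Ioo) fun p hp => ?_
    have h2 : R < p.1 := by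
      by_contra h
      exact hp.2 ⟨⟨hp.1.1.le, not_lt.1 h⟩, ⟨hp.1.2.1.le, hp.1.2.2.le⟩⟩
    simp only [G]
    rw [hR]
    · rfl
    · have h0 : (0 : ℝ) < p.1 := hp.1.1
      rw [norm_mul, hen, mul_one, Complex.norm_real, Real.norm_of_nonneg h0.le]
      exact h2
  rw [← Complex.integral_comp_polarCoord_symm]
  have h1 : ∫ p in polarCoord.target, p.1 • (fderiv ℝ g (Complex.polarCoord.symm p)
      (Complex.polarCoord.symm p) / ‖Complex.polarCoord.symm p‖ ^ 2) =
      ∫ p in Ioi (0 : ℝ) ×ˢ Ioo (-Real.pi) Real.pi, G p := by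
    refine setIntegral_congr_fun (measurableSet_Ioi.prod measurableSet_Ioo) fun p hp => ?_
    have h0 : (0 : ℝ) < p.1 := hp.1
    have h2 : Complex.polarCoord.symm p = p.1 * e p.2 := Complex.polarCoord_symm_apply p
    have h3 : (p.1 : ℂ) * e p.2 = p.1 • e p.2 := (Complex.real_smul).symm
    simp only [h2, norm_mul, hen, G, Complex.norm_real, Real.norm_of_nonneg h0.le, smul_eq_mul]
    nth_rewrite 2 [h3]
    rw [map_smul, smul_eq_mul]
    field_simp
  -- On the ray of angle `θ` the integrand in polar coordinates is the radial derivative of `g`.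
  have h2 : ∀ θ : ℝ, ∫ r in Ioi (0 : ℝ), G (r, θ) = -g 0 := by
    intro θ
    let φ : ℝ → ℝ := fun r => g (r * e θ)
    have hl : ContDiff ℝ 1 fun r : ℝ => (r : ℂ) * e θ :=
      Complex.ofRealCLM.contDiff.mul contDiff_const
    have h3 : ∀ r : ℝ, deriv φ r = G (r, θ) := by
      intro r
      have h4 : HasDerivAt (fun r : ℝ => (r : ℂ) * e θ) (e θ) r := by
        simpa using (Complex.ofRealCLM.hasDerivAt (x := r)).mul_const (e θ)
      exact ((hg.differentiable one_ne_zero _).hasFDerivAt.comp_hasDerivAt r h4).deriv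
    have hφc : HasCompactSupport φ := by
      obtain ⟨R, hR⟩ := hgc.isCompact.isBounded.subset_closedBall 0
      refine HasCompactSupport.intro (isCompact_closedBall (0 : ℝ) R) fun r hr => ?_
      refine image_eq_zero_of_notMem_tsupport (f := g) (x := r * e θ) fun h => hr ?_
      have := hR h
      simpa [hen] using this
    have hφd : ContDiff ℝ 1 φ := hg.comp hl
    have := hφc.integral_Ioi_deriv_eq hφd 0
    simp only [h3] at this
    simpa [φ] using this
  rw [h1, Measure.volume_eq_prod, ← Measure.prod_restrict, integral_prod_symm]
  · simp only [h2]
    rw [setIntegral_const, Real.volume_real_Ioo_of_le (by linarith [Real.pi_pos]), smul_eq_mul]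
    ring
  · rw [Measure.prod_restrict, ← Measure.volume_eq_prod]
    exact hGi

/-- The simple pole `1 / u₀` is locally integrable. -/
theorem integrable_div_coord {n : ℕ} {H : Cn (n + 1) → ℂ} (hH : Continuous H)
    (hHc : HasCompactSupport H) : Integrable fun u => H u / u 0 := by
  obtain ⟨R, hR⟩ := hHc.isCompact.isBounded.subset_closedBall 0
  obtain ⟨C, hC⟩ := hH.bounded_above_of_compact_support hHc
  -- A bound by the product of `1 / ‖t‖` on a disc, which is integrable on the plane, and a constant
  -- on a ball.
  let φ : ℂ → ℝ := fun t => (Iio (R + 1)).indicator (fun r : ℝ => r⁻¹) ‖t‖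
  let χ : Cn n → ℝ := (Metric.closedBall 0 R).indicator fun _ => C
  have hφ : Integrable φ := by
    rw [integrable_fun_norm_addHaar]
    have h1 : IntegrableOn (fun _ : ℝ => (1 : ℝ)) (Ioo 0 (R + 1)) := by simp
    have h2 : IntegrableOn ((Ioo 0 (R + 1)).indicator fun _ : ℝ => (1 : ℝ)) (Ioi 0) :=
      ((integrable_indicator_iff measurableSet_Ioo).2 h1).integrableOn
    refine h2.congr_fun (fun r hr => ?_) measurableSet_Ioi
    have hr0 : (0 : ℝ) < r := hr
    by_cases h : r < R + 1
    · simp [indicator, h, hr0, Complex.finrank_real_complex, hr0.ne']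
    · simp [indicator, h]
  have hχ : Integrable χ := by
    refine (integrable_indicator_iff Metric.isClosed_closedBall.measurableSet).2 ?_
    exact integrableOn_const (isCompact_closedBall (0 : Cn n) R).measure_lt_top.ne
  have h1 : Integrable fun p : ℂ × Cn n => φ p.1 * χ p.2 := hφ.mul_prod hχ
  refine ((measurePreserving_cons n).integrable_comp_emb (measurableEmbedding_cons n)).1 ?_
  refine Integrable.mono' h1 ?_ (Filter.Eventually.of_forall fun p => ?_)
  · have hm : Measurable fun u : Cn (n + 1) => H u / u 0 :=
      hH.measurable.div (measurable_pi_apply 0)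
    exact (hm.comp (measurableEmbedding_cons n).measurable).aestronglyMeasurable
  · simp only [Function.comp_apply, Fin.cons_zero, norm_div]
    by_cases hp : (Fin.cons p.1 p.2 : Cn (n + 1)) ∈ tsupport H
    · have h2 : ‖(Fin.cons p.1 p.2 : Cn (n + 1))‖ ≤ R := by simpa using hR hp
      have h3 : ‖p.1‖ ≤ R := (norm_le_pi_norm (Fin.cons p.1 p.2 : Cn (n + 1)) 0).trans h2
      have h4 : ‖p.2‖ ≤ R := (pi_norm_le_iff_of_nonneg ((norm_nonneg _).trans h2)).2 fun i =>
        (norm_le_pi_norm (Fin.cons p.1 p.2 : Cn (n + 1)) i.succ).trans h2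
      have h5 : ‖p.1‖ < R + 1 := by linarith
      simp only [φ, χ, indicator, mem_Iio, h5, if_true, Metric.mem_closedBall, dist_zero_right, h4]
      rw [div_eq_inv_mul]
      exact mul_le_mul_of_nonneg_left (hC _) (by positivity)
    · rw [image_eq_zero_of_notMem_tsupport hp, norm_zero, zero_div]
      refine mul_nonneg ?_ (indicator_nonneg (fun _ _ => (norm_nonneg _).trans (hC 0)) _)
      simp only [φ, indicator_apply]
      split_ifs
      · positivity
      · rfl

/-- The inclusion of the hyperplane `u₀ = 0`. -/
def tailIncl (n : ℕ) : Cn n →L[ℂ] Cn (n + 1) :=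
  LinearMap.toContinuousLinearMap
    { toFun := fun y => Fin.cons 0 y
      map_add' := fun x y => by
        ext i
        refine Fin.cases ?_ (fun j => ?_) i <;> simp
      map_smul' := fun c y => by
        ext i
        refine Fin.cases ?_ (fun j => ?_) i <;> simp }

theorem tailIncl_apply {n : ℕ} (y : Cn n) : tailIncl n y = Fin.cons 0 y := rfl

theorem cons_eq_add {n : ℕ} (t : ℂ) (y : Cn n) :
    (Fin.cons t y : Cn (n + 1)) = Pi.single 0 t + tailIncl n y := by
  ext i
  refine Fin.cases ?_ (fun j => ?_) i <;> simp [tailIncl_apply]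

theorem hasFDerivAt_cons_right {n : ℕ} (t : ℂ) (y : Cn n) :
    HasFDerivAt (fun y : Cn n => (Fin.cons t y : Cn (n + 1))) ((tailIncl n).restrictScalars ℝ) y := by
  simp only [cons_eq_add]
  exact (((tailIncl n).restrictScalars ℝ).hasFDerivAt).const_add _

theorem hasFDerivAt_cons_left {n : ℕ} (t : ℂ) (y : Cn n) :
    HasFDerivAt (fun t : ℂ => (Fin.cons t y : Cn (n + 1)))
      ((ContinuousLinearMap.single ℝ (fun _ => ℂ) 0)) t := by
  simp only [cons_eq_add]
  exact ((ContinuousLinearMap.single ℝ (fun _ : Fin (n + 1) => ℂ) 0).hasFDerivAt).add_const _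

theorem contDiff_cons {n : ℕ} :
    ContDiff ℝ ∞ fun p : ℂ × Cn n => (Fin.cons p.1 p.2 : Cn (n + 1)) := by
  simp only [cons_eq_add]
  exact ((ContinuousLinearMap.single ℝ (fun _ : Fin (n + 1) => ℂ) 0).contDiff.comp
    contDiff_fst).add (((tailIncl n).restrictScalars ℝ).contDiff.comp contDiff_snd)

theorem hasCompactSupport_comp_cons_right {n : ℕ} {F : Type*} [Zero F] {Φ : Cn (n + 1) → F}
    (hΦ : HasCompactSupport Φ) (t : ℂ) : HasCompactSupport fun y : Cn n => Φ (Fin.cons t y) := by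
  obtain ⟨R, hR⟩ := hΦ.isCompact.isBounded.subset_closedBall 0
  refine HasCompactSupport.intro (isCompact_closedBall (0 : Cn n) R) fun y hy => ?_
  refine image_eq_zero_of_notMem_tsupport (f := Φ) fun h => hy ?_
  have h1 : ‖(Fin.cons t y : Cn (n + 1))‖ ≤ R := by simpa using hR h
  rw [Metric.mem_closedBall, dist_zero_right]
  exact (pi_norm_le_iff_of_nonneg ((norm_nonneg _).trans h1)).2 fun i =>
    (norm_le_pi_norm (Fin.cons t y : Cn (n + 1)) i.succ).trans h1

theorem hasCompactSupport_comp_cons_left {n : ℕ} {F : Type*} [Zero F] {Φ : Cn (n + 1) → F}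
    (hΦ : HasCompactSupport Φ) (y : Cn n) : HasCompactSupport fun t : ℂ => Φ (Fin.cons t y) := by
  obtain ⟨R, hR⟩ := hΦ.isCompact.isBounded.subset_closedBall 0
  refine HasCompactSupport.intro (isCompact_closedBall (0 : ℂ) R) fun t ht => ?_
  refine image_eq_zero_of_notMem_tsupport (f := Φ) fun h => ht ?_
  have h1 : ‖(Fin.cons t y : Cn (n + 1))‖ ≤ R := by simpa using hR h
  rw [Metric.mem_closedBall, dist_zero_right]
  exact (norm_le_pi_norm (Fin.cons t y : Cn (n + 1)) 0).trans h1

/-- A derivative along the hyperplane `u₀ = 0` may be integrated by parts, as the pole is constant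
in that direction. -/
theorem integral_fderiv_tail_div {n : ℕ} {Φ : Cn (n + 1) → ℂ} (hΦ : ContDiff ℝ 1 Φ)
    (hΦc : HasCompactSupport Φ) (v : Cn n) :
    ∫ u, fderiv ℝ Φ u (Fin.cons 0 v) / u 0 = 0 := by
  have hi : Integrable fun u => fderiv ℝ Φ u (Fin.cons 0 v) / u 0 :=
    integrable_div_coord ((hΦ.continuous_fderiv one_ne_zero).clm_apply continuous_const)
      (hΦc.fderiv_apply ℝ _)
  rw [← (measurePreserving_cons n).integral_comp (measurableEmbedding_cons n),
    Measure.volume_eq_prod, integral_prod]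
  · refine integral_eq_zero_of_ae (Filter.Eventually.of_forall fun t => ?_)
    simp only [Fin.cons_zero, Pi.zero_apply]
    rw [integral_div]
    have h1 : ∀ y : Cn n, fderiv ℝ Φ (Fin.cons t y) (Fin.cons 0 v) =
        fderiv ℝ (fun y : Cn n => Φ (Fin.cons t y)) y v := fun y => by
      have := (hΦ.differentiable one_ne_zero (Fin.cons t y)).hasFDerivAt.comp y
        (hasFDerivAt_cons_right t y)
      rw [HasFDerivAt.fderiv (f := fun y : Cn n => Φ (Fin.cons t y)) this]
      rfl
    simp only [h1]
    rw [integral_fderiv_apply_eq_zero ?_ (hasCompactSupport_comp_cons_right hΦc t), zero_div]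
    exact hΦ.comp ((contDiff_cons.comp (contDiff_prodMk_right t)).of_le (by simp))
  · exact ((measurePreserving_cons n).integrable_comp_emb (measurableEmbedding_cons n)).2 hi

/-- The terms with derivatives in the `u₀` direction combine to the derivative of `b` along the
radius, divided by `‖u₀‖ ^ 2`. -/
theorem integral_radial_div {n : ℕ} {b : Cn (n + 1) → ℝ} (hb : ContDiff ℝ 1 b)
    (hbc : HasCompactSupport b) :
    ∫ u, ((Complex.I * fderiv ℝ b u (Fin.cons 1 0) - fderiv ℝ b u (Fin.cons Complex.I 0)) /
      u 0).im = -(2 * Real.pi) * ∫ y : Cn n, b (Fin.cons 0 y) := by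
  have hc : ∀ v, Continuous fun u => fderiv ℝ b u v := fun v =>
    (hb.continuous_fderiv one_ne_zero).clm_apply continuous_const
  have hs : ∀ v, HasCompactSupport fun u => fderiv ℝ b u v := fun v => hbc.fderiv_apply ℝ _
  have hi : Integrable fun u : Cn (n + 1) => (Complex.I * fderiv ℝ b u (Fin.cons 1 0) -
      fderiv ℝ b u (Fin.cons Complex.I 0)) / u 0 := by
    refine integrable_div_coord (by have := hc; fun_prop) ?_
    refine HasCompactSupport.sub ?_ ?_
    · exact ((hs (Fin.cons 1 0)).comp_left (g := ((↑) : ℝ → ℂ)) rfl).mul_left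
    · exact (hs (Fin.cons Complex.I 0)).comp_left (g := ((↑) : ℝ → ℂ)) rfl
  rw [← (measurePreserving_cons n).integral_comp (measurableEmbedding_cons n),
    Measure.volume_eq_prod, integral_prod_symm]
  · rw [← integral_const_mul]
    refine integral_congr_ae (Filter.Eventually.of_forall fun y => ?_)
    simp only [Fin.cons_zero]
    rw [← integral_fderiv_self_div_norm_sq (g := fun t => b (Fin.cons t y)) ?_
      (hasCompactSupport_comp_cons_left hbc y)]
    · refine integral_congr_ae ?_
      filter_upwards with t
      have := (hb.differentiable one_ne_zero (Fin.cons t y)).hasFDerivAt.comp t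
        (hasFDerivAt_cons_left t y)
      have h2 : fderiv ℝ (fun t => b (Fin.cons t y)) t t = t.re * fderiv ℝ b (Fin.cons t y)
          (Fin.cons 1 0) + t.im * fderiv ℝ b (Fin.cons t y) (Fin.cons Complex.I 0) := by
        have h3 : (Pi.single 0 t : Cn (n + 1)) =
            t.re • (Fin.cons 1 0 : Cn (n + 1)) + t.im • (Fin.cons Complex.I 0 : Cn (n + 1)) := by
          ext i
          refine Fin.cases ?_ (fun j => ?_) i
          · simp [Complex.re_add_im]
          · simp
        rw [HasFDerivAt.fderiv (f := fun t => b (Fin.cons t y)) this,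
          ContinuousLinearMap.comp_apply, ContinuousLinearMap.single_apply, h3, map_add, map_smul, map_smul]
        rfl
      rw [h2, Complex.div_im, ← Complex.normSq_eq_norm_sq]
      simp
      ring
    · exact hb.comp ((contDiff_cons.comp (contDiff_prodMk_left y)).of_le (by simp))
  · exact ((measurePreserving_cons n).integrable_comp_emb (measurableEmbedding_cons n)).2 hi.im

/-- The angular form `Im (dt / t)` in the first coordinate. -/
def angForm (n : ℕ) (u : Cn (n + 1)) : Alt (n + 1) 1 :=
  ContinuousAlternatingMap.ofSubsingleton ℝ (Cn (n + 1)) ℝ (0 : Fin 1)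
    (Complex.imCLM.comp ((u 0)⁻¹ • ContinuousLinearMap.proj (R := ℝ) (φ := fun _ => ℂ) 0))

theorem angForm_apply {n : ℕ} (u : Cn (n + 1)) (v : Fin 1 → Cn (n + 1)) :
    angForm n u v = (v 0 0 / u 0).im := by
  simp [angForm, div_eq_inv_mul]

theorem contDiffAt_angForm {n : ℕ} {u : Cn (n + 1)} (hu : u 0 ≠ 0) :
    ContDiffAt ℝ ∞ (angForm n) u := by
  have h1 : ContDiffAt ℝ ∞ (fun u : Cn (n + 1) => (u 0)⁻¹) u :=
    (contDiff_apply ℝ ℂ (0 : Fin (n + 1))).contDiffAt.inv hu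
  have h2 : ContDiffAt ℝ ∞ (fun u : Cn (n + 1) => Complex.imCLM.comp
      ((u 0)⁻¹ • ContinuousLinearMap.proj (R := ℝ) (φ := fun _ : Fin (n + 1) => ℂ) 0)) u :=
    contDiffAt_const.clm_comp (h1.smul contDiffAt_const)
  exact (ContinuousAlternatingMap.ofSubsingletonLIE (𝕜 := ℝ) (E := Cn (n + 1)) (F := ℝ)
    (0 : Fin 1)).toContinuousLinearEquiv.contDiff.contDiffAt.comp u h2

theorem frame_succ_zero (n : ℕ) :
    (frame (n + 1) : Fin (2 * n + 1 + 1) → Cn (n + 1)) 0 = Fin.cons 1 0 := by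
  ext j
  refine Fin.cases ?_ (fun j => ?_) j <;> simp [frame, Fin.ext_iff]

theorem frame_succ_one (n : ℕ) :
    (frame (n + 1) : Fin (2 * n + 1 + 1) → Cn (n + 1)) (Fin.succ 0) = Fin.cons Complex.I 0 := by
  ext j
  change (Pi.single (⟨1 / 2, by omega⟩ : Fin (n + 1))
    (if 1 % 2 = 0 then (1 : ℂ) else Complex.I) : Cn (n + 1)) j = _
  refine Fin.cases ?_ (fun j => ?_) j <;> simp [Fin.ext_iff]

theorem frame_succ_succ (n : ℕ) (i : Fin (2 * n)) :
    (frame (n + 1) : Fin (2 * n + 1 + 1) → Cn (n + 1)) i.succ.succ = Fin.cons 0 (frame n i) := by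
  have h1 : ((i : ℕ) + 1 + 1) / 2 = i / 2 + 1 := by omega
  have h2 : ((i : ℕ) + 1 + 1) % 2 = i % 2 := by omega
  ext j
  refine Fin.cases ?_ (fun j => ?_) j <;> simp [frame, Pi.single_apply, Fin.ext_iff, h1, h2]

/-- The residue formula: the form `Im (dt / t)` is closed off the hyperplane `t = 0`, and its
exterior derivative in the sense of currents is `2π` times the current of integration over the
hyperplane. -/
theorem integral_extDeriv_wedge_angForm {n : ℕ} {β : Cn (n + 1) → Alt (n + 1) (2 * n)}
    (hβ : ContDiff ℝ ∞ β) (hβc : HasCompactSupport β) :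
    Integrable (fun u => extDeriv (fun w => wedge (β w) (angForm n w)) u (frame (n + 1))) ∧
      ∫ u, extDeriv (fun w => wedge (β w) (angForm n w)) u (frame (n + 1)) =
        -(2 * Real.pi) * ∫ y : Cn n, β (Fin.cons 0 y) fun i => Fin.cons 0 (frame n i) := by
  let f : Fin (2 * n + 1 + 1) → Cn (n + 1) := frame (n + 1)
  -- The component of `β` along the hyperplane, and the numerators `Φ i` of the components of the
  -- wedge product.
  let b : Cn (n + 1) → ℝ := fun u => β u fun i => Fin.cons 0 (frame n i)
  let Φ : Fin (2 * n + 1 + 1) → Cn (n + 1) → ℂ := fun i u => ∑ k : Fin (2 * n + 1),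
    (-1) ^ (k : ℕ) * i.removeNth f k 0 * (β u (k.removeNth (i.removeNth f)) : ℂ)
  have hev : ∀ v : Fin (2 * n) → Cn (n + 1), ContDiff ℝ ∞ (fun u => β u v) := fun v =>
    (ContinuousAlternatingMap.apply ℝ (Cn (n + 1)) ℝ v).contDiff.comp hβ
  have hevc : ∀ v : Fin (2 * n) → Cn (n + 1), HasCompactSupport (fun u => β u v) := fun v =>
    hβc.comp_left (g := fun a : Alt (n + 1) (2 * n) => a v) rfl
  have hΦ : ∀ i, ContDiff ℝ ∞ (Φ i) := fun i => ContDiff.sum fun k _ =>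
    contDiff_const.mul (Complex.ofRealCLM.contDiff.comp (hev _))
  have hΦc : ∀ i, HasCompactSupport (Φ i) := by
    intro i
    refine HasCompactSupport.intro hβc.isCompact fun u hu => ?_
    simp [Φ, image_eq_zero_of_notMem_tsupport hu]
  have hW : ∀ i u, wedge (β u) (angForm n u) (i.removeNth f) = (Φ i u / u 0).im := by
    intro i u
    rw [wedge_one_apply, Finset.sum_div, Complex.im_sum, Even.neg_one_pow ⟨n, by ring⟩, one_mul]
    refine Finset.sum_congr rfl fun k _ => ?_
    rw [angForm_apply]
    have : (-1 : ℂ) ^ (k : ℕ) * i.removeNth f k 0 * (β u (k.removeNth (i.removeNth f)) : ℂ) / u 0 =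
        (((-1 : ℝ) ^ (k : ℕ) * β u (k.removeNth (i.removeNth f)) : ℝ) : ℂ) *
          (i.removeNth f k 0 / u 0) := by
      push_cast
      ring
    rw [this, Complex.im_ofReal_mul]
    ring
  have hf0 : ∀ i : Fin (2 * n), f i.succ.succ = Fin.cons 0 (frame n i) := frame_succ_succ n
  have hΦ0 : ∀ u, Φ 0 u = Complex.I * b u := by
    intro u
    simp only [Φ]
    rw [Fin.sum_univ_succ, Finset.sum_eq_zero, add_zero]
    · have h1 : (0 : Fin (2 * n + 1 + 1)).removeNth f 0 = Fin.cons Complex.I 0 := frame_succ_one n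
      have h2 : (0 : Fin (2 * n + 1)).removeNth ((0 : Fin (2 * n + 1 + 1)).removeNth f) =
          fun i => Fin.cons 0 (frame n i) := funext fun i => hf0 i
      rw [h1, h2]
      simp [b]
    · intro k _
      have h1 : (0 : Fin (2 * n + 1 + 1)).removeNth f k.succ = Fin.cons 0 (frame n k) := hf0 k
      rw [h1]
      simp
  have hΦ1 : ∀ u, Φ (Fin.succ 0) u = b u := by
    intro u
    have h3 : ∀ k : Fin (2 * n), (Fin.succ 0 : Fin (2 * n + 1 + 1)).removeNth f k.succ =
        Fin.cons 0 (frame n k) := fun k => by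
      rw [← hf0 k]
      simp only [Fin.removeNth]
      congr 1
    simp only [Φ]
    rw [Fin.sum_univ_succ, Finset.sum_eq_zero, add_zero]
    · have h1 : (Fin.succ 0 : Fin (2 * n + 1 + 1)).removeNth f 0 = Fin.cons 1 0 :=
        frame_succ_zero n
      have h2 : (0 : Fin (2 * n + 1)).removeNth ((Fin.succ 0 : Fin (2 * n + 1 + 1)).removeNth f) =
          fun i => Fin.cons 0 (frame n i) := funext fun i => h3 i
      rw [h1, h2]
      simp [b]
    · intro k _
      rw [h3 k]
      simp
  -- The derivative of the pole contributes the second term. In `hmain` these contributions cancel: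
  -- only the first two vectors of the frame have a nonzero coordinate `v 0`.
  have hfd : ∀ i u, u 0 ≠ 0 → ∀ v, fderiv ℝ (fun w => (Φ i w / w 0).im) u v =
      (fderiv ℝ (Φ i) u v / u 0).im - (Φ i u * v 0 / u 0 ^ 2).im := by
    intro i u hu v
    have h1 : HasFDerivAt (fun w : Cn (n + 1) => w 0)
        (ContinuousLinearMap.proj (R := ℝ) (φ := fun _ : Fin (n + 1) => ℂ) 0) u :=
      (ContinuousLinearMap.proj (R := ℝ) (φ := fun _ : Fin (n + 1) => ℂ) 0).hasFDerivAt
    have h2 := ((hΦ i).differentiable (by simp) u).hasFDerivAt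
    have h4 := ((hasDerivAt_inv hu).hasFDerivAt.restrictScalars ℝ).comp u h1
    have h3 := Complex.imCLM.hasFDerivAt.comp u (h2.mul h4)
    rw [HasFDerivAt.fderiv (f := fun w => (Φ i w / w 0).im) h3, ← Complex.sub_im]
    rw [ContinuousLinearMap.comp_apply, Complex.imCLM_apply]
    congr 1
    simp
    field_simp
    ring
  have hmain : ∀ u, u 0 ≠ 0 → extDeriv (fun w => wedge (β w) (angForm n w)) u (frame (n + 1)) =
      ((Complex.I * fderiv ℝ b u (Fin.cons 1 0) - fderiv ℝ b u (Fin.cons Complex.I 0)) / u 0).im +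
      ∑ i : Fin (2 * n), (-1 : ℝ) ^ (i : ℕ) *
        (fderiv ℝ (Φ i.succ.succ) u (Fin.cons 0 (frame n i)) / u 0).im := by
    intro u hu
    have hd : DifferentiableAt ℝ (fun w => wedge (β w) (angForm n w)) u :=
      (contDiffAt_wedge hβ.contDiffAt (contDiffAt_angForm hu)).differentiableAt (by simp)
    have e1 : extDeriv (fun w => wedge (β w) (angForm n w)) u (frame (n + 1)) =
        ∑ i : Fin (2 * n + 1 + 1), (-1 : ℝ) ^ (i : ℕ) *
          ((fderiv ℝ (Φ i) u (f i) / u 0).im - (Φ i u * f i 0 / u 0 ^ 2).im) := by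
      refine (extDeriv_apply hd f).trans (Finset.sum_congr rfl fun i _ => ?_)
      have h4 : (fun w => wedge (β w) (angForm n w) (i.removeNth f)) =
          fun w => (Φ i w / w 0).im := funext (hW i)
      rw [h4, hfd i u hu]
      simp
    have hbd := (hev (fun i => Fin.cons 0 (frame n i))).differentiable (by simp) u
    have hbd' : HasFDerivAt (fun u => (b u : ℂ)) (Complex.ofRealCLM.comp (fderiv ℝ b u)) u :=
      Complex.ofRealCLM.hasFDerivAt.comp u hbd.hasFDerivAt
    have d0 : ∀ v, fderiv ℝ (Φ 0) u v = Complex.I * fderiv ℝ b u v := fun v => by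
      rw [show Φ 0 = fun u => Complex.I * (b u : ℂ) from funext hΦ0,
        HasFDerivAt.fderiv (hbd'.const_mul Complex.I)]
      simp
    have d1 : ∀ v, fderiv ℝ (Φ (Fin.succ 0)) u v = fderiv ℝ b u v := fun v => by
      rw [show Φ (Fin.succ 0) = fun u => (b u : ℂ) from funext hΦ1, HasFDerivAt.fderiv hbd']
      simp
    have hf00 : f 0 = Fin.cons 1 0 := frame_succ_zero n
    have hf01 : f (Fin.succ 0) = Fin.cons Complex.I 0 := frame_succ_one n
    rw [e1, Fin.sum_univ_succ, Fin.sum_univ_succ, d0, d1, hΦ0, hΦ1, hf00, hf01, ← add_assoc]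
    congr 1
    · simp only [Fin.val_zero, pow_zero, one_mul, Fin.val_succ, zero_add, pow_one, Fin.cons_zero,
        mul_one, sub_div, Complex.sub_im]
      rw [mul_comm (b u : ℂ) Complex.I]
      ring
    · refine Finset.sum_congr rfl fun i _ => ?_
      rw [hf0 i]
      simp [pow_succ]
  have hae : ∀ᵐ u : Cn (n + 1), u 0 ≠ 0 := by
    have hV : (LinearMap.ker (LinearMap.proj (R := ℝ) (φ := fun _ : Fin (n + 1) => ℂ) 0)) ≠ ⊤ := by
      intro h
      have : (Pi.single 0 1 : Cn (n + 1)) ∈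
        LinearMap.ker (LinearMap.proj (R := ℝ) (φ := fun _ : Fin (n + 1) => ℂ) 0) :=
        h ▸ Submodule.mem_top
      simp at this
    refine measure_mono_null (fun u hu => ?_) (Measure.addHaar_submodule volume _ hV)
    simpa using hu
  have hbi : Integrable fun u : Cn (n + 1) => (Complex.I * fderiv ℝ b u (Fin.cons 1 0) -
      fderiv ℝ b u (Fin.cons Complex.I 0)) / u 0 := by
    have hc : ∀ v, Continuous fun u => fderiv ℝ b u v := fun v =>
      ((hev _).continuous_fderiv (by simp)).clm_apply continuous_const
    have hs : ∀ v, HasCompactSupport fun u => fderiv ℝ b u v := fun v =>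
      (hevc _).fderiv_apply ℝ _
    refine integrable_div_coord (by have := hc; fun_prop) ?_
    refine HasCompactSupport.sub ?_ ?_
    · exact ((hs (Fin.cons 1 0)).comp_left (g := ((↑) : ℝ → ℂ)) rfl).mul_left
    · exact (hs (Fin.cons Complex.I 0)).comp_left (g := ((↑) : ℝ → ℂ)) rfl
  have hΦi : ∀ i : Fin (2 * n), Integrable fun u : Cn (n + 1) =>
      fderiv ℝ (Φ i.succ.succ) u (Fin.cons 0 (frame n i)) / u 0 := fun i =>
    integrable_div_coord (((hΦ _).continuous_fderiv (by simp)).clm_apply continuous_const)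
      ((hΦc _).fderiv_apply ℝ _)
  have hs : Integrable fun u : Cn (n + 1) => ∑ i : Fin (2 * n), (-1 : ℝ) ^ (i : ℕ) *
        (fderiv ℝ (Φ i.succ.succ) u (Fin.cons 0 (frame n i)) / u 0).im :=
    integrable_finsetSum _ fun i _ => (hΦi i).im.const_mul _
  have hev' : (fun u => extDeriv (fun w => wedge (β w) (angForm n w)) u (frame (n + 1))) =ᵐ[volume]
      fun u => ((Complex.I * fderiv ℝ b u (Fin.cons 1 0) -
        fderiv ℝ b u (Fin.cons Complex.I 0)) / u 0).im + ∑ i : Fin (2 * n), (-1 : ℝ) ^ (i : ℕ) *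
        (fderiv ℝ (Φ i.succ.succ) u (Fin.cons 0 (frame n i)) / u 0).im := by
    filter_upwards [hae] with u hu
    exact hmain u hu
  refine ⟨(hbi.im.add hs).congr hev'.symm, ?_⟩
  rw [integral_congr_ae hev', integral_add (f := fun u => ((Complex.I * fderiv ℝ b u
      (Fin.cons 1 0) - fderiv ℝ b u (Fin.cons Complex.I 0)) / u 0).im) hbi.im hs,
    integral_finsetSum (f := fun (i : Fin (2 * n)) u => (-1 : ℝ) ^ (i : ℕ) *
      (fderiv ℝ (Φ i.succ.succ) u (Fin.cons 0 (frame n i)) / u 0).im) _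
      fun i _ => (hΦi i).im.const_mul _, Finset.sum_eq_zero, add_zero]
  · exact integral_radial_div ((hev _).of_le (by simp)) (hevc _)
  · intro i _
    have h5 := integral_im (𝕜 := ℂ) (hΦi i)
    rw [integral_fderiv_tail_div ((hΦ _).of_le (by simp)) (hΦc _)] at h5
    rw [integral_const_mul]
    refine mul_eq_zero_of_right _ (h5.trans ?_)
    simp

end Residue

/-! ### The maximal atlas -/

section Maximal

variable {n : ℕ} {X : Type*} [TopologicalSpace X]

/-- The holomorphic inverse function theorem, in terms of transitions. -/
theorem locallyEquivalent_of_injective_fderiv {X : Type*} {s t : Set (Cn n)} {p q : Cn n → X}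
    (hs : IsOpen s) (ht : IsOpen t) {g : Cn n → Cn n} {u : Cn n} (hg : AnalyticAt ℂ g u)
    (hinj : Function.Injective (fderiv ℂ g u)) (hu : u ∈ s) (hgu : g u ∈ t)
    (hq : ∀ᶠ w in 𝓝 u, q (g w) = p w) : LocallyEquivalent s p t q u (g u) := by
  have hdet : (fderiv ℂ g u).det ≠ 0 := by
    have h1 : IsUnit (fderiv ℂ g u : Cn n →ₗ[ℂ] Cn n) :=
      (LinearMap.isUnit_iff_ker_eq_bot _).2 (LinearMap.ker_eq_bot.2 hinj)
    exact (LinearMap.isUnit_iff_isUnit_det _).1 h1 |>.ne_zero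
  have hfd : ∀ w, AnalyticAt ℂ g w → ∀ hd : (fderiv ℂ g w).det ≠ 0, HasFDerivAt g
      ((fderiv ℂ g w).toContinuousLinearEquivOfDetNeZero hd : Cn n →L[ℂ] Cn n) w := by
    intro w hw hd
    rw [ContinuousLinearMap.coe_toContinuousLinearEquivOfDetNeZero]
    exact hw.differentiableAt.hasFDerivAt
  -- Mathlib provides a local inverse; smoothness on the whole domain is achieved by shrinking it to
  -- an open set `O` on which `g` is analytic with invertible derivative.
  let H := ContDiffAt.toOpenPartialHomeomorph g (hg.contDiffAt (n := ω)) (hfd u hg hdet) (by simp)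
  have hHu : u ∈ H.source := ContDiffAt.mem_toOpenPartialHomeomorph_source _ _ _
  have hHg : ⇑H = g := ContDiffAt.toOpenPartialHomeomorph_coe _ _ _
  have hev : ∀ᶠ w in 𝓝 u, AnalyticAt ℂ g w ∧ (fderiv ℂ g w).det ≠ 0 ∧ w ∈ s ∧ g w ∈ t ∧
      q (g w) = p w := by
    refine hg.eventually_analyticAt.and (Filter.Eventually.and ?_ ((hs.eventually_mem hu).and
      ((hg.continuousAt.eventually (ht.mem_nhds hgu)).and hq)))
    have h1 : ContinuousAt (fun w => (fderiv ℂ g w).det) u :=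
      ContinuousLinearMap.continuous_det.continuousAt.comp hg.fderiv.continuousAt
    exact h1.eventually_ne hdet
  obtain ⟨O, hO, hOo, huO⟩ := eventually_nhds_iff.1 hev
  have hsrc : ∀ w ∈ (H.restrOpen O hOo).source, w ∈ H.source ∧ w ∈ O := fun w hw => by
    rwa [OpenPartialHomeomorph.restrOpen_source] at hw
  refine ⟨H.restrOpen O hOo, ⟨?_, ?_, ?_, ?_, ?_⟩, ?_, ?_⟩
  · exact fun w hw => (hO w (hsrc w hw).2).2.2.1
  · intro y hy
    have h1 := (H.restrOpen O hOo).map_target hy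
    have h2 := (H.restrOpen O hOo).right_inv hy
    rw [← h2]
    change H _ ∈ t
    rw [hHg]
    exact (hO _ (hsrc _ h1).2).2.2.2.1
  · intro w hw
    change ContDiffWithinAt ℂ ω H _ w
    rw [hHg]
    exact ((hO w (hsrc w hw).2).1.contDiffAt).contDiffWithinAt
  · intro y hy
    have h1 := hO _ (hsrc _ ((H.restrOpen O hOo).map_target hy)).2
    refine ContDiffAt.contDiffWithinAt ?_
    refine (H.restrOpen O hOo).contDiffAt_symm hy
      (f₀' := (fderiv ℂ g _).toContinuousLinearEquivOfDetNeZero h1.2.1) ?_ ?_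
    · change HasFDerivAt H _ _
      rw [hHg]
      exact hfd _ h1.1 h1.2.1
    · change ContDiffAt ℂ ω H _
      rw [hHg]
      exact h1.1.contDiffAt
  · intro w hw
    change q (H w) = p w
    rw [hHg]
    exact (hO w (hsrc w hw).2).2.2.2.2
  · rw [OpenPartialHomeomorph.restrOpen_source]
    exact ⟨hHu, huO⟩
  · exact congrFun hHg u

theorem IsTransition.fderiv_trans {X : Type*} {s t o : Set (Cn n)} {p q r : Cn n → X}
    {h h' : OpenPartialHomeomorph (Cn n) (Cn n)} (hh : IsTransition s p t q h)
    (hh' : IsTransition t q o r h') {w : Cn n} (hw : w ∈ h.source) (hw' : h w ∈ h'.source) :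
    fderiv ℝ (h.trans h') w = (fderiv ℝ h' (h w)).comp (fderiv ℝ h w) :=
  fderiv_comp w ((hh'.contDiffAt hw').differentiableAt (by simp))
    ((hh.contDiffAt hw).differentiableAt (by simp))

/-- A chart is compatible with an orbifold if it is related to the charts of the atlas by local
biholomorphisms near any two points with the same image. -/
def ComplexOrbifold.Compatible (𝓧 : ComplexOrbifold n X) (p : OrbifoldChart n X) : Prop :=
  ∀ c ∈ 𝓧.charts, ∀ u ∈ p.dom, ∀ v ∈ c.dom, p.proj u = c.proj v →
    LocallyEquivalent p.dom p.proj c.dom c.proj u v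

/-- The orbifold given by the maximal atlas, which consists of all compatible charts. -/
def ComplexOrbifold.maximal (𝓧 : ComplexOrbifold n X) : ComplexOrbifold n X where
  charts := {p | 𝓧.Compatible p}
  cover x := by
    obtain ⟨c, hc, hx⟩ := 𝓧.cover x
    exact ⟨c, 𝓧.compatible c hc, hx⟩
  compatible p hp q hq u hu v hv huv := by
    obtain ⟨c, hc, w, hw, hwu⟩ := 𝓧.cover (p.proj u)
    exact (hp c hc u hu w hw hwu.symm).trans (hq c hc v hv w hw (huv.symm.trans hwu.symm)).symm

/-- A chart of an atlas, as a chart of the maximal atlas. -/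
def ComplexOrbifold.toMaximal (𝓧 : ComplexOrbifold n X) (c : 𝓧.charts) : 𝓧.maximal.charts :=
  ⟨c.1, 𝓧.compatible c.1 c.2⟩

/-- The restriction of a family of forms on the maximal atlas to the given atlas. -/
def ComplexOrbifold.ofMaximal {𝓧 : ComplexOrbifold n X} {k : ℕ} (α : 𝓧.maximal.Family k) :
    𝓧.Family k := fun c => α (𝓧.toMaximal c)

theorem ComplexOrbifold.ofMaximal_mem_forms {𝓧 : ComplexOrbifold n X} {k : ℕ}
    {α : 𝓧.maximal.Family k} (hα : α ∈ 𝓧.maximal.forms k) : ofMaximal α ∈ 𝓧.forms k :=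
  ⟨fun c => hα.1 (𝓧.toMaximal c), fun c d => hα.2 (𝓧.toMaximal c) (𝓧.toMaximal d)⟩

theorem ComplexOrbifold.ofMaximal_mem_closedForms {𝓧 : ComplexOrbifold n X} {k : ℕ}
    {α : 𝓧.maximal.Family k} (hα : α ∈ 𝓧.maximal.closedForms k) :
    ofMaximal α ∈ 𝓧.closedForms k :=
  ⟨ofMaximal_mem_forms hα.1, fun c => hα.2 (𝓧.toMaximal c)⟩

theorem ComplexOrbifold.exists_transition (𝓧 : ComplexOrbifold n X) (p : 𝓧.maximal.charts)
    {u : Cn n} (hu : u ∈ p.1.dom) : ∃ L : 𝓧.charts × OpenPartialHomeomorph (Cn n) (Cn n),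
      IsTransition p.1.dom p.1.proj L.1.1.dom L.1.1.proj L.2 ∧ u ∈ L.2.source := by
  obtain ⟨c, hc, w, hw, hwu⟩ := 𝓧.cover (p.1.proj u)
  obtain ⟨h, hh, hus, -⟩ := p.2 c hc u hu w hw hwu.symm
  exact ⟨(⟨c, hc⟩, h), hh, hus⟩

open scoped Classical in
/-- The extension of a natural family of forms to the maximal atlas. It is computed with an
arbitrarily chosen transition; `ComplexOrbifold.extend_eq` shows that the choice is irrelevant. -/
def ComplexOrbifold.extend {𝓧 : ComplexOrbifold n X} {k : ℕ} (α : 𝓧.Family k) :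
    𝓧.maximal.Family k := fun p u =>
  if hu : u ∈ p.1.dom then
    (α (𝓧.exists_transition p hu).choose.1
      ((𝓧.exists_transition p hu).choose.2 u)).compContinuousLinearMap
        (fderiv ℝ (𝓧.exists_transition p hu).choose.2 u)
  else 0

theorem ComplexOrbifold.extend_eq {𝓧 : ComplexOrbifold n X} {k : ℕ} {α : 𝓧.Family k}
    (hα : 𝓧.Natural α) {p : 𝓧.maximal.charts} {c : 𝓧.charts}
    {h : OpenPartialHomeomorph (Cn n) (Cn n)}
    (hh : IsTransition p.1.dom p.1.proj c.1.dom c.1.proj h) {u : Cn n} (hu : u ∈ h.source) :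
    extend α p u = (α c (h u)).compContinuousLinearMap (fderiv ℝ h u) := by
  have hup := hh.source_subset hu
  simp only [extend, dif_pos hup]
  set L := (𝓧.exists_transition p hup).choose with hL
  obtain ⟨hk, huk⟩ := (𝓧.exists_transition p hup).choose_spec
  rw [← hL] at hk huk
  have hki := L.2.left_inv huk
  have hsrc : L.2 u ∈ (L.2.symm.trans h).source := by
    rw [OpenPartialHomeomorph.trans_source]
    exact ⟨L.2.map_source huk, by simpa [hki] using hu⟩
  have hg : IsTransition L.1.1.dom L.1.1.proj c.1.dom c.1.proj (L.2.symm.trans h) :=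
    hk.symm.trans hh
  have h1 := hα L.1 c _ hg (L.2 u) hsrc
  have h2 : h =ᶠ[𝓝 u] L.2.trans (L.2.symm.trans h) := by
    filter_upwards [L.2.open_source.mem_nhds huk] with w hw
    simp [L.2.left_inv hw]
  rw [h1, h2.fderiv_eq, hk.fderiv_trans hg huk hsrc]
  simp only [OpenPartialHomeomorph.coe_trans, Function.comp_apply, hki]
  rfl

theorem ComplexOrbifold.extend_toMaximal {𝓧 : ComplexOrbifold n X} {k : ℕ} {α : 𝓧.Family k}
    (hα : 𝓧.Natural α) (c : 𝓧.charts) {u : Cn n} (hu : u ∈ c.1.dom) :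
    extend α (𝓧.toMaximal c) u = α c u := by
  rw [extend_eq hα (p := 𝓧.toMaximal c) (IsTransition.refl c.1.isOpen_dom) hu]
  have : fderiv ℝ (OpenPartialHomeomorph.ofSet c.1.dom c.1.isOpen_dom) u =
      ContinuousLinearMap.id ℝ (Cn n) := fderiv_id
  rw [this]
  rfl

theorem ComplexOrbifold.Natural.extend {𝓧 : ComplexOrbifold n X} {k : ℕ} {α : 𝓧.Family k}
    (hα : 𝓧.Natural α) : 𝓧.maximal.Natural (ComplexOrbifold.extend α) := by
  intro p q h hh w hw
  obtain ⟨⟨c, l⟩, hl, hwl⟩ := 𝓧.exists_transition q (hh.target_subset (h.map_source hw))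
  have hsrc : w ∈ (h.trans l).source := by
    rw [OpenPartialHomeomorph.trans_source]
    exact ⟨hw, hwl⟩
  rw [extend_eq hα hl hwl, extend_eq hα (hh.trans hl) hsrc, hh.fderiv_trans hl hw hwl]
  rfl

theorem ComplexOrbifold.extend_eventuallyEq {𝓧 : ComplexOrbifold n X} {k : ℕ} {α : 𝓧.Family k}
    (hα : 𝓧.Natural α) (p : 𝓧.maximal.charts) {u : Cn n} (hu : u ∈ p.1.dom) :
    ∃ (c : 𝓧.charts) (h : OpenPartialHomeomorph (Cn n) (Cn n)),
      IsTransition p.1.dom p.1.proj c.1.dom c.1.proj h ∧ u ∈ h.source ∧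
      extend α p =ᶠ[𝓝 u] fun w => (α c (h w)).compContinuousLinearMap (fderiv ℝ h w) := by
  obtain ⟨⟨c, h⟩, hh, hus⟩ := 𝓧.exists_transition p hu
  refine ⟨c, h, hh, hus, ?_⟩
  filter_upwards [h.open_source.mem_nhds hus] with w hw
  exact extend_eq hα hh hw

theorem ComplexOrbifold.extend_mem_forms {𝓧 : ComplexOrbifold n X} {k : ℕ} {α : 𝓧.Family k}
    (hα : α ∈ 𝓧.forms k) : extend α ∈ 𝓧.maximal.forms k := by
  refine ⟨fun p u hu => ?_, (forms.natural hα).extend⟩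
  obtain ⟨c, h, hh, hus, hev⟩ := extend_eventuallyEq (forms.natural hα) p hu
  refine ContDiffAt.contDiffWithinAt (ContDiffAt.congr_of_eventuallyEq ?_ hev)
  have hc := hh.contDiffAt hus
  exact contDiffAt_comp
    ((forms.contDiffAt hα c (hh.target_subset (h.map_source hus))).comp u hc)
    (hc.fderiv_right (m := ∞) (by simp))

theorem ComplexOrbifold.extend_mem_closedForms {𝓧 : ComplexOrbifold n X} {k : ℕ}
    {α : 𝓧.Family k} (hα : α ∈ 𝓧.closedForms k) : extend α ∈ 𝓧.maximal.closedForms k := by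
  refine ⟨extend_mem_forms hα.1, fun p u hu => ?_⟩
  obtain ⟨c, h, hh, hus, hev⟩ := extend_eventuallyEq (forms.natural hα.1) p hu
  have hhu := hh.target_subset (h.map_source hus)
  rw [hev.extDeriv_eq, extDeriv_pullback (r := ∞) (forms_differentiableAt hα.1 c hhu)
    (hh.contDiffAt hus) (by
      simp only [minSmoothness_of_isRCLikeNormedField]
      exact ENat.LEInfty.out), hα.2 c _ hhu]
  rfl

theorem ComplexOrbifold.integral_ofMaximal [T2Space X] [CompactSpace X] {𝓧 : ComplexOrbifold n X}
    {α : 𝓧.maximal.Family (2 * n)} (hα : α ∈ 𝓧.maximal.forms (2 * n)) :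
    𝓧.integral (ofMaximal α) = 𝓧.maximal.integral α := by
  obtain ⟨t, p, ρ, -, hρ, hρ1, hρs⟩ := 𝓧.exists_smooth_partition univ fun x => by
    obtain ⟨c, hc, hx⟩ := 𝓧.cover x
    exact ⟨⟨c, hc⟩, mem_univ _, hx⟩
  have h := ofMaximal_mem_forms hα
  rw [𝓧.integral_eq_partition p ρ (fun k => (hρ k).continuous) hρ1 hρs (forms.natural h)
      (fun c => (h.1 c).continuousOn),
    𝓧.maximal.integral_eq_partition (fun k => 𝓧.toMaximal (p k)) ρ
      (fun k => (hρ k).continuous) hρ1 hρs (forms.natural hα) (fun c => (hα.1 c).continuousOn)]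
  rfl

theorem ComplexOrbifold.integral_extend [T2Space X] [CompactSpace X] {𝓧 : ComplexOrbifold n X}
    {α : 𝓧.Family (2 * n)} (hα : α ∈ 𝓧.forms (2 * n)) :
    𝓧.maximal.integral (extend α) = 𝓧.integral α := by
  rw [← integral_ofMaximal (extend_mem_forms hα)]
  exact 𝓧.integral_congr fun c u hu => extend_toMaximal (forms.natural hα) c hu

/-- Local equivalences of a parametrization with the charts of an orbifold make it a chart, once its
fibres are the orbits of a finite linear group. -/
def ComplexOrbifold.mkChart (𝓧 : ComplexOrbifold n X) (dom : Set (Cn n)) (hdom : IsOpen dom)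
    (G : Subgroup (Cn n ≃ₗ[ℂ] Cn n)) (hG : Finite G) (hmap : ∀ γ ∈ G, ∀ u ∈ dom, γ u ∈ dom)
    (proj : Cn n → X)
    (hiff : ∀ u ∈ dom, ∀ v ∈ dom, proj u = proj v ↔ ∃ γ ∈ G, γ u = v)
    (hcompat : ∀ c ∈ 𝓧.charts, ∀ u ∈ dom, ∀ v ∈ c.dom, proj u = c.proj v →
      LocallyEquivalent dom proj c.dom c.proj u v) : 𝓧.maximal.charts :=
  ⟨{ dom := dom
     isOpen_dom := hdom
     group := G
     finite_group := hG
     map_dom := hmap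
     proj := proj
     continuousOn_proj := by
       intro u hu
       obtain ⟨c, hc, v, hv, hvu⟩ := 𝓧.cover (proj u)
       obtain ⟨h, hh, hus, -⟩ := hcompat c hc u hu v hv hvu.symm
       have h1 : ContinuousAt (fun w => c.proj (h w)) u :=
         ContinuousAt.comp (g := c.proj) (c.continuousOn_proj.continuousAt (c.isOpen_dom.mem_nhds
           (hh.target_subset (h.map_source hus)))) (h.continuousAt hus)
       refine (h1.congr ?_).continuousWithinAt
       filter_upwards [h.open_source.mem_nhds hus] with w hw
       exact hh.comm w hw
     isOpen_image := by
       intro W hW hWo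
       rw [isOpen_iff_mem_nhds]
       rintro _ ⟨u, hu, rfl⟩
       obtain ⟨c, hc, v, hv, hvu⟩ := 𝓧.cover (proj u)
       obtain ⟨h, hh, hus, -⟩ := hcompat c hc u (hW hu) v hv hvu.symm
       have h1 : IsOpen (h '' (h.source ∩ W)) :=
         h.isOpen_image_of_subset_source (h.open_source.inter hWo) inter_subset_left
       have h2 : IsOpen (c.proj '' (h '' (h.source ∩ W))) := by
         refine c.isOpen_image _ ?_ h1
         rintro _ ⟨w, hw, rfl⟩
         exact hh.target_subset (h.map_source hw.1)
       refine Filter.mem_of_superset (h2.mem_nhds ⟨h u, ⟨u, ⟨hus, hu⟩, rfl⟩, hh.comm u hus⟩) ?_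
       rintro _ ⟨_, ⟨w, ⟨hw, hwW⟩, rfl⟩, rfl⟩
       exact ⟨w, hwW, (hh.comm w hw).symm⟩
     proj_eq_iff := hiff }, hcompat⟩

/-- The restriction of a chart to an open subset of the orbifold. -/
def ComplexOrbifold.restrictChart (𝓧 : ComplexOrbifold n X) (p : 𝓧.maximal.charts) (O : Set X)
    (hO : IsOpen O) : 𝓧.maximal.charts :=
  𝓧.mkChart (p.1.dom ∩ p.1.proj ⁻¹' O) (p.1.continuousOn_proj.isOpen_inter_preimage p.1.isOpen_dom hO)
    p.1.group p.1.finite_group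
    (fun γ hγ u hu => ⟨p.1.map_dom γ hγ u hu.1, by
      rw [mem_preimage, p.1.proj_act hγ hu.1]
      exact hu.2⟩) p.1.proj (fun u hu v hv => p.1.proj_eq_iff u hu.1 v hv.1)
    (fun c hc u hu v hv huv => (p.2 c hc u hu.1 v hv huv).restr
      (p.1.continuousOn_proj.isOpen_inter_preimage p.1.isOpen_dom hO) c.isOpen_dom hu hv)

theorem ComplexOrbifold.image_restrictChart (𝓧 : ComplexOrbifold n X) (p : 𝓧.maximal.charts)
    {O : Set X} (hO : IsOpen O) : (𝓧.restrictChart p O hO).1.image = p.1.image ∩ O := by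
  ext x
  constructor
  · rintro ⟨u, hu, rfl⟩
    exact ⟨⟨u, hu.1, rfl⟩, hu.2⟩
  · rintro ⟨⟨u, hu, rfl⟩, hx⟩
    exact ⟨u, ⟨hu, hx⟩, rfl⟩

/-- Thinness needs to be checked only in enough charts to cover the orbifold. -/
theorem ComplexOrbifold.thin_of_cover (𝓧 : ComplexOrbifold n X) {B : Set X}
    (hB : ∀ x ∈ B, ∃ c : 𝓧.charts, x ∈ c.1.image ∧
      volume {u | u ∈ c.1.dom ∧ c.1.proj u ∈ B} = 0) : 𝓧.Thin B := by
  intro d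
  refine measure_null_of_locally_null _ fun u hu => ?_
  obtain ⟨c, ⟨v, hv, hvu⟩, hc⟩ := hB _ hu.2
  obtain ⟨h, hh, hus, -⟩ := 𝓧.compatible d.1 d.2 c.1 c.2 u hu.1 v hv hvu.symm
  refine ⟨_, Filter.inter_mem self_mem_nhdsWithin (mem_nhdsWithin_of_mem_nhds
    (h.open_source.mem_nhds hus)), ?_⟩
  have h1 : {u | u ∈ d.1.dom ∧ d.1.proj u ∈ B} ∩ h.source ⊆
      h.symm '' (h.target ∩ {u | u ∈ c.1.dom ∧ c.1.proj u ∈ B}) := by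
    rintro w ⟨⟨hw, hwB⟩, hws⟩
    refine ⟨h w, ⟨h.map_source hws, hh.target_subset (h.map_source hws), ?_⟩, h.left_inv hws⟩
    rw [hh.comm w hws]
    exact hwB
  refine measure_mono_null h1 (addHaar_image_eq_zero_of_differentiableOn_of_addHaar_eq_zero _ ?_
    (measure_mono_null inter_subset_right hc))
  intro w hw
  exact ((hh.symm.contDiffAt hw.1).differentiableAt (by simp)).differentiableWithinAt

end Maximal

/-! ### Restriction to suborbifolds -/

section Restriction

variable {n m : ℕ} {X : Type*} [TopologicalSpace X]

/-- The elements of the group of a chart are transitions from the chart to itself. -/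
theorem OrbifoldChart.isTransition_act (c : OrbifoldChart n X) {γ : Cn n ≃ₗ[ℂ] Cn n}
    (hγ : γ ∈ c.group) {u : Cn n} (hu : u ∈ c.dom) :
    ∃ h, IsTransition c.dom c.proj c.dom c.proj h ∧ u ∈ h.source ∧ ⇑h = γ := by
  let h := γ.toContinuousLinearEquiv.toHomeomorph.toOpenPartialHomeomorph
  have hh : IsTransition {w | w ∈ c.dom} c.proj {w | w ∈ c.dom} c.proj
      (h.restrOpen c.dom c.isOpen_dom) := by
    have hs : (h.restrOpen c.dom c.isOpen_dom).source = c.dom := by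
      rw [OpenPartialHomeomorph.restrOpen_source]
      exact univ_inter _
    refine ⟨hs.subset, ?_, ?_, ?_, ?_⟩
    · intro y hy
      have h1 := (h.restrOpen c.dom c.isOpen_dom).map_target hy
      rw [hs] at h1
      rw [← (h.restrOpen c.dom c.isOpen_dom).right_inv hy]
      exact c.map_dom γ hγ _ h1
    · exact γ.toContinuousLinearEquiv.contDiff.contDiffOn
    · exact γ.toContinuousLinearEquiv.symm.contDiff.contDiffOn
    · intro w hw
      rw [hs] at hw
      exact c.proj_act hγ hw
  refine ⟨_, hh, ?_, rfl⟩
  rw [OpenPartialHomeomorph.restrOpen_source]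
  exact ⟨mem_univ _, hu⟩

/-- The pullback of an orbifold form along a smooth lift of a map does not depend on the lift. Two
lifts to the same chart differ by group elements, each of which works on a closed set; the union of
the interiors of these sets is dense. -/
theorem ComplexOrbifold.pullback_lift_eq {𝓧 : ComplexOrbifold n X} {k : ℕ} {β : 𝓧.Family k}
    (hβ : β ∈ 𝓧.forms k) {c d : 𝓧.charts} {ℓ ℓ' : Cn m → Cn n} {u : Cn m}
    (hℓ : ContDiffAt ℝ ω ℓ u) (hℓ' : ContDiffAt ℝ ω ℓ' u) (hc : ℓ u ∈ c.1.dom)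
    (hd : ℓ' u ∈ d.1.dom) (heq : ∀ᶠ w in 𝓝 u, c.1.proj (ℓ w) = d.1.proj (ℓ' w)) :
    (β c (ℓ u)).compContinuousLinearMap (fderiv ℝ ℓ u) =
      (β d (ℓ' u)).compContinuousLinearMap (fderiv ℝ ℓ' u) := by
  -- First suppose that both lifts go to the same chart. If the two pullbacks differ at `u`, they
  -- differ on a neighborhood `O` of `u`.
  have hsame : ∀ ℓ : Cn m → Cn n, ContDiffAt ℝ ω ℓ u → ℓ u ∈ d.1.dom →
      (∀ᶠ w in 𝓝 u, d.1.proj (ℓ w) = d.1.proj (ℓ' w)) →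
      (β d (ℓ u)).compContinuousLinearMap (fderiv ℝ ℓ u) =
        (β d (ℓ' u)).compContinuousLinearMap (fderiv ℝ ℓ' u) := by
    intro ℓ hℓ hdu heq
    have hcont : ∀ ℓ : Cn m → Cn n, ContDiffAt ℝ ω ℓ u → ℓ u ∈ d.1.dom →
        ContinuousAt (fun w => (β d (ℓ w)).compContinuousLinearMap (fderiv ℝ ℓ w)) u := by
      intro ℓ hℓ hdu
      exact (contDiffAt_comp ((forms.contDiffAt hβ d hdu).comp u (hℓ.of_le le_top))
        (hℓ.fderiv_right (m := ∞) (by exact le_top))).continuousAt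
    by_contra hne
    have h1 := (hcont ℓ hℓ hdu).ne_iff_eventually_ne (hcont ℓ' hℓ' hd) |>.1 hne
    have h2 : ∀ᶠ w in 𝓝 u, ContDiffAt ℝ ω ℓ w := hℓ.eventually (by simp)
    have h3 : ∀ᶠ w in 𝓝 u, ContDiffAt ℝ ω ℓ' w := hℓ'.eventually (by simp)
    obtain ⟨O, hO, hOo, huO⟩ := eventually_nhds_iff.1 (h1.and (h2.and (h3.and (heq.and
      ((hℓ.continuousAt.eventually (d.1.isOpen_dom.mem_nhds hdu)).and
      (hℓ'.continuousAt.eventually (d.1.isOpen_dom.mem_nhds hd)))))))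
    let F : d.1.group → Set (Cn m) := fun γ => {w | w ∈ O ∧ γ.1 (ℓ w) = ℓ' w}
    have hcov : ⋃ γ, (closure (F γ) ∪ Oᶜ) = univ := by
      refine eq_univ_of_forall fun w => ?_
      rw [mem_iUnion]
      by_cases hw : w ∈ O
      · obtain ⟨-, -, -, h4, h5, h6⟩ := hO w hw
        obtain ⟨γ, hγ, hγw⟩ := (d.1.proj_eq_iff _ h5 _ h6).1 h4
        exact ⟨⟨γ, hγ⟩, Or.inl (subset_closure ⟨hw, hγw⟩)⟩
      · exact ⟨1, Or.inr hw⟩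
    -- By the Baire property there is a point of `O` near which a single group element `γ` carries
    -- one lift to the other.
    have hdense := dense_iUnion_interior_of_closed
      (fun γ => isClosed_closure.union hOo.isClosed_compl) hcov
    obtain ⟨w, hwO, hw⟩ := hdense.exists_mem_open hOo ⟨u, huO⟩ |>.imp fun w h => h.symm
    obtain ⟨γ, hγ⟩ := mem_iUnion.1 hw
    have hcl : ∀ y ∈ O, y ∈ closure (F γ) → γ.1 (ℓ y) = ℓ' y := by
      intro y hy hyc
      obtain ⟨-, h2, h3, -⟩ := hO y hy
      have e1 : ContinuousAt (fun y => γ.1 (ℓ y)) y :=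
        (OrbifoldChart.continuous_act γ.1).continuousAt.comp h2.continuousAt
      by_contra hne'
      have e2 := e1.ne_iff_eventually_ne h3.continuousAt |>.1 hne'
      obtain ⟨z, hz, hzF⟩ := mem_closure_iff_nhds.1 hyc _ e2
      exact hz hzF.2
    have hev : ∀ᶠ y in 𝓝 w, γ.1 (ℓ y) = ℓ' y := by
      filter_upwards [isOpen_interior.mem_nhds hγ, hOo.mem_nhds hwO] with y hy hyO
      rcases interior_subset hy with h | h
      · exact hcl y hyO h
      · exact absurd hyO h
    obtain ⟨hnew, h2, h3, -, h5, -⟩ := hO w hwO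
    obtain ⟨h, hh, hs, hγh⟩ := d.1.isTransition_act γ.2 h5
    refine hnew ?_
    have e3 : ℓ' =ᶠ[𝓝 w] h ∘ ℓ := by
      filter_upwards [hev] with y hy
      simp [hγh, hy]
    rw [forms.natural hβ d d h hh _ hs, e3.eq_of_nhds, e3.fderiv_eq,
      fderiv_comp w ((hh.contDiffAt hs).differentiableAt (by simp)) (h2.differentiableAt (by simp))]
    rfl
  -- In general one lift is moved to the chart of the other by a transition.
  obtain ⟨h, hh, hs, -⟩ := 𝓧.compatible _ c.2 _ d.2 _ hc _ hd heq.self_of_nhds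
  have hhω : ContDiffAt ℝ ω h (ℓ u) :=
    (hh.holomorphic.contDiffAt (h.open_source.mem_nhds hs)).restrict_scalars ℝ
  rw [← hsame (h ∘ ℓ) (hhω.comp u hℓ) (hh.target_subset (h.map_source hs)), forms.natural hβ c d h hh _ hs,
    fderiv_comp u (hhω.differentiableAt (by simp)) (hℓ.differentiableAt (by simp))]
  · rfl
  · filter_upwards [heq, hℓ.continuousAt.eventually (h.open_source.mem_nhds hs)] with w hw hw'
    rw [Function.comp_apply, hh.comm _ hw', hw]

/-- The restriction may be computed with any smooth lift of the inclusion. -/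
theorem Suborbifold.restrict_eq {𝓧 : ComplexOrbifold n X} {E : Set X} (S : Suborbifold 𝓧 E m)
    {k : ℕ} {β : 𝓧.Family k} (hβ : β ∈ 𝓧.forms k) (c : S.orb.charts) {u : Cn m}
    (hu : u ∈ c.1.dom) {d : 𝓧.charts} {ℓ : Cn m → Cn n} (hℓ : ContDiffAt ℝ ω ℓ u)
    (hd : ℓ u ∈ d.1.dom) (heq : ∀ᶠ w in 𝓝 u, d.1.proj (ℓ w) = c.1.proj w) :
    S.restrict β c u = (β d (ℓ u)).compContinuousLinearMap (fderiv ℝ ℓ u) := by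
  obtain ⟨h1, -, h2, h3⟩ := (S.immersion c u hu).choose_spec
  simp only [Suborbifold.restrict, dif_pos hu]
  refine ComplexOrbifold.pullback_lift_eq hβ (h1.contDiffAt.restrict_scalars ℝ) hℓ h2 hd ?_
  filter_upwards [heq, h3] with w hw hw'
  rw [hw, hw']

theorem Suborbifold.restrict_eventuallyEq {𝓧 : ComplexOrbifold n X} {E : Set X}
    (S : Suborbifold 𝓧 E m) {k : ℕ} {β : 𝓧.Family k} (hβ : β ∈ 𝓧.forms k) (c : S.orb.charts)
    {u : Cn m} (hu : u ∈ c.1.dom) {d : 𝓧.charts} {ℓ : Cn m → Cn n} (hℓ : ContDiffAt ℝ ω ℓ u)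
    (hd : ℓ u ∈ d.1.dom) (heq : ∀ᶠ w in 𝓝 u, d.1.proj (ℓ w) = c.1.proj w) :
    S.restrict β c =ᶠ[𝓝 u] fun w => (β d (ℓ w)).compContinuousLinearMap (fderiv ℝ ℓ w) := by
  filter_upwards [hℓ.eventually (by simp), eventually_eventually_nhds.2 heq,
    hℓ.continuousAt.eventually (d.1.isOpen_dom.mem_nhds hd), c.1.isOpen_dom.mem_nhds hu]
    with w h1 h2 h3 h4
  exact S.restrict_eq hβ c h4 h1 h3 h2

theorem Suborbifold.restrict_mem_forms {𝓧 : ComplexOrbifold n X} {E : Set X}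
    (S : Suborbifold 𝓧 E m) {k : ℕ} {β : 𝓧.Family k} (hβ : β ∈ 𝓧.forms k) :
    S.restrict β ∈ S.orb.forms k := by
  refine ⟨fun c u hu => ?_, fun c d h hh w hw => ?_⟩
  · obtain ⟨⟨d, ℓ⟩, h1, -, h2, h3⟩ := S.immersion c u hu
    have h4 : ContDiffAt ℝ ω ℓ u := h1.contDiffAt.restrict_scalars ℝ
    refine ContDiffAt.contDiffWithinAt (ContDiffAt.congr_of_eventuallyEq ?_
      (S.restrict_eventuallyEq hβ c hu h4 h2 h3))
    exact contDiffAt_comp ((ComplexOrbifold.forms.contDiffAt hβ d h2).comp u (h4.of_le le_top))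
      (h4.fderiv_right (m := ∞) (by exact le_top))
  · have hhw := hh.target_subset (h.map_source hw)
    obtain ⟨⟨e, ℓ⟩, h1, -, h2, h3⟩ := S.immersion d (h w) hhw
    have h4 : ContDiffAt ℝ ω ℓ (h w) := h1.contDiffAt.restrict_scalars ℝ
    have h5 : ContDiffAt ℝ ω h w :=
      (hh.holomorphic.contDiffAt (h.open_source.mem_nhds hw)).restrict_scalars ℝ
    rw [S.restrict_eq hβ d hhw h4 h2 h3, S.restrict_eq hβ c (hh.source_subset hw) (ℓ := ℓ ∘ h)
      (h4.comp w h5) h2 ?_, fderiv_comp w (h4.differentiableAt (by simp))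
      (h5.differentiableAt (by simp))]
    · rfl
    · filter_upwards [(h.continuousAt hw).eventually h3, h.open_source.mem_nhds hw] with y hy hy'
      rw [Function.comp_apply, hy, hh.comm y hy']

/-- A suborbifold, with respect to the maximal atlases. -/
def Suborbifold.maximal {𝓧 : ComplexOrbifold n X} {E : Set X} (S : Suborbifold 𝓧 E m) :
    Suborbifold 𝓧.maximal E m where
  orb := S.orb.maximal
  immersion c u hu := by
    obtain ⟨⟨d, h⟩, hh, hus⟩ := S.orb.exists_transition c hu
    obtain ⟨⟨e, ℓ⟩, h1, h2, h3, h4⟩ := S.immersion d (h u) (hh.target_subset (h.map_source hus))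
    have hd : DifferentiableAt ℂ h u := hh.differentiableAt hus
    refine ⟨(𝓧.toMaximal e, ℓ ∘ h), ?_, ?_, h3, ?_⟩
    · exact h1.comp (hh.holomorphic.contDiffAt (h.open_source.mem_nhds hus)).analyticAt
    · change Function.Injective (fderiv ℂ (ℓ ∘ h) u)
      rw [fderiv_comp u h1.differentiableAt hd]
      refine h2.comp ?_
      have hd' : DifferentiableAt ℂ h.symm (h u) := hh.symm.differentiableAt (h.map_source hus)
      have h5 : (fderiv ℂ h.symm (h u)).comp (fderiv ℂ h u) = ContinuousLinearMap.id ℂ (Cn m) := by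
        rw [← fderiv_comp u hd' hd]
        have : h.symm ∘ h =ᶠ[𝓝 u] id := by
          filter_upwards [h.open_source.mem_nhds hus] with w hw
          exact h.left_inv hw
        rw [this.fderiv_eq, fderiv_id]
      exact Function.LeftInverse.injective (g := fderiv ℂ h.symm (h u)) fun v =>
        congrArg (fun L => L v) h5
    · filter_upwards [(h.continuousAt hus).eventually h4, h.open_source.mem_nhds hus] with w hw hw'
      change e.1.proj (ℓ (h w)) = _
      rw [hw, hh.comm w hw']

theorem Suborbifold.integral_restrict_maximal [T2Space X] [CompactSpace X]
    {𝓧 : ComplexOrbifold n X} {E : Set X} (hE : IsClosed E) (S : Suborbifold 𝓧 E m)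
    {β : 𝓧.Family (2 * m)} (hβ : β ∈ 𝓧.forms (2 * m)) :
    S.orb.integral (S.restrict β) =
      S.orb.maximal.integral (S.maximal.restrict (ComplexOrbifold.extend β)) := by
  have : CompactSpace E := isCompact_iff_compactSpace.1 hE.isCompact
  have h1 := S.maximal.restrict_mem_forms (ComplexOrbifold.extend_mem_forms hβ)
  rw [← ComplexOrbifold.integral_ofMaximal (𝓧 := S.orb) h1]
  refine S.orb.integral_congr fun c u hu => ?_
  obtain ⟨⟨d, ℓ⟩, h2, -, h3, h4⟩ := S.immersion c u hu
  have h5 : ContDiffAt ℝ ω ℓ u := h2.contDiffAt.restrict_scalars ℝ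
  rw [S.restrict_eq hβ c hu h5 h3 h4]
  change _ = S.maximal.restrict (ComplexOrbifold.extend β) (S.orb.toMaximal c) u
  rw [S.maximal.restrict_eq (ComplexOrbifold.extend_mem_forms hβ) (S.orb.toMaximal c)
    (d := 𝓧.toMaximal d) hu h5 h3 h4,
    ComplexOrbifold.extend_toMaximal (ComplexOrbifold.forms.natural hβ) d h3]

end Restriction

/-! ### Stokes' theorem on compact orbifolds -/

section Stokes

variable {n : ℕ} {X : Type*} [TopologicalSpace X]

theorem extDeriv_zero {k : ℕ} (u : Cn n) : extDeriv (fun _ : Cn n => (0 : Alt n k)) u = 0 := by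
  have := extDeriv_smul (0 : ℝ) (0 : Cn n → Alt n k) (x := u)
  rw [zero_smul, zero_smul] at this
  exact this

theorem extDeriv_sum {k : ℕ} {ι : Type*} (s : Finset ι) {f : ι → Cn n → Alt n k} {u : Cn n}
    (hf : ∀ i ∈ s, DifferentiableAt ℝ (f i) u) :
    extDeriv (fun w => ∑ i ∈ s, f i w) u = ∑ i ∈ s, extDeriv (f i) u := by
  unfold extDeriv
  rw [fderiv_fun_sum hf]
  exact map_sum (ContinuousAlternatingMap.alternatizeUncurryFinCLM ℝ (Cn n) ℝ) _ s

/-- Stokes' theorem in a chart, for a form supported over a compact subset of the image. -/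
theorem OrbifoldChart.integral_extDeriv [T2Space X] (c : OrbifoldChart (n + 1) X) {K : Set X}
    (hK : IsCompact K) (hKc : K ⊆ c.image) {α : Cn (n + 1) → Alt (n + 1) (2 * n + 1)}
    (hα : ContDiffOn ℝ ∞ α c.dom) (hα0 : ∀ u ∈ c.dom, c.proj u ∉ K → α u = 0) :
    IntegrableOn (fun u => extDeriv α u (frame (n + 1))) c.dom ∧
      ∫ u in c.dom, extDeriv α u (frame (n + 1)) = 0 := by
  have hC := c.isCompact_preimage hK hKc
  have h0 : ∀ u ∈ c.dom, u ∉ {u | u ∈ c.dom ∧ c.proj u ∈ K} → α u = 0 := fun u hu hu' =>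
    hα0 u hu fun h => hu' ⟨hu, h⟩
  have h1 : ContDiff ℝ ∞ (c.dom.indicator α) :=
    contDiff_indicator c.isOpen_dom hC.isClosed (fun u hu => hu.1) hα h0
  have h2 : HasCompactSupport (c.dom.indicator α) := hasCompactSupport_indicator hC h0
  obtain ⟨h3, h4⟩ := integral_extDeriv_eq_zero (h1.of_le (by simp)) h2
  have h5 : ∀ u ∈ c.dom, extDeriv α u = extDeriv (c.dom.indicator α) u := fun u hu => by
    refine Filter.EventuallyEq.extDeriv_eq ?_
    filter_upwards [c.isOpen_dom.mem_nhds hu] with w hw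
    rw [indicator_of_mem hw]
  have h6 : ∀ u ∉ c.dom, extDeriv (c.dom.indicator α) u (frame (n + 1)) = 0 := fun u hu => by
    have : c.dom.indicator α =ᶠ[𝓝 u] fun _ => 0 := by
      filter_upwards [hC.isClosed.isOpen_compl.mem_nhds fun h => hu h.1] with w hw
      by_cases hwc : w ∈ c.dom
      · rw [indicator_of_mem hwc, h0 w hwc hw]
      · exact indicator_of_notMem hwc _
    rw [this.extDeriv_eq, extDeriv_zero]
    rfl
  refine ⟨h3.integrableOn.congr_fun (fun u hu => by simp only [h5 u hu]) c.isOpen_dom.measurableSet, ?_⟩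
  rw [setIntegral_congr_fun (g := fun u => extDeriv (c.dom.indicator α) u (frame (n + 1)))
    c.isOpen_dom.measurableSet (fun u hu => by simp only [h5 u hu]),
    setIntegral_eq_integral_of_forall_compl_eq_zero h6, h4]

/-- Stokes' theorem. -/
theorem ComplexOrbifold.integral_extDeriv [T2Space X] [CompactSpace X]
    (𝓧 : ComplexOrbifold (n + 1) X) {α : 𝓧.Family (2 * n + 1)} (hα : α ∈ 𝓧.forms (2 * n + 1)) :
    𝓧.integral (fun c u => extDeriv (α c) u) = 0 := by
  obtain ⟨t, p, ρ, -, hρ, hρ1, hρs⟩ := 𝓧.exists_smooth_partition univ fun x => by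
    obtain ⟨c, hc, hx⟩ := 𝓧.cover x
    exact ⟨⟨c, hc⟩, mem_univ _, hx⟩
  have hρα : ∀ k, fmul (ρ k) α ∈ 𝓧.forms (2 * n + 1) := fun k => fmul_mem_forms (hρ k) hα
  have hchart := fun k => (p k).1.integral_extDeriv (isClosed_tsupport (ρ k)).isCompact (hρs k)
    ((hρα k).1 (p k)) (fun u _ hu => by simp [fmul, image_eq_zero_of_notMem_tsupport hu])
  refine (𝓧.integral_eq_sum isClosed_empty 𝓧.thin_empty p _
    (fun k c u => extDeriv (fmul (ρ k) α c) u)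
    (fun k => forms.natural (extDeriv_mem_forms (hρα k)))
    (fun k c => ((extDeriv_mem_forms (hρα k)).1 c).continuousOn.mono sdiff_subset) ?_
    (fun k => (hchart k).1) ?_).trans ?_
  · intro k c u hu _ hne
    refine hρs k ?_
    by_contra h
    refine hne ?_
    have h1 := c.1.continuousOn_proj.continuousAt (c.1.isOpen_dom.mem_nhds hu)
    have h2 : fmul (ρ k) α c =ᶠ[𝓝 u] fun _ => 0 := by
      filter_upwards [h1.eventually ((isClosed_tsupport (ρ k)).isOpen_compl.mem_nhds h)] with w hw
      simp [fmul, image_eq_zero_of_notMem_tsupport hw]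
    rw [h2.extDeriv_eq, extDeriv_zero]
  · intro c u hu _
    have h1 : α c =ᶠ[𝓝 u] fun w => ∑ k, fmul (ρ k) α c w := by
      filter_upwards with w
      simp only [fmul, ← Finset.sum_smul, hρ1, one_smul]
    rw [h1.extDeriv_eq, extDeriv_sum _ fun k _ => forms_differentiableAt (hρα k) c hu]
  · refine Finset.sum_eq_zero fun k _ => ?_
    rw [(hchart k).2, mul_zero]

end Stokes

/-! ### Forms dual to a divisor -/

section Residue

variable {n : ℕ} {X : Type*} [TopologicalSpace X]

theorem volume_hyperplane (n : ℕ) (j : Fin n) : volume {u : Cn n | u j = 0} = 0 := by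
  have hV : (LinearMap.ker (LinearMap.proj (R := ℝ) (φ := fun _ : Fin n => ℂ) j)) ≠ ⊤ := by
    intro h
    have : (Pi.single j 1 : Cn n) ∈ LinearMap.ker (LinearMap.proj (R := ℝ) (φ := fun _ => ℂ) j) :=
      h ▸ Submodule.mem_top
    simp at this
  refine measure_mono_null (fun u hu => ?_) (Measure.addHaar_submodule volume _ hV)
  simpa using hu

/-- The residue formula in a chart in which the divisor is the hyperplane `u₀ = 0`. -/
theorem OrbifoldChart.integral_extDeriv_residue [T2Space X] (c : OrbifoldChart (n + 1) X)
    {K : Set X} (hK : IsCompact K) (hKc : K ⊆ c.image)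
    {α : Cn (n + 1) → Alt (n + 1) (2 * n)} (hα : ContDiffOn ℝ ∞ α c.dom)
    (hα0 : ∀ u ∈ c.dom, c.proj u ∉ K → α u = 0) {ξ σ : Cn (n + 1) → Alt (n + 1) 1}
    (hσ : ContDiffOn ℝ ∞ σ c.dom)
    (hξ : ∀ u ∈ c.dom, u 0 ≠ 0 → ξ u = -(2 * Real.pi)⁻¹ • angForm n u + σ u)
    {g : Cn (n + 1) → ℝ} (hg : ∀ u ∈ c.dom, u 0 ≠ 0 →
      g u = extDeriv (fun w => wedge (α w) (ξ w)) u (frame (n + 1))) :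
    IntegrableOn g c.dom ∧ ∫ u in c.dom, g u =
      ∫ y in {y : Cn n | (Fin.cons 0 y : Cn (n + 1)) ∈ c.dom},
        α (Fin.cons 0 y) fun i => Fin.cons 0 (frame n i) := by
  have hC := c.isCompact_preimage hK hKc
  have h0 : ∀ u ∈ c.dom, u ∉ {u | u ∈ c.dom ∧ c.proj u ∈ K} → α u = 0 := fun u hu hu' =>
    hα0 u hu fun h => hu' ⟨hu, h⟩
  have hA : ContDiff ℝ ∞ (c.dom.indicator α) :=
    contDiff_indicator c.isOpen_dom hC.isClosed (fun u hu => hu.1) hα h0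
  have hAc : HasCompactSupport (c.dom.indicator α) := hasCompactSupport_indicator hC h0
  obtain ⟨r1, r2⟩ := integral_extDeriv_wedge_angForm hA hAc
  obtain ⟨s1, s2⟩ := c.integral_extDeriv hK hKc (α := fun u => wedge (α u) (σ u))
    (fun u hu => (contDiffAt_wedge (hα.contDiffAt (c.isOpen_dom.mem_nhds hu))
      (hσ.contDiffAt (c.isOpen_dom.mem_nhds hu))).contDiffWithinAt)
    (fun u hu hu' => by rw [hα0 u hu hu', wedge_zero_left])
  -- The singular part of `ξ` contributes the residue, and its smooth part `σ` an exact form.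
  set R : Cn (n + 1) → ℝ := fun u =>
    extDeriv (fun w => wedge (c.dom.indicator α w) (angForm n w)) u (frame (n + 1)) with hR
  have hae : ∀ᵐ u : Cn (n + 1), u 0 ≠ 0 := by
    rw [ae_iff]
    simpa using volume_hyperplane (n + 1) 0
  have hgR : g =ᵐ[volume.restrict c.dom] fun u => -(2 * Real.pi)⁻¹ * R u +
      extDeriv (fun w => wedge (α w) (σ w)) u (frame (n + 1)) := by
    filter_upwards [ae_restrict_of_ae hae, ae_restrict_mem c.isOpen_dom.measurableSet] with u hu0 hu
    have e1 : (fun w => wedge (α w) (ξ w)) =ᶠ[𝓝 u] ((-(2 * Real.pi)⁻¹) •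
        fun w => wedge (c.dom.indicator α w) (angForm n w)) + fun w => wedge (α w) (σ w) := by
      have h1 : ∀ᶠ w : Cn (n + 1) in 𝓝 u, w 0 ≠ 0 :=
        (continuous_apply 0).continuousAt.eventually_ne hu0
      filter_upwards [h1, c.isOpen_dom.mem_nhds hu] with w hw hwc
      simp only [Pi.add_apply, Pi.smul_apply]
      rw [hξ w hwc hw, indicator_of_mem hwc, wedge_add_right, wedge_smul_right]
    have d1 : DifferentiableAt ℝ (fun w => wedge (c.dom.indicator α w) (angForm n w)) u :=
      (contDiffAt_wedge hA.contDiffAt (contDiffAt_angForm hu0)).differentiableAt (by simp)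
    have d2 : DifferentiableAt ℝ (fun w => wedge (α w) (σ w)) u :=
      (contDiffAt_wedge (hα.contDiffAt (c.isOpen_dom.mem_nhds hu))
        (hσ.contDiffAt (c.isOpen_dom.mem_nhds hu))).differentiableAt (by simp)
    rw [hg u hu hu0, e1.extDeriv_eq, extDeriv_add (d1.const_smul _) d2, extDeriv_smul]
    rfl
  have hR0 : ∀ u ∉ c.dom, R u = 0 := fun u hu => by
    have : (fun w => wedge (c.dom.indicator α w) (angForm n w)) =ᶠ[𝓝 u] fun _ => 0 := by
      filter_upwards [hC.isClosed.isOpen_compl.mem_nhds fun h => hu h.1] with w hw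
      by_cases hwc : w ∈ c.dom
      · rw [indicator_of_mem hwc, h0 w hwc hw, wedge_zero_left]
      · rw [indicator_of_notMem hwc, wedge_zero_left]
    rw [hR]
    simp only
    rw [this.extDeriv_eq, extDeriv_zero]
    rfl
  have hi : IntegrableOn (fun u => -(2 * Real.pi)⁻¹ * R u) c.dom := (r1.const_mul _).integrableOn
  refine ⟨(hi.add s1).congr hgR.symm, ?_⟩
  rw [integral_congr_ae hgR, integral_add hi s1, s2, add_zero, integral_const_mul,
    setIntegral_eq_integral_of_forall_compl_eq_zero hR0, r2, ← mul_assoc]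
  have hpi : -(2 * Real.pi)⁻¹ * -(2 * Real.pi) = 1 := by
    have := Real.pi_pos.ne'
    field_simp
  rw [hpi, one_mul]
  have hD : MeasurableSet {y : Cn n | (Fin.cons 0 y : Cn (n + 1)) ∈ c.dom} :=
    (c.isOpen_dom.preimage (tailIncl n).continuous).measurableSet
  rw [← setIntegral_eq_integral_of_forall_compl_eq_zero
    (s := {y : Cn n | (Fin.cons 0 y : Cn (n + 1)) ∈ c.dom})]
  · refine setIntegral_congr_fun hD fun y hy => ?_
    have hy' : (Fin.cons 0 y : Cn (n + 1)) ∈ c.dom := hy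
    simp only [indicator_of_mem hy']
  · intro y hy
    have hy' : (Fin.cons 0 y : Cn (n + 1)) ∉ c.dom := hy
    rw [indicator_of_notMem hy']
    rfl

theorem sum_eq_sum_subtype {ι M : Type*} [Fintype ι] [AddCommMonoid M] (p : ι → Prop)
    [DecidablePred p] (f : ι → M) (hf : ∀ k, ¬ p k → f k = 0) :
    ∑ k, f k = ∑ k : {k // p k}, f k := by
  rw [← Finset.sum_subtype (Finset.univ.filter p) (by simp) f, Finset.sum_filter_of_ne]
  intro k _ hk
  by_contra h
  exact hk (hf k h)

/-- Let `ξ` be a one-form off a divisor `E` which in suitable charts has the form `- dθ / 2π` plus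
a smooth form, where `θ` is the argument of the coordinate defining `E`. Then a two-form `τ`
extending `dξ` is Poincaré dual to `E`. -/
theorem Suborbifold.integral_wedge_eq [T2Space X] [CompactSpace X] {𝓧 : ComplexOrbifold (n + 1) X}
    {E : Set X} (hE : IsClosed E) (S : Suborbifold 𝓧 E n) {ξ : 𝓧.maximal.Family 1}
    (hξ : 𝓧.maximal.Natural ξ)
    (hξs : ∀ c, ∀ u ∈ c.1.dom, c.1.proj u ∉ E → ContDiffAt ℝ ∞ (ξ c) u)
    {τ : 𝓧.maximal.Family 2}
    (hτ : ∀ c, ∀ u ∈ c.1.dom, c.1.proj u ∉ E → τ c u = extDeriv (ξ c) u)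
    {J : Type*} (P : J → 𝓧.maximal.charts) (Q : J → S.orb.maximal.charts)
    (hPE : ∀ j, ∀ u ∈ (P j).1.dom, (P j).1.proj u ∈ E ↔ u 0 = 0)
    (hcov : ∀ x ∈ E, ∃ j, x ∈ (P j).1.image)
    (hQd : ∀ j, (Q j).1.dom = {y | (Fin.cons 0 y : Cn (n + 1)) ∈ (P j).1.dom})
    (hQ : ∀ j, ∀ y ∈ (Q j).1.dom, ((Q j).1.proj y : X) = (P j).1.proj (Fin.cons 0 y))
    (hcard : ∀ j, Nat.card (Q j).1.group = Nat.card (P j).1.group)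
    (σ : J → Cn (n + 1) → Alt (n + 1) 1) (hσ : ∀ j, ContDiffOn ℝ ∞ (σ j) (P j).1.dom)
    (hξσ : ∀ j, ∀ u ∈ (P j).1.dom, u 0 ≠ 0 →
      ξ (P j) u = -(2 * Real.pi)⁻¹ • angForm n u + σ j u)
    {β : 𝓧.maximal.Family (2 * n)} (hβ : β ∈ 𝓧.maximal.closedForms (2 * n)) :
    𝓧.maximal.integral (fun c u => wedge (β c u) (τ c u)) =
      S.orb.maximal.integral (S.maximal.restrict β) := by
  classical
  have : CompactSpace E := isCompact_iff_compactSpace.1 hE.isCompact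
  have hQrestr : ∀ j, ∀ y ∈ (Q j).1.dom, S.maximal.restrict β (Q j) y (frame n) =
      β (P j) (Fin.cons 0 y) fun i => Fin.cons 0 (frame n i) := by
    intro j y hy
    have hy' : tailIncl n y ∈ (P j).1.dom := by
      rw [hQd j] at hy
      exact hy
    rw [S.maximal.restrict_eq hβ.1 (Q j) hy (d := P j) (ℓ := tailIncl n)
      ((tailIncl n).restrictScalars ℝ).contDiff.contDiffAt hy' ?_]
    · have : fderiv ℝ (tailIncl n) y = (tailIncl n).restrictScalars ℝ :=
        ((tailIncl n).restrictScalars ℝ).fderiv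
      rw [this]
      rfl
    · filter_upwards [(Q j).1.isOpen_dom.mem_nhds hy] with w hw
      exact (hQ j w hw).symm
  have hthin : 𝓧.maximal.Thin E := 𝓧.maximal.thin_of_cover fun x hx => by
    obtain ⟨j, hj⟩ := hcov x hx
    refine ⟨P j, hj, measure_mono_null ?_ (volume_hyperplane (n + 1) 0)⟩
    exact fun u hu => (hPE j u hu.1).1 hu.2
  -- A partition of unity subordinate to the charts `P j` and to charts disjoint from `E`.
  obtain ⟨t, p, ρ, hpS, hρ, hρ1, hρs⟩ := 𝓧.maximal.exists_smooth_partition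
    (range P ∪ {c | ∀ x ∈ c.1.image, x ∉ E}) fun x => by
      by_cases hx : x ∈ E
      · obtain ⟨j, hj⟩ := hcov x hx
        exact ⟨P j, Or.inl ⟨j, rfl⟩, hj⟩
      · obtain ⟨c, hc, hxc⟩ := 𝓧.maximal.cover x
        refine ⟨𝓧.restrictChart ⟨c, hc⟩ Eᶜ hE.isOpen_compl, Or.inr fun y hy => ?_, ?_⟩
        · rw [𝓧.image_restrictChart] at hy
          exact hy.2
        · rw [𝓧.image_restrictChart]
          exact ⟨hxc, hx⟩
  have hρβ : ∀ k, ComplexOrbifold.fmul (ρ k) β ∈ 𝓧.maximal.forms (2 * n) := fun k =>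
    ComplexOrbifold.fmul_mem_forms (hρ k) hβ.1
  have hw : ∀ k c, ∀ u ∈ c.1.dom, c.1.proj u ∉ E → ContDiffAt ℝ ∞
      (fun w => wedge (ComplexOrbifold.fmul (ρ k) β c w) (ξ c w)) u := fun k c u hu huE =>
    contDiffAt_wedge (ComplexOrbifold.forms.contDiffAt (hρβ k) c hu) (hξs c u hu huE)
  -- Off `E` the form `β ∧ τ` is the sum of the exact forms `d (ρ k β ∧ ξ)`, as `β` is closed. The
  -- value on `E` is irrelevant, since `E` is thin.
  let ψ : t → 𝓧.maximal.Family (2 * (n + 1)) := fun k c u => if c.1.proj u ∈ E then 0 else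
    extDeriv (fun w => wedge (ComplexOrbifold.fmul (ρ k) β c w) (ξ c w)) u
  have hψ : ∀ k c u, c.1.proj u ∉ E → ψ k c u =
      extDeriv (fun w => wedge (ComplexOrbifold.fmul (ρ k) β c w) (ξ c w)) u :=
    fun k c u hu => if_neg hu
  have hnat : ∀ k, 𝓧.maximal.Natural (ψ k) := by
    intro k c d h hh w hw'
    by_cases hE' : d.1.proj (h w) ∈ E
    · have hE'' : c.1.proj w ∈ E := hh.comm w hw' ▸ hE'
      simp only [ψ, if_pos hE', if_pos hE'']
      rfl
    · have hE'' : c.1.proj w ∉ E := hh.comm w hw' ▸ hE'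
      rw [hψ k c w hE'', hψ k d _ hE']
      have hN := (ComplexOrbifold.forms.natural (hρβ k)).wedge hξ
      exact hN.extDeriv_eq hh hw' ((hw k d _ (hh.target_subset (h.map_source hw'))
        hE').differentiableAt (by simp))
  -- In the charts `P j` the residue formula applies, in the remaining ones Stokes' theorem.
  have hpart : ∀ k, IntegrableOn (fun u => ψ k (p k) u (frame (n + 1))) (p k).1.dom ∧
      (∀ j, P j = p k → ∫ u in (p k).1.dom, ψ k (p k) u (frame (n + 1)) =
        ∫ y in (Q j).1.dom, ρ k ((Q j).1.proj y) * S.maximal.restrict β (Q j) y (frame n)) ∧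
      ((∀ j, P j ≠ p k) → ∫ u in (p k).1.dom, ψ k (p k) u (frame (n + 1)) = 0) := by
    intro k
    by_cases hk : ∃ j, P j = p k
    · have hres : ∀ j, P j = p k →
          IntegrableOn (fun u => ψ k (p k) u (frame (n + 1))) (p k).1.dom ∧
          ∫ u in (p k).1.dom, ψ k (p k) u (frame (n + 1)) =
          ∫ y in (Q j).1.dom, ρ k ((Q j).1.proj y) * S.maximal.restrict β (Q j) y (frame n) := by
        intro j hj
        have hsk := hρs k
        rw [← hj] at hsk ⊢
        obtain ⟨h1, h2⟩ := (P j).1.integral_extDeriv_residue (isClosed_tsupport (ρ k)).isCompact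
          hsk ((hρβ k).1 (P j))
          (fun u _ hu => by simp [ComplexOrbifold.fmul, image_eq_zero_of_notMem_tsupport hu])
          (hσ j) (hξσ j) (g := fun u => ψ k (P j) u (frame (n + 1)))
          (fun u hu hu0 => by rw [hψ k _ u (by rwa [hPE j u hu])])
        refine ⟨h1, h2.trans ?_⟩
        rw [← hQd j]
        refine setIntegral_congr_fun (Q j).1.isOpen_dom.measurableSet fun y hy => ?_
        simp only [hQrestr j y hy, hQ j y hy]
        rfl
      obtain ⟨j, hj⟩ := hk
      exact ⟨(hres j hj).1, fun j hj => (hres j hj).2, fun h => absurd hj (h j)⟩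
    · have hdis : ∀ u ∈ (p k).1.dom, (p k).1.proj u ∉ E := by
        rcases hpS k with ⟨j, hj⟩ | h
        · exact absurd ⟨j, hj⟩ hk
        · exact fun u hu => h _ ⟨u, hu, rfl⟩
      obtain ⟨h1, h2⟩ := (p k).1.integral_extDeriv (isClosed_tsupport (ρ k)).isCompact (hρs k)
        (α := fun w => wedge (ComplexOrbifold.fmul (ρ k) β (p k) w) (ξ (p k) w))
        (fun u hu => (hw k _ u hu (hdis u hu)).contDiffWithinAt)
        (fun u _ hu => by
          simp [ComplexOrbifold.fmul, image_eq_zero_of_notMem_tsupport hu, wedge_zero_left])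
      refine ⟨h1.congr_fun (fun u hu => ?_) (p k).1.isOpen_dom.measurableSet,
        fun j hj => absurd ⟨j, hj⟩ hk, fun _ => h2 ▸ ?_⟩
      · simp only [hψ k _ u (hdis u hu)]
      · refine setIntegral_congr_fun (p k).1.isOpen_dom.measurableSet fun u hu => ?_
        simp only [hψ k _ u (hdis u hu)]
  rw [𝓧.maximal.integral_eq_sum hE hthin p (fun c u => wedge (β c u) (τ c u)) ψ hnat ?_ ?_
    (fun k => (hpart k).1) ?_]
  · let I : Type _ := {k : t // ∃ j, P j = p k}
    -- The functions belonging to the charts `P j` restrict to a partition of unity on `E`,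
    -- subordinate to the charts `Q j`.
    let jj : I → J := fun k => k.2.choose
    have hjj : ∀ k : I, P (jj k) = p k.1 := fun k => k.2.choose_spec
    have hzero : ∀ k, (¬ ∃ j, P j = p k) → ∀ x ∈ E, ρ k x = 0 := by
      intro k hk x hx
      refine image_eq_zero_of_notMem_tsupport fun h => ?_
      rcases hpS k with ⟨j, hj⟩ | h'
      · exact hk ⟨j, hj⟩
      · exact h' x (hρs k h) hx
    have hr := S.maximal.restrict_mem_forms hβ.1
    have hpi := S.orb.maximal.integral_eq_partition (fun k : I => Q (jj k))
      (fun k x => ρ k.1 x.1) (fun k => (hρ k.1).continuous.comp continuous_subtype_val) ?_ ?_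
      (ComplexOrbifold.forms.natural hr) (fun c => (hr.1 c).continuousOn)
    · refine Eq.trans ?_ hpi.symm
      rw [sum_eq_sum_subtype (fun k => ∃ j, P j = p k)]
      · refine Finset.sum_congr rfl fun k _ => ?_
        rw [(hpart k.1).2.1 (jj k) (hjj k), hcard, hjj k]
      · intro k hk
        rw [(hpart k).2.2 fun j hj => hk ⟨j, hj⟩, mul_zero]
    · intro x
      rw [← hρ1 x.1]
      exact (sum_eq_sum_subtype (fun k => ∃ j, P j = p k) (fun k => ρ k x.1)
        fun k hk => hzero k hk x.1 x.2).symm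
    · intro k x hx
      have h1 : x.1 ∈ tsupport (ρ k.1) := by
        have := closure_subset_preimage_closure_image (f := Subtype.val) (s := Function.support
          fun x : E => ρ k.1 x.1) continuous_subtype_val hx
        refine closure_mono ?_ this
        rintro _ ⟨y, hy, rfl⟩
        exact hy
      obtain ⟨u, hu, hux⟩ := hρs k.1 h1
      rw [← hjj k] at hu hux
      have h2 : u 0 = 0 := (hPE _ u hu).1 (hux ▸ x.2)
      have h3 : u = Fin.cons 0 (Fin.tail u) := by rw [← h2, Fin.cons_self_tail]
      have h4 : Fin.tail u ∈ (Q (jj k)).1.dom := by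
        rw [hQd, mem_ofPred_eq, ← h3]
        exact hu
      refine ⟨Fin.tail u, h4, Subtype.ext ?_⟩
      rw [hQ _ _ h4, ← h3, hux]
  · intro k c u hu
    refine ContinuousAt.continuousWithinAt ?_
    have h1 := contDiffAt_extDeriv (hw k c u hu.1 hu.2)
    refine h1.continuousAt.congr ?_
    filter_upwards [(c.1.isOpen_diff hE).mem_nhds hu] with w hw'
    exact (hψ k c w hw'.2).symm
  · intro k c u hu huE hne
    refine hρs k ?_
    by_contra h
    refine hne ?_
    have h1 := c.1.continuousOn_proj.continuousAt (c.1.isOpen_dom.mem_nhds hu)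
    have h2 : (fun w => wedge (ComplexOrbifold.fmul (ρ k) β c w) (ξ c w)) =ᶠ[𝓝 u]
        fun _ => 0 := by
      filter_upwards [h1.eventually ((isClosed_tsupport (ρ k)).isOpen_compl.mem_nhds h)] with w hw
      simp [ComplexOrbifold.fmul, image_eq_zero_of_notMem_tsupport hw, wedge_zero_left]
    rw [hψ k c u huE, h2.extDeriv_eq, extDeriv_zero]
  · intro c u hu huE
    have h1 : (fun w => wedge (β c w) (ξ c w)) =ᶠ[𝓝 u]
        fun w => ∑ k, wedge (ComplexOrbifold.fmul (ρ k) β c w) (ξ c w) := by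
      filter_upwards with w
      simp only [ComplexOrbifold.fmul, wedge_smul_left, ← Finset.sum_smul, hρ1, one_smul]
    have h2 := extDeriv_wedge_of_closed (ComplexOrbifold.forms_differentiableAt hβ.1 c hu)
      ((hξs c u hu huE).differentiableAt (by simp)) (hβ.2 c u hu)
    rw [Even.neg_one_pow ⟨n, by ring⟩, one_smul, h1.extDeriv_eq,
      extDeriv_sum _ fun k _ => (hw k c u hu huE).differentiableAt (by simp)] at h2
    rw [hτ c u hu huE, ← h2]
    exact Finset.sum_congr rfl fun k _ => (hψ k c u huE).symm

end Residue

/-! ### Charts of the weighted blow-up -/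

section Hyperplane

variable {n : ℕ} {X : Type*} [TopologicalSpace X]

/-- The coordinates other than the first, as a linear map. -/
def tailProj (n : ℕ) : Cn (n + 1) →L[ℂ] Cn n :=
  ContinuousLinearMap.pi fun i => ContinuousLinearMap.proj i.succ

theorem tailProj_apply (u : Cn (n + 1)) : tailProj n u = Fin.tail u := rfl

/-- If a divisor is the hyperplane `u₀ = 0` in some chart, then this hyperplane parametrizes an
open subset of the divisor, compatibly with any suborbifold structure. -/
theorem Suborbifold.locallyEquivalent_hyperplane {𝓧 : ComplexOrbifold (n + 1) X} {E : Set X}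
    (S : Suborbifold 𝓧 E n) (P : 𝓧.maximal.charts)
    (hPE : ∀ u ∈ P.1.dom, P.1.proj u ∈ E ↔ u 0 = 0) {q : Cn n → E}
    (hq : ∀ y, (Fin.cons 0 y : Cn (n + 1)) ∈ P.1.dom → (q y : X) = P.1.proj (Fin.cons 0 y)) :
    ∀ c ∈ S.orb.charts, ∀ y ∈ {y | (Fin.cons 0 y : Cn (n + 1)) ∈ P.1.dom}, ∀ v ∈ c.dom,
      q y = c.proj v →
        LocallyEquivalent {y | (Fin.cons 0 y : Cn (n + 1)) ∈ P.1.dom} q c.dom c.proj y v := by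
  intro c hc y hy v hv hyv
  obtain ⟨⟨d, ℓ⟩, h1, h2, h3, h4⟩ := S.immersion ⟨c, hc⟩ v hv
  simp only at h1 h2 h3 h4
  have hyd : P.1.proj (Fin.cons 0 y) = d.1.proj (ℓ v) := by
    rw [h4.self_of_nhds, ← hq y hy, hyv]
  obtain ⟨h, hh, hs, hhy⟩ := P.2 d.1 d.2 _ hy _ h3 hyd
  have hs' : ℓ v ∈ h.target := hhy ▸ h.map_source hs
  have hsy : h.symm (ℓ v) = Fin.cons 0 y := by rw [← hhy, h.left_inv hs]
  have hA : AnalyticAt ℂ h.symm (ℓ v) :=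
    (hh.holomorphic_symm.contDiffAt (h.open_target.mem_nhds hs')).analyticAt
  -- A local lift of the inclusion of the divisor, expressed in the coordinates of the hyperplane.
  -- It is an immersion between spaces of equal dimension, hence a local biholomorphism.
  let κ : Cn n → Cn n := fun w => tailProj n (h.symm (ℓ w))
  have hκA : AnalyticAt ℂ κ v := (tailProj n).analyticAt _ |>.comp (hA.comp h1)
  have hκv : κ v = y := by
    simp only [κ, hsy, tailProj_apply, Fin.tail_cons]
  have hev : ∀ᶠ w in 𝓝 v, h.symm (ℓ w) = tailIncl n (κ w) ∧ q (κ w) = c.proj w := by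
    filter_upwards [h4, h1.continuousAt.eventually (h.open_target.mem_nhds hs')] with w hw hw'
    have e1 : P.1.proj (h.symm (ℓ w)) = c.proj w := by rw [hh.symm.comm _ hw', hw]
    have e2 : h.symm (ℓ w) ∈ P.1.dom := hh.source_subset (h.map_target hw')
    have e3 : h.symm (ℓ w) 0 = 0 := (hPE _ e2).1 (by rw [e1]; exact (c.proj w).2)
    have e4 : h.symm (ℓ w) = tailIncl n (κ w) := by
      simp only [κ, tailIncl_apply, tailProj_apply]
      rw [← e3, Fin.cons_self_tail]
    refine ⟨e4, Subtype.ext ?_⟩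
    rw [e4] at e1 e2
    rw [hq _ e2]
    exact e1
  have hinj : Function.Injective (fderiv ℂ κ v) := by
    have e1 : fderiv ℂ (h.symm ∘ ℓ) v = (tailIncl n).comp (fderiv ℂ κ v) := by
      have : h.symm ∘ ℓ =ᶠ[𝓝 v] tailIncl n ∘ κ := hev.mono fun w hw => hw.1
      rw [this.fderiv_eq, fderiv_comp v (tailIncl n).differentiableAt hκA.differentiableAt,
        ContinuousLinearMap.fderiv]
    have e2 : fderiv ℂ (h.symm ∘ ℓ) v = (fderiv ℂ h.symm (ℓ v)).comp (fderiv ℂ ℓ v) :=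
      fderiv_comp v hA.differentiableAt h1.differentiableAt
    have e3 : Function.Injective (fderiv ℂ h.symm (ℓ v)) := by
      have e4 : (fderiv ℂ h (h.symm (ℓ v))).comp (fderiv ℂ h.symm (ℓ v)) =
          ContinuousLinearMap.id ℂ (Cn (n + 1)) := by
        rw [← fderiv_comp _ (hh.differentiableAt (h.map_target hs')) hA.differentiableAt]
        have : h ∘ h.symm =ᶠ[𝓝 (ℓ v)] id := by
          filter_upwards [h.open_target.mem_nhds hs'] with w hw
          exact h.right_inv hw
        rw [this.fderiv_eq, fderiv_id]
      exact Function.LeftInverse.injective (g := fderiv ℂ h (h.symm (ℓ v))) fun v =>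
        congrArg (fun L => L v) e4
    have e5 : Function.Injective ((tailIncl n).comp (fderiv ℂ κ v)) := by
      rw [← e1, e2]
      exact e3.comp h2
    exact Function.Injective.of_comp (f := tailIncl n) e5
  have := locallyEquivalent_of_injective_fderiv (p := c.proj) (q := q) c.isOpen_dom
    (t := {y | (Fin.cons 0 y : Cn (n + 1)) ∈ P.1.dom})
    (P.1.isOpen_dom.preimage (tailIncl n).continuous) hκA hinj hv (by rw [hκv]; exact hy)
    (hev.mono fun w hw => hw.2)
  rw [hκv] at this
  exact this.symm

end Hyperplane

section Slices

variable {n : ℕ}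

/-- Diagonal automorphisms of coordinate space. -/
def diagHom (n : ℕ) : (Fin n → ℂˣ) →* (Cn n ≃ₗ[ℂ] Cn n) where
  toFun s :=
    { toFun := fun u l => s l * u l
      invFun := fun u l => (s l)⁻¹ * u l
      map_add' := fun u v => by
        ext l
        simp [mul_add]
      map_smul' := fun c u => by
        ext l
        simp
        ring
      left_inv := fun u => by
        ext l
        simp
      right_inv := fun u => by
        ext l
        simp }
  map_one' := by
    ext u l
    simp
  map_mul' s t := by
    ext u l
    simp [mul_assoc]

theorem diagHom_apply (s : Fin n → ℂˣ) (u : Cn n) (l : Fin n) : diagHom n s u l = s l * u l := rfl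

/-- The action `y_l ↦ s ^ a_l y_l` on the hyperplane `t = 0` of the slice `z_j = 1`; it preserves
the fibers of the projection if `s ^ a_j = 1`. -/
def tailHom (a : Fin (n + 1) → ℕ) (j : Fin (n + 1)) : ℂˣ →* (Cn n ≃ₗ[ℂ] Cn n) :=
  (diagHom n).comp (MonoidHom.mk' (fun s l => s ^ a (j.succAbove l)) fun s t => by
    ext l
    simp [mul_pow])

/-- The action on the slice `z_j = 1`, with `t` as first coordinate; it preserves the fibers of the
projection if `s ^ a_j = 1`. -/
def sliceHom (a : Fin (n + 1) → ℕ) (j : Fin (n + 1)) : ℂˣ →* (Cn (n + 1) ≃ₗ[ℂ] Cn (n + 1)) :=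
  (diagHom (n + 1)).comp (MonoidHom.mk'
    (fun s => (Fin.cons s⁻¹ fun l => s ^ a (j.succAbove l) : Fin (n + 1) → ℂˣ)) fun s t => by
      ext l
      refine Fin.cases ?_ (fun l => ?_) l
      · simp [mul_comm]
      · simp [mul_pow])

theorem tailHom_apply (a : Fin (n + 1) → ℕ) (j : Fin (n + 1)) (s : ℂˣ) (y : Cn n) (l : Fin n) :
    tailHom a j s y l = (s : ℂ) ^ a (j.succAbove l) * y l := by
  simp [tailHom, diagHom_apply]

theorem sliceHom_apply_zero (a : Fin (n + 1) → ℕ) (j : Fin (n + 1)) (s : ℂˣ) (u : Cn (n + 1)) :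
    sliceHom a j s u 0 = (s : ℂ)⁻¹ * u 0 := by
  simp [sliceHom, diagHom_apply]

theorem sliceHom_apply_succ (a : Fin (n + 1) → ℕ) (j : Fin (n + 1)) (s : ℂˣ) (u : Cn (n + 1))
    (l : Fin n) : sliceHom a j s u l.succ = (s : ℂ) ^ a (j.succAbove l) * u l.succ := by
  simp [sliceHom, diagHom_apply]

/-- The image of the group of `k`-th roots of unity. -/
def rootsGroup {G : Type*} [Group G] (k : ℕ) (φ : ℂˣ →* G) : Subgroup G :=
  (φ.comp (rootsOfUnity k ℂ).subtype).range

theorem mem_rootsGroup {G : Type*} [Group G] {k : ℕ} {φ : ℂˣ →* G} {γ : G} :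
    γ ∈ rootsGroup k φ ↔ ∃ s : ℂˣ, s ^ k = 1 ∧ φ s = γ := by
  constructor
  · rintro ⟨⟨s, hs⟩, rfl⟩
    exact ⟨s, hs, rfl⟩
  · rintro ⟨s, hs, rfl⟩
    exact ⟨⟨s, hs⟩, rfl⟩

theorem card_rootsGroup {G : Type*} [Group G] {k : ℕ} (hk : 0 < k) {φ : ℂˣ →* G}
    (hφ : ∀ s : ℂˣ, s ^ k = 1 → φ s = 1 → s = 1) : Nat.card (rootsGroup k φ) = k := by
  have : NeZero k := ⟨hk.ne'⟩
  have hinj : Function.Injective (φ.comp (rootsOfUnity k ℂ).subtype) := by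
    rw [injective_iff_map_eq_one]
    rintro ⟨s, hs⟩ h
    exact Subtype.ext (hφ s hs h)
  rw [rootsGroup, ← Nat.card_congr (MonoidHom.ofInjective hinj).toEquiv, Complex.card_rootsOfUnity]

theorem finite_rootsGroup {G : Type*} [Group G] {k : ℕ} (hk : 0 < k) (φ : ℂˣ →* G) :
    Finite (rootsGroup k φ) := by
  have : NeZero k := ⟨hk.ne'⟩
  exact Set.finite_range (φ.comp (rootsOfUnity k ℂ).subtype)

theorem sliceHom_injective (a : Fin (n + 1) → ℕ) (j : Fin (n + 1)) (s : ℂˣ)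
    (h : sliceHom a j s = 1) : s = 1 := by
  have := congrArg (fun γ => γ (fun _ => 1) 0) h
  simp only [sliceHom_apply_zero] at this
  ext
  simpa using this

/-- The roots of unity act effectively on the exceptional divisor, since the weights are coprime. -/
theorem tailHom_injective (hn : 1 ≤ n) {a : Fin (n + 1) → ℕ}
    (hcop : Pairwise fun j l => Nat.Coprime (a j) (a l)) (j : Fin (n + 1)) (s : ℂˣ)
    (hs : s ^ a j = 1) (h : tailHom a j s = 1) : s = 1 := by
  let l : Fin n := ⟨0, hn⟩
  have := congrArg (fun γ => γ (fun _ => 1) l) h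
  simp only [tailHom_apply] at this
  have h1 : s ^ a (j.succAbove l) = 1 := by
    ext
    simpa using this
  have h2 := hcop (Fin.succAbove_ne j l).symm
  have h3 : orderOf s ∣ 1 := by
    rw [← h2.gcd_eq_one]
    exact Nat.dvd_gcd (orderOf_dvd_of_pow_eq_one hs) (orderOf_dvd_of_pow_eq_one h1)
  exact orderOf_eq_one_iff.1 (Nat.dvd_one.1 h3)

/-- The point of `ℂ × ℂⁿ⁺¹` on the slice `z_j = 1` with coordinates `u = (t, y)`. -/
def slicePt (j : Fin (n + 1)) (u : Cn (n + 1)) : ℂ × Cn (n + 1) :=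
  (u 0, j.insertNth 1 (Fin.tail u))

/-- The linear isomorphism which moves the first coordinate to the place `j`. -/
def moveFirst (j : Fin (n + 1)) : Cn (n + 1) ≃L[ℂ] Cn (n + 1) :=
  LinearEquiv.toContinuousLinearEquiv
    { toFun := fun u => j.insertNth (u 0) (Fin.tail u)
      invFun := fun w => Fin.cons (w j) (j.removeNth w)
      map_add' := fun u v => by
        ext i
        refine Fin.succAboveCases j ?_ (fun i => ?_) i <;> simp [Fin.tail]
      map_smul' := fun c u => by
        ext i
        refine Fin.succAboveCases j ?_ (fun i => ?_) i <;> simp [Fin.tail]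
      left_inv := fun u => by simp
      right_inv := fun w => by simp }

theorem moveFirst_apply (j : Fin (n + 1)) (u : Cn (n + 1)) :
    moveFirst j u = j.insertNth (u 0) (Fin.tail u) := rfl

theorem slice_moveFirst (j : Fin (n + 1)) (u : Cn (n + 1)) :
    slice j (moveFirst j u) = slicePt j u := by
  ext i
  · simp [slice, slicePt, moveFirst_apply]
  · simp only [slice, slicePt, moveFirst_apply]
    refine Fin.succAboveCases j ?_ (fun i => ?_) i <;> simp

end Slices

section Model

variable {n : ℕ} {X : Type*} [TopologicalSpace X] {M : Type*} [TopologicalSpace M]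

/-- The data of a weighted blow-up `g : X → M` near a point `x₀`: a chart `φ` of `M` centered at
`x₀` and a parametrization `Ψ` of the part of `X` over the source of `φ` by the points of `ℂ × (ℂⁿ⁺¹
∖ 0)` over the target of `φ`. -/
structure LocalModel (𝓧 : ComplexOrbifold (n + 1) X) (g : X → M) (a : Fin (n + 1) → ℕ) (x₀ : M)
    (φ : OpenPartialHomeomorph M (Cn (n + 1))) (Ψ : ℂ × Cn (n + 1) → X) : Prop where
  pos : ∀ j, 0 < a j
  coprime : Pairwise fun j l => Nat.Coprime (a j) (a l)
  mem : x₀ ∈ φ.source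
  center : φ x₀ = 0
  image : Ψ '' blowupDomain a φ.target = g ⁻¹' φ.source
  map_eq : ∀ p ∈ blowupDomain a φ.target, g (Ψ p) = φ.symm (blowdown a p)
  fiber : ∀ p ∈ blowupDomain a φ.target, ∀ q ∈ blowupDomain a φ.target,
    Ψ p = Ψ q ↔ ∃ s : ℂ, s ≠ 0 ∧ q.1 = s⁻¹ * p.1 ∧ ∀ l, q.2 l = s ^ a l * p.2 l
  compat : ∀ j, ∀ c ∈ 𝓧.charts, ∀ u, slice j u ∈ blowupDomain a φ.target → ∀ v ∈ c.dom,
    Ψ (slice j u) = c.proj v →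
      LocallyEquivalent {w | slice j w ∈ blowupDomain a φ.target}
        (fun w => Ψ (slice j w)) c.dom c.proj u v

theorem insertNth_one_ne_zero (j : Fin (n + 1)) (y : Cn n) :
    (j.insertNth 1 y : Cn (n + 1)) ≠ 0 := fun h => by
  have := congrFun h j
  simp at this

theorem slicePt_mem_iff {a : Fin (n + 1) → ℕ} {W : Set (Cn (n + 1))} {j : Fin (n + 1)}
    {u : Cn (n + 1)} : slicePt j u ∈ blowupDomain a W ↔ blowdown a (slicePt j u) ∈ W :=
  ⟨fun h => h.2, fun h => ⟨insertNth_one_ne_zero j _, h⟩⟩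

theorem contDiff_slicePt (j : Fin (n + 1)) :
    ContDiff ℂ ω fun u : Cn (n + 1) => (slicePt j u).2 := by
  rw [contDiff_pi]
  intro i
  refine Fin.succAboveCases j ?_ (fun i => ?_) i
  · simp only [slicePt, Fin.insertNth_apply_same]
    exact contDiff_const
  · simp only [slicePt, Fin.insertNth_apply_succAbove]
    exact contDiff_apply ℂ ℂ i.succ

theorem contDiff_blowdown_slicePt (a : Fin (n + 1) → ℕ) (j : Fin (n + 1)) :
    ContDiff ℂ ω fun u : Cn (n + 1) => blowdown a (slicePt j u) := by
  rw [contDiff_pi]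
  intro l
  exact ((contDiff_apply ℂ ℂ (0 : Fin (n + 1))).pow _).mul
    (contDiff_pi.1 (contDiff_slicePt j) l)

theorem slicePt_act {a : Fin (n + 1) → ℕ} {j : Fin (n + 1)} {s : ℂˣ} (hs : s ^ a j = 1)
    (u : Cn (n + 1)) : (slicePt j (sliceHom a j s u)).1 = (s : ℂ)⁻¹ * (slicePt j u).1 ∧
      ∀ l, (slicePt j (sliceHom a j s u)).2 l = (s : ℂ) ^ a l * (slicePt j u).2 l := by
  refine ⟨sliceHom_apply_zero a j s u, fun l => ?_⟩
  have hs' : (s : ℂ) ^ a j = 1 := by rw [← Units.val_pow_eq_pow_val, hs, Units.val_one]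
  refine Fin.succAboveCases j ?_ (fun l => ?_) l
  · simp [slicePt, hs']
  · simp [slicePt, Fin.tail, sliceHom_apply_succ]

/-- The blow-down map is invariant under the action. -/
theorem blowdown_act (a : Fin (n + 1) → ℕ) {p q : ℂ × Cn (n + 1)} {s : ℂ} (hs : s ≠ 0)
    (h1 : q.1 = s⁻¹ * p.1) (h2 : ∀ l, q.2 l = s ^ a l * p.2 l) :
    blowdown a q = blowdown a p := by
  ext l
  simp only [blowdown, h1, h2, mul_pow, inv_pow]
  field_simp

namespace LocalModel

variable {𝓧 : ComplexOrbifold (n + 1) X} {g : X → M} {a : Fin (n + 1) → ℕ} {x₀ : M}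
  {φ : OpenPartialHomeomorph M (Cn (n + 1))} {Ψ : ℂ × Cn (n + 1) → X}

/-- The slice `z_j = 1` as an orbifold chart, with `t` as first coordinate. -/
def sliceChart (H : LocalModel 𝓧 g a x₀ φ Ψ) (j : Fin (n + 1)) : 𝓧.maximal.charts :=
  𝓧.mkChart {u | blowdown a (slicePt j u) ∈ φ.target}
    (φ.open_target.preimage (contDiff_blowdown_slicePt a j).continuous)
    (rootsGroup (a j) (sliceHom a j)) (finite_rootsGroup (H.pos j) _)
    (fun γ hγ u hu => by
      obtain ⟨s, hs, rfl⟩ := mem_rootsGroup.1 hγ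
      obtain ⟨h1, h2⟩ := slicePt_act hs u
      rw [mem_ofPred_eq, blowdown_act a s.ne_zero h1 h2]
      exact hu)
    (fun u => Ψ (slicePt j u))
    (fun u hu v hv => by
      rw [H.fiber _ (slicePt_mem_iff.2 hu) _ (slicePt_mem_iff.2 hv)]
      constructor
      · rintro ⟨s, hs, h1, h2⟩
        have hj : s ^ a j = 1 := by
          have := h2 j
          simp only [slicePt, Fin.insertNth_apply_same, mul_one] at this
          exact this.symm
        refine ⟨_, mem_rootsGroup.2 ⟨Units.mk0 s hs, by ext; simpa using hj, rfl⟩, ?_⟩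
        ext l
        refine Fin.cases ?_ (fun l => ?_) l
        · rw [sliceHom_apply_zero]
          exact h1.symm
        · rw [sliceHom_apply_succ]
          have := h2 (j.succAbove l)
          simp only [slicePt, Fin.insertNth_apply_succAbove] at this
          exact this.symm
      · rintro ⟨γ, hγ, rfl⟩
        obtain ⟨s, hs, rfl⟩ := mem_rootsGroup.1 hγ
        exact ⟨s, s.ne_zero, slicePt_act hs u⟩)
    (fun c hc u hu v hv huv => by
      have h1 := H.compat j c hc (moveFirst j u)
        (by rw [slice_moveFirst]; exact slicePt_mem_iff.2 hu) v hv
        (by rw [slice_moveFirst]; exact huv)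
      refine LocallyEquivalent.trans (locallyEquivalent_of_injective_fderiv
        (φ.open_target.preimage (contDiff_blowdown_slicePt a j).continuous) ?_
        (g := moveFirst j) ((moveFirst j).toContinuousLinearMap.analyticAt u) ?_ hu ?_ ?_) h1
      · have h2 : {w | slice j w ∈ blowupDomain a φ.target} = (moveFirst j).symm ⁻¹'
            {u | blowdown a (slicePt j u) ∈ φ.target} := by
          ext w
          rw [mem_ofPred_eq, mem_preimage, mem_ofPred_eq, ← slicePt_mem_iff, ← slice_moveFirst,
            ContinuousLinearEquiv.apply_symm_apply]
        rw [h2]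
        exact (φ.open_target.preimage (contDiff_blowdown_slicePt a j).continuous).preimage
          (moveFirst j).symm.continuous
      · rw [ContinuousLinearEquiv.fderiv]
        exact (moveFirst j).injective
      · rw [mem_ofPred_eq, slice_moveFirst]
        exact slicePt_mem_iff.2 hu
      · exact Filter.Eventually.of_forall fun w => congrArg Ψ (slice_moveFirst j w))

variable (H : LocalModel 𝓧 g a x₀ φ Ψ) (j : Fin (n + 1))

theorem mem_dom_sliceChart {u : Cn (n + 1)} :
    u ∈ (H.sliceChart j).1.dom ↔ blowdown a (slicePt j u) ∈ φ.target := Iff.rfl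

theorem proj_sliceChart (u : Cn (n + 1)) : (H.sliceChart j).1.proj u = Ψ (slicePt j u) := rfl

theorem card_sliceChart : Nat.card (H.sliceChart j).1.group = a j :=
  card_rootsGroup (H.pos j) fun s _ h => sliceHom_injective a j s h

theorem map_proj {u : Cn (n + 1)} (hu : u ∈ (H.sliceChart j).1.dom) :
    g ((H.sliceChart j).1.proj u) = φ.symm (blowdown a (slicePt j u)) :=
  H.map_eq _ (slicePt_mem_iff.2 hu)

include H in
theorem zero_mem : (0 : Cn (n + 1)) ∈ φ.target := by
  rw [← H.center]
  exact φ.map_source H.mem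

include H in
theorem symm_eq_iff {w : Cn (n + 1)} (hw : w ∈ φ.target) : φ.symm w = x₀ ↔ w = 0 := by
  rw [← φ.left_inv H.mem, H.center]
  exact φ.symm.injOn.eq_iff hw H.zero_mem

include H in
theorem blowdown_zero (z : Cn (n + 1)) : blowdown a (0, z) = 0 := by
  ext l
  simp [blowdown, (H.pos l).ne']

include H in
theorem blowdown_slicePt_eq_zero {u : Cn (n + 1)} : blowdown a (slicePt j u) = 0 ↔ u 0 = 0 := by
  constructor
  · intro h
    have := congrFun h j
    simpa [blowdown, slicePt, (H.pos j).ne'] using this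
  · intro h
    rw [slicePt, h, H.blowdown_zero]

/-- In a slice, the exceptional divisor is the hyperplane `t = 0`. -/
theorem mem_exceptional {u : Cn (n + 1)} (hu : u ∈ (H.sliceChart j).1.dom) :
    (H.sliceChart j).1.proj u ∈ g ⁻¹' {x₀} ↔ u 0 = 0 := by
  rw [mem_preimage, mem_singleton_iff, H.map_proj j hu, H.symm_eq_iff hu,
    H.blowdown_slicePt_eq_zero]

theorem cons_zero_mem (y : Cn n) : (Fin.cons 0 y : Cn (n + 1)) ∈ (H.sliceChart j).1.dom := by
  rw [mem_dom_sliceChart, (H.blowdown_slicePt_eq_zero j).2 (by simp)]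
  exact H.zero_mem

/-- A nonzero coordinate `z_l` can be normalized to `1` by the action. -/
theorem exists_slicePt_eq {z : Cn (n + 1)} {l : Fin (n + 1)} (hl : z l ≠ 0) :
    ∃ y : Cn n, (H.sliceChart l).1.proj (Fin.cons 0 y) = Ψ (0, z) := by
  have hz : z ≠ 0 := fun h => hl (by rw [h]; rfl)
  have hp : ((0 : ℂ), z) ∈ blowupDomain a φ.target := ⟨hz, by
    rw [H.blowdown_zero]
    exact H.zero_mem⟩
  obtain ⟨s, hs⟩ := IsAlgClosed.exists_pow_nat_eq (z l)⁻¹ (H.pos l)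
  have hs0 : s ≠ 0 := by
    rintro rfl
    rw [zero_pow (H.pos l).ne'] at hs
    exact inv_ne_zero hl hs.symm
  refine ⟨fun i => s ^ a (l.succAbove i) * z (l.succAbove i), ?_⟩
  refine ((H.fiber _ hp _ (slicePt_mem_iff.2 (H.cons_zero_mem l _))).2 ⟨s, hs0, ?_, fun i => ?_⟩).symm
  · simp [slicePt]
  · refine Fin.succAboveCases l ?_ (fun i => ?_) i
    · simp [slicePt, hs, hl]
    · simp [slicePt]

/-- The slices cover the exceptional divisor. -/
theorem exists_mem_image {x : X} (hx : x ∈ g ⁻¹' {x₀}) : ∃ j, x ∈ (H.sliceChart j).1.image := by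
  have h1 : x ∈ g ⁻¹' φ.source := by
    rw [mem_preimage, mem_singleton_iff] at hx
    rw [mem_preimage, hx]
    exact H.mem
  rw [← H.image] at h1
  obtain ⟨⟨t, z⟩, hp, rfl⟩ := h1
  have h2 : blowdown a (t, z) = 0 := by
    rw [← H.symm_eq_iff hp.2, ← H.map_eq _ hp]
    exact hx
  obtain ⟨l, hl⟩ := Function.ne_iff.1 hp.1
  have ht : t = 0 := by
    have := congrFun h2 l
    simp only [blowdown, Pi.zero_apply, mul_eq_zero, pow_eq_zero_iff (H.pos l).ne'] at this
    exact this.resolve_right hl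
  subst ht
  obtain ⟨y, hy⟩ := H.exists_slicePt_eq hl
  exact ⟨l, _, H.cons_zero_mem l y, hy⟩

/-- The chart of the exceptional divisor given by the slice `z_j = 1`. -/
def divisorChart (S : Suborbifold 𝓧 (g ⁻¹' {x₀}) n) : S.orb.maximal.charts :=
  S.orb.mkChart {y | (Fin.cons 0 y : Cn (n + 1)) ∈ (H.sliceChart j).1.dom}
    ((H.sliceChart j).1.isOpen_dom.preimage (tailIncl n).continuous)
    (rootsGroup (a j) (tailHom a j)) (finite_rootsGroup (H.pos j) _)
    (fun _ _ _ _ => H.cons_zero_mem j _)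
    (fun y => ⟨(H.sliceChart j).1.proj (Fin.cons 0 y),
      (H.mem_exceptional j (H.cons_zero_mem j y)).2 (by simp)⟩)
    (fun y hy z hz => by
      rw [Subtype.mk.injEq, (H.sliceChart j).1.proj_eq_iff _ hy _ hz]
      constructor
      · rintro ⟨γ, hγ, h⟩
        obtain ⟨s, hs, rfl⟩ := mem_rootsGroup.1 hγ
        refine ⟨_, mem_rootsGroup.2 ⟨s, hs, rfl⟩, ?_⟩
        ext l
        have := congrFun h l.succ
        simpa [sliceHom_apply_succ, tailHom_apply] using this
      · rintro ⟨γ, hγ, rfl⟩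
        obtain ⟨s, hs, rfl⟩ := mem_rootsGroup.1 hγ
        refine ⟨_, mem_rootsGroup.2 ⟨s, hs, rfl⟩, ?_⟩
        ext l
        refine Fin.cases ?_ (fun l => ?_) l
        · simp [sliceHom_apply_zero]
        · simp [sliceHom_apply_succ, tailHom_apply])
    (S.locallyEquivalent_hyperplane (H.sliceChart j) (fun _ hu => H.mem_exceptional j hu)
      fun _ _ => rfl)

theorem card_divisorChart (hn : 1 ≤ n) (S : Suborbifold 𝓧 (g ⁻¹' {x₀}) n) :
    Nat.card (H.divisorChart j S).1.group = a j :=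
  card_rootsGroup (H.pos j) fun s hs h => tailHom_injective hn H.coprime j s hs h

end LocalModel

end Model

/-! ### The angular form of the weighted action -/

section Radial

variable {n m : ℕ}

/-- The angular form `Im ⟨w, dw⟩ / |w|²`, which restricts to `dθ` on every complex line through the
origin. -/
def radialForm (m : ℕ) (w : Cn m) : Alt m 1 :=
  ContinuousAlternatingMap.ofSubsingleton ℝ (Cn m) ℝ (0 : Fin 1)
    ((∑ l, ‖w l‖ ^ 2)⁻¹ • Complex.imCLM.comp (∑ l, (starRingEnd ℂ) (w l) •
      ContinuousLinearMap.proj (R := ℝ) (φ := fun _ : Fin m => ℂ) l))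

theorem radialForm_apply (w : Cn m) (v : Fin 1 → Cn m) :
    radialForm m w v = (∑ l, (starRingEnd ℂ) (w l) * v 0 l).im / ∑ l, ‖w l‖ ^ 2 := by
  simp [radialForm, div_eq_inv_mul]

theorem sum_norm_sq_pos {w : Cn m} (hw : w ≠ 0) : 0 < ∑ l, ‖w l‖ ^ 2 := by
  obtain ⟨l, hl⟩ := Function.ne_iff.1 hw
  exact Finset.sum_pos' (fun _ _ => by positivity) ⟨l, Finset.mem_univ _, by
    have := norm_pos_iff.2 hl
    positivity⟩

theorem contDiff_norm_sq_apply (l : Fin m) : ContDiff ℝ ∞ fun w : Cn m => ‖w l‖ ^ 2 :=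
  (contDiff_norm_sq ℝ).comp (contDiff_apply ℝ ℂ l)

theorem contDiffAt_radialForm {w : Cn m} (hw : w ≠ 0) : ContDiffAt ℝ ∞ (radialForm m) w := by
  have h1 : ContDiffAt ℝ ∞ (fun w : Cn m => (∑ l, ‖w l‖ ^ 2)⁻¹) w :=
    (ContDiff.sum fun l _ => contDiff_norm_sq_apply l).contDiffAt.inv (sum_norm_sq_pos hw).ne'
  have h2 : ContDiff ℝ ∞ fun w : Cn m => (∑ l, (starRingEnd ℂ) (w l) •
      ContinuousLinearMap.proj (R := ℝ) (φ := fun _ : Fin m => ℂ) l) :=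
    ContDiff.sum fun l _ => (Complex.conjCLE.contDiff.comp (contDiff_apply ℝ ℂ l)).smul contDiff_const
  exact (ContinuousAlternatingMap.ofSubsingletonLIE (𝕜 := ℝ) (E := Cn m) (F := ℝ)
    (0 : Fin 1)).contDiff.contDiffAt.comp w (h1.smul (contDiffAt_const.clm_comp h2.contDiffAt))

/-- The pullback of the angular form by a map. -/
def pullRadial (G : Cn m → Cn n) (u : Cn m) : Alt m 1 :=
  (radialForm n (G u)).compContinuousLinearMap (fderiv ℝ G u)

theorem contDiffAt_pullRadial {G : Cn m → Cn n} {u : Cn m} (hG : ContDiffAt ℝ ∞ G u)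
    (h0 : G u ≠ 0) : ContDiffAt ℝ ∞ (pullRadial G) u :=
  contDiffAt_comp ((contDiffAt_radialForm h0).comp u hG) (hG.fderiv_right (m := ∞) (by simp))

theorem pullRadial_comp {k : ℕ} {G : Cn m → Cn n} {F : Cn k → Cn m} {u : Cn k}
    (hG : DifferentiableAt ℝ G (F u)) (hF : DifferentiableAt ℝ F u) :
    pullRadial (fun w => G (F w)) u =
      (pullRadial G (F u)).compContinuousLinearMap (fderiv ℝ F u) := by
  rw [pullRadial, fderiv_fun_comp u hG hF]
  rfl

theorem pullRadial_congr {G G' : Cn m → Cn n} {u : Cn m} (h : G =ᶠ[𝓝 u] G') :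
    pullRadial G u = pullRadial G' u := by
  rw [pullRadial, pullRadial, h.fderiv_eq, h.eq_of_nhds]

/-- The angular form of a product is the sum of the angular forms of the factors. -/
theorem pullRadial_smul {s : Cn m → ℂ} {Z : Cn m → Cn n} {u : Cn m} (hs : DifferentiableAt ℝ s u)
    (hZ : DifferentiableAt ℝ Z u) (hs0 : s u ≠ 0) (hZ0 : Z u ≠ 0) (v : Fin 1 → Cn m) :
    pullRadial (fun w => s w • Z w) u v = (fderiv ℝ s u (v 0) / s u).im + pullRadial Z u v := by
  have hZp := (sum_norm_sq_pos hZ0).ne'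
  have hsp : ‖s u‖ ^ 2 ≠ 0 := by
    have := norm_pos_iff.2 hs0
    positivity
  simp only [pullRadial, ContinuousAlternatingMap.compContinuousLinearMap_apply, radialForm_apply,
    Function.comp_apply]
  have h1 : ∀ l, fderiv ℝ (fun w => s w • Z w) u (v 0) l =
      s u * fderiv ℝ Z u (v 0) l + fderiv ℝ s u (v 0) * Z u l := by
    intro l
    rw [fderiv_fun_smul hs hZ]
    simp
  have h2 : ∑ l, (starRingEnd ℂ) ((s u • Z u) l) * fderiv ℝ (fun w => s w • Z w) u (v 0) l =
      ((‖s u‖ ^ 2 : ℝ) : ℂ) * (((∑ l, ‖Z u l‖ ^ 2 : ℝ) : ℂ) * (fderiv ℝ s u (v 0) / s u) +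
        ∑ l, (starRingEnd ℂ) (Z u l) * fderiv ℝ Z u (v 0) l) := by
    push_cast
    rw [Finset.sum_mul, ← Finset.sum_add_distrib, Finset.mul_sum]
    refine Finset.sum_congr rfl fun l _ => ?_
    rw [h1, Pi.smul_apply, smul_eq_mul, map_mul, ← Complex.conj_mul', ← Complex.conj_mul']
    field_simp
    ring
  have h3 : ∑ l, ‖(s u • Z u) l‖ ^ 2 = ‖s u‖ ^ 2 * ∑ l, ‖Z u l‖ ^ 2 := by
    rw [Finset.mul_sum]
    exact Finset.sum_congr rfl fun l _ => by rw [Pi.smul_apply, norm_smul, mul_pow]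
  rw [h2, h3, Complex.im_ofReal_mul, Complex.add_im, Complex.im_ofReal_mul]
  field_simp

end Radial

section Weights

variable {n : ℕ}

/-- The map `w ↦ (w_l ^ (A / a_l))`, where `A` is the product of the weights. It transforms the
action with weights `a` into the action with all weights equal to `A`. -/
def weightPow (a : Fin n → ℕ) (w : Cn n) : Cn n := fun l => w l ^ ((∏ i, a i) / a l)

theorem contDiff_weightPow (a : Fin n → ℕ) : ContDiff ℝ ∞ (weightPow a) :=
  contDiff_pi.2 fun l => (contDiff_apply ℝ ℂ l).pow _

theorem mul_div_weight {a : Fin n → ℕ} (l : Fin n) : a l * ((∏ i, a i) / a l) = ∏ i, a i :=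
  Nat.mul_div_cancel' (Finset.dvd_prod_of_mem a (Finset.mem_univ l))

theorem weightPow_ne_zero {a : Fin n → ℕ} {w : Cn n} (hw : w ≠ 0) : weightPow a w ≠ 0 := by
  obtain ⟨l, hl⟩ := Function.ne_iff.1 hw
  exact Function.ne_iff.2 ⟨l, pow_ne_zero _ hl⟩

theorem weightPow_blowdown (a : Fin n → ℕ) (p : ℂ × Cn n) :
    weightPow a (blowdown a p) = p.1 ^ (∏ i, a i) • weightPow a p.2 := by
  ext l
  simp only [weightPow, blowdown, mul_pow, Pi.smul_apply, smul_eq_mul]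
  rw [← pow_mul, mul_div_weight]

/-- The connection form `dθ / 2π` of the action with weights `a`. -/
def weightForm (a : Fin n → ℕ) (w : Cn n) : Alt n 1 :=
  ((2 * Real.pi * ∏ i, a i)⁻¹ : ℝ) • pullRadial (weightPow a) w

theorem contDiffAt_weightForm (a : Fin n → ℕ) {w : Cn n} (hw : w ≠ 0) :
    ContDiffAt ℝ ∞ (weightForm a) w :=
  (contDiffAt_pullRadial (contDiff_weightPow a).contDiffAt (weightPow_ne_zero hw)).const_smul _

/-- The map `y ↦ (y_l ^ (A / a_l))` on the slice `z_j = 1`, as a map to the full space. -/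
def slicePow (a : Fin (n + 1) → ℕ) (j : Fin (n + 1)) (y : Cn n) : Cn (n + 1) :=
  weightPow a (j.insertNth 1 y)

theorem contDiff_insertNth (j : Fin (n + 1)) :
    ContDiff ℝ ∞ fun y : Cn n => (j.insertNth 1 y : Cn (n + 1)) := by
  rw [contDiff_pi]
  intro i
  refine Fin.succAboveCases j ?_ (fun i => ?_) i
  · simp only [Fin.insertNth_apply_same]
    exact contDiff_const
  · simp only [Fin.insertNth_apply_succAbove]
    exact contDiff_apply ℝ ℂ i

theorem contDiff_slicePow (a : Fin (n + 1) → ℕ) (j : Fin (n + 1)) : ContDiff ℝ ∞ (slicePow a j) :=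
  (contDiff_weightPow a).comp (contDiff_insertNth j)

theorem slicePow_ne_zero (a : Fin (n + 1) → ℕ) (j : Fin (n + 1)) (y : Cn n) :
    slicePow a j y ≠ 0 := weightPow_ne_zero (insertNth_one_ne_zero j y)

/-- The connection form on the slice `z_j = 1`. -/
def sliceForm (a : Fin (n + 1) → ℕ) (j : Fin (n + 1)) (y : Cn n) : Alt n 1 :=
  ((2 * Real.pi * ∏ i, a i)⁻¹ : ℝ) • pullRadial (slicePow a j) y

theorem contDiff_sliceForm (a : Fin (n + 1) → ℕ) (j : Fin (n + 1)) :
    ContDiff ℝ ∞ (sliceForm a j) :=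
  contDiff_iff_contDiffAt.2 fun y =>
    (contDiffAt_pullRadial (contDiff_slicePow a j).contDiffAt (slicePow_ne_zero a j y)).const_smul _

theorem fderiv_tailProj (u : Cn (n + 1)) :
    fderiv ℝ (tailProj n) u = (tailProj n).restrictScalars ℝ :=
  ((tailProj n).restrictScalars ℝ).fderiv

/-- On the slice `z_j = 1` the connection form is `dθ / 2π` in the direction of `t`, plus a form
pulled back from the exceptional divisor. -/
theorem weightForm_slice {a : Fin (n + 1) → ℕ} (ha : ∀ j, 0 < a j) (j : Fin (n + 1))
    {u : Cn (n + 1)} (hu : u 0 ≠ 0) :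
    (weightForm a (blowdown a (slicePt j u))).compContinuousLinearMap
        (fderiv ℝ (fun w => blowdown a (slicePt j w)) u) =
      (2 * Real.pi)⁻¹ • angForm n u +
        (sliceForm a j (tailProj n u)).compContinuousLinearMap
          ((tailProj n).restrictScalars ℝ) := by
  have hA : ((∏ i, a i : ℕ) : ℝ) ≠ 0 :=
    Nat.cast_ne_zero.2 (Finset.prod_pos fun i _ => ha i).ne'
  have hb : DifferentiableAt ℝ (fun w => blowdown a (slicePt j w)) u :=
    (((contDiff_blowdown_slicePt a j).restrict_scalars ℝ).contDiffAt).differentiableAt (by simp)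
  -- Raising to the powers `A / a_l` turns the blow-down map into multiplication of `slicePow` by
  -- `t ^ A`, to which `pullRadial_smul` applies.
  have e1 : (pullRadial (weightPow a) (blowdown a (slicePt j u))).compContinuousLinearMap
        (fderiv ℝ (fun w => blowdown a (slicePt j w)) u) =
      pullRadial (fun w : Cn (n + 1) => w 0 ^ (∏ i, a i) • slicePow a j (tailProj n w)) u := by
    rw [← pullRadial_comp (G := weightPow a) (F := fun w => blowdown a (slicePt j w))
      (((contDiff_weightPow a).contDiffAt).differentiableAt (by simp)) hb]
    refine pullRadial_congr (Filter.Eventually.of_forall fun w => ?_)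
    exact weightPow_blowdown a _
  have e2 : (pullRadial (slicePow a j) (tailProj n u)).compContinuousLinearMap
      ((tailProj n).restrictScalars ℝ) = pullRadial (fun w => slicePow a j (tailProj n w)) u := by
    rw [← fderiv_tailProj u]
    exact (pullRadial_comp (((contDiff_slicePow a j).contDiffAt).differentiableAt (by simp))
      (((tailProj n).restrictScalars ℝ).differentiableAt)).symm
  have hs : HasFDerivAt (fun w : Cn (n + 1) => w 0 ^ (∏ i, a i))
      (((∏ i, a i : ℕ) * u 0 ^ ((∏ i, a i) - 1)) •
        ContinuousLinearMap.proj (R := ℝ) (φ := fun _ : Fin (n + 1) => ℂ) 0) u := by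
    have h1 := ((hasDerivAt_pow (∏ i, a i) (u 0)).hasFDerivAt.restrictScalars ℝ).comp u
      (ContinuousLinearMap.proj (R := ℝ) (φ := fun _ : Fin (n + 1) => ℂ) 0).hasFDerivAt
    refine h1.congr_fderiv ?_
    ext v
    simp [mul_comm]
  have hZ : DifferentiableAt ℝ (fun w => slicePow a j (tailProj n w)) u :=
    (((contDiff_slicePow a j).contDiffAt).differentiableAt (by simp)).comp u
      ((tailProj n).restrictScalars ℝ).differentiableAt
  ext v
  have e3 := congrArg (fun β => β v) e1
  have e4 := congrArg (fun β => β v) e2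
  simp only [weightForm, sliceForm, ContinuousAlternatingMap.compContinuousLinearMap_apply,
    ContinuousAlternatingMap.add_apply, ContinuousAlternatingMap.smul_apply] at e3 e4 ⊢
  rw [e3, e4, pullRadial_smul hs.differentiableAt hZ (pow_ne_zero _ hu)
    (slicePow_ne_zero a j _), hs.fderiv, angForm_apply, smul_add]
  congr 1
  have e5 : ((((∏ i, a i : ℕ) * u 0 ^ ((∏ i, a i) - 1)) •
        ContinuousLinearMap.proj (R := ℝ) (φ := fun _ : Fin (n + 1) => ℂ) 0) (v 0) /
          u 0 ^ (∏ i, a i)) = ((∏ i, a i : ℕ) : ℝ) * (v 0 0 / u 0) := by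
    have h2 : u 0 ^ (∏ i, a i) = u 0 ^ ((∏ i, a i) - 1) * u 0 := by
      rw [← pow_succ, Nat.sub_add_cancel (Finset.prod_pos fun i _ => ha i)]
    rw [h2]
    simp only [smul_apply, ContinuousLinearMap.proj_apply, smul_eq_mul,
      Complex.ofReal_natCast]
    field_simp
  rw [e5, Complex.im_ofReal_mul, smul_eq_mul, smul_eq_mul]
  push_cast at hA ⊢
  field_simp

end Weights

/-! ### Closed forms that extend over a divisor -/

section Extension

variable {n : ℕ} {X : Type*} [TopologicalSpace X]

theorem extDeriv_comp_transition {X : Type*} {s t : Set (Cn n)} {p q : Cn n → X} {k : ℕ}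
    {h : OpenPartialHomeomorph (Cn n) (Cn n)} (hh : IsTransition s p t q h) {w : Cn n}
    (hw : w ∈ h.source) {α : Cn n → Alt n k} (hα : DifferentiableAt ℝ α (h w)) :
    extDeriv (fun v => (α (h v)).compContinuousLinearMap (fderiv ℝ h v)) w =
      (extDeriv α (h w)).compContinuousLinearMap (fderiv ℝ h w) := by
  refine extDeriv_pullback (r := ∞) hα (hh.contDiffAt hw) ?_
  simp only [minSmoothness_of_isRCLikeNormedField]
  exact ENat.LEInfty.out

theorem contDiffAt_comp_transition {X : Type*} {s t : Set (Cn n)} {p q : Cn n → X} {k : ℕ}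
    {h : OpenPartialHomeomorph (Cn n) (Cn n)} (hh : IsTransition s p t q h) {w : Cn n}
    (hw : w ∈ h.source) {α : Cn n → Alt n k} (hα : ContDiffAt ℝ ∞ α (h w)) :
    ContDiffAt ℝ ∞ (fun v => (α (h v)).compContinuousLinearMap (fderiv ℝ h v)) w :=
  contDiffAt_comp (hα.comp w (hh.contDiffAt hw))
    ((hh.contDiffAt hw).fderiv_right (m := ∞) (by simp))

theorem extDeriv_extDeriv_eq_zero {k : ℕ} {α : Cn n → Alt n k} {u : Cn n}
    (hα : ContDiffAt ℝ ∞ α u) : extDeriv (extDeriv α) u = 0 := by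
  refine extDeriv_extDeriv_apply hα ?_
  simp only [minSmoothness_of_isRCLikeNormedField]
  exact ENat.LEInfty.out

/-- The differential of a form on the complement of a divisor extends over the divisor to a closed
form, if it does so in charts covering the divisor. -/
theorem ComplexOrbifold.exists_closedForms_extension (𝓧 : ComplexOrbifold n X) {E : Set X}
    (hE : IsClosed E) {k : ℕ} {ξ : 𝓧.Family k} (hξ : 𝓧.Natural ξ)
    (hξs : ∀ c, ∀ u ∈ c.1.dom, c.1.proj u ∉ E → ContDiffAt ℝ ∞ (ξ c) u)
    {J : Type*} (P : J → 𝓧.charts) (hcov : ∀ x ∈ E, ∃ j, x ∈ (P j).1.image)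
    (hdense : ∀ j, ∀ u ∈ (P j).1.dom, u ∈ closure {w | w ∈ (P j).1.dom ∧ (P j).1.proj w ∉ E})
    (σ : J → Cn n → Alt n k) (hσ : ∀ j, ContDiffOn ℝ ∞ (σ j) (P j).1.dom)
    (hξσ : ∀ j, ∀ u ∈ (P j).1.dom, (P j).1.proj u ∉ E →
      extDeriv (ξ (P j)) u = extDeriv (σ j) u) :
    ∃ τ ∈ 𝓧.closedForms (k + 1),
      (∀ c, ∀ u ∈ c.1.dom, c.1.proj u ∉ E → τ c u = extDeriv (ξ c) u) ∧
      ∀ j, ∀ u ∈ (P j).1.dom, τ (P j) u = extDeriv (σ j) u := by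
  let off : 𝓧.charts → Set (Cn n) := fun c => {w | w ∈ c.1.dom ∧ c.1.proj w ∉ E}
  have hoff : ∀ c, IsOpen (off c) := fun c =>
    c.1.continuousOn_proj.isOpen_inter_preimage c.1.isOpen_dom hE.isOpen_compl
  -- The extension by continuity. Near the divisor it is given by the differentials of the `σ j`
  -- (`h2`), so it is smooth there.
  let τ : 𝓧.Family (k + 1) := fun c => extendFrom (off c) (extDeriv (ξ c))
  have h1 : ∀ c, ∀ u ∈ off c, τ c u = extDeriv (ξ c) u := fun c u hu =>
    extendFrom_eq (subset_closure hu)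
      ((contDiffAt_extDeriv (hξs c u hu.1 hu.2)).continuousAt.mono_left nhdsWithin_le_nhds)
  have hσs : ∀ j, ∀ u ∈ (P j).1.dom, ContDiffAt ℝ ∞ (σ j) u := fun j u hu =>
    (hσ j).contDiffAt ((P j).1.isOpen_dom.mem_nhds hu)
  have h2 : ∀ c j h, IsTransition c.1.dom c.1.proj (P j).1.dom (P j).1.proj h →
      ∀ w ∈ h.source, τ c w =
        (extDeriv (σ j) (h w)).compContinuousLinearMap (fderiv ℝ h w) := by
    intro c j h hh w hw
    have hhw := hh.target_subset (h.map_source hw)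
    refine extendFrom_eq ?_ ?_
    · have h3 : h w ∈ closure (h.target ∩ off (P j)) :=
        h.open_target.inter_closure ⟨h.map_source hw, hdense j _ hhw⟩
      have h4 := ((h.continuousAt_symm (h.map_source hw)).continuousWithinAt).mem_closure
        (t := off c) h3 fun v hv => ⟨hh.source_subset (h.map_target hv.1), by
          have := hh.symm.comm v hv.1
          rw [this]
          exact hv.2.2⟩
      rwa [h.left_inv hw] at h4
    · refine Filter.Tendsto.congr' ?_ ((contDiffAt_comp_transition hh hw
        (contDiffAt_extDeriv (hσs j _ hhw))).continuousAt.mono_left nhdsWithin_le_nhds)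
      filter_upwards [self_mem_nhdsWithin, mem_nhdsWithin_of_mem_nhds
        (h.open_source.mem_nhds hw)] with v hv hvs
      have hhv := hh.target_subset (h.map_source hvs)
      have hvE : (P j).1.proj (h v) ∉ E := by
        rw [hh.comm v hvs]
        exact hv.2
      rw [hξ.extDeriv_eq hh hvs ((hξs (P j) _ hhv hvE).differentiableAt (by simp)),
        hξσ j _ hhv hvE]
  have h3 : ∀ c : 𝓧.charts, ∀ u ∈ c.1.dom, c.1.proj u ∈ E → ∃ j h,
      IsTransition c.1.dom c.1.proj (P j).1.dom (P j).1.proj h ∧ u ∈ h.source := by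
    intro c u hu huE
    obtain ⟨j, v, hv, hvu⟩ := hcov _ huE
    obtain ⟨h, hh, hus, -⟩ := 𝓧.compatible c.1 c.2 _ (P j).2 u hu v hv hvu.symm
    exact ⟨j, h, hh, hus⟩
  have h4 : ∀ c, ∀ u ∈ c.1.dom, ContDiffAt ℝ ∞ (τ c) u ∧ extDeriv (τ c) u = 0 := by
    intro c u hu
    by_cases huE : c.1.proj u ∈ E
    · obtain ⟨j, h, hh, hus⟩ := h3 c u hu huE
      have hev : τ c =ᶠ[𝓝 u] fun w =>
          (extDeriv (σ j) (h w)).compContinuousLinearMap (fderiv ℝ h w) := by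
        filter_upwards [h.open_source.mem_nhds hus] with w hw
        exact h2 c j h hh w hw
      have hs := hσs j _ (hh.target_subset (h.map_source hus))
      have hs' := contDiffAt_extDeriv hs
      refine ⟨(contDiffAt_comp_transition hh hus hs').congr_of_eventuallyEq hev, ?_⟩
      rw [hev.extDeriv_eq, extDeriv_comp_transition hh hus (hs'.differentiableAt (by simp)),
        extDeriv_extDeriv_eq_zero hs]
      rfl
    · have hev : τ c =ᶠ[𝓝 u] extDeriv (ξ c) := by
        filter_upwards [(hoff c).mem_nhds ⟨hu, huE⟩] with w hw
        exact h1 c w hw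
      have hs := hξs c u hu huE
      refine ⟨(contDiffAt_extDeriv hs).congr_of_eventuallyEq hev, ?_⟩
      rw [hev.extDeriv_eq, extDeriv_extDeriv_eq_zero hs]
  refine ⟨τ, ⟨⟨fun c u hu => (h4 c u hu).1.contDiffWithinAt, fun c d h hh w hw => ?_⟩,
    fun c u hu => (h4 c u hu).2⟩, fun c u hu huE => h1 c u ⟨hu, huE⟩, fun j u hu => ?_⟩
  · have hwc := hh.source_subset hw
    have hwd := hh.target_subset (h.map_source hw)
    by_cases hwE : d.1.proj (h w) ∈ E
    · obtain ⟨j, l, hl, hwl⟩ := h3 d _ hwd hwE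
      have hsrc : w ∈ (h.trans l).source := by
        rw [OpenPartialHomeomorph.trans_source]
        exact ⟨hw, hwl⟩
      rw [h2 c j _ (hh.trans hl) w hsrc, h2 d j l hl _ hwl, hh.fderiv_trans hl hw hwl]
      rfl
    · have hwE' : c.1.proj w ∉ E := by
        rw [← hh.comm w hw]
        exact hwE
      rw [h1 c w ⟨hwc, hwE'⟩, h1 d _ ⟨hwd, hwE⟩]
      exact hξ.extDeriv_eq hh hw ((hξs d _ hwd hwE).differentiableAt (by simp))
  · rw [h2 (P j) j _ (IsTransition.refl (P j).1.isOpen_dom) u hu]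
    have : fderiv ℝ (OpenPartialHomeomorph.ofSet (P j).1.dom (P j).1.isOpen_dom) u =
        ContinuousLinearMap.id ℝ (Cn n) := fderiv_id
    rw [this]
    rfl

end Extension

/-! ### Holomorphic maps in general charts -/

section HolomorphicCharts

variable {n m : ℕ} {X : Type*} [TopologicalSpace X] {M : Type*} [TopologicalSpace M]
  [ChartedSpace (Cn m) M] {𝓧 : ComplexOrbifold n X}

theorem HolomorphicMap.continuous (f : HolomorphicMap 𝓧 m M) : Continuous f.toFun := by
  rw [continuous_iff_continuousAt]
  intro x
  obtain ⟨c, hc, u, hu, rfl⟩ := 𝓧.cover x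
  intro O hO
  have h1 := ((f.holomorphic c hc).contMDiffAt (c.isOpen_dom.mem_nhds hu)).continuousAt hO
  obtain ⟨W, hW, hWo, huW⟩ := mem_nhds_iff.1 (Filter.inter_mem h1 (c.isOpen_dom.mem_nhds hu))
  rw [Filter.mem_map]
  refine Filter.mem_of_superset ((c.isOpen_image W (fun w hw => (hW hw).2) hWo).mem_nhds
    ⟨u, huW, rfl⟩) ?_
  rintro _ ⟨w, hw, rfl⟩
  exact (hW hw).1

theorem HolomorphicMap.contMDiffAt_maximal (f : HolomorphicMap 𝓧 m M) (p : 𝓧.maximal.charts)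
    {u : Cn n} (hu : u ∈ p.1.dom) :
    ContMDiffAt 𝓘(ℂ, Cn n) 𝓘(ℂ, Cn m) ω (fun w => f.toFun (p.1.proj w)) u := by
  obtain ⟨⟨c, h⟩, hh, hus⟩ := 𝓧.exists_transition p hu
  have h1 := (f.holomorphic c.1 c.2).contMDiffAt
    (c.1.isOpen_dom.mem_nhds (hh.target_subset (h.map_source hus)))
  have h2 : ContMDiffAt 𝓘(ℂ, Cn n) 𝓘(ℂ, Cn n) ω h u :=
    (hh.holomorphic.contDiffAt (h.open_source.mem_nhds hus)).contMDiffAt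
  refine (ContMDiffAt.comp u h1 h2).congr_of_eventuallyEq ?_
  filter_upwards [h.open_source.mem_nhds hus] with w hw
  exact congrArg f.toFun (hh.comm w hw).symm

theorem HolomorphicMap.contDiffAt_chart (f : HolomorphicMap 𝓧 m M) (p : 𝓧.maximal.charts)
    {φ : OpenPartialHomeomorph M (Cn m)} (hφ : φ ∈ IsManifold.maximalAtlas 𝓘(ℂ, Cn m) ω M)
    {u : Cn n} (hu : u ∈ p.1.dom) (hs : f.toFun (p.1.proj u) ∈ φ.source) :
    ContDiffAt ℂ ω (fun w => φ (f.toFun (p.1.proj w))) u :=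
  contMDiffAt_iff_contDiffAt.1 (ContMDiffAt.comp u (contMDiffAt_of_mem_maximalAtlas hφ hs)
    (f.contMDiffAt_maximal p hu))

open scoped Classical in
/-- The pullback of a form supported in the target of a chart `φ`, along a map to the manifold. -/
def chartPullback (𝓧 : ComplexOrbifold n X) (g : X → M) (φ : OpenPartialHomeomorph M (Cn m)) {k : ℕ}
    (κ : Cn m → Alt m k) : 𝓧.Family k := fun c u =>
  if g (c.1.proj u) ∈ φ.source then
    (κ (φ (g (c.1.proj u)))).compContinuousLinearMap
      (fderiv ℝ (fun w => φ (g (c.1.proj w))) u)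
  else 0

theorem HolomorphicMap.natural_chartPullback (f : HolomorphicMap 𝓧 m M)
    {φ : OpenPartialHomeomorph M (Cn m)} (hφ : φ ∈ IsManifold.maximalAtlas 𝓘(ℂ, Cn m) ω M) {k : ℕ}
    (κ : Cn m → Alt m k) : 𝓧.maximal.Natural (chartPullback 𝓧.maximal f.toFun φ κ) := by
  intro c d h hh w hw
  have h0 := hh.comm w hw
  by_cases hs : f.toFun (c.1.proj w) ∈ φ.source
  · have hs' : f.toFun (d.1.proj (h w)) ∈ φ.source := by rwa [h0]
    simp only [chartPullback, if_pos hs, if_pos hs']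
    rw [h0]
    have hd := hh.target_subset (h.map_source hw)
    have h1 : (fun v => φ (f.toFun (c.1.proj v))) =ᶠ[𝓝 w]
        fun v => (fun v => φ (f.toFun (d.1.proj v))) (h v) := by
      filter_upwards [h.open_source.mem_nhds hw] with v hv
      simp only [hh.comm v hv]
    rw [h1.fderiv_eq, fderiv_fun_comp w (((f.contDiffAt_chart d hφ hd hs').restrict_scalars ℝ).differentiableAt (by simp))
      ((hh.contDiffAt hw).differentiableAt (by simp))]
    rfl
  · have hs' : f.toFun (d.1.proj (h w)) ∉ φ.source := by rwa [h0]
    simp only [chartPullback, if_neg hs, if_neg hs']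
    rfl

theorem HolomorphicMap.contDiffAt_chartPullback (f : HolomorphicMap 𝓧 m M)
    {φ : OpenPartialHomeomorph M (Cn m)} (hφ : φ ∈ IsManifold.maximalAtlas 𝓘(ℂ, Cn m) ω M) {k : ℕ}
    {κ : Cn m → Alt m k} (p : 𝓧.maximal.charts) {u : Cn n} (hu : u ∈ p.1.dom)
    (hs : f.toFun (p.1.proj u) ∈ φ.source)
    (hκ : ContDiffAt ℝ ∞ κ (φ (f.toFun (p.1.proj u)))) :
    ContDiffAt ℝ ∞ (chartPullback 𝓧.maximal f.toFun φ κ p) u := by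
  have h1 : ContDiffAt ℝ ω (fun w => φ (f.toFun (p.1.proj w))) u :=
    (f.contDiffAt_chart p hφ hu hs).restrict_scalars ℝ
  refine (contDiffAt_comp (ContDiffAt.comp u hκ (h1.of_le le_top))
    (h1.fderiv_right (m := ∞) le_top)).congr_of_eventuallyEq ?_
  filter_upwards [(f.contMDiffAt_maximal p hu).continuousAt (φ.open_source.mem_nhds hs)] with w hw
  exact if_pos hw

theorem HolomorphicMap.eventually_chartPullback_eq_zero [T2Space M] (f : HolomorphicMap 𝓧 m M)
    {φ : OpenPartialHomeomorph M (Cn m)} {k : ℕ}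
    {κ : Cn m → Alt m k} {K : Set (Cn m)} (hK : IsCompact K) (hKφ : K ⊆ φ.target)
    (hκ : ∀ w ∉ K, κ w = 0) (p : 𝓧.maximal.charts) {u : Cn n} (hu : u ∈ p.1.dom)
    (hs : f.toFun (p.1.proj u) ∉ φ.source) :
    chartPullback 𝓧.maximal f.toFun φ κ p =ᶠ[𝓝 u] 0 := by
  have h1 : IsClosed (φ.symm '' K) := (hK.image_of_continuousOn (φ.continuousOn_symm.mono hKφ)).isClosed
  have h2 : f.toFun (p.1.proj u) ∈ (φ.symm '' K)ᶜ := by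
    rintro ⟨w, hw, hw'⟩
    exact hs (hw' ▸ φ.map_target (hKφ hw))
  filter_upwards [(f.contMDiffAt_maximal p hu).continuousAt (h1.isOpen_compl.mem_nhds h2)] with w hw
  simp only [chartPullback, Pi.zero_apply]
  split_ifs with h3
  · rw [hκ _ fun h4 => hw ⟨_, h4, φ.left_inv h3⟩]
    rfl
  · rfl

end HolomorphicCharts

/-! ### The Thom form of the exceptional divisor -/

section Thom

/-- The angular form is closed. -/
theorem extDeriv_angForm {n : ℕ} {u : Cn (n + 1)} (hu : u 0 ≠ 0) : extDeriv (angForm n) u = 0 := by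
  have hd : DifferentiableAt ℝ (angForm n) u := (contDiffAt_angForm hu).differentiableAt (by simp)
  have h1 : ∀ c : ℂ, ∀ v : Cn (n + 1),
      fderiv ℝ (fun w : Cn (n + 1) => (c / w 0).im) u v = (-(c * v 0) / u 0 ^ 2).im := by
    intro c v
    have h2 : HasFDerivAt (fun z : ℂ => c * z⁻¹) _ (u 0) :=
      ((hasDerivAt_inv hu).const_mul c).hasFDerivAt.restrictScalars ℝ
    have h3 := Complex.imCLM.hasFDerivAt.comp u (h2.comp u
      (ContinuousLinearMap.proj (R := ℝ) (φ := fun _ : Fin (n + 1) => ℂ) 0).hasFDerivAt)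
    have h4 : (fun w : Cn (n + 1) => (c / w 0).im) = Complex.imCLM ∘ (fun z : ℂ => c * z⁻¹) ∘
        ContinuousLinearMap.proj (R := ℝ) (φ := fun _ : Fin (n + 1) => ℂ) 0 := by
      ext w
      simp [div_eq_mul_inv]
    rw [h4, h3.fderiv]
    change (v 0 • (c * -(u 0 ^ 2)⁻¹)).im = _
    refine congrArg Complex.im ?_
    rw [smul_eq_mul]
    field_simp
  ext v
  rw [extDeriv_apply hd v, Fin.sum_univ_two]
  simp only [angForm_apply, h1, Fin.removeNth, Fin.val_zero, Fin.val_one, pow_zero, pow_one]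
  simp
  ring_nf

variable {n : ℕ} {X : Type*} [TopologicalSpace X] {M : Type*} [TopologicalSpace M]
  [ChartedSpace (Cn (n + 1)) M] {𝓧 : ComplexOrbifold (n + 1) X}

namespace LocalModel

variable {f : HolomorphicMap 𝓧 (n + 1) M} {a : Fin (n + 1) → ℕ} {x₀ : M}
  {φ : OpenPartialHomeomorph M (Cn (n + 1))} {Ψ : ℂ × Cn (n + 1) → X}

theorem chart_map_proj (H : LocalModel 𝓧 f.toFun a x₀ φ Ψ) (j : Fin (n + 1)) {u : Cn (n + 1)}
    (hu : u ∈ (H.sliceChart j).1.dom) : f.toFun ((H.sliceChart j).1.proj u) ∈ φ.source ∧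
      φ (f.toFun ((H.sliceChart j).1.proj u)) = blowdown a (slicePt j u) := by
  rw [H.map_proj j hu]
  exact ⟨φ.map_target hu, φ.right_inv hu⟩

theorem chartPullback_slice (H : LocalModel 𝓧 f.toFun a x₀ φ Ψ) (j : Fin (n + 1)) {k : ℕ}
    (κ : Cn (n + 1) → Alt (n + 1) k) {u : Cn (n + 1)} (hu : u ∈ (H.sliceChart j).1.dom) :
    chartPullback 𝓧.maximal f.toFun φ κ (H.sliceChart j) u =
      (κ (blowdown a (slicePt j u))).compContinuousLinearMap
        (fderiv ℝ (fun w => blowdown a (slicePt j w)) u) := by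
  have h1 : (fun w => φ (f.toFun ((H.sliceChart j).1.proj w))) =ᶠ[𝓝 u]
      fun w => blowdown a (slicePt j w) := by
    filter_upwards [(H.sliceChart j).1.isOpen_dom.mem_nhds hu] with w hw
    exact (H.chart_map_proj j hw).2
  rw [chartPullback, if_pos (H.chart_map_proj j hu).1, h1.fderiv_eq, h1.eq_of_nhds]

/-- The exceptional divisor of a weighted blow-up has a Poincaré dual `τ` supported near it, whose
restriction to the divisor is minus the curvature of the connection form. It is the differential of
a cut-off of minus the connection form. -/
theorem exists_thomForm [T2Space X] [CompactSpace X] [T2Space M] (hn : 1 ≤ n)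
    (H : LocalModel 𝓧 f.toFun a x₀ φ Ψ)
    (hφ : φ ∈ IsManifold.maximalAtlas 𝓘(ℂ, Cn (n + 1)) ω M) :
    ∃ τ ∈ 𝓧.maximal.closedForms 2,
      (∀ (S : Suborbifold 𝓧 (f.toFun ⁻¹' {x₀}) n), ∀ β ∈ 𝓧.maximal.closedForms (2 * n),
        𝓧.maximal.integral (fun c u => wedge (β c u) (τ c u)) =
          S.orb.maximal.integral (S.maximal.restrict β)) ∧
      (∀ j y, (τ (H.sliceChart j) (Fin.cons 0 y)).compContinuousLinearMap
        ((tailIncl n).restrictScalars ℝ) = -extDeriv (sliceForm a j) y) ∧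
      ∀ c, ∀ u ∈ c.1.dom, f.toFun (c.1.proj u) ∉ φ.source → τ c u = 0 := by
  classical
  have hE : IsClosed (f.toFun ⁻¹' {x₀}) := isClosed_singleton.preimage f.continuous
  -- `κ` is minus the connection form, cut off so that it extends by zero outside the chart `φ`; it
  -- is singular only at the center.
  obtain ⟨r, hr, hrφ⟩ := Metric.nhds_basis_closedBall.mem_iff.1 (φ.open_target.mem_nhds H.zero_mem)
  let χ : ContDiffBump (0 : Cn (n + 1)) := ⟨r / 2, r, by positivity, by linarith⟩
  let κ : Cn (n + 1) → Alt (n + 1) 1 := fun w => -(χ w • weightForm a w)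
  have hκ : ∀ w ≠ 0, ContDiffAt ℝ ∞ κ w := fun w hw =>
    (χ.contDiffAt.smul (contDiffAt_weightForm a hw)).neg
  have hκK : ∀ w ∉ Metric.closedBall (0 : Cn (n + 1)) r, κ w = 0 := fun w hw => by
    have : χ w = 0 := by
      refine χ.zero_of_le_dist ?_
      rw [Metric.mem_closedBall, not_le] at hw
      exact hw.le
    simp only [κ, this, zero_smul, neg_zero]
  let ξ : 𝓧.maximal.Family 1 := chartPullback 𝓧.maximal f.toFun φ κ
  have hξ : 𝓧.maximal.Natural ξ := f.natural_chartPullback hφ κ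
  have hξ0 : ∀ c : 𝓧.maximal.charts, ∀ u ∈ c.1.dom, f.toFun (c.1.proj u) ∉ φ.source →
      ξ c =ᶠ[𝓝 u] 0 := fun c u hu hs =>
    f.eventually_chartPullback_eq_zero (isCompact_closedBall 0 r) hrφ hκK c hu hs
  have hξs : ∀ c : 𝓧.maximal.charts, ∀ u ∈ c.1.dom, c.1.proj u ∉ f.toFun ⁻¹' {x₀} →
      ContDiffAt ℝ ∞ (ξ c) u := by
    intro c u hu huE
    by_cases hs : f.toFun (c.1.proj u) ∈ φ.source
    · refine f.contDiffAt_chartPullback hφ c hu hs (hκ _ fun h => huE ?_)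
      rw [mem_preimage, mem_singleton_iff, ← φ.left_inv hs, h, ← H.center, φ.left_inv H.mem]
    · exact contDiffAt_const.congr_of_eventuallyEq (hξ0 c u hu hs)
  -- Near the exceptional divisor the pullback of `κ` is `-(2π)⁻¹ • angForm n` plus the smooth
  -- form `ν j`, the pullback of minus the connection form on the slice.
  let ν : Fin (n + 1) → Cn (n + 1) → Alt (n + 1) 1 := fun j u =>
    (-sliceForm a j (tailProj n u)).compContinuousLinearMap (fderiv ℝ (tailProj n) u)
  have hν : ∀ j u, ContDiffAt ℝ ∞ (ν j) u := fun j u =>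
    contDiffAt_comp ((contDiff_sliceForm a j).neg.contDiffAt.comp u
      ((tailProj n).restrictScalars ℝ).contDiff.contDiffAt)
      ((((tailProj n).restrictScalars ℝ).contDiff (n := ∞)).contDiffAt.fderiv_right
        (m := ∞) (by simp))
  -- The case distinction fills in the values on the divisor, where the sum of the two singular
  -- forms is not defined; by `hσν` this gives a smooth form.
  let σ : Fin (n + 1) → Cn (n + 1) → Alt (n + 1) 1 := fun j u =>
    if u 0 = 0 then ν j u else ξ (H.sliceChart j) u + (2 * Real.pi)⁻¹ • angForm n u
  have hξσ : ∀ j, ∀ u ∈ (H.sliceChart j).1.dom, u 0 ≠ 0 →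
      ξ (H.sliceChart j) u = -(2 * Real.pi)⁻¹ • angForm n u + σ j u := by
    intro j u hu hu0
    have h1 : ∀ (x g : Alt (n + 1) 1) (c : ℝ), x = -c • g + (x + c • g) := fun x g c => by
      ext v
      simp only [ContinuousAlternatingMap.add_apply, ContinuousAlternatingMap.smul_apply, smul_eq_mul]
      ring
    have h2 : σ j u = ξ (H.sliceChart j) u + (2 * Real.pi)⁻¹ • angForm n u := if_neg hu0
    rw [h2]
    exact h1 _ _ _
  have hopen : IsOpen {u : Cn (n + 1) | u 0 ≠ 0} :=
    isOpen_ne_fun (continuous_apply 0) continuous_const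
  have hσν : ∀ j u, u 0 = 0 → σ j =ᶠ[𝓝 u] ν j := by
    intro j u hu0
    have h1 : ∀ᶠ w in 𝓝 u, blowdown a (slicePt j w) ∈ Metric.ball 0 (r / 2) := by
      refine (contDiff_blowdown_slicePt a j).continuous.continuousAt.eventually
        (Metric.isOpen_ball.mem_nhds ?_)
      change blowdown a (slicePt j u) ∈ _
      rw [(H.blowdown_slicePt_eq_zero j).2 hu0]
      exact Metric.mem_ball_self (by positivity)
    filter_upwards [h1] with w hw
    by_cases hw0 : w 0 = 0
    · simp only [σ, if_pos hw0]
    · have hwd : w ∈ (H.sliceChart j).1.dom :=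
        hrφ (Metric.ball_subset_closedBall (Metric.ball_subset_ball (by linarith) hw))
      have hχ : χ (blowdown a (slicePt j w)) = 1 :=
        χ.one_of_mem_closedBall (Metric.ball_subset_closedBall hw)
      have h2 := weightForm_slice H.pos j hw0
      simp only [σ, if_neg hw0, ν, fderiv_tailProj]
      change chartPullback 𝓧.maximal f.toFun φ κ (H.sliceChart j) w + _ = _
      rw [H.chartPullback_slice j κ hwd]
      simp only [κ, hχ, one_smul]
      ext v
      have h3 := congrArg (fun β => β v) h2
      simp only [ContinuousAlternatingMap.compContinuousLinearMap_apply,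
        ContinuousAlternatingMap.add_apply, ContinuousAlternatingMap.neg_apply] at h3 ⊢
      rw [h3]
      ring
  have hσ : ∀ j, ContDiffOn ℝ ∞ (σ j) (H.sliceChart j).1.dom := by
    intro j u hu
    refine ContDiffAt.contDiffWithinAt ?_
    by_cases hu0 : u 0 = 0
    · exact (hν j u).congr_of_eventuallyEq (hσν j u hu0)
    · have h1 : ContDiffAt ℝ ∞ (fun w => ξ (H.sliceChart j) w + (2 * Real.pi)⁻¹ • angForm n w) u :=
        (hξs _ u hu fun h => hu0 ((H.mem_exceptional j hu).1 h)).add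
          ((contDiffAt_angForm hu0).const_smul _)
      refine h1.congr_of_eventuallyEq ?_
      filter_upwards [hopen.mem_nhds hu0] with w hw
      exact if_neg hw
  have hdense : Dense {u : Cn (n + 1) | u 0 ≠ 0} :=
    Measure.dense_of_ae (μ := volume) (measure_eq_zero_iff_ae_notMem.1 (volume_hyperplane (n + 1) 0))
  obtain ⟨τ, hτ, hτ1, hτ2⟩ := 𝓧.maximal.exists_closedForms_extension hE hξ hξs
    H.sliceChart (fun x hx => H.exists_mem_image hx) (fun j u hu => by
      refine closure_mono ?_ (hdense.open_subset_closure_inter (H.sliceChart j).1.isOpen_dom hu)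
      exact fun w hw => ⟨hw.1, fun h => hw.2 ((H.mem_exceptional j hw.1).1 h)⟩) σ hσ
    (fun j u hu huE => by
      have hu0 : u 0 ≠ 0 := fun h => huE ((H.mem_exceptional j hu).2 h)
      have h1 : ξ (H.sliceChart j) =ᶠ[𝓝 u]
          (-(2 * Real.pi)⁻¹ : ℝ) • angForm n + σ j := by
        filter_upwards [hopen.mem_nhds hu0, (H.sliceChart j).1.isOpen_dom.mem_nhds hu] with w hw hw'
        exact hξσ j w hw' hw
      have h2 : DifferentiableAt ℝ ((-(2 * Real.pi)⁻¹ : ℝ) • angForm n) u :=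
        ((contDiffAt_angForm hu0).differentiableAt (by simp)).const_smul _
      rw [h1.extDeriv_eq, extDeriv_add h2
        (((hσ j).contDiffAt ((H.sliceChart j).1.isOpen_dom.mem_nhds hu)).differentiableAt (by simp)),
        extDeriv_smul, extDeriv_angForm hu0, smul_zero, zero_add])
  refine ⟨τ, hτ, fun S β hβ => ?_, fun j y => ?_, fun c u hu hs => ?_⟩
  · exact S.integral_wedge_eq hE hξ hξs hτ1 H.sliceChart (fun j => H.divisorChart j S)
      (fun j u hu => H.mem_exceptional j hu) (fun x hx => H.exists_mem_image hx) (fun _ => rfl)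
      (fun _ _ _ => rfl) (fun j => by rw [H.card_divisorChart j hn S, H.card_sliceChart j]) σ hσ
      hξσ hβ
  · have h0 : (Fin.cons 0 y : Cn (n + 1)) 0 = 0 := by simp
    rw [hτ2 j _ (H.cons_zero_mem j y), (hσν j _ h0).extDeriv_eq]
    have h1 : extDeriv (ν j) (Fin.cons 0 y) =
        (extDeriv (fun z => -sliceForm a j z) (tailProj n (Fin.cons 0 y))).compContinuousLinearMap
          (fderiv ℝ (tailProj n) (Fin.cons 0 y)) := by
      refine extDeriv_pullback (r := ∞) (((contDiff_sliceForm a j).neg.contDiffAt).differentiableAt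
        (by simp)) ((tailProj n).restrictScalars ℝ).contDiff.contDiffAt ?_
      simp only [minSmoothness_of_isRCLikeNormedField]
      exact ENat.LEInfty.out
    have h2 : tailProj n (Fin.cons 0 y) = y := by rw [tailProj_apply, Fin.tail_cons]
    have h3 : extDeriv (fun z => -sliceForm a j z) y = -extDeriv (sliceForm a j) y := by
      have := extDeriv_smul (-1 : ℝ) (sliceForm a j) (x := y)
      rw [neg_one_smul, neg_one_smul] at this
      exact this
    rw [h1, h2, h3, fderiv_tailProj]
    ext v
    simp only [ContinuousAlternatingMap.compContinuousLinearMap_apply]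
    congr 1
  · have huE : c.1.proj u ∉ f.toFun ⁻¹' {x₀} := fun h => hs (by
      rw [mem_preimage, mem_singleton_iff] at h
      rw [h]
      exact H.mem)
    rw [hτ1 c u hu huE, (hξ0 c u hu hs).extDeriv_eq]
    exact extDeriv_zero u

end LocalModel

end Thom

/-! ### Integration of pulled back forms -/

section Pullback

variable {m : ℕ} {X : Type*} [TopologicalSpace X] {M : Type*} [TopologicalSpace M]
  [ChartedSpace (Cn m) M] [IsManifold 𝓘(ℂ, Cn m) ω M] {𝓧 : ComplexOrbifold m X}

/-- Over the set where a holomorphic map is biholomorphic, the charts of the target are charts of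
the source, and pulling back does not change the expression of forms. -/
theorem HolomorphicMap.exists_chart_of_biholomorphic [Nonempty X] (f : HolomorphicMap 𝓧 m M)
    {F : Set M} (hF : IsClosed F) (hbij : BijOn f.toFun (f.toFun ⁻¹' Fᶜ) Fᶜ)
    (hbih : ∀ c ∈ 𝓧.charts, ∀ e ∈ atlas (Cn m) M, ∀ u ∈ c.dom, ∀ v ∈ e.target,
      f.toFun (c.proj u) = e.symm v → f.toFun (c.proj u) ∉ F →
        LocallyEquivalent c.dom (fun w => f.toFun (c.proj w)) e.target e.symm u v)
    (q : (ComplexOrbifold.ofManifold m M).charts) :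
    ∃ c : 𝓧.maximal.charts, c.1.dom = q.1.dom ∩ q.1.proj ⁻¹' Fᶜ ∧ Nat.card c.1.group = 1 ∧
      (∀ u ∈ c.1.dom, f.toFun (c.1.proj u) = q.1.proj u) ∧
      ∀ {k : ℕ}, ∀ α ∈ (ComplexOrbifold.ofManifold m M).forms k, ∀ u ∈ c.1.dom,
        ComplexOrbifold.extend (f.pullback k α) c u = α q u := by
  obtain ⟨_, e, he, rfl⟩ := q
  choose! inv hinv using fun y (hy : y ∈ Fᶜ) => hbij.surjOn hy
  have hdom : IsOpen (e.target ∩ e.symm ⁻¹' Fᶜ) :=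
    e.symm.isOpen_inter_preimage hF.isOpen_compl
  have hproj : ∀ u ∈ e.target ∩ e.symm ⁻¹' Fᶜ, f.toFun (inv (e.symm u)) = e.symm u :=
    fun u hu => (hinv _ hu.2).2
  have hcompat : ∀ c ∈ 𝓧.charts, ∀ u ∈ e.target ∩ e.symm ⁻¹' Fᶜ, ∀ v ∈ c.dom,
      inv (e.symm u) = c.proj v →
        LocallyEquivalent (e.target ∩ e.symm ⁻¹' Fᶜ) (fun w => inv (e.symm w)) c.dom c.proj u v := by
    intro c hc u hu v hv huv
    have h1 : f.toFun (c.proj v) = e.symm u := by rw [← huv, hproj u hu]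
    obtain ⟨h, hh, hus, hhu⟩ := ((hbih c hc e he v hv u hu.1 h1 (by rw [h1]; exact hu.2)).symm).restr
      hdom c.isOpen_dom hu hv
    refine ⟨h, ⟨hh.source_subset, hh.target_subset, hh.holomorphic, hh.holomorphic_symm,
      fun w hw => ?_⟩, hus, hhu⟩
    have h2 := hh.comm w hw
    have h3 := hh.source_subset hw
    refine hbij.injOn (show f.toFun (c.proj (h w)) ∈ Fᶜ from ?_) (hinv _ h3.2).1 ?_
    · rw [h2]
      exact h3.2
    · rw [h2, hproj w h3]
  -- The chart is `q` followed by the inverse of `f`, with trivial group.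
  let c : 𝓧.maximal.charts := 𝓧.mkChart (e.target ∩ e.symm ⁻¹' Fᶜ) hdom ⊥ inferInstance
    (fun γ hγ u hu => by
      rw [Subgroup.mem_bot] at hγ
      simpa [hγ] using hu)
    (fun u => inv (e.symm u))
    (fun u hu v hv => by
      constructor
      · intro h
        refine ⟨1, Subgroup.one_mem _, e.symm.injOn hu.1 hv.1 ?_⟩
        have h1 := hproj u hu
        rw [h, hproj v hv] at h1
        exact h1.symm
      · rintro ⟨γ, hγ, rfl⟩
        rw [Subgroup.mem_bot] at hγ
        simp [hγ]) hcompat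
  refine ⟨c, rfl, Subgroup.card_bot, hproj, fun {k} α hα u hu => ?_⟩
  obtain ⟨⟨d, h⟩, hh, hus⟩ := 𝓧.exists_transition c hu
  have hhu := hh.target_subset (h.map_source hus)
  rw [ComplexOrbifold.extend_eq (ComplexOrbifold.forms.natural (f.pullback_mem_forms hα)) hh hus]
  let z : M := f.toFun (d.1.proj (h u))
  have hz : z = e.symm u := by
    change f.toFun (d.1.proj (h u)) = _
    rw [hh.comm u hus]
    exact hproj u hu
  -- The pullback is defined with the preferred chart at the image point, so a change of charts on
  -- `M` is needed to compare with `q`.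
  have htr := isTransition_ofChart he (chart_mem_atlas (Cn m) z)
  have hsrc : u ∈ (e.symm.trans (chartAt (Cn m) z)).source := by
    rw [OpenPartialHomeomorph.trans_source]
    refine ⟨hu.1, ?_⟩
    rw [mem_preimage, ← hz]
    exact mem_chart_source _ z
  have hev : (fun w => f.lift d.1 z (h w)) =ᶠ[𝓝 u] e.symm.trans (chartAt (Cn m) z) := by
    filter_upwards [h.open_source.mem_nhds hus] with w hw
    have h1 : f.toFun (d.1.proj (h w)) = e.symm w := by
      rw [hh.comm w hw]
      exact hproj w (hh.source_subset hw)
    simp only [HolomorphicMap.lift, h1, OpenPartialHomeomorph.coe_trans, Function.comp_apply]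
  have hfd : fderiv ℝ (e.symm.trans (chartAt (Cn m) z)) u =
      (fderiv ℝ (f.lift d.1 z) (h u)).comp (fderiv ℝ h u) := by
    rw [← hev.fderiv_eq]
    exact fderiv_fun_comp u ((f.lift_contDiffAt d.2 hhu (mem_chart_source _ _)).differentiableAt
      (by simp)) ((hh.contDiffAt hus).differentiableAt (by simp))
  have h2 := ComplexOrbifold.forms.natural hα ⟨_, e, he, rfl⟩ (ComplexOrbifold.prefChart z) _ htr
    u hsrc
  rw [h2, hfd, ← hev.eq_of_nhds]
  rfl

/-- A holomorphic map which is biholomorphic over the complement of a finite set, with thin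
preimage, preserves integrals. -/
theorem HolomorphicMap.integral_pullback [T2Space M] [CompactSpace M] [T2Space X] [CompactSpace X]
    [Nonempty X] (hm : 0 < m) (f : HolomorphicMap 𝓧 m M) {F : Set M} (hF : F.Finite)
    (hthin : 𝓧.maximal.Thin (f.toFun ⁻¹' F))
    (hbij : BijOn f.toFun (f.toFun ⁻¹' Fᶜ) Fᶜ)
    (hbih : ∀ c ∈ 𝓧.charts, ∀ e ∈ atlas (Cn m) M, ∀ u ∈ c.dom, ∀ v ∈ e.target,
      f.toFun (c.proj u) = e.symm v → f.toFun (c.proj u) ∉ F →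
        LocallyEquivalent c.dom (fun w => f.toFun (c.proj w)) e.target e.symm u v)
    {α : (ComplexOrbifold.ofManifold m M).Family (2 * m)}
    (hα : α ∈ (ComplexOrbifold.ofManifold m M).forms (2 * m)) :
    𝓧.integral (f.pullback (2 * m) α) = (ComplexOrbifold.ofManifold m M).integral α := by
  obtain ⟨t, q, ρ, -, hρ, hρ1, hρs⟩ := (ComplexOrbifold.ofManifold m M).exists_smooth_partition univ
    fun x => by
      obtain ⟨c, hc, hx⟩ := (ComplexOrbifold.ofManifold m M).cover x
      exact ⟨⟨c, hc⟩, mem_univ _, hx⟩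
  have hβ := ComplexOrbifold.extend_mem_forms (f.pullback_mem_forms hα)
  rw [← ComplexOrbifold.integral_extend (f.pullback_mem_forms hα),
    (ComplexOrbifold.ofManifold m M).integral_eq_partition q ρ (fun k => (hρ k).continuous) hρ1 hρs
      (ComplexOrbifold.forms.natural hα) fun c => (hα.1 c).continuousOn]
  choose c hcd hcg hcp hcα using fun k =>
    f.exists_chart_of_biholomorphic hF.isClosed hbij hbih (q k)
  have hg : ∀ k, Nat.card (q k).1.group = 1 := fun k => by
    obtain ⟨e, he, h⟩ := (q k).2
    rw [← h]
    exact Subgroup.card_bot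
  -- The charts `c k` omit finitely many points of the charts `q k`, which is a null set in positive
  -- dimension.
  have hnull : ∀ k, volume ((q k).1.dom \ (c k).1.dom) = 0 := by
    intro k
    obtain ⟨e, he, h⟩ := (q k).2
    have h1 : ((q k).1.dom \ (c k).1.dom) ⊆ e '' F := by
      rintro u ⟨hu, hu'⟩
      rw [hcd k] at hu'
      have h2 : (q k).1.proj u ∈ F := by
        by_contra h3
        exact hu' ⟨hu, h3⟩
      refine ⟨_, h2, ?_⟩
      rw [← h] at hu ⊢
      exact e.right_inv hu
    have : Nonempty (Fin m) := ⟨⟨0, hm⟩⟩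
    exact measure_mono_null h1 ((hF.image e).measure_zero volume)
  have hI : ∀ k, ∀ u ∈ (c k).1.dom, ComplexOrbifold.fmul (fun x => ρ k (f.toFun x))
      (ComplexOrbifold.extend (f.pullback (2 * m) α)) (c k) u (frame m) =
        ρ k ((q k).1.proj u) * α (q k) u (frame m) := by
    intro k u hu
    simp only [ComplexOrbifold.fmul, hcα k α hα u hu, hcp k u hu,
      ContinuousAlternatingMap.smul_apply, smul_eq_mul]
  refine (𝓧.maximal.integral_eq_sum (hF.isClosed.preimage f.continuous) hthin c _
    (fun k => ComplexOrbifold.fmul (fun x => ρ k (f.toFun x))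
      (ComplexOrbifold.extend (f.pullback (2 * m) α)))
    (fun k => (ComplexOrbifold.forms.natural hβ).fmul _) (fun k d => ?_) (fun k d u hu huB hne => ?_)
    (fun k => ?_) (fun d u hu huB => ?_)).trans (Finset.sum_congr rfl fun k _ => ?_)
  · have h1 : ContinuousOn (fun u => ρ k (f.toFun (d.1.proj u))) d.1.dom :=
      ((hρ k).continuous.comp f.continuous).comp_continuousOn d.1.continuousOn_proj
    have h2 := (h1.smul (hβ.1 d).continuousOn).mono
      (sdiff_subset (s := d.1.dom) (t := d.1.proj ⁻¹' (f.toFun ⁻¹' F)))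
    exact h2
  · have h1 : f.toFun (d.1.proj u) ∈ (q k).1.image := by
      refine hρs k (subset_closure fun h => hne ?_)
      simp only [ComplexOrbifold.fmul, h, zero_smul]
    obtain ⟨v, hv, hvu⟩ := h1
    have hvd : v ∈ (c k).1.dom := by
      rw [hcd k]
      refine ⟨hv, ?_⟩
      rw [mem_preimage, hvu]
      exact huB
    refine ⟨v, hvd, hbij.injOn (show f.toFun _ ∈ Fᶜ from ?_) (show f.toFun _ ∈ Fᶜ from huB) ?_⟩
    · rw [hcp k v hvd, hvu]
      exact huB
    · rw [hcp k v hvd, hvu]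
  · have h1 : IntegrableOn (fun u => ρ k ((q k).1.proj u) * α (q k) u (frame m)) (q k).1.dom := by
      refine (q k).1.integrableOn_of_support (isClosed_tsupport (ρ k)).isCompact (hρs k) ?_ ?_
      · exact (hρ k (q k)).continuousOn.mul
          ((continuous_apply_frame (frame m)).comp_continuousOn (hα.1 _).continuousOn)
      · intro u _ hu
        simp [image_eq_zero_of_notMem_tsupport hu]
    refine (h1.mono_set ?_).congr_fun (fun u hu => (hI k u hu).symm)
      (c k).1.isOpen_dom.measurableSet
    rw [hcd k]
    exact inter_subset_left
  · simp only [ComplexOrbifold.fmul, ← Finset.sum_smul, hρ1, one_smul]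
  · rw [hcg k, hg k, setIntegral_congr_fun (c k).1.isOpen_dom.measurableSet (hI k)]
    refine congrArg (_ * ·) (setIntegral_congr_set ?_)
    refine Filter.EventuallyLE.antisymm (LE.le.eventuallyLE ?_) (ae_le_set.2 (hnull k))
    rw [hcd k]
    exact inter_subset_left

end Pullback

/-! ### Top powers and volumes -/

section Volumes

variable {n : ℕ}

theorem dx_apply (j : Fin n) (v : Fin 1 → Cn n) : dx j v = (v 0 j).re := rfl

theorem dy_apply (j : Fin n) (v : Fin 1 → Cn n) : dy j v = (v 0 j).im := rfl

theorem wedgePow_comp {m : ℕ} (α : Alt n 2) (g : Cn m →L[ℝ] Cn n) (k : ℕ) :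
    wedgePow (α.compContinuousLinearMap g) k = (wedgePow α k).compContinuousLinearMap g := by
  induction k with
  | zero => rfl
  | succ k ih => rw [wedgePow, wedgePow, wedge_comp, ih]

theorem wedgePow_smul (c : ℝ) (α : Alt n 2) (k : ℕ) :
    wedgePow (c • α) k = c ^ k • wedgePow α k := by
  induction k with
  | zero => rw [pow_zero, one_smul]; rfl
  | succ k ih =>
    rw [wedgePow, wedgePow, ih, wedge_smul_left, wedge_smul_right, smul_smul, pow_succ]

/-- The real frame of the coordinate subspace with coordinates `J 0, J 1, …`. -/
def frameOf {m : ℕ} (J : Fin m → Fin n) : Fin (2 * m) → Cn n := fun i =>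
  Pi.single (J ⟨i / 2, by omega⟩) (if (i : ℕ) % 2 = 0 then 1 else Complex.I)

theorem removeNth_frameOf {m : ℕ} (J : Fin (m + 1) → Fin n) (p : Fin (m + 1)) :
    (⟨2 * p, by omega⟩ : Fin (2 * m + 1)).removeNth
      ((⟨2 * p + 1, by omega⟩ : Fin (2 * m + 1 + 1)).removeNth (frameOf J)) =
        frameOf (J ∘ p.succAbove) := by
  ext i : 1
  simp only [Fin.removeNth, frameOf, Function.comp_apply]
  have h1 : (((⟨2 * p + 1, by omega⟩ : Fin (2 * m + 1 + 1)).succAbove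
      ((⟨2 * p, by omega⟩ : Fin (2 * m + 1)).succAbove i) : Fin (2 * m + 1 + 1)) : ℕ) =
        if (i : ℕ) < 2 * p then (i : ℕ) else i + 2 := by
    simp only [Fin.succAbove, Fin.lt_def, Fin.val_castSucc]
    split_ifs <;> simp_all <;> omega
  have h2 : (p.succAbove ⟨i / 2, by omega⟩ : ℕ) = if (i : ℕ) < 2 * p then (i : ℕ) / 2 else i / 2 + 1 := by
    simp only [Fin.succAbove, Fin.lt_def, Fin.val_castSucc]
    split_ifs <;> simp_all <;> omega
  have h3 : ∀ (k : ℕ) (hk : k < 2 * (m + 1)) , k = (if (i : ℕ) < 2 * p then (i : ℕ) else i + 2) →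
    (Pi.single (J ⟨k / 2, by omega⟩) (if k % 2 = 0 then 1 else Complex.I) : Cn n) =
     Pi.single (J (p.succAbove ⟨i / 2, by omega⟩)) (if (i : ℕ) % 2 = 0 then 1 else Complex.I) := by
    intro k hk hki
    have h4 : (⟨k / 2, by omega⟩ : Fin (m + 1)) = p.succAbove ⟨i / 2, by omega⟩ := by
      ext
      rw [h2]
      simp only
      split_ifs at hki ⊢ <;> omega
    have h5 : k % 2 = (i : ℕ) % 2 := by split_ifs at hki <;> omega
    rw [h4, h5]
  exact h3 _ (Fin.is_lt _) h1

theorem frameOf_apply_re {m : ℕ} {J : Fin m → Fin n} (hJ : Function.Injective J) (p : Fin m)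
    (i : Fin (2 * m)) : (frameOf J i (J p)).re = if (i : ℕ) = 2 * p then 1 else 0 := by
  simp only [frameOf, Pi.single_apply, hJ.eq_iff, Fin.ext_iff]
  split_ifs <;> first | omega | simp

theorem frameOf_apply_im {m : ℕ} {J : Fin m → Fin n} (hJ : Function.Injective J) (p : Fin m)
    (i : Fin (2 * m)) : (frameOf J i (J p)).im = if (i : ℕ) = 2 * p + 1 then 1 else 0 := by
  simp only [frameOf, Pi.single_apply, hJ.eq_iff, Fin.ext_iff]
  split_ifs <;> first | omega | simp

/-- The `m`-th power of the standard form takes the value `m!` on the frame of a coordinate subspace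
of dimension `m`: expanding the last factor `∑ dx_j ∧ dy_j`, each of the `m` coordinates of the
subspace contributes the same power on the subspace spanned by the remaining ones. -/
theorem wedgePow_stdForm_frameOf {m : ℕ} (J : Fin m → Fin n) (hJ : Function.Injective J) :
    wedgePow (stdForm n) m (frameOf J) = m.factorial := by
  induction m with
  | zero => simp [wedgePow]
  | succ m ih =>
    have hterm : ∀ (γ : Alt n (2 * m)) (j : Fin n), wedge γ (wedge (dx j) (dy j)) (frameOf J) =
        wedge (p := 2 * m + 1) (wedge γ (dx j)) (dy j) (frameOf J) := by
      intro γ j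
      rw [wedge_assoc_one_one]
    have h1 : wedgePow (stdForm n) (m + 1) (frameOf J) =
        ∑ j, wedge (p := 2 * m + 1) (wedge (wedgePow (stdForm n) m) (dx j)) (dy j) (frameOf J) := by
      rw [wedgePow, stdForm, wedge_sum_right, ContinuousAlternatingMap.sum_apply]
      exact Finset.sum_congr rfl fun j _ => hterm _ j
    rw [h1, ← Fintype.sum_of_injective J hJ (fun _ => (m.factorial : ℝ)) _ (fun j hj => ?_)
      (fun p => ?_)]
    · simp [Nat.factorial_succ]
    · rw [wedge_one_apply]
      refine mul_eq_zero_of_right _ (Finset.sum_eq_zero fun i _ => ?_)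
      have : frameOf J i j = 0 := by
        rw [frameOf, Pi.single_eq_of_ne]
        rintro rfl
        exact hj ⟨_, rfl⟩
      rw [dy_apply, this]
      simp
    -- Only the two frame vectors of the coordinate `J p` contribute to `dx ∧ dy` in this
    -- coordinate.
    · have hp := p.2
      rw [wedge_one_apply, Finset.sum_eq_single (⟨2 * p + 1, by omega⟩ : Fin (2 * m + 1 + 1)),
        wedge_one_apply, Finset.sum_eq_single (⟨2 * p, by omega⟩ : Fin (2 * m + 1)),
        removeNth_frameOf, ih _ (hJ.comp Fin.succAbove_right_injective), dy_apply,
        dx_apply]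
      · have h2 : ((⟨2 * p + 1, by omega⟩ : Fin (2 * m + 1 + 1)).removeNth (frameOf J)
            (⟨2 * p, by omega⟩ : Fin (2 * m + 1)) (J p)).re = 1 := by
          rw [Fin.removeNth, frameOf_apply_re hJ, if_pos]
          simp [Fin.succAbove, Fin.lt_def]
        have h3 : (frameOf J (⟨2 * p + 1, by omega⟩ : Fin (2 * m + 1 + 1)) (J p)).im = 1 := by
          rw [frameOf_apply_im hJ, if_pos rfl]
        rw [h2, h3, pow_succ (-1 : ℝ) (2 * m), Even.neg_one_pow ⟨m, by ring⟩]
        simp only [pow_succ, pow_mul]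
        norm_num
      · intro i _ hi
        rw [dx_apply, Fin.removeNth, frameOf_apply_re hJ, if_neg, zero_mul, mul_zero]
        intro h2
        refine hi (Fin.ext ?_)
        simp only [Fin.succAbove, Fin.lt_def, Fin.val_castSucc] at h2 ⊢
        split_ifs at h2 <;> simp at h2 ⊢ <;> omega
      · simp
      · intro i _ hi
        rw [dy_apply, frameOf_apply_im hJ, if_neg, zero_mul, mul_zero]
        exact fun h2 => hi (Fin.ext h2)
      · simp

theorem wedgePow_stdForm_frame (n : ℕ) : wedgePow (stdForm n) n (frame n) = n.factorial :=
  wedgePow_stdForm_frameOf id Function.injective_id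

theorem gamma_two_mul_div_two (n : ℕ) : Real.Gamma (2 * n / 2 + 1) = n.factorial := by
  rw [mul_div_cancel_left₀ _ (two_ne_zero), Real.Gamma_nat_eq_factorial]

theorem volume_unitBall (n : ℕ) : volume {w : Cn n | ∑ l, ‖w l‖ ^ 2 < 1} =
    ENNReal.ofReal (Real.pi ^ n / n.factorial) := by
  have h := Complex.volume_sum_rpow_lt_one (ι := Fin n) (p := 2) (by norm_num)
  simp only [Real.rpow_two, Fintype.card_fin, gamma_two_mul_div_two] at h
  rw [h]
  have h1 : Real.Gamma (2 / 2 + 1) = 1 := by norm_num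
  rw [h1, mul_one]

theorem volume_closedUnitBall (n : ℕ) : volume {w : Cn (n + 1) | ∑ l, ‖w l‖ ^ 2 ≤ 1} =
    ENNReal.ofReal (Real.pi ^ (n + 1) / (n + 1).factorial) := by
  have h := Complex.volume_sum_rpow_le (ι := Fin (n + 1)) (p := 2) (by norm_num) 1
  rw [Fintype.card_fin, gamma_two_mul_div_two] at h
  have h1 : Real.Gamma (2 / 2 + 1) = 1 := by norm_num
  rw [h1, mul_one, ENNReal.ofReal_one, one_pow, one_mul] at h
  rw [← h]
  congr 1
  ext w
  simp only [mem_ofPred_eq, Real.rpow_two, ← Real.sqrt_eq_rpow, Real.sqrt_le_one]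

theorem symplecticVolume_eq (S : Set (Cn n)) :
    symplecticVolume S = n.factorial * (volume S).toReal := by
  simp only [symplecticVolume, wedgePow_stdForm_frame]
  rw [setIntegral_const, smul_eq_mul, mul_comm]
  rfl

theorem symplecticVolume_ellipsoid {a : Fin (n + 1) → ℕ} (ha : ∀ j, 0 < a j) {r : ℝ} (hr : 0 < r) :
    symplecticVolume (ellipsoid a r) = r ^ (n + 1) / ∏ j, (a j : ℝ) := by
  have ha' : ∀ j, (0 : ℝ) < a j := fun j => Nat.cast_pos.2 (ha j)
  -- The ellipsoid is the preimage of the unit ball under the scaling of the coordinates by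
  -- `√(π a_j / r)`.
  let c : Fin (n + 1) → ℝ := fun j => Real.sqrt (Real.pi * a j / r)
  have hc : ∀ j, c j ^ 2 = Real.pi * a j / r := fun j =>
    Real.sq_sqrt (by have := ha' j; positivity)
  let L : Cn (n + 1) →L[ℂ] Cn (n + 1) :=
    LinearMap.toContinuousLinearMap (Matrix.toLin' (Matrix.diagonal fun j => (c j : ℂ)))
  have hL : ∀ z j, L z j = c j * z j := fun z j => by
    simp [L, Matrix.mulVec_diagonal]
  have hdet : (L.restrictScalars ℝ).det = ∏ j, (Real.pi * a j / r) := by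
    rw [det_restrictScalars_eq]
    have : L.det = ∏ j, (c j : ℂ) := by
      change LinearMap.det (Matrix.toLin' (Matrix.diagonal fun j => (c j : ℂ))) = _
      rw [LinearMap.det_toLin', Matrix.det_diagonal]
    rw [this, map_prod]
    exact Finset.prod_congr rfl fun j _ => by rw [Complex.normSq_ofReal, ← hc, sq]
  have hpos : 0 < ∏ j, (Real.pi * a j / r) := Finset.prod_pos fun j _ => by
    have := ha' j
    positivity
  have hpre : ellipsoid a r = (L.restrictScalars ℝ : Cn (n + 1) →ₗ[ℝ] Cn (n + 1)) ⁻¹'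
      {w | ∑ l, ‖w l‖ ^ 2 ≤ 1} := by
    ext z
    have h1 : ∑ l, ‖L z l‖ ^ 2 = Real.pi * (∑ j, (a j : ℝ) * ‖z j‖ ^ 2) / r := by
      rw [Finset.mul_sum, Finset.sum_div]
      refine Finset.sum_congr rfl fun j _ => ?_
      rw [hL, norm_mul, mul_pow, Complex.norm_real, Real.norm_eq_abs, sq_abs, hc]
      ring
    change _ ≤ r ↔ ∑ l, ‖L z l‖ ^ 2 ≤ 1
    rw [h1, div_le_one hr]
  rw [symplecticVolume_eq, hpre, Measure.addHaar_preimage_linearMap volume (by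
    change (L.restrictScalars ℝ).det ≠ 0
    rw [hdet]
    exact hpos.ne')]
  change ((n + 1).factorial : ℝ) * (ENNReal.ofReal |((L.restrictScalars ℝ).det)⁻¹| * _).toReal = _
  rw [hdet, volume_closedUnitBall, ENNReal.toReal_mul, ENNReal.toReal_ofReal (abs_nonneg _),
    ENNReal.toReal_ofReal (by positivity), abs_of_pos (inv_pos.2 hpos)]
  have h2 : ∏ j, (Real.pi * a j / r) = Real.pi ^ (n + 1) * (∏ j, (a j : ℝ)) / r ^ (n + 1) := by
    rw [Finset.prod_div_distrib, Finset.prod_mul_distrib]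
    simp
  have h3 : (0 : ℝ) < ∏ j, (a j : ℝ) := Finset.prod_pos fun j _ => ha' j
  have h4 : ((n + 1).factorial : ℝ) ≠ 0 := Nat.cast_ne_zero.2 (Nat.factorial_ne_zero _)
  rw [h2]
  field_simp

end Volumes

/-! ### The curvature of the exceptional divisor -/

section BallMap

variable {n : ℕ}

/-- The radial diffeomorphism `w ↦ w / √(1 + |w|²)` from coordinate space to the unit ball. -/
def ballMap (n : ℕ) (w : Cn n) : Cn n := (Real.sqrt (1 + ∑ l, ‖w l‖ ^ 2))⁻¹ • w

theorem one_add_sum_pos (w : Cn n) : 0 < 1 + ∑ l, ‖w l‖ ^ 2 := by positivity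

theorem contDiff_ballMap (n : ℕ) : ContDiff ℝ ∞ (ballMap n) := by
  have h1 : ContDiff ℝ ∞ fun w : Cn n => 1 + ∑ l, ‖w l‖ ^ 2 :=
    contDiff_const.add (ContDiff.sum fun l _ => contDiff_norm_sq_apply l)
  exact ((h1.sqrt fun w => (one_add_sum_pos w).ne').inv
    fun w => (Real.sqrt_pos.2 (one_add_sum_pos w)).ne').smul contDiff_id

/-- The real inner product with `w`. -/
def reInner (w : Cn n) : Cn n →L[ℝ] ℝ :=
  Complex.reCLM.comp (∑ l, (starRingEnd ℂ) (w l) •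
    ContinuousLinearMap.proj (R := ℝ) (φ := fun _ : Fin n => ℂ) l)

theorem reInner_apply (w v : Cn n) : reInner w v = (∑ l, (starRingEnd ℂ) (w l) * v l).re := by
  simp [reInner]

theorem reInner_self (w : Cn n) : reInner w w = ∑ l, ‖w l‖ ^ 2 := by
  rw [reInner_apply, Complex.re_sum]
  refine Finset.sum_congr rfl fun l _ => ?_
  rw [Complex.conj_mul', ← Complex.ofReal_pow, Complex.ofReal_re]

theorem hasFDerivAt_sum_norm_sq (w : Cn n) :
    HasFDerivAt (fun w : Cn n => ∑ l, ‖w l‖ ^ 2) ((2 : ℝ) • reInner w) w := by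
  have h1 := HasFDerivAt.fun_sum (u := Finset.univ) fun l (_ : l ∈ Finset.univ) =>
    (ContinuousLinearMap.proj (R := ℝ) (φ := fun _ : Fin n => ℂ) l).hasFDerivAt (x := w) |>.norm_sq
  refine h1.congr_fderiv ?_
  ext v
  simp only [sum_apply, smul_apply, ContinuousLinearMap.comp_apply,
    innerSL_apply_apply, ContinuousLinearMap.proj_apply, Complex.inner, reInner_apply,
    Complex.re_sum, smul_eq_mul, nsmul_eq_mul, Finset.mul_sum]
  refine Finset.sum_congr rfl fun l _ => ?_
  simp
  ring

theorem hasFDerivAt_ballMap (w : Cn n) :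
    HasFDerivAt (ballMap n) ((Real.sqrt (1 + ∑ l, ‖w l‖ ^ 2))⁻¹ •
      (ContinuousLinearMap.id ℝ (Cn n) +
        (-(1 + ∑ l, ‖w l‖ ^ 2)⁻¹ • reInner w).smulRight w)) w := by
  have h0 := one_add_sum_pos w
  have h1 : HasFDerivAt (fun w : Cn n => 1 + ∑ l, ‖w l‖ ^ 2) ((2 : ℝ) • reInner w) w :=
    (hasFDerivAt_sum_norm_sq w).const_add 1
  have h2 := (HasFDerivAt.sqrt h1 h0.ne')
  have h3 := (hasDerivAt_inv (Real.sqrt_pos.2 h0).ne').hasFDerivAt.comp w h2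
  have h4 := HasFDerivAt.smul h3 (hasFDerivAt_id w)
  refine HasFDerivAt.congr_fderiv (f := ballMap n) h4 ?_
  have h5 : Real.sqrt (1 + ∑ l, ‖w l‖ ^ 2) ^ 2 = 1 + ∑ l, ‖w l‖ ^ 2 := Real.sq_sqrt h0.le
  ext v i
  have h7 : ((Real.sqrt (1 + ∑ l, ‖w l‖ ^ 2) : ℝ) : ℂ) ^ 2 = 1 + ∑ l, (‖w l‖ : ℂ) ^ 2 := by
    exact_mod_cast congrArg (fun x : ℝ => (x : ℂ)) h5
  simp
  rw [h7]
  ring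

theorem det_fderiv_ballMap_pos (w : Cn n) : 0 < (fderiv ℝ (ballMap n) w).det := by
  have h0 := one_add_sum_pos w
  rw [(hasFDerivAt_ballMap w).fderiv]
  -- The derivative is a multiple of a transvection, whose determinant is known.
  have h1 : ContinuousLinearMap.det (ContinuousLinearMap.id ℝ (Cn n) +
        (-(1 + ∑ l, ‖w l‖ ^ 2)⁻¹ • reInner w).smulRight w) = (1 + ∑ l, ‖w l‖ ^ 2)⁻¹ := by
    have h2 := LinearMap.transvection.det
      ((-(1 + ∑ l, ‖w l‖ ^ 2)⁻¹ • reInner w : Cn n →L[ℝ] ℝ) : Module.Dual ℝ (Cn n)) w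
    have h3 : ((-(1 + ∑ l, ‖w l‖ ^ 2)⁻¹ • reInner w : Cn n →L[ℝ] ℝ)) w =
      -(1 + ∑ l, ‖w l‖ ^ 2)⁻¹ * ∑ l, ‖w l‖ ^ 2 := by
      rw [smul_apply, reInner_self, smul_eq_mul]
    refine Eq.trans ?_ (h2.trans ?_)
    · congr 1
    · refine (congrArg (1 + ·) h3).trans ?_
      field_simp
      ring
  have h4 : ∀ (c : ℝ) (T : Cn n →L[ℝ] Cn n), (c • T).det =
      c ^ Module.finrank ℝ (Cn n) * T.det := fun c T => LinearMap.det_smul c _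
  rw [h4, h1]
  have h5 := Real.sqrt_pos.2 h0
  positivity

theorem sum_norm_sq_ballMap (w : Cn n) : ∑ l, ‖ballMap n w l‖ ^ 2 =
    (∑ l, ‖w l‖ ^ 2) / (1 + ∑ l, ‖w l‖ ^ 2) := by
  rw [Finset.sum_div]
  refine Finset.sum_congr rfl fun l _ => ?_
  rw [ballMap, Pi.smul_apply, norm_smul, mul_pow, norm_inv, inv_pow, Real.norm_eq_abs, sq_abs,
    Real.sq_sqrt (one_add_sum_pos w).le]
  ring

theorem injective_ballMap (n : ℕ) : Function.Injective (ballMap n) := by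
  intro w w' h
  have h1 := sum_norm_sq_ballMap w
  rw [h, sum_norm_sq_ballMap w', div_eq_div_iff (one_add_sum_pos _).ne' (one_add_sum_pos _).ne'] at h1
  have h2 : ∑ l, ‖w' l‖ ^ 2 = ∑ l, ‖w l‖ ^ 2 := by linarith
  simp only [ballMap, h2] at h
  exact smul_right_injective _ (inv_ne_zero (Real.sqrt_pos.2 (one_add_sum_pos w)).ne') h

theorem range_ballMap (n : ℕ) : range (ballMap n) = {w : Cn n | ∑ l, ‖w l‖ ^ 2 < 1} := by
  ext b
  constructor
  · rintro ⟨w, rfl⟩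
    rw [mem_ofPred_eq, sum_norm_sq_ballMap, div_lt_one (one_add_sum_pos w)]
    linarith
  · intro hb
    have hb' : 0 < 1 - ∑ l, ‖b l‖ ^ 2 := sub_pos.2 hb
    refine ⟨(Real.sqrt (1 - ∑ l, ‖b l‖ ^ 2))⁻¹ • b, ?_⟩
    have h1 : ∑ l, ‖((Real.sqrt (1 - ∑ l, ‖b l‖ ^ 2))⁻¹ • b) l‖ ^ 2 =
        (∑ l, ‖b l‖ ^ 2) / (1 - ∑ l, ‖b l‖ ^ 2) := by
      rw [Finset.sum_div]
      refine Finset.sum_congr rfl fun l _ => ?_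
      rw [Pi.smul_apply, norm_smul, mul_pow, norm_inv, inv_pow, Real.norm_eq_abs, sq_abs,
        Real.sq_sqrt hb'.le]
      ring
    have h2 : 1 + (∑ l, ‖b l‖ ^ 2) / (1 - ∑ l, ‖b l‖ ^ 2) = (1 - ∑ l, ‖b l‖ ^ 2)⁻¹ := by
      field_simp
      ring
    rw [ballMap, h1, h2, Real.sqrt_inv, inv_inv, smul_smul,
      mul_inv_cancel₀ (Real.sqrt_pos.2 hb').ne', one_smul]

/-- The total mass of the pulled back Lebesgue measure is the volume of the unit ball. -/
theorem lintegral_det_ballMap (n : ℕ) :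
    ∫⁻ w, ENNReal.ofReal (fderiv ℝ (ballMap n) w).det =
      ENNReal.ofReal (Real.pi ^ n / n.factorial) := by
  have h := lintegral_abs_det_fderiv_eq_addHaar_image volume MeasurableSet.univ
    (fun w _ => (hasFDerivAt_ballMap w).hasFDerivWithinAt) (injective_ballMap n).injOn
  rw [image_univ, range_ballMap, volume_unitBall, Measure.restrict_univ] at h
  rw [← h]
  refine lintegral_congr fun w => ?_
  rw [← (hasFDerivAt_ballMap w).fderiv, abs_of_pos (det_fderiv_ballMap_pos w)]

end BallMap

section PowerMap

variable {n : ℕ}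

/-- The map `y ↦ (y_l ^ k_l)`. -/
def powMap (k : Fin n → ℕ) (y : Cn n) : Cn n := fun l => y l ^ k l

theorem contDiff_powMap (k : Fin n → ℕ) : ContDiff ℂ ω (powMap k) :=
  contDiff_pi.2 fun l => (contDiff_apply ℂ ℂ l).pow _

theorem contDiff_real_powMap (k : Fin n → ℕ) : ContDiff ℝ ∞ (powMap k) :=
  ((contDiff_powMap k).restrict_scalars ℝ).of_le le_top

theorem fderiv_powMap_apply (k : Fin n → ℕ) (y v : Cn n) (l : Fin n) :
    fderiv ℂ (powMap k) y v l = k l * y l ^ (k l - 1) * v l := by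
  have h1 : HasFDerivAt (powMap k) (ContinuousLinearMap.pi fun l =>
      (k l * y l ^ (k l - 1)) • ContinuousLinearMap.proj (R := ℂ) (φ := fun _ : Fin n => ℂ) l) y := by
    rw [hasFDerivAt_pi]
    intro l
    have h2 := (hasDerivAt_pow (k l) (y l)).hasFDerivAt.comp y
      (ContinuousLinearMap.proj (R := ℂ) (φ := fun _ : Fin n => ℂ) l).hasFDerivAt
    refine h2.congr_fderiv ?_
    ext v
    simp [mul_comm]
  rw [h1.fderiv]
  simp

theorem fderiv_real_powMap (k : Fin n → ℕ) (y : Cn n) :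
    fderiv ℝ (powMap k) y = (fderiv ℂ (powMap k) y).restrictScalars ℝ :=
  (((contDiff_powMap k).contDiffAt.differentiableAt (by simp)).hasFDerivAt.restrictScalars ℝ).fderiv

theorem det_fderiv_powMap_nonneg (k : Fin n → ℕ) (y : Cn n) :
    0 ≤ (fderiv ℝ (powMap k) y).det := by
  rw [fderiv_real_powMap, det_restrictScalars_eq]
  exact Complex.normSq_nonneg _

theorem encard_pow_eq {k : ℕ} (hk : 0 < k) {w : ℂ} (hw : w ≠ 0) :
    ((Polynomial.nthRoots k w).toFinset).card = k := by
  have h1 := Complex.isPrimitiveRoot_exp k hk.ne'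
  rw [Multiset.toFinset_card_of_nodup (h1.nthRoots_nodup hw), h1.card_nthRoots,
    if_pos (IsAlgClosed.exists_pow_nat_eq w hk)]

/-- The power map covers almost every point `∏ k_l` times. -/
theorem lintegral_powMap {k : Fin n → ℕ} (hk : ∀ l, 0 < k l) {G : Cn n → ENNReal}
    (hG : Measurable G) :
    ∫⁻ y, G (powMap k y) * ENNReal.ofReal (fderiv ℝ (powMap k) y).det =
      (∏ l, (k l : ENNReal)) * ∫⁻ w, G w := by
  -- The power map is a covering over the complement of the coordinate hyperplanes; the fibers are
  -- counted there.
  let s : Set (Cn n) := {y | ∀ l, y l ≠ 0}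
  have hs : IsOpen s := by
    simp only [s, ofPred_forall]
    exact isOpen_iInter_of_finite fun l => isOpen_ne_fun (continuous_apply l) continuous_const
  have hs0 : ∀ᵐ y : Cn n, y ∈ s :=
    ae_all_iff.2 fun l => measure_eq_zero_iff_ae_notMem.1 (volume_hyperplane n l)
  have hsr : volume.restrict s = (volume : Measure (Cn n)) :=
    Measure.restrict_eq_self_of_ae_mem hs0
  have hmap : ∀ y ∈ s, powMap k y ∈ s := fun y hy l => pow_ne_zero _ (hy l)
  have hmeas : Measurable fun y => G (powMap k y) * ENNReal.ofReal (fderiv ℝ (powMap k) y).det := by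
    refine (hG.comp (contDiff_powMap k).continuous.measurable).mul
      (ENNReal.measurable_ofReal.comp ?_)
    exact (ContinuousLinearMap.continuous_det.comp
      ((contDiff_real_powMap k).continuous_fderiv (by simp))).measurable
  have h := lintegral_fiber_count (Y := Cn n) (p := powMap k) (q := id) hs hs ?_ ?_
    (F := fun y => G (powMap k y) * ENNReal.ofReal (fderiv ℝ (powMap k) y).det) (G := G)
    hmeas.aemeasurable hG.aemeasurable ?_
  · rw [hsr] at h
    have h1 : ∀ᵐ y : Cn n, G (powMap k y) * ENNReal.ofReal (fderiv ℝ (powMap k) y).det *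
        (({v | v ∈ s ∧ id v = powMap k y}.encard : ℕ∞) : ENNReal) =
          G (powMap k y) * ENNReal.ofReal (fderiv ℝ (powMap k) y).det := by
      filter_upwards [hs0] with y hy
      have : {v | v ∈ s ∧ id v = powMap k y} = {powMap k y} := by
        ext v
        simp only [id, mem_ofPred_eq, mem_singleton_iff, and_iff_right_iff_imp]
        rintro rfl
        exact hmap y hy
      rw [this, encard_singleton]
      simp
    have h2 : ∀ᵐ v : Cn n, G v * (({u | u ∈ s ∧ powMap k u = id v}.encard : ℕ∞) : ENNReal) =
        (∏ l, (k l : ENNReal)) * G v := by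
      filter_upwards [hs0] with v hv
      have : {u | u ∈ s ∧ powMap k u = id v} =
          (Fintype.piFinset fun l => (Polynomial.nthRoots (k l) (v l)).toFinset : Set (Cn n)) := by
        ext u
        simp only [id, mem_ofPred_eq, Finset.mem_coe, Fintype.mem_piFinset, Multiset.mem_toFinset,
          Polynomial.mem_nthRoots (hk _)]
        constructor
        · rintro ⟨-, rfl⟩ l
          rfl
        · intro hu
          refine ⟨fun l h0 => hv l ?_, funext hu⟩
          rw [← hu l, h0, zero_pow (hk l).ne']
      rw [this, encard_coe_eq_coe_finsetCard, Fintype.card_piFinset,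
        Finset.prod_congr rfl fun l _ => encard_pow_eq (hk l) (hv l), mul_comm,
        ENat.toENNReal_coe, Nat.cast_prod]
    rw [lintegral_congr_ae h1, lintegral_congr_ae h2, lintegral_const_mul _ hG] at h
    exact h
  · intro u hu v hv huv
    have hv' : v = powMap k u := huv.symm
    rw [hv']
    refine locallyEquivalent_of_injective_fderiv hs hs (contDiff_powMap k).contDiffAt.analyticAt
      ?_ hu (hmap u hu) (Filter.Eventually.of_forall fun _ => rfl)
    intro x y hxy
    ext l
    have h3 := congrFun hxy l
    rw [fderiv_powMap_apply, fderiv_powMap_apply] at h3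
    exact mul_left_cancel₀ (mul_ne_zero (Nat.cast_ne_zero.2 (hk l).ne') (pow_ne_zero _ (hu l))) h3
  · exact fun v _ => ⟨univ, Filter.univ_mem, Function.injective_id.injOn⟩
  · intro h hh w hw
    have h3 : ∀ v ∈ h.source, h v = powMap k v := fun v hv => hh.comm v hv
    have h4 : h =ᶠ[𝓝 w] powMap k := by
      filter_upwards [h.open_source.mem_nhds hw] with v hv
      exact h3 v hv
    rw [h4.fderiv_eq, h3 w hw, abs_of_nonneg (det_fderiv_powMap_nonneg k w), mul_comm]

end PowerMap

section Curvature

variable {n : ℕ}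

/-- The form `Im ⟨w, dw⟩`, a primitive of twice the standard symplectic form. -/
def imForm (n : ℕ) (w : Cn n) : Alt n 1 :=
  ContinuousAlternatingMap.ofSubsingleton ℝ (Cn n) ℝ (0 : Fin 1)
    (Complex.imCLM.comp (∑ l, (starRingEnd ℂ) (w l) •
      ContinuousLinearMap.proj (R := ℝ) (φ := fun _ : Fin n => ℂ) l))

theorem imForm_apply (w : Cn n) (v : Fin 1 → Cn n) :
    imForm n w v = (∑ l, (starRingEnd ℂ) (w l) * v 0 l).im := by
  simp [imForm]

theorem contDiff_imForm (n : ℕ) : ContDiff ℝ ∞ (imForm n) := by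
  have h2 : ContDiff ℝ ∞ fun w : Cn n => (∑ l, (starRingEnd ℂ) (w l) •
      ContinuousLinearMap.proj (R := ℝ) (φ := fun _ : Fin n => ℂ) l) :=
    ContDiff.sum fun l _ => (Complex.conjCLE.contDiff.comp (contDiff_apply ℝ ℂ l)).smul contDiff_const
  exact (ContinuousAlternatingMap.ofSubsingletonLIE (𝕜 := ℝ) (E := Cn n) (F := ℝ)
    (0 : Fin 1)).contDiff.comp (contDiff_const.clm_comp h2)

theorem stdForm_apply (v : Fin 2 → Cn n) :
    stdForm n v = (∑ l, (starRingEnd ℂ) (v 0 l) * v 1 l).im := by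
  rw [stdForm, ContinuousAlternatingMap.sum_apply, Complex.im_sum]
  refine Finset.sum_congr rfl fun l _ => ?_
  have h := wedge_one_apply (dx l) (dy l) v
  rw [h, Fin.sum_univ_two, dy_apply, dy_apply, dx_apply, dx_apply]
  simp [Fin.removeNth]
  ring

theorem extDeriv_imForm (w : Cn n) : extDeriv (imForm n) w = (2 : ℝ) • stdForm n := by
  have hd : DifferentiableAt ℝ (imForm n) w := (contDiff_imForm n).contDiffAt.differentiableAt (by simp)
  have h1 : ∀ c v : Cn n, fderiv ℝ (fun w : Cn n => (∑ l, (starRingEnd ℂ) (w l) * c l).im) w v =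
      (∑ l, (starRingEnd ℂ) (v l) * c l).im := by
    intro c v
    let L : Cn n →L[ℝ] ℝ := Complex.imCLM.comp (∑ l, c l • (Complex.conjCLE.toContinuousLinearMap.comp
      (ContinuousLinearMap.proj (R := ℝ) (φ := fun _ : Fin n => ℂ) l)))
    have hL : ∀ w, L w = (∑ l, (starRingEnd ℂ) (w l) * c l).im := fun w => by
      simp [L, mul_comm]
    have h2 : (fun w : Cn n => (∑ l, (starRingEnd ℂ) (w l) * c l).im) = L := funext fun w => (hL w).symm
    rw [h2, ContinuousLinearMap.fderiv, hL]
  ext v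
  rw [extDeriv_apply hd v, Fin.sum_univ_two]
  simp only [imForm_apply, h1, ContinuousAlternatingMap.smul_apply, stdForm_apply]
  simp only [Complex.im_sum, Fin.removeNth, Fin.val_zero, Fin.val_one, pow_zero, pow_one, one_smul,
    neg_smul, smul_eq_mul, Finset.mul_sum, ← sub_eq_add_neg, ← Finset.sum_sub_distrib]
  refine Finset.sum_congr rfl fun l _ => ?_
  simp
  ring

/-- The pullback of `imForm` to coordinate space is the affine form of the connection form of the
tautological bundle: the derivative of the radial factor is real and drops out of the imaginary
part. -/
theorem imForm_ballMap (w : Cn n) (v : Fin 1 → Cn n) :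
    (imForm n (ballMap n w)).compContinuousLinearMap (fderiv ℝ (ballMap n) w) v =
      (∑ l, (starRingEnd ℂ) (w l) * v 0 l).im / (1 + ∑ l, ‖w l‖ ^ 2) := by
  have h0 := one_add_sum_pos w
  rw [ContinuousAlternatingMap.compContinuousLinearMap_apply, imForm_apply,
    (hasFDerivAt_ballMap w).fderiv, Complex.im_sum, Complex.im_sum, Finset.sum_div]
  refine Finset.sum_congr rfl fun l _ => ?_
  have h5 : Real.sqrt (1 + ∑ l, ‖w l‖ ^ 2) ^ 2 = 1 + ∑ l, ‖w l‖ ^ 2 := Real.sq_sqrt h0.le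
  set s := Real.sqrt (1 + ∑ l, ‖w l‖ ^ 2) with hs
  set g := (-(1 + ∑ l, ‖w l‖ ^ 2)⁻¹ • reInner w) (v 0) with hg
  have h1 : ((s⁻¹ • (ContinuousLinearMap.id ℝ (Cn n) +
        (-(1 + ∑ l, ‖w l‖ ^ 2)⁻¹ • reInner w).smulRight w)) ∘ v) 0 l =
      ((s⁻¹ : ℝ) : ℂ) * (v 0 l + (g : ℂ) * w l) := rfl
  have h2 : ballMap n w l = ((s⁻¹ : ℝ) : ℂ) * w l := rfl
  rw [h1, h2, map_mul, Complex.conj_ofReal]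
  have h3 : ((s⁻¹ : ℝ) : ℂ) * (starRingEnd ℂ) (w l) * (((s⁻¹ : ℝ) : ℂ) * (v 0 l + (g : ℂ) * w l)) =
      ((s⁻¹ ^ 2 : ℝ) : ℂ) * ((starRingEnd ℂ) (w l) * v 0 l + ((g * ‖w l‖ ^ 2 : ℝ) : ℂ)) := by
    push_cast
    rw [← Complex.conj_mul']
    ring
  rw [h3, Complex.im_ofReal_mul, Complex.add_im, Complex.ofReal_im, add_zero, inv_pow, h5]
  field_simp

/-- The exponents `A / a_l` on the slice `z_j = 1`. -/
def sliceExp (a : Fin (n + 1) → ℕ) (j : Fin (n + 1)) (l : Fin n) : ℕ :=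
  (∏ i, a i) / a (j.succAbove l)

theorem sliceExp_pos {a : Fin (n + 1) → ℕ} (ha : ∀ j, 0 < a j) (j : Fin (n + 1)) (l : Fin n) :
    0 < sliceExp a j l :=
  Nat.div_pos (Nat.le_of_dvd (Finset.prod_pos fun i _ => ha i)
    (Finset.dvd_prod_of_mem a (Finset.mem_univ _))) (ha _)

theorem slicePow_eq (a : Fin (n + 1) → ℕ) (j : Fin (n + 1)) (y : Cn n) :
    slicePow a j y = j.insertNth 1 (powMap (sliceExp a j) y) := by
  ext i
  refine Fin.succAboveCases j ?_ (fun i => ?_) i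
  · simp [slicePow, weightPow]
  · simp [slicePow, weightPow, powMap, sliceExp]

/-- The connection form on a slice, in terms of the radial diffeomorphism to the unit ball: the
slice is identified with a branched covering of the ball. -/
theorem pullRadial_slicePow (a : Fin (n + 1) → ℕ) (j : Fin (n + 1)) (y : Cn n) :
    pullRadial (slicePow a j) y =
      (imForm n (ballMap n (powMap (sliceExp a j) y))).compContinuousLinearMap
        (fderiv ℝ (fun z => ballMap n (powMap (sliceExp a j) z)) y) := by
  have hP := (contDiff_real_powMap (sliceExp a j)).contDiffAt.differentiableAt (x := y) (by simp)
  have h1 : HasFDerivAt (slicePow a j) (ContinuousLinearMap.pi (j.insertNth 0 fun l =>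
      (ContinuousLinearMap.proj (R := ℝ) (φ := fun _ : Fin n => ℂ) l).comp
        (fderiv ℝ (powMap (sliceExp a j)) y))) y := by
    rw [hasFDerivAt_pi']
    intro i
    have h2 : (fun z => slicePow a j z i) =
        fun z => (j.insertNth 1 (powMap (sliceExp a j) z) : Cn (n + 1)) i :=
      funext fun z => by rw [slicePow_eq]
    rw [h2]
    refine Fin.succAboveCases j ?_ (fun l => ?_) i
    · simp only [Fin.insertNth_apply_same]
      refine (hasFDerivAt_const (1 : ℂ) y).congr_fderiv ?_
      ext v
      simp
    · simp only [Fin.insertNth_apply_succAbove]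
      refine ((ContinuousLinearMap.proj (R := ℝ) (φ := fun _ : Fin n => ℂ) l).hasFDerivAt.comp y
        hP.hasFDerivAt).congr_fderiv ?_
      ext v
      simp
  have h3 : fderiv ℝ (fun z => ballMap n (powMap (sliceExp a j) z)) y =
      (fderiv ℝ (ballMap n) (powMap (sliceExp a j) y)).comp (fderiv ℝ (powMap (sliceExp a j)) y) :=
    fderiv_fun_comp y ((contDiff_ballMap n).contDiffAt.differentiableAt (by simp)) hP
  ext v
  have h4 := imForm_ballMap (powMap (sliceExp a j) y) (fderiv ℝ (powMap (sliceExp a j)) y ∘ v)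
  rw [h3]
  refine Eq.trans ?_ h4.symm
  rw [pullRadial, ContinuousAlternatingMap.compContinuousLinearMap_apply, radialForm_apply, h1.fderiv,
    slicePow_eq, Fin.sum_univ_succAbove _ j, Fin.sum_univ_succAbove _ j]
  simp

/-- The curvature of the connection on a slice is a multiple of the standard symplectic form of the
unit ball, pulled back along a branched covering. -/
theorem extDeriv_sliceForm (a : Fin (n + 1) → ℕ) (j : Fin (n + 1)) (y : Cn n) :
    extDeriv (sliceForm a j) y = ((Real.pi * ∏ i, a i)⁻¹ : ℝ) •
      (stdForm n).compContinuousLinearMap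
        (fderiv ℝ (fun z => ballMap n (powMap (sliceExp a j) z)) y) := by
  have h1 : sliceForm a j = fun z => ((2 * Real.pi * ∏ i, a i)⁻¹ : ℝ) •
      (imForm n (ballMap n (powMap (sliceExp a j) z))).compContinuousLinearMap
        (fderiv ℝ (fun z => ballMap n (powMap (sliceExp a j) z)) z) :=
    funext fun z => by rw [sliceForm, pullRadial_slicePow]
  have h2 : extDeriv (fun z => (imForm n (ballMap n (powMap (sliceExp a j) z))).compContinuousLinearMap
        (fderiv ℝ (fun z => ballMap n (powMap (sliceExp a j) z)) z)) y =
      (extDeriv (imForm n) (ballMap n (powMap (sliceExp a j) y))).compContinuousLinearMap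
        (fderiv ℝ (fun z => ballMap n (powMap (sliceExp a j) z)) y) := by
    refine extDeriv_pullback (r := ∞) ((contDiff_imForm n).contDiffAt.differentiableAt (by simp))
      ((contDiff_ballMap n).comp (contDiff_real_powMap _)).contDiffAt ?_
    simp only [minSmoothness_of_isRCLikeNormedField]
    exact ENat.LEInfty.out
  have h3 := extDeriv_smul ((2 * Real.pi * ∏ i, a i)⁻¹ : ℝ)
    (fun z => (imForm n (ballMap n (powMap (sliceExp a j) z))).compContinuousLinearMap
        (fderiv ℝ (fun z => ballMap n (powMap (sliceExp a j) z)) z)) (x := y)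
  rw [h1]
  refine h3.trans ?_
  rw [h2, extDeriv_imForm]
  ext v
  simp only [ContinuousAlternatingMap.smul_apply, ContinuousAlternatingMap.compContinuousLinearMap_apply,
    smul_eq_mul]
  rw [mul_inv, mul_inv, mul_inv]
  ring

/-- The volume of a slice with respect to the curvature: the covering of the unit ball has degree
`∏ A / a_l`, where `A` is the product of all weights, and the ball has symplectic volume `πⁿ`. -/
theorem integral_wedgePow_extDeriv_sliceForm {a : Fin (n + 1) → ℕ} (ha : ∀ j, 0 < a j)
    (j : Fin (n + 1)) :
    ∫ y, wedgePow (extDeriv (sliceForm a j) y) n (frame n) =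
      ∏ l, (a (j.succAbove l) : ℝ)⁻¹ := by
  let k := sliceExp a j
  let A : ℝ := ∏ i, (a i : ℝ)
  have hA : 0 < A := Finset.prod_pos fun i _ => Nat.cast_pos.2 (ha i)
  let G : Cn n → ℝ := fun w => (fderiv ℝ (ballMap n) w).det
  have hGc : Continuous G := ContinuousLinearMap.continuous_det.comp
    ((contDiff_ballMap n).continuous_fderiv (by simp))
  have hDc : Continuous fun y => (fderiv ℝ (powMap k) y).det :=
    ContinuousLinearMap.continuous_det.comp ((contDiff_real_powMap k).continuous_fderiv (by simp))
  have h1 : ∀ y, wedgePow (extDeriv (sliceForm a j) y) n (frame n) =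
      ((Real.pi * A)⁻¹ ^ n * n.factorial) * (G (powMap k y) * (fderiv ℝ (powMap k) y).det) := by
    intro y
    have h2 : (fderiv ℝ (fun z => ballMap n (powMap k z)) y).det =
        G (powMap k y) * (fderiv ℝ (powMap k) y).det := by
      have h3 := fderiv_fun_comp (𝕜 := ℝ) y
        ((contDiff_ballMap n).contDiffAt.differentiableAt (by simp))
        ((contDiff_real_powMap k).contDiffAt.differentiableAt (x := y) (by simp))
      rw [h3]
      exact LinearMap.det_comp _ _
    rw [extDeriv_sliceForm, wedgePow_smul, wedgePow_comp, ContinuousAlternatingMap.smul_apply,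
      alt_comp_frame, h2, wedgePow_stdForm_frame]
    simp only [A, Nat.cast_prod, smul_eq_mul]
    ring
  have hnn : ∀ y, 0 ≤ G (powMap k y) * (fderiv ℝ (powMap k) y).det := fun y =>
    mul_nonneg (det_fderiv_ballMap_pos _).le (det_fderiv_powMap_nonneg k y)
  have h4 : ∫ y, G (powMap k y) * (fderiv ℝ (powMap k) y).det =
      (∏ l, (k l : ℝ)) * (Real.pi ^ n / n.factorial) := by
    rw [integral_eq_lintegral_of_nonneg_ae (Filter.Eventually.of_forall hnn)
      ((hGc.comp (contDiff_real_powMap k).continuous).mul hDc).aestronglyMeasurable]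
    simp only [ENNReal.ofReal_mul (det_fderiv_ballMap_pos _).le, G]
    rw [lintegral_powMap (sliceExp_pos ha j) (G := fun w => ENNReal.ofReal (G w))
      (ENNReal.measurable_ofReal.comp hGc.measurable), lintegral_det_ballMap, ENNReal.toReal_mul,
      ENNReal.toReal_ofReal (by positivity), ENNReal.toReal_prod]
    simp [k]
  simp only [h1]
  rw [integral_const_mul, h4]
  have h5 : ∏ l, (k l : ℝ) = A ^ n * ∏ l, (a (j.succAbove l) : ℝ)⁻¹ := by
    have h6 : ∀ l, (k l : ℝ) = A * (a (j.succAbove l) : ℝ)⁻¹ := fun l => by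
      have h7 := mul_div_weight (a := a) (j.succAbove l)
      have h8 : (a (j.succAbove l) : ℝ) * (k l : ℝ) = A := by
        simp only [A]
        exact_mod_cast h7
      have h9 : (a (j.succAbove l) : ℝ) ≠ 0 := Nat.cast_ne_zero.2 (ha _).ne'
      rw [← h8]
      field_simp
    rw [Finset.prod_congr rfl fun l _ => h6 l, Finset.prod_mul_distrib]
    simp
  rw [h5, inv_pow, mul_pow]
  have h6 : (n.factorial : ℝ) ≠ 0 := Nat.cast_ne_zero.2 (Nat.factorial_ne_zero n)
  field_simp

end Curvature

/-! ### Forms on the exceptional divisor -/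

section Restriction

variable {n m : ℕ} {X : Type*} [TopologicalSpace X]

/-- The restrictions of all forms to a suborbifold are given by one linear map at each point. -/
theorem Suborbifold.exists_restrict_eq {𝓧 : ComplexOrbifold n X} {E : Set X}
    (S : Suborbifold 𝓧 E m) (c : S.orb.charts) {u : Cn m} (hu : u ∈ c.1.dom) :
    ∃ (d : 𝓧.charts) (ℓ : Cn m → Cn n), ContDiffAt ℝ ω ℓ u ∧ ℓ u ∈ d.1.dom ∧
      (∀ᶠ w in 𝓝 u, d.1.proj (ℓ w) = c.1.proj w) ∧ ∀ {k : ℕ} (β : 𝓧.Family k),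
        S.restrict β c u = (β d (ℓ u)).compContinuousLinearMap (fderiv ℝ ℓ u) := by
  obtain ⟨h1, -, h2, h3⟩ := (S.immersion c u hu).choose_spec
  exact ⟨_, _, h1.contDiffAt.restrict_scalars ℝ, h2, h3, fun β => dif_pos hu⟩

theorem Suborbifold.restrict_congr {𝓧 : ComplexOrbifold n X} {E : Set X} (S : Suborbifold 𝓧 E m)
    {k : ℕ} {β γ : 𝓧.Family k} (h : ∀ d, ∀ v ∈ d.1.dom, β d v = γ d v) (c : S.orb.charts) {u : Cn m}
    (hu : u ∈ c.1.dom) : S.restrict β c u = S.restrict γ c u := by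
  obtain ⟨d, ℓ, -, h2, -, h4⟩ := S.exists_restrict_eq c hu
  rw [h4, h4, h d _ h2]

theorem ComplexOrbifold.extend_ofMaximal {𝓧 : ComplexOrbifold n X} {k : ℕ}
    {α : 𝓧.maximal.Family k} (hα : 𝓧.maximal.Natural α) (p : 𝓧.maximal.charts) {u : Cn n}
    (hu : u ∈ p.1.dom) : extend (ofMaximal α) p u = α p u := by
  obtain ⟨⟨c, h⟩, hh, hus⟩ := 𝓧.exists_transition p hu
  have h1 : 𝓧.Natural (ofMaximal α) := fun c d => hα (𝓧.toMaximal c) (𝓧.toMaximal d)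
  rw [extend_eq h1 hh hus]
  exact (hα p (𝓧.toMaximal c) h hh u hus).symm

theorem wedgePow_mem_closedForms {𝓧 : ComplexOrbifold n X} {α : 𝓧.Family 2}
    (hα : α ∈ 𝓧.closedForms 2) (k : ℕ) :
    (fun c u => wedgePow (α c u) k : 𝓧.Family (2 * k)) ∈ 𝓧.closedForms (2 * k) := by
  induction k with
  | zero =>
    refine ⟨⟨fun c => contDiffOn_const, fun c d h hh w hw => rfl⟩, fun c u hu => ?_⟩
    have : DifferentiableAt ℝ (fun _ : Cn n => wedgePow (0 : Alt n 2) 0) u :=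
      differentiableAt_const _
    ext v
    refine (extDeriv_apply this v).trans ?_
    simp
  | succ k ih => exact ComplexOrbifold.wedge_mem_closedForms ih hα

/-- The integral over a suborbifold of a form given on the maximal atlas. -/
theorem Suborbifold.integral_restrict_ofMaximal [T2Space X] [CompactSpace X]
    {𝓧 : ComplexOrbifold n X} {E : Set X} (hE : IsClosed E) (S : Suborbifold 𝓧 E m)
    {β : 𝓧.maximal.Family (2 * m)} (hβ : β ∈ 𝓧.maximal.forms (2 * m)) :
    S.orb.integral (S.restrict (ComplexOrbifold.ofMaximal β)) =
      S.orb.maximal.integral (S.maximal.restrict β) := by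
  have : CompactSpace E := isCompact_iff_compactSpace.1 hE.isCompact
  rw [S.integral_restrict_maximal hE (ComplexOrbifold.ofMaximal_mem_forms hβ)]
  refine S.orb.maximal.integral_congr fun c u hu => S.maximal.restrict_congr (fun d v hv => ?_) c hu
  exact ComplexOrbifold.extend_ofMaximal (ComplexOrbifold.forms.natural hβ) d hv

end Restriction

section DivisorVolume

variable {n : ℕ} {X : Type*} [TopologicalSpace X] {M : Type*} [TopologicalSpace M]
  [ChartedSpace (Cn (n + 1)) M] {𝓧 : ComplexOrbifold (n + 1) X}

namespace LocalModel

variable {f : HolomorphicMap 𝓧 (n + 1) M} {a : Fin (n + 1) → ℕ} {x₀ : M}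
  {φ : OpenPartialHomeomorph M (Cn (n + 1))} {Ψ : ℂ × Cn (n + 1) → X}

/-- The self-intersection number of the exceptional divisor: one slice covers the divisor up to a
set of measure zero, and its group contributes the remaining factor `1 / a₀`. -/
theorem integral_wedgePow_neg [T2Space X] [CompactSpace X] [T1Space M] (hn : 1 ≤ n)
    (H : LocalModel 𝓧 f.toFun a x₀ φ Ψ) (S : Suborbifold 𝓧 (f.toFun ⁻¹' {x₀}) n)
    {τ : 𝓧.maximal.Family 2} (hτ : τ ∈ 𝓧.maximal.closedForms 2)
    (hτ0 : ∀ j y, (τ (H.sliceChart j) (Fin.cons 0 y)).compContinuousLinearMap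
        ((tailIncl n).restrictScalars ℝ) = -extDeriv (sliceForm a j) y) :
    S.orb.maximal.integral
      (S.maximal.restrict (k := 2 * n) fun c u => wedgePow (-τ c u) n) = (∏ j, (a j : ℝ))⁻¹ := by
  have hE : IsClosed (f.toFun ⁻¹' {x₀}) := isClosed_singleton.preimage f.continuous
  have : CompactSpace (f.toFun ⁻¹' {x₀}) := isCompact_iff_compactSpace.1 hE.isCompact
  let Q := H.divisorChart 0 S
  have hQd : Q.1.dom = univ := eq_univ_of_forall fun y => H.cons_zero_mem 0 y
  let β : 𝓧.maximal.Family (2 * n) := fun c u => wedgePow (-τ c u) n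
  have hβ : β ∈ 𝓧.maximal.forms (2 * n) :=
    (wedgePow_mem_closedForms (neg_mem hτ) n).1
  have hα := S.maximal.restrict_mem_forms hβ
  have hval : ∀ y, S.maximal.restrict β Q y = wedgePow (extDeriv (sliceForm a 0) y) n := by
    intro y
    have h1 : fderiv ℝ (tailIncl n) y = (tailIncl n).restrictScalars ℝ :=
      ((tailIncl n).restrictScalars ℝ).fderiv
    rw [S.maximal.restrict_eq hβ Q (hQd ▸ mem_univ y) (d := H.sliceChart 0) (ℓ := tailIncl n)
      ((tailIncl n).restrictScalars ℝ).contDiff.contDiffAt (H.cons_zero_mem 0 y)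
      (Filter.Eventually.of_forall fun _ => rfl), h1]
    have h2 := hτ0 0 y
    have h3 : (-τ (H.sliceChart 0) (Fin.cons 0 y)).compContinuousLinearMap
        ((tailIncl n).restrictScalars ℝ) = extDeriv (sliceForm a 0) y := by
      rw [← neg_neg (extDeriv (sliceForm a 0) y), ← h2]
      rfl
    rw [← h3]
    exact (wedgePow_comp _ _ _).symm
  have hint := integral_wedgePow_extDeriv_sliceForm H.pos 0
  have hpos : ∀ j, (a j : ℝ) ≠ 0 := fun j => Nat.cast_ne_zero.2 (H.pos j).ne'
  -- A point of another slice lies in the image of the slice `z₀ = 1` as soon as its coordinate `z₀`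
  -- does not vanish.
  have hthin : S.orb.maximal.Thin Q.1.imageᶜ := by
    refine S.orb.maximal.thin_of_cover fun z _ => ?_
    obtain ⟨j, u, hu, hz⟩ := H.exists_mem_image z.2
    have hu0 : u 0 = 0 := (H.mem_exceptional j hu).1 (by rw [hz]; exact z.2)
    have hu' : (Fin.cons 0 (Fin.tail u) : Cn (n + 1)) = u := by rw [← hu0, Fin.cons_self_tail]
    refine ⟨H.divisorChart j S, ⟨Fin.tail u, H.cons_zero_mem j _, Subtype.ext ?_⟩, ?_⟩
    · change (H.sliceChart j).1.proj (Fin.cons 0 (Fin.tail u)) = z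
      rw [hu', hz]
    · have h1 : {y | y ∈ (H.divisorChart j S).1.dom ∧
          (H.divisorChart j S).1.proj y ∈ Q.1.imageᶜ} ⊆
            {y : Cn n | (j.insertNth 1 y : Cn (n + 1)) 0 = 0} := by
        rintro y ⟨-, hy⟩
        by_contra h0
        obtain ⟨y', hy'⟩ := H.exists_slicePt_eq h0
        refine hy ⟨y', hQd ▸ mem_univ y', Subtype.ext ?_⟩
        change (H.sliceChart 0).1.proj (Fin.cons 0 y') = (H.sliceChart j).1.proj (Fin.cons 0 y)
        rw [hy', H.proj_sliceChart, slicePt, Fin.cons_zero, Fin.tail_cons]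
      refine measure_mono_null h1 ?_
      rcases Fin.eq_self_or_eq_succAbove j 0 with h0 | ⟨l, hl⟩
      · subst h0
        simp
      · rw [hl]
        simp only [Fin.insertNth_apply_succAbove]
        exact volume_hyperplane n l
  rw [S.orb.maximal.integral_eq_sum (ι := Unit)
    (Q.1.isOpen_image _ subset_rfl Q.1.isOpen_dom).isClosed_compl hthin (fun _ => Q)
    (S.maximal.restrict β) (fun _ => S.maximal.restrict β)
    (fun _ => ComplexOrbifold.forms.natural hα)
    (fun _ c => (hα.1 c).continuousOn.mono sdiff_subset) (fun _ c u _ hu _ => not_not.1 hu)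
    (fun _ => ?_) (fun c u _ _ => by simp)]
  · simp only [hval, hQd, Measure.restrict_univ, hint, Finset.univ_unique, Finset.sum_singleton]
    rw [H.card_divisorChart 0 hn S, Fin.prod_univ_succAbove _ 0, mul_inv, Finset.prod_inv_distrib]
  · simp only [hval, hQd, integrableOn_univ]
    -- Integrability follows from the value of the integral, which would be zero otherwise.
    refine not_imp_comm.1 integral_undef ?_
    rw [hint]
    exact Finset.prod_ne_zero_iff.2 fun l _ => inv_ne_zero (hpos _)

end LocalModel

end DivisorVolume

/-! ### Telescoping of wedge powers -/

section Telescope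

variable {n : ℕ}

/-- The sum `∑ α ^ i ∧ β ^ (m - i)` over `0 ≤ i ≤ m`, the quotient of `α ^ (m + 1) - β ^ (m + 1)`
by `α - β`. -/
def geomForm (α β : Alt n 2) : (m : ℕ) → Alt n (2 * m)
  | 0 => wedgePow β 0
  | m + 1 => wedge (geomForm α β m) α + wedgePow β (m + 1)

theorem wedgePow_sub_wedgePow (α β : Alt n 2) (m : ℕ) :
    wedgePow α (m + 1) - wedgePow β (m + 1) = wedge (geomForm α β m) (α - β) := by
  induction m with
  | zero => exact (wedge_sub_right _ _ _).symm
  | succ m ih =>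
    change wedge (wedgePow α (m + 1)) α - wedge (wedgePow β (m + 1)) β =
      wedge (wedge (geomForm α β m) α + wedgePow β (m + 1)) (α - β)
    rw [wedge_add_left, wedge_right_comm, ← ih, wedge_sub_left, wedge_sub_right, sub_add_sub_cancel]

theorem geomForm_zero_right (α : Alt n 2) (m : ℕ) : geomForm α 0 m = wedgePow α m := by
  induction m with
  | zero => rfl
  | succ m ih =>
    change wedge (geomForm α 0 m) α + wedge (wedgePow 0 m) 0 = wedge (wedgePow α m) α
    rw [ih, wedge_zero_right, add_zero]

theorem geomForm_comp {m : ℕ} (α β : Alt n 2) (g : Cn m →L[ℝ] Cn n) (k : ℕ) :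
    geomForm (α.compContinuousLinearMap g) (β.compContinuousLinearMap g) k =
      (geomForm α β k).compContinuousLinearMap g := by
  induction k with
  | zero => exact wedgePow_comp β g 0
  | succ k ih =>
    change wedge (geomForm _ _ k) (α.compContinuousLinearMap g) + wedgePow _ (k + 1) =
      (wedge (geomForm α β k) α).compContinuousLinearMap g +
        (wedgePow β (k + 1)).compContinuousLinearMap g
    rw [ih, ← wedgePow_comp, ← wedge_comp]

variable {X : Type*} [TopologicalSpace X] {𝓧 : ComplexOrbifold n X}

theorem geomForm_mem_closedForms {α β : 𝓧.Family 2} (hα : α ∈ 𝓧.closedForms 2)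
    (hβ : β ∈ 𝓧.closedForms 2) (m : ℕ) :
    (fun c u => geomForm (α c u) (β c u) m : 𝓧.Family (2 * m)) ∈ 𝓧.closedForms (2 * m) := by
  induction m with
  | zero => exact wedgePow_mem_closedForms hβ 0
  | succ m ih =>
    exact add_mem (ComplexOrbifold.wedge_mem_closedForms ih hα) (wedgePow_mem_closedForms hβ (m + 1))

end Telescope

/-! ### Pairing of cohomology classes -/

section Pairing

variable {n : ℕ} {X : Type*} [TopologicalSpace X] [T2Space X] [CompactSpace X]
  {𝓧 : ComplexOrbifold (n + 1) X}

/-- Integration of the wedge product with a closed form of degree `2 n`. -/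
def pairing (Γ : 𝓧.closedForms (2 * n)) : 𝓧.closedForms 2 →ₗ[ℝ] ℝ where
  toFun β := 𝓧.integral fun c u => wedge (Γ.1 c u) (β.1 c u)
  map_add' β β' := by
    have h := (ComplexOrbifold.wedge_mem_closedForms Γ.2 β.2).1
    have h' := (ComplexOrbifold.wedge_mem_closedForms Γ.2 β'.2).1
    refine Eq.trans ?_ (𝓧.integral_add (ComplexOrbifold.forms.natural h)
      (fun c => (h.1 c).continuousOn) (ComplexOrbifold.forms.natural h')
      (fun c => (h'.1 c).continuousOn))
    exact 𝓧.integral_congr fun c u _ => wedge_add_right _ _ _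
  map_smul' s β := by
    refine Eq.trans ?_ (𝓧.integral_smul s _)
    exact 𝓧.integral_congr fun c u _ => wedge_smul_right _ _ _

theorem pairing_apply (Γ : 𝓧.closedForms (2 * n)) (β : 𝓧.closedForms 2) :
    pairing Γ β = 𝓧.integral fun c u => wedge (Γ.1 c u) (β.1 c u) := rfl

theorem pairing_eq_zero (Γ : 𝓧.closedForms (2 * n)) {β : 𝓧.closedForms 2} (hβ : 𝓧.cls β = 0) :
    pairing Γ β = 0 := by
  obtain ⟨α, hα, h⟩ := (Submodule.Quotient.mk_eq_zero _).1 hβ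
  have hΓα := ComplexOrbifold.wedge_mem_forms Γ.2.1 hα
  refine (pairing_apply Γ β).trans <|
    Eq.trans (𝓧.integral_congr fun c u hu => ?_) (𝓧.integral_extDeriv hΓα)
  change wedge (Γ.1 c u) (β.1 c u) = extDeriv (fun w => wedge (Γ.1 c w) (α c w)) u
  rw [extDeriv_wedge_of_closed (ComplexOrbifold.forms_differentiableAt Γ.2.1 c hu)
    (ComplexOrbifold.forms_differentiableAt hα c hu) (Γ.2.2 c u hu), pow_mul, neg_one_sq, one_pow,
    one_smul, ← h c u hu]
  rfl

theorem topPower_sub_topPower (α β : 𝓧.closedForms 2) :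
    𝓧.topPower α - 𝓧.topPower β =
      pairing ⟨_, geomForm_mem_closedForms α.2 β.2 n⟩ (α - β) := by
  have h := (geomForm_mem_closedForms α.2 β.2 n)
  have h1 := (wedgePow_mem_closedForms β.2 (n + 1)).1
  have h2 := (ComplexOrbifold.wedge_mem_closedForms h (α - β).2).1
  rw [sub_eq_iff_eq_add]
  refine Eq.trans ?_ (𝓧.integral_add (ComplexOrbifold.forms.natural h2)
    (fun c => (h2.1 c).continuousOn) (ComplexOrbifold.forms.natural h1)
    (fun c => (h1.1 c).continuousOn))
  exact 𝓧.integral_congr fun c u _ => sub_eq_iff_eq_add.1 (wedgePow_sub_wedgePow _ _ _)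

end Pairing

/-! ### Weighted blow-ups -/

section Blowup

variable {n : ℕ} {X : Type*} [TopologicalSpace X] {M : Type*} [TopologicalSpace M]
  [ChartedSpace (Cn (n + 1)) M] {𝓧 : ComplexOrbifold (n + 1) X} {f : HolomorphicMap 𝓧 (n + 1) M}

/-- The Thom form of an exceptional divisor: it represents the Poincaré dual, its opposite has
volume `1 / (a₁ ⋯ aₙ)` on the divisor, and it vanishes outside the given coordinate
neighborhood. -/
theorem LocalModel.exists_dualForm [T2Space X] [CompactSpace X] [T2Space M] (hn : 1 ≤ n)
    [IsManifold 𝓘(ℂ, Cn (n + 1)) ω M] {a : Fin (n + 1) → ℕ} {x₀ : M}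
    {φ : OpenPartialHomeomorph M (Cn (n + 1))}
    {Ψ : ℂ × Cn (n + 1) → X} (H : LocalModel 𝓧 f.toFun a x₀ φ Ψ)
    (hφ : φ ∈ IsManifold.maximalAtlas 𝓘(ℂ, Cn (n + 1)) ω M)
    (S : Suborbifold 𝓧 (f.toFun ⁻¹' {x₀}) n) :
    ∃ τ : 𝓧.closedForms 2,
      (∀ β : 𝓧.closedForms (2 * n), pairing β τ = S.orb.integral (S.restrict β.1)) ∧
      S.orb.integral (S.restrict (k := 2 * n) fun c u => wedgePow (-τ.1 c u) n) =
        (∏ j, (a j : ℝ))⁻¹ ∧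
      ∀ c, ∀ u ∈ c.1.dom, f.toFun (c.1.proj u) ∉ φ.source → τ.1 c u = 0 := by
  have hE : IsClosed (f.toFun ⁻¹' {x₀}) := isClosed_singleton.preimage f.continuous
  obtain ⟨τ, hτ, h1, h2, h3⟩ := H.exists_thomForm hn hφ
  refine ⟨⟨_, ComplexOrbifold.ofMaximal_mem_closedForms hτ⟩, fun β => ?_, ?_,
    fun c u hu => h3 (𝓧.toMaximal c) u hu⟩
  · have hβ := ComplexOrbifold.extend_mem_closedForms β.2
    have hw := (ComplexOrbifold.wedge_mem_closedForms hβ hτ).1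
    rw [S.integral_restrict_maximal hE β.2.1, ← h1 S _ hβ]
    refine (pairing_apply β _).trans <|
      Eq.trans (𝓧.integral_congr fun c u hu => ?_) (ComplexOrbifold.integral_ofMaximal hw)
    change wedge (β.1 c u) (τ (𝓧.toMaximal c) u) =
      wedge (ComplexOrbifold.extend β.1 (𝓧.toMaximal c) u) (τ (𝓧.toMaximal c) u)
    rw [ComplexOrbifold.extend_toMaximal (ComplexOrbifold.forms.natural β.2.1) c hu]
  · exact (S.integral_restrict_ofMaximal hE (wedgePow_mem_closedForms (neg_mem hτ) n).1).trans
      (H.integral_wedgePow_neg hn S hτ h2)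

/-- A form pulled back along a map vanishes on the fibers of the map. -/
theorem Suborbifold.pullback_comp_eq_zero [IsManifold 𝓘(ℂ, Cn (n + 1)) ω M] {x₀ : M} {m k : ℕ}
    {α : (ComplexOrbifold.ofManifold (n + 1) M).Family (k + 1)}
    (S : Suborbifold 𝓧 (f.toFun ⁻¹' {x₀}) m) (c : S.orb.charts) {u : Cn m} {d : 𝓧.charts}
    {ℓ : Cn m → Cn (n + 1)} (hℓ : ContDiffAt ℝ ω ℓ u) (hℓu : ℓ u ∈ d.1.dom)
    (hev : ∀ᶠ w in 𝓝 u, d.1.proj (ℓ w) = c.1.proj w) :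
    (f.pullback (k + 1) α d (ℓ u)).compContinuousLinearMap (fderiv ℝ ℓ u) = 0 := by
  set p := f.toFun (d.1.proj (ℓ u)) with hp
  have h1 : (fun w => f.lift d.1 p (ℓ w)) =ᶠ[𝓝 u] fun _ => chartAt (Cn (n + 1)) p x₀ := by
    filter_upwards [hev] with w hw
    have h2 : f.toFun (c.1.proj w) = x₀ := (c.1.proj w).2
    rw [HolomorphicMap.lift, hw, h2]
  have h2 : (fderiv ℝ (f.lift d.1 p) (ℓ u)).comp (fderiv ℝ ℓ u) = 0 := by
    have h3 := fderiv_comp u ((f.lift_contDiffAt d.2 hℓu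
      (mem_chart_source (Cn (n + 1)) p)).differentiableAt (by simp)) (hℓ.differentiableAt (by simp))
    rw [← h3]
    exact h1.fderiv_eq.trans (fderiv_const_apply _)
  change (α (ComplexOrbifold.prefChart p) (f.lift d.1 p (ℓ u))).compContinuousLinearMap
    ((fderiv ℝ (f.lift d.1 p) (ℓ u)).comp (fderiv ℝ ℓ u)) = 0
  rw [h2]
  ext v
  change α (ComplexOrbifold.prefChart p) (f.lift d.1 p (ℓ u)) (fun _ => 0) = 0
  exact ContinuousAlternatingMap.map_coord_zero _ (0 : Fin (k + 1)) rfl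

variable {k : ℕ} {x : Fin k → M} {a : Fin k → Fin (n + 1) → ℕ}

theorem IsWeightedBlowup.exists_localModel (hf : IsWeightedBlowup 𝓧 f x a)
    (ha : ∀ i j, 0 < a i j) (hcop : ∀ i, Pairwise fun j l => Nat.Coprime (a i j) (a i l))
    (i : Fin k) : ∃ φ ∈ IsManifold.maximalAtlas 𝓘(ℂ, Cn (n + 1)) ω M,
      (∀ j ≠ i, x j ∉ φ.source) ∧ ∃ Ψ, LocalModel 𝓧 f.toFun (a i) (x i) φ Ψ := by
  obtain ⟨φ, hφ, h1, h2, h3, Ψ, h4, h5, h6, h7⟩ := hf.model i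
  exact ⟨φ, hφ, h3, Ψ, ha i, hcop i, h1, h2, h4, h5, h6, h7⟩

theorem IsWeightedBlowup.thin_exceptional (hf : IsWeightedBlowup 𝓧 f x a)
    (ha : ∀ i j, 0 < a i j) (hcop : ∀ i, Pairwise fun j l => Nat.Coprime (a i j) (a i l)) :
    𝓧.maximal.Thin (f.toFun ⁻¹' range x) := by
  refine 𝓧.maximal.thin_of_cover fun z hz => ?_
  obtain ⟨i, hi⟩ := hz
  obtain ⟨φ, -, hx, Ψ, H⟩ := hf.exists_localModel ha hcop i
  obtain ⟨j, u, hu, hz⟩ := H.exists_mem_image (x := z) hi.symm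
  refine ⟨H.sliceChart j, ⟨u, hu, hz⟩, measure_mono_null ?_ (volume_hyperplane (n + 1) 0)⟩
  rintro w ⟨hw, l, hl⟩
  have h1 := (H.chart_map_proj j hw).1
  rw [← hl] at h1
  have hli : l = i := by
    by_contra h
    exact hx l h h1
  exact (H.mem_exceptional j hw).1 (by rw [mem_preimage, ← hl, hli]; rfl)

theorem IsWeightedBlowup.nonempty [Nonempty M] (hf : IsWeightedBlowup 𝓧 f x a)
    (ha : ∀ i j, 0 < a i j) (hcop : ∀ i, Pairwise fun j l => Nat.Coprime (a i j) (a i l)) :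
    Nonempty X := by
  obtain ⟨m⟩ := ‹Nonempty M›
  by_cases hm : m ∈ range x
  · obtain ⟨i, -⟩ := hm
    obtain ⟨φ, -, -, Ψ, -⟩ := hf.exists_localModel ha hcop i
    exact ⟨Ψ 0⟩
  · obtain ⟨z, -⟩ := hf.bijOn.surjOn hm
    exact ⟨z⟩

theorem IsWeightedBlowup.topPower_pullback [IsManifold 𝓘(ℂ, Cn (n + 1)) ω M] [T2Space M]
    [CompactSpace M] [Nonempty M] [T2Space X] [CompactSpace X] (hf : IsWeightedBlowup 𝓧 f x a)
    (ha : ∀ i j, 0 < a i j) (hcop : ∀ i, Pairwise fun j l => Nat.Coprime (a i j) (a i l))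
    (Ω : (ComplexOrbifold.ofManifold (n + 1) M).closedForms 2) :
    𝓧.topPower ⟨f.pullback 2 Ω.1, f.pullback_mem_closedForms Ω.2⟩ =
      (ComplexOrbifold.ofManifold (n + 1) M).topPower Ω := by
  have := hf.nonempty ha hcop
  refine Eq.trans (𝓧.integral_congr fun c u _ => ?_)
    (f.integral_pullback n.succ_pos (finite_range x) (hf.thin_exceptional ha hcop) hf.bijOn
      hf.biholomorphic (wedgePow_mem_closedForms Ω.2 (n + 1)).1)
  exact wedgePow_comp _ _ _

end Blowup

end WeightedBlowup

end

theorem mainTheorem8 (n : ℕ) (hn : 1 ≤ n)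
    {M : Type*} [TopologicalSpace M] [ChartedSpace (Cn (n + 1)) M]
    [IsManifold 𝓘(ℂ, Cn (n + 1)) ω M] [T2Space M] [CompactSpace M] [ConnectedSpace M]
    (Ω : (ComplexOrbifold.ofManifold (n + 1) M).closedForms 2)
    (hΩ : (ComplexOrbifold.ofManifold (n + 1) M).Tames Ω)
    (k : ℕ) (x : Fin k → M) (hx : Function.Injective x)
    (a : Fin k → Fin (n + 1) → ℕ) (ha : ∀ i j, 0 < a i j)
    (hcop : ∀ i, Pairwise fun j l => Nat.Coprime (a i j) (a i l))
    {X : Type*} [TopologicalSpace X] [T2Space X] [CompactSpace X]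
    (𝓧 : ComplexOrbifold (n + 1) X) (f : HolomorphicMap 𝓧 (n + 1) M)
    (hf : IsWeightedBlowup 𝓧 f x a)
    (E : ∀ i, Suborbifold 𝓧 (f.toFun ⁻¹' {x i}) n)
    (ε e : Fin k → 𝓧.H2) (hε : ∀ i, IsPoincareDual 𝓧 (E i) (ε i))
    (he : ∀ i, e i = (∏ j, (a i j : ℝ)) • ε i)
    (r : Fin k → ℝ) (hr : ∀ i, 0 < r i) :
    (∀ θ : 𝓧.closedForms 2,
      𝓧.cls θ = f.pullbackH2 ((ComplexOrbifold.ofManifold (n + 1) M).cls Ω) -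
        ∑ i, (r i / ∏ j, (a i j : ℝ)) • e i →
      𝓧.topPower θ = (ComplexOrbifold.ofManifold (n + 1) M).topPower Ω -
        ∑ i, symplecticVolume (ellipsoid (a i) (r i))) ∧
    ∀ i, symplecticVolume (ellipsoid (a i) (r i)) = r i ^ (n + 1) / ∏ j, (a i j : ℝ) := by
  have hprod : ∀ i, (∏ j, (a i j : ℝ)) ≠ 0 := fun i =>
    Finset.prod_ne_zero_iff.2 fun j _ => Nat.cast_ne_zero.2 (ha i j).ne'
  have hvol : ∀ i, symplecticVolume (ellipsoid (a i) (r i)) =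
      r i ^ (n + 1) / ∏ j, (a i j : ℝ) := fun i => symplecticVolume_ellipsoid (ha i) (hr i)
  refine ⟨fun θ hθ => ?_, hvol⟩
  choose φ hφ hxφ Ψ H using hf.exists_localModel ha hcop
  choose τ hτ1 hτ2 hτ3 using fun i => (H i).exists_dualForm hn (hφ i) (E i)
  choose η hη using fun i => Submodule.mkQ_surjective _ (ε i)
  let A : 𝓧.closedForms 2 := ⟨f.pullback 2 Ω.1, f.pullback_mem_closedForms Ω.2⟩
  let θ' : 𝓧.closedForms 2 := A - ∑ i, r i • τ i
  -- `θ` and `θ'` have the same pairing with every closed form: replacing a representative `η i` of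
  -- `ε i` by the Thom form `τ i` does not change the pairing, whether or not the classes agree.
  have hstep : ∀ Γ : 𝓧.closedForms (2 * n), pairing Γ (θ - θ') = 0 := by
    intro Γ
    have h1 : 𝓧.cls (θ - (A - ∑ i, r i • η i)) = 0 := by
      have h2 : ∀ i, (r i / ∏ j, (a i j : ℝ)) • e i = r i • 𝓧.cls (η i) := fun i => by
        rw [he i, smul_smul, div_mul_cancel₀ _ (hprod i), ← hη i]
      rw [map_sub, hθ, map_sub, map_sum, Finset.sum_congr rfl fun i _ => h2 i, sub_eq_zero]
      simp only [map_smul]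
      rfl
    have h2 : ∀ i, pairing Γ (η i) = pairing Γ (τ i) := fun i =>
      (hε i (η i) (hη i) Γ.1 Γ.2).trans (hτ1 i Γ).symm
    have h3 := pairing_eq_zero Γ h1
    simp only [θ', map_sub, map_sum, map_smul] at h3 ⊢
    simpa only [h2] using h3
  have hθ' : 𝓧.topPower θ = 𝓧.topPower θ' := by
    rw [← sub_eq_zero, topPower_sub_topPower]
    exact hstep _
  -- On `E i` the pulled back form `A` and the Thom forms `τ j` with `j ≠ i` vanish, so that of the
  -- telescoping factor `Γ` only `(-r i • τ i) ^ n` is left.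
  let Γ : 𝓧.closedForms (2 * n) := ⟨_, geomForm_mem_closedForms θ'.2 A.2 n⟩
  have hΓ : ∀ i, (E i).orb.integral ((E i).restrict Γ.1) = r i ^ n * (∏ j, (a i j : ℝ))⁻¹ := by
    intro i
    have hE : IsClosed (f.toFun ⁻¹' {x i}) := isClosed_singleton.preimage f.continuous
    have : CompactSpace (f.toFun ⁻¹' {x i}) := isCompact_iff_compactSpace.1 hE.isCompact
    rw [← hτ2 i, ← (E i).orb.integral_smul]
    refine (E i).orb.integral_congr fun c u hu => ?_
    obtain ⟨d, ℓ, hℓ, hℓu, hev, h4⟩ := (E i).exists_restrict_eq c hu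
    have hA : (A.1 d (ℓ u)).compContinuousLinearMap (fderiv ℝ ℓ u) = 0 :=
      (E i).pullback_comp_eq_zero c hℓ hℓu hev
    have hfx : f.toFun (d.1.proj (ℓ u)) = x i := by
      rw [hev.self_of_nhds]
      exact (c.1.proj u).2
    have hτj : ∀ j ≠ i, (τ j).1 d (ℓ u) = 0 := fun j hj =>
      hτ3 j d _ hℓu (by rw [hfx]; exact hxφ j i hj.symm)
    have hθA : (θ'.1 d (ℓ u)).compContinuousLinearMap (fderiv ℝ ℓ u) =
        r i • ((-(τ i).1 d (ℓ u)).compContinuousLinearMap (fderiv ℝ ℓ u)) := by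
      have h5 : θ'.1 d (ℓ u) = A.1 d (ℓ u) - ∑ j, r j • (τ j).1 d (ℓ u) := by
        let ev : 𝓧.closedForms 2 →ₗ[ℝ] Alt (n + 1) 2 :=
          { toFun := fun β => β.1 d (ℓ u), map_add' := fun _ _ => rfl, map_smul' := fun _ _ => rfl }
        change ev θ' = ev A - ∑ j, r j • ev (τ j)
        simp only [θ', map_sub, map_sum, map_smul]
      rw [h5, Finset.sum_eq_single i (fun j _ hj => by rw [hτj j hj, smul_zero]) (by simp)]
      ext v
      have h6 := DFunLike.congr_fun hA v
      change A.1 d (ℓ u) (fun l => fderiv ℝ ℓ u (v l)) = 0 at h6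
      change A.1 d (ℓ u) (fun l => fderiv ℝ ℓ u (v l)) -
        r i * (τ i).1 d (ℓ u) (fun l => fderiv ℝ ℓ u (v l)) =
          r i * -(τ i).1 d (ℓ u) (fun l => fderiv ℝ ℓ u (v l))
      rw [h6]
      ring
    refine (h4 _).trans ?_
    refine Eq.trans ?_ (congrArg (fun t => r i ^ n • t)
      (h4 (k := 2 * n) fun c u => wedgePow (-(τ i).1 c u) n)).symm
    refine (geomForm_comp _ _ _ _).symm.trans ?_
    rw [hA, geomForm_zero_right, hθA, wedgePow_smul, wedgePow_comp]
  have hfinal : 𝓧.topPower θ' - 𝓧.topPower A = -∑ i, r i ^ (n + 1) / ∏ j, (a i j : ℝ) := by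
    rw [topPower_sub_topPower]
    change pairing Γ (θ' - A) = _
    have h5 : θ' - A = -∑ i, r i • τ i := by simp only [θ']; abel
    simp only [h5, map_neg, map_sum, map_smul, hτ1, hΓ, smul_eq_mul]
    refine congrArg _ (Finset.sum_congr rfl fun i _ => ?_)
    rw [pow_succ', div_eq_mul_inv, mul_assoc]
  rw [hθ', sub_eq_iff_eq_add'.1 hfinal, hf.topPower_pullback ha hcop Ω, ← sub_eq_add_neg]
  simp only [hvol]
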